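/- Setup. Let $k$ be an algebraically closed field, $q\in k\setminus\{0,1\}$, $d,\ell\ge 0$ integers and $\mathbf Q=(Q_1,\dots,Q_\ell)\in(k^*)^\ell$. Let $J^{\ell,d}\subset\{0,1\}^{\ell+d}$ be the set of tuples $\mathbf c$ with exactly $\ell$ entries $1$ ("red") and $d$ entries $0$ ("black"). The algebra $H=H_{d,\mathbf Q}(q)$ is the unital $k$-algebra with generators $e(\mathbf c)$ ($\mathbf c\in J^{\ell,d}$), $T_r$ ($1\le r<\ell+d$), $X_i,X_i'$ ($1\le i\le \ell+d$) and relations: $\sum_{\mathbf c}e(\mathbf c)=1$, $e(\mathbf b)e(\mathbf c)=\delta_{\mathbf b\mathbf c}e(\mathbf c)$; $X_ie(\mathbf c)=X_i'e(\mathbf c)=0$ if $c_i=1$ and $X_iX_i'e(\mathbf c)=X_i'X_ie(\mathbf c)=e(\mathbf c)$ if $c_i=0$; the $X_i$ commute with each other, the $X'_i$ commute with each other, and both commute with all $e(\mathbf c)$; $T_rT_s=T_sT_r$ if $|r-s|>1$; $T_rX_i=X_iT_r$ if $i\ne r,r+1$; $T_re(\mathbf c)=e(s_r\mathbf c)T_r$,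 and $T_re(\mathbf c)=0$ if $c_r=c_{r+1}=1$; $(T_rX_{r+1}-X_rT_r)e(\mathbf c)=(q-1)X_{r+1}e(\mathbf c)$ and $(T_rX_r-X_{r+1}T_r)e(\mathbf c)=-(q-1)X_{r+1}e(\mathbf c)$ if $c_r=c_{r+1}=0$, and both left sides are $0$ otherwise; $T_r^2e(\mathbf c)=(q-1)T_re(\mathbf c)+qe(\mathbf c)$ if $c_r=c_{r+1}=0$, $T_r^2e(\mathbf c)=(X_r-Q_m)e(\mathbf c)$ if $c_r=0$ and position $r+1$ is the $m$-th red one, $T_r^2e(\mathbf c)=(X_{r+1}-Q_m)e(\mathbf c)$ if $c_{r+1}=0$ and position $r$ is the $m$-th red one; $(T_rT_{r+1}T_r-T_{r+1}T_rT_{r+1})e(\mathbf c)$ equals $0$ if $c_{r+1}=0$ and equals $(1-q)X_{r+2}e(\mathbf c)$ if $(c_r,c_{r+1},c_{r+2})=(0,1,0)$. Put $x_i=\sum_{\mathbf c}X_{i_{\mathbf c}}e(\mathbf c)$ for $1\le i\le d$, where $i_{\mathbf c}$ is the position of the $i$-th black entry of $\mathbf c$; these elements commute and are invertible. For $\mathbf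 b,\mathbf c\in J^{\ell,d}$ and $w\in\mathfrak S_d$ let $\pi\in\mathfrak S_{\ell+d}$ be the permutation that sends the $i$-th black position of $\mathbf c$ to the $w(i)$-th black position of $\mathbf b$ and the $m$-th red position of $\mathbf c$ to the $m$-th red position of $\mathbf b$. A diagram for $(w,\mathbf b,\mathbf c)$ is a reduced expression $\pi=s_{r_1}\cdots s_{r_n}$; its element is $T_w^{\mathbf b,\mathbf c}=T_{r_1}\cdots T_{r_n}e(\mathbf c)\in e(\mathbf b)He(\mathbf c)$ (it may depend on the reduced expression). An $(\ell+1)$-composition $\lambda=(\lambda^{(0)},\dots,\lambda^{(\ell)})$ of $d$ is a tuple of finite (possibly empty) sequences of positive integers with total sum $d$; $\mathcal C_d^\ell$ is the set of all of them. Let $\mathfrak S_\lambda\subset\mathfrak S_d$ be the Young subgroup of the concatenation of $\lambda^{(0)},\dots,\lambda^{(\ell)}$, and let $\mathbf c_\lambda\in J^{\ell,d}$ be the sequence $0^{|\lambda^{(0)}|}\,1\,0^{|\lambda^{(1)}|}\,1\cdots1\,0^{|\lambda^{(\ell)}|}$. For $y\in\mathfrak S_\lambda$ the element $T_ye(\mathbf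 c_\lambda):=T_y^{\mathbf c_\lambda,\mathbf c_\lambda}$ does not depend on the diagram. Put $m_\lambda=\sum_{y\in\mathfrak S_\lambda}(-q)^{l(w_\lambda)-l(y)}T_ye(\mathbf c_\lambda)$, where $l$ is the length and $w_\lambda$ is the longest element of $\mathfrak S_\lambda$. Regard $m_\lambda H$ as a right $H$-module. The affine Schur algebra of level $\ell$ is $S_{d,\mathbf Q}(q)=\mathrm{End}_H\big(\bigoplus_{\lambda\in\mathcal C_d^\ell}m_\lambda H\big)$. For $\lambda,\mu\in\mathcal C^\ell_d$ let $D_{\mu,\lambda}$ be the set of shortest representatives of the double cosets $\mathfrak S_\mu\backslash\mathfrak S_d/\mathfrak S_\lambda$. For $w\in D_{\mu,\lambda}$ let $\mathcal X^+_{\lambda\cap w^{-1}(\mu)}$ be the set of Laurent monomials $p=x_1^{a_1}\cdots x_d^{a_d}$ ($a\in\mathbb Z^d$) such that $a_r\le a_{r+1}$ whenever $s_r\in\mathfrak S_\lambda\cap w^{-1}\mathfrak S_\mu w$; for such $p$ let $D_{w,p}$ be the set of shortest representatives, in $\mathfrak S_\lambda$, of the right cosets $(\mathfrak S_\lambda\cap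 w^{-1}\mathfrak S_\mu w\cap\mathrm{Stab}(a))\,y$, and let $r_{w,p}$ be the maximal length of an element of $D_{w,p}$. Call a diagram for $(w,\mathbf c_\mu,\mathbf c_\lambda)$ admissible if its element $T_w=T_w^{\mathbf c_\mu,\mathbf c_\lambda}$ satisfies $T_w\,T_ze(\mathbf c_\lambda)=T_{wzw^{-1}}e(\mathbf c_\mu)\,T_w$ for all $z\in\mathfrak S_\lambda\cap w^{-1}\mathfrak S_\mu w$. Theorem. (1) Let $\lambda,\mu\in\mathcal C_d^\ell$. Every $w\in D_{\mu,\lambda}$ has an admissible diagram. For every choice of admissible diagrams, one for each $w\in D_{\mu,\lambda}$, with elements $T_w$, the formula $$b^{w,p}\colon\ m_\lambda h\longmapsto m_\mu\,T_w\,p\,\Big(\sum_{y\in D_{w,p}}(-q)^{r_{w,p}-l(y)}T_ye(\mathbf c_\lambda)\Big)h$$ gives well-defined homomorphisms, and the family $\{b^{w,p}\mid w\in D_{\mu,\lambda},\ p\in\mathcal X^+_{\lambda\cap w^{-1}(\mu)}\}$ is a $k$-basis of $\mathrm{Hom}_H(m_\lambda H,m_\mu H)$. (2) The following maps are well defined,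 and their extensions by zero to the other summands generate the $k$-algebra $S_{d,\mathbf Q}(q)$: - the idempotents $e(\lambda)$, $\lambda\in\mathcal C_d^\ell$, i.e. the identity maps of the summands $m_\lambda H$; - the splits $m_\lambda H\to m_\mu H$, $m_\lambda h\mapsto m_\lambda h$ (inclusion), and the merges $m_\mu H\to m_\lambda H$, $m_\mu h\mapsto m_\lambda h$, for all $\lambda,\mu$ such that $\mu$ is obtained from $\lambda$ by replacing one part $a+b$ of some $\lambda^{(t)}$ by two consecutive parts $a,b$ ($a,b>0$); - the left crossings $m_\lambda H\to m_\mu H$, $x\mapsto T_1^{\mathbf c_\mu,\mathbf c_\lambda}x$, and the right crossings $m_\mu H\to m_\lambda H$, $x\mapsto T_1^{\mathbf c_\lambda,\mathbf c_\mu}x$ (the subscript is $1\in\mathfrak S_d$; here the diagram is unique), for all $\lambda,\mu$ such that $\mu$ is obtained from $\lambda$ by moving the first part of some $\lambda^{(t)}$, $t\ge1$, to the end of $\lambda^{(t-1)}$; - the polynomials $fe(\lambda)\colon m_\lambda H\to m_\lambda H$, $x\mapsto fx$, for $\lambda\in\mathcal C_d^\ell$ and $f\in k[x_1^{\pm1},\dots,x_d^{\pm1}]^{\mathfrak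 S_\lambda}$. -/

import Mathlib

namespace HigherSchur

/-! ### Symmetric groups: length, reduced words, shortest coset representatives -/

/-- The left one of the two adjacent positions `r`, `r + 1` (counting positions from `0`). -/
def lo {n : ℕ} (r : Fin (n - 1)) : Fin n := ⟨r, by omega⟩

/-- The right one of the two adjacent positions `r`, `r + 1`. -/
def hi {n : ℕ} (r : Fin (n - 1)) : Fin n := ⟨r + 1, by omega⟩

/-- The simple transposition exchanging the positions `r` and `r + 1`. -/
def simple {n : ℕ} (r : Fin (n - 1)) : Equiv.Perm (Fin n) := Equiv.swap (lo r) (hi r)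

/-- The length of a permutation: the number of its inversions. -/
def len {n : ℕ} (w : Equiv.Perm (Fin n)) : ℕ :=
  (Finset.univ.filter fun ij : Fin n × Fin n => ij.1 < ij.2 ∧ w ij.2 < w ij.1).card

/-- `L = [r₁, …, r_m]` is a reduced word of `w`, i.e. `w = s_{r₁} ⋯ s_{r_m}` with `m` minimal. -/
def IsReducedWord {n : ℕ} (w : Equiv.Perm (Fin n)) (L : List (Fin (n - 1))) : Prop :=
  (L.map simple).prod = w ∧ L.length = len w

theorem simple_lt {n : ℕ} (r : Fin (n - 1)) {i j : Fin n} (h : i < j)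
    (h' : ¬ (i = lo r ∧ j = hi r)) : simple r i < simple r j := by
  unfold simple
  rw [Equiv.swap_apply_def, Equiv.swap_apply_def]
  simp only [lo, hi, Fin.ext_iff, Fin.lt_def] at *
  split_ifs <;> (try simp only []) <;> omega

theorem simple_simple {n : ℕ} (r : Fin (n - 1)) (i : Fin n) : simple r (simple r i) = i := by
  simp [simple]

theorem len_mul_simple {n : ℕ} (w : Equiv.Perm (Fin n)) (r : Fin (n - 1))
    (h : w (hi r) < w (lo r)) : len w = len (w * simple r) + 1 := by
  have hlt : lo r < hi r := by simp [lo, hi, Fin.lt_def]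
  have hmem : (lo r, hi r) ∈ Finset.univ.filter
      (fun ij : Fin n × Fin n => ij.1 < ij.2 ∧ w ij.2 < w ij.1) := by simp [h, hlt]
  have hlo : simple r (lo r) = hi r := by simp [simple]
  have hhi : simple r (hi r) = lo r := by simp [simple]
  unfold len
  rw [← Finset.card_erase_add_one hmem]
  congr 1
  refine Finset.card_bij' (fun ij _ => (simple r ij.1, simple r ij.2))
    (fun ij _ => (simple r ij.1, simple r ij.2)) ?_ ?_ ?_ ?_
  · rintro ⟨i, j⟩ hij
    simp only [Finset.mem_erase, Finset.mem_filter, Finset.mem_univ, true_and, ne_eq,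
      Prod.mk.injEq] at hij
    refine Finset.mem_filter.mpr ⟨Finset.mem_univ _, simple_lt r hij.2.1 hij.1, ?_⟩
    simp only [Equiv.Perm.mul_apply, simple_simple]
    exact hij.2.2
  · rintro ⟨i, j⟩ hij'
    have hij : i < j ∧ w (simple r j) < w (simple r i) := (Finset.mem_filter.mp hij').2
    have hne : ¬ (i = lo r ∧ j = hi r) := by
      rintro ⟨rfl, rfl⟩
      rw [hlo, hhi] at hij
      exact absurd hij.2 (not_lt.mpr h.le)
    simp only [Finset.mem_erase, Finset.mem_filter, Finset.mem_univ, true_and, ne_eq,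
      Prod.mk.injEq]
    refine ⟨?_, simple_lt r hij.1 hne, hij.2⟩
    rintro ⟨h1, h2⟩
    have e1 : i = hi r := by rw [← hlo, ← h1, simple_simple]
    have e2 : j = lo r := by rw [← hhi, ← h2, simple_simple]
    rw [e1, e2] at hij
    exact absurd hij.1 (not_lt.mpr hlt.le)
  · rintro ⟨i, j⟩ _
    simp [simple_simple]
  · rintro ⟨i, j⟩ _
    simp [simple_simple]

theorem eq_one_of_no_descent {n : ℕ} (w : Equiv.Perm (Fin n))
    (h : ∀ r : Fin (n - 1), ¬ w (hi r) < w (lo r)) : w = 1 := by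
  cases n with
  | zero => exact Subsingleton.elim _ _
  | succ n =>
    have hm : StrictMono w := by
      rw [Fin.strictMono_iff_lt_succ]
      intro i
      have h1 := h ⟨i, by simp⟩
      have h2 : w i.castSucc ≠ w i.succ := fun e => by
        have := w.injective e
        exact absurd this (Fin.castSucc_lt_succ).ne
      exact lt_of_le_of_ne (not_lt.mp h1) h2
    have : (hm.orderIsoOfSurjective w w.surjective) = OrderIso.refl _ := Subsingleton.elim _ _
    ext i
    have h3 := congrArg (fun f : Fin (n + 1) ≃o Fin (n + 1) => f i) this
    simpa using congrArg Fin.val h3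

/-- Every permutation has a reduced word. -/
theorem exists_isReducedWord {n : ℕ} (w : Equiv.Perm (Fin n)) :
    ∃ L : List (Fin (n - 1)), IsReducedWord w L := by
  obtain ⟨m, hm⟩ : ∃ m, len w = m := ⟨_, rfl⟩
  induction m generalizing w with
  | zero =>
    have hw : w = 1 := eq_one_of_no_descent w fun r hr => by
      have := len_mul_simple w r hr
      omega
    exact ⟨[], by simp [hw], by simp [hm]⟩
  | succ m ih =>
    by_cases hd : ∃ r : Fin (n - 1), w (hi r) < w (lo r)
    · obtain ⟨r, hr⟩ := hd
      have h1 := len_mul_simple w r hr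
      obtain ⟨L, hL, hL'⟩ := ih (w * simple r) (by omega)
      refine ⟨L ++ [r], ?_, ?_⟩
      · rw [List.map_append, List.prod_append, hL]
        simp [simple, mul_assoc]
      · simp only [List.length_append, List.length_singleton]
        omega
    · push Not at hd
      have hw : w = 1 := eq_one_of_no_descent w fun r => not_lt.mpr (hd r)
      subst hw
      have h0 : len (1 : Equiv.Perm (Fin n)) = 0 := by
        unfold len
        rw [Finset.card_eq_zero, Finset.filter_eq_empty_iff]
        rintro ⟨i, j⟩ _ ⟨h1, h2⟩
        exact absurd h1 (not_lt.mpr (le_of_lt h2))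
      omega

/-- A chosen reduced word. -/
noncomputable def redWord {n : ℕ} (w : Equiv.Perm (Fin n)) : List (Fin (n - 1)) :=
  (exists_isReducedWord w).choose

/-- The permutations that preserve the fibres of `g`. -/
def fibreSubgroup {d : ℕ} {α : Type*} (g : Fin d → α) : Subgroup (Equiv.Perm (Fin d)) where
  carrier := {w | ∀ i, g (w i) = g i}
  one_mem' := fun _ => rfl
  mul_mem' := fun {v w} hv hw i => by rw [Equiv.Perm.mul_apply, hv, hw]
  inv_mem' := fun {w} hw i => by
    have h := hw (w⁻¹ i)
    rw [← Equiv.Perm.mul_apply, mul_inv_cancel, Equiv.Perm.one_apply] at h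
    exact h.symm

/-- `w` has shortest length in its double coset `A w B`. -/
def IsDoubleMin {d : ℕ} (A B : Subgroup (Equiv.Perm (Fin d))) (w : Equiv.Perm (Fin d)) : Prop :=
  ∀ x ∈ A, ∀ y ∈ B, len w ≤ len (x * w * y)

/-- The elements of `B` that have shortest length in their coset `A y`. -/
def leftMin {d : ℕ} (A B : Subgroup (Equiv.Perm (Fin d))) : Set (Equiv.Perm (Fin d)) :=
  {y | y ∈ B ∧ ∀ x ∈ A, len y ≤ len (x * y)}

/-! ### Colour sequences and the higher level affine Hecke algebra -/

/-- The sequences of `ℓ` red (`true`) and `d` black (`false`) strands. -/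
abbrev ColourSeq (ℓ d : ℕ) : Type :=
  {c : Fin (ℓ + d) → Bool // (Finset.univ.filter fun i => c i = true).card = ℓ}

namespace ColourSeq

variable {ℓ d : ℕ}

/-- The permutation action, `(π c)_m = c_{π⁻¹ m}`. -/
def act (π : Equiv.Perm (Fin (ℓ + d))) (c : ColourSeq ℓ d) : ColourSeq ℓ d :=
  ⟨fun m => c.1 (π⁻¹ m), by
    refine Eq.trans ?_ c.2
    refine Finset.card_bij' (fun i _ => π⁻¹ i) (fun i _ => π i) ?_ ?_ ?_ ?_ <;> simp⟩

/-- The set of positions of the red strands. -/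
def reds (c : ColourSeq ℓ d) : Finset (Fin (ℓ + d)) := Finset.univ.filter fun i => c.1 i = true

/-- The increasing enumerations of the red and of the black positions. -/
noncomputable def place (c : ColourSeq ℓ d) : Fin ℓ ⊕ Fin d ≃ Fin (ℓ + d) :=
  finSumEquivOfFinset (s := c.reds) c.2 (by
    rw [Finset.card_compl, Fintype.card_fin, show c.reds.card = ℓ from c.2]; omega)

/-- The position of the `m`-th red strand. -/
noncomputable def redPos (c : ColourSeq ℓ d) (m : Fin ℓ) : Fin (ℓ + d) := c.place (Sum.inl m)

/-- The position of the `i`-th black strand. -/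
noncomputable def blackPos (c : ColourSeq ℓ d) (i : Fin d) : Fin (ℓ + d) := c.place (Sum.inr i)

end ColourSeq

/-- The generators of the higher level affine Hecke algebra. -/
inductive Gen (ℓ d : ℕ) : Type
  | e (c : ColourSeq ℓ d)
  | T (r : Fin (ℓ + d - 1))
  | X (i : Fin (ℓ + d))
  | X' (i : Fin (ℓ + d))

section Hecke

variable {k : Type*} [Field k] {ℓ : ℕ} (q : k) (Q : Fin ℓ → k) (d : ℕ)

/-- A generator, as an element of the free algebra. -/
def gen (k : Type*) [Field k] {ℓ d : ℕ} (g : Gen ℓ d) : FreeAlgebra k (Gen ℓ d) :=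
  FreeAlgebra.ι k g

open Gen in
/-- The defining relations of the higher level affine Hecke algebra. -/
inductive Rel : FreeAlgebra k (Gen ℓ d) → FreeAlgebra k (Gen ℓ d) → Prop
  | e_sum : Rel (∑ c : ColourSeq ℓ d, gen k (e c)) 1
  | e_idem (c : ColourSeq ℓ d) : Rel (gen k (e c) * gen k (e c)) (gen k (e c))
  | e_orth (b c : ColourSeq ℓ d) (h : b ≠ c) : Rel (gen k (e b) * gen k (e c)) 0
  | X_red (i : Fin (ℓ + d)) (c : ColourSeq ℓ d) (h : c.1 i = true) :
      Rel (gen k (X i) * gen k (e c)) 0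
  | X'_red (i : Fin (ℓ + d)) (c : ColourSeq ℓ d) (h : c.1 i = true) :
      Rel (gen k (X' i) * gen k (e c)) 0
  | X_X' (i : Fin (ℓ + d)) (c : ColourSeq ℓ d) (h : c.1 i = false) :
      Rel (gen k (X i) * gen k (X' i) * gen k (e c)) (gen k (e c))
  | X'_X (i : Fin (ℓ + d)) (c : ColourSeq ℓ d) (h : c.1 i = false) :
      Rel (gen k (X' i) * gen k (X i) * gen k (e c)) (gen k (e c))
  | X_e (i : Fin (ℓ + d)) (c : ColourSeq ℓ d) :
      Rel (gen k (X i) * gen k (e c)) (gen k (e c) * gen k (X i))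
  | X'_e (i : Fin (ℓ + d)) (c : ColourSeq ℓ d) :
      Rel (gen k (X' i) * gen k (e c)) (gen k (e c) * gen k (X' i))
  | X_comm (i j : Fin (ℓ + d)) : Rel (gen k (X i) * gen k (X j)) (gen k (X j) * gen k (X i))
  | X'_comm (i j : Fin (ℓ + d)) :
      Rel (gen k (X' i) * gen k (X' j)) (gen k (X' j) * gen k (X' i))
  | T_far (r s : Fin (ℓ + d - 1)) (h : (r : ℕ) + 1 < s) :
      Rel (gen k (T r) * gen k (T s)) (gen k (T s) * gen k (T r))
  | T_X_far (r : Fin (ℓ + d - 1)) (i : Fin (ℓ + d)) (h : i ≠ lo r) (h' : i ≠ hi r) :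
      Rel (gen k (T r) * gen k (X i)) (gen k (X i) * gen k (T r))
  | T_red (r : Fin (ℓ + d - 1)) (c : ColourSeq ℓ d) (h : c.1 (lo r) = true)
      (h' : c.1 (hi r) = true) : Rel (gen k (T r) * gen k (e c)) 0
  | T_e (r : Fin (ℓ + d - 1)) (c : ColourSeq ℓ d) :
      Rel (gen k (T r) * gen k (e c)) (gen k (e (c.act (simple r))) * gen k (T r))
  | T_X_hi (r : Fin (ℓ + d - 1)) (c : ColourSeq ℓ d) (h : c.1 (lo r) = false)
      (h' : c.1 (hi r) = false) :
      Rel ((gen k (T r) * gen k (X (hi r)) - gen k (X (lo r)) * gen k (T r)) * gen k (e c))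
        ((q - 1) • (gen k (X (hi r)) * gen k (e c)))
  | T_X_hi_red (r : Fin (ℓ + d - 1)) (c : ColourSeq ℓ d)
      (h : c.1 (lo r) = true ∨ c.1 (hi r) = true) :
      Rel ((gen k (T r) * gen k (X (hi r)) - gen k (X (lo r)) * gen k (T r)) * gen k (e c)) 0
  | T_X_lo (r : Fin (ℓ + d - 1)) (c : ColourSeq ℓ d) (h : c.1 (lo r) = false)
      (h' : c.1 (hi r) = false) :
      Rel ((gen k (T r) * gen k (X (lo r)) - gen k (X (hi r)) * gen k (T r)) * gen k (e c))
        (-((q - 1) • (gen k (X (hi r)) * gen k (e c))))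
  | T_X_lo_red (r : Fin (ℓ + d - 1)) (c : ColourSeq ℓ d)
      (h : c.1 (lo r) = true ∨ c.1 (hi r) = true) :
      Rel ((gen k (T r) * gen k (X (lo r)) - gen k (X (hi r)) * gen k (T r)) * gen k (e c)) 0
  | T_sq (r : Fin (ℓ + d - 1)) (c : ColourSeq ℓ d) (h : c.1 (lo r) = false)
      (h' : c.1 (hi r) = false) :
      Rel (gen k (T r) * gen k (T r) * gen k (e c))
        ((q - 1) • (gen k (T r) * gen k (e c)) + q • gen k (e c))
  | T_sq_black_red (r : Fin (ℓ + d - 1)) (c : ColourSeq ℓ d) (m : Fin ℓ)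
      (h : c.1 (lo r) = false) (h' : c.redPos m = hi r) :
      Rel (gen k (T r) * gen k (T r) * gen k (e c))
        (gen k (X (lo r)) * gen k (e c) - Q m • gen k (e c))
  | T_sq_red_black (r : Fin (ℓ + d - 1)) (c : ColourSeq ℓ d) (m : Fin ℓ)
      (h : c.redPos m = lo r) (h' : c.1 (hi r) = false) :
      Rel (gen k (T r) * gen k (T r) * gen k (e c))
        (gen k (X (hi r)) * gen k (e c) - Q m • gen k (e c))
  | braid (r s : Fin (ℓ + d - 1)) (hs : (s : ℕ) = r + 1) (c : ColourSeq ℓ d)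
      (h : c.1 (hi r) = false) :
      Rel ((gen k (T r) * gen k (T s) * gen k (T r) - gen k (T s) * gen k (T r) * gen k (T s))
        * gen k (e c)) 0
  | braid_red (r s : Fin (ℓ + d - 1)) (hs : (s : ℕ) = r + 1) (c : ColourSeq ℓ d)
      (h : c.1 (lo r) = false) (h' : c.1 (hi r) = true) (h'' : c.1 (hi s) = false) :
      Rel ((gen k (T r) * gen k (T s) * gen k (T r) - gen k (T s) * gen k (T r) * gen k (T s))
        * gen k (e c)) ((1 - q) • (gen k (X (hi s)) * gen k (e c)))

/-- The higher level affine Hecke algebra `H_{d,Q}(q)`. -/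
def Hecke : Type _ := RingQuot (Rel q Q d)

noncomputable instance : Ring (Hecke q Q d) := inferInstanceAs (Ring (RingQuot (Rel q Q d)))

noncomputable instance : Algebra k (Hecke q Q d) :=
  inferInstanceAs (Algebra k (RingQuot (Rel q Q d)))

variable {d}

/-- The image of a generator in `H_{d,Q}(q)`. -/
noncomputable def heckeGen (g : Gen ℓ d) : Hecke q Q d :=
  RingQuot.mkAlgHom k (Rel q Q d) (FreeAlgebra.ι k g)

/-- The integral powers of `x_i = ∑_c X_{i_c} e(c)`, where `i_c` is the position of the `i`-th
black strand of `c`; the inverse of `x_i` is `∑_c X'_{i_c} e(c)`. -/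
noncomputable def xPow (i : Fin d) : ℤ → Hecke q Q d
  | Int.ofNat n =>
      (∑ c : ColourSeq ℓ d, heckeGen q Q (Gen.X (c.blackPos i)) * heckeGen q Q (Gen.e c)) ^ n
  | Int.negSucc n =>
      (∑ c : ColourSeq ℓ d, heckeGen q Q (Gen.X' (c.blackPos i)) * heckeGen q Q (Gen.e c))
        ^ (n + 1)

/-- The Laurent monomial `x^a = x_1^{a_1} ⋯ x_d^{a_d}` in `H_{d,Q}(q)`. -/
noncomputable def xMon (a : Fin d → ℤ) : Hecke q Q d :=
  (List.ofFn fun i => xPow q Q i (a i)).prod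

/-- The image in `H_{d,Q}(q)` of a Laurent polynomial in `x_1, …, x_d`. -/
noncomputable def xPoly (f : AddMonoidAlgebra k (Fin d → ℤ)) : Hecke q Q d :=
  f.coeff.sum fun a t => t • xMon q Q a

/-- The permutation of all the strands, from the sequence `c` (at the bottom) to `b` (at the top),
that is `w` on the black strands and keeps the order of the red ones. -/
noncomputable def strandPerm (b c : ColourSeq ℓ d) (w : Equiv.Perm (Fin d)) :
    Equiv.Perm (Fin (ℓ + d)) :=
  c.place.symm.trans ((Equiv.sumCongr (Equiv.refl _) w).trans b.place)

/-- `L` encodes a diagram for `w` with top `b` and bottom `c`: its black strands represent `w` with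
the minimal number of crossings, red strands do not meet, and a red strand and a black strand meet
at most once. That is, any two strands cross at most once. -/
def IsDiagram (b c : ColourSeq ℓ d) (w : Equiv.Perm (Fin d)) (L : List (Fin (ℓ + d - 1))) : Prop :=
  IsReducedWord (strandPerm b c w) L

/-- The element `T_{r₁} ⋯ T_{r_m} e(c)` of a diagram `[r₁, …, r_m]` with bottom `c`. -/
noncomputable def diagElt (c : ColourSeq ℓ d) (L : List (Fin (ℓ + d - 1))) : Hecke q Q d :=
  (L.map fun r => heckeGen q Q (Gen.T r)).prod * heckeGen q Q (Gen.e c)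

/-- The element `T_w^{b,c}` for a chosen diagram. It is used only where all diagrams give
the same element: for `b = c` and `w` in the Young subgroup of an `(ℓ+1)`-composition with colour
sequence `c`, and for `w = 1` and sequences that differ by moving one red strand. -/
noncomputable def stdElt (b c : ColourSeq ℓ d) (w : Equiv.Perm (Fin d)) : Hecke q Q d :=
  diagElt q Q c (redWord (strandPerm b c w))

open Classical in
/-- `∑_{y ∈ S} (-q)^{r - l(y)} T_y e(c)`, where `r` is the maximal length of an element of `S`. -/
noncomputable def signedSum (c : ColourSeq ℓ d) (S : Set (Equiv.Perm (Fin d))) : Hecke q Q d :=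
  ∑ y ∈ Finset.univ.filter (fun y => y ∈ S),
    (-q) ^ ((Finset.univ.filter (fun y => y ∈ S)).sup len - len y) • stdElt q Q c c y

end Hecke

/-! ### Compositions -/

/-- The `(ℓ+1)`-compositions of `d`. -/
@[ext]
structure MultiComp (ℓ d : ℕ) where
  parts : Fin (ℓ + 1) → List ℕ
  parts_pos : ∀ t, ∀ a ∈ parts t, 0 < a
  sum_parts : ∑ t, (parts t).sum = d

namespace MultiComp

variable {ℓ d : ℕ}

/-- The composition of `d` obtained by concatenation of the components. -/
def concat (lam : MultiComp ℓ d) : Composition d where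
  blocks := (List.ofFn lam.parts).flatten
  blocks_pos := by
    intro i hi
    obtain ⟨l, hl, hil⟩ := List.mem_flatten.mp hi
    obtain ⟨t, rfl⟩ := (List.mem_ofFn' _ _).mp hl
    exact lam.parts_pos t i hil
  blocks_sum := by
    rw [List.sum_flatten, List.map_ofFn, List.sum_ofFn]
    exact lam.sum_parts

/-- The Young subgroup of `S_d`. -/
def young (lam : MultiComp ℓ d) : Subgroup (Equiv.Perm (Fin d)) := fibreSubgroup lam.concat.index

/-- The position of the `m`-th red strand: it has `m` red strands to its left, and
the black strands of the components `0, …, m`. -/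
def redPlace (lam : MultiComp ℓ d) (m : Fin ℓ) : ℕ :=
  m + ∑ t ∈ Finset.univ.filter (fun t : Fin (ℓ + 1) => (t : ℕ) ≤ m), (lam.parts t).sum

theorem redPlace_lt (lam : MultiComp ℓ d) (m : Fin ℓ) : lam.redPlace m < ℓ + d := by
  have h1 : ∑ t ∈ Finset.univ.filter (fun t : Fin (ℓ + 1) => (t : ℕ) ≤ m), (lam.parts t).sum ≤ d :=
    (Finset.sum_le_sum_of_subset (Finset.filter_subset _ _)).trans lam.sum_parts.le
  have := m.2
  unfold redPlace
  omega

theorem redPlace_strictMono (lam : MultiComp ℓ d) : StrictMono lam.redPlace := by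
  intro m m' h
  have h1 : ∑ t ∈ Finset.univ.filter (fun t : Fin (ℓ + 1) => (t : ℕ) ≤ m), (lam.parts t).sum ≤
      ∑ t ∈ Finset.univ.filter (fun t : Fin (ℓ + 1) => (t : ℕ) ≤ m'), (lam.parts t).sum := by
    refine Finset.sum_le_sum_of_subset fun t ht => ?_
    simp only [Finset.mem_filter, Finset.mem_univ, true_and] at ht ⊢
    exact ht.trans h.le
  have h2 : (m : ℕ) < m' := h
  unfold redPlace
  omega

/-- The colour sequence of an `(ℓ+1)`-composition: the black strands of the components
`0, …, ℓ`, with one red strand between any two consecutive components. -/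
def colours (lam : MultiComp ℓ d) : ColourSeq ℓ d :=
  ⟨fun i => decide (∃ m : Fin ℓ, lam.redPlace m = i), by
    have h : (Finset.univ.filter fun i : Fin (ℓ + d) =>
        decide (∃ m : Fin ℓ, lam.redPlace m = i) = true) =
        Finset.univ.image fun m : Fin ℓ => (⟨lam.redPlace m, lam.redPlace_lt m⟩ : Fin (ℓ + d)) := by
      ext i
      simp [Fin.ext_iff]
    rw [h, Finset.card_image_of_injective, Finset.card_univ, Fintype.card_fin]
    intro m m' hm
    exact lam.redPlace_strictMono.injective (Fin.ext_iff.mp hm)⟩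

/-- `mu` is a split of `lam`: one part of one component of `lam` is replaced by two parts with
the same sum. -/
def IsSplit (lam mu : MultiComp ℓ d) : Prop :=
  ∃ (t : Fin (ℓ + 1)) (pre post : List ℕ) (a b : ℕ),
    lam.parts t = pre ++ (a + b) :: post ∧ mu.parts t = pre ++ a :: b :: post ∧
      ∀ s, s ≠ t → mu.parts s = lam.parts s

/-- `mu` is a left crossing of `lam`: the first part of some component of `lam` is moved to the end
of the preceding component. -/
def IsLeftCrossing (lam mu : MultiComp ℓ d) : Prop :=
  ∃ (t : Fin ℓ) (a : ℕ),
    lam.parts t.succ = a :: mu.parts t.succ ∧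
      mu.parts t.castSucc = lam.parts t.castSucc ++ [a] ∧
      ∀ s, s ≠ t.castSucc → s ≠ t.succ → mu.parts s = lam.parts s

end MultiComp

/-- The subgroup `S_lam ∩ w⁻¹ S_mu w`. -/
def interSubgroup {ℓ d : ℕ} (lam mu : MultiComp ℓ d) (w : Equiv.Perm (Fin d)) :
    Subgroup (Equiv.Perm (Fin d)) :=
  lam.young ⊓ mu.young.comap (MulAut.conj w).toMonoidHom

/-- The exponents `a` are non-decreasing inside each block of `lam ∩ w⁻¹(mu)`. -/
def IsDominant {ℓ d : ℕ} (lam mu : MultiComp ℓ d) (w : Equiv.Perm (Fin d)) (a : Fin d → ℤ) : Prop :=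
  ∀ r : Fin (d - 1), simple r ∈ interSubgroup lam mu w → a (lo r) ≤ a (hi r)

/-- The pairs `(w, p)` of a shortest double coset representative `w ∈ D_{mu,lam}` and a monomial
`p = x^a`, given by its exponents `a`, that is dominant for `lam ∩ w⁻¹(mu)`. -/
abbrev BasisIndex {ℓ d : ℕ} (lam mu : MultiComp ℓ d) : Type :=
  {wa : Equiv.Perm (Fin d) × (Fin d → ℤ) //
    IsDoubleMin mu.young lam.young wa.1 ∧ IsDominant lam mu wa.1 wa.2}

/-! ### The higher level affine Schur algebra -/

section Schur

variable {k : Type*} [Field k] {ℓ d : ℕ} (q : k) (Q : Fin ℓ → k)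

/-- The element `m_lam`. -/
noncomputable def mElt (lam : MultiComp ℓ d) : Hecke q Q d :=
  signedSum q Q lam.colours (lam.young : Set (Equiv.Perm (Fin d)))

/-- The right ideal `m_lam H`, as a right `H`-module. -/
noncomputable abbrev mIdeal (lam : MultiComp ℓ d) : Submodule (Hecke q Q d)ᵐᵒᵖ (Hecke q Q d) :=
  Submodule.span (Hecke q Q d)ᵐᵒᵖ {mElt q Q lam}

/-- The element `m_lam h` of `m_lam H`. -/
noncomputable def mMul (lam : MultiComp ℓ d) (h : Hecke q Q d) : mIdeal q Q lam :=
  ⟨mElt q Q lam * h,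
    Submodule.smul_mem _ (MulOpposite.op h) (Submodule.mem_span_singleton_self _)⟩

/-- The space `Hom_H(m_lam H, m_mu H)`. -/
abbrev HomSpace (lam mu : MultiComp ℓ d) : Type _ :=
  mIdeal q Q lam →ₗ[(Hecke q Q d)ᵐᵒᵖ] mIdeal q Q mu

open Classical in
/-- The affine Schur algebra `S_{d,Q}(q)` of level `ℓ`. -/
abbrev SchurAlg (d : ℕ) : Type _ :=
  Module.End (Hecke q Q d)ᵐᵒᵖ (DirectSum (MultiComp ℓ d) fun lam => mIdeal q Q lam)

open Classical in
/-- The extension by zero of a homomorphism between two summands. -/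
noncomputable def extend {lam mu : MultiComp ℓ d} (f : HomSpace q Q lam mu) : SchurAlg q Q d :=
  DirectSum.lof (Hecke q Q d)ᵐᵒᵖ (MultiComp ℓ d) (fun nu => mIdeal q Q nu) mu ∘ₗ f ∘ₗ
    DirectSum.component (Hecke q Q d)ᵐᵒᵖ (MultiComp ℓ d) (fun nu => mIdeal q Q nu) lam

/-- The split is the inclusion `m_lam H ⊆ m_mu H`. -/
def IsSplitMap {lam mu : MultiComp ℓ d} (f : HomSpace q Q lam mu) : Prop :=
  ∀ x, (f x : Hecke q Q d) = x

/-- The merge is `m_mu h ↦ m_lam h`. -/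
def IsMergeMap {mu lam : MultiComp ℓ d} (f : HomSpace q Q mu lam) : Prop :=
  ∀ h, f (mMul q Q mu h) = mMul q Q lam h

/-- The left multiplication with the diagram from `lam` (bottom) to `mu` (top) in which no two
black strands cross. If one of `lam`, `mu` is a left crossing of the other, the only crossings of
this diagram are those of one red strand with the strands of the part that is moved. -/
def IsCrossingMap {lam mu : MultiComp ℓ d} (f : HomSpace q Q lam mu) : Prop :=
  ∀ x, (f x : Hecke q Q d) = stdElt q Q mu.colours lam.colours 1 * x

/-- The multiplication with a Laurent polynomial. -/
def IsPolyMap {lam : MultiComp ℓ d} (p : AddMonoidAlgebra k (Fin d → ℤ))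
    (f : HomSpace q Q lam lam) : Prop :=
  ∀ x, (f x : Hecke q Q d) = xPoly q Q p * x

/-- The Laurent polynomial `p` is invariant under the Young subgroup of `lam`. -/
def IsInvariant (lam : MultiComp ℓ d) (p : AddMonoidAlgebra k (Fin d → ℤ)) : Prop :=
  ∀ w ∈ lam.young, ∀ a : Fin d → ℤ, p.coeff (a ∘ w) = p.coeff a

/-- The idempotents, splits, merges, left and right crossings and (invariant) polynomials. -/
inductive IsGenerator : SchurAlg q Q d → Prop
  | idem (lam : MultiComp ℓ d) : IsGenerator (extend q Q (LinearMap.id : HomSpace q Q lam lam))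
  | split (lam mu : MultiComp ℓ d) (h : lam.IsSplit mu) (f : HomSpace q Q lam mu)
      (hf : IsSplitMap q Q f) : IsGenerator (extend q Q f)
  | merge (lam mu : MultiComp ℓ d) (h : lam.IsSplit mu) (f : HomSpace q Q mu lam)
      (hf : IsMergeMap q Q f) : IsGenerator (extend q Q f)
  | leftCrossing (lam mu : MultiComp ℓ d) (h : lam.IsLeftCrossing mu) (f : HomSpace q Q lam mu)
      (hf : IsCrossingMap q Q f) : IsGenerator (extend q Q f)
  | rightCrossing (lam mu : MultiComp ℓ d) (h : lam.IsLeftCrossing mu) (f : HomSpace q Q mu lam)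
      (hf : IsCrossingMap q Q f) : IsGenerator (extend q Q f)
  | poly (lam : MultiComp ℓ d) (p : AddMonoidAlgebra k (Fin d → ℤ)) (h : IsInvariant lam p)
      (f : HomSpace q Q lam lam) (hf : IsPolyMap q Q p f) : IsGenerator (extend q Q f)

/-- The diagram `L` for `w ∈ D_{mu,lam}` is admissible if `T_w T_z = T_{w z w⁻¹} T_w`
for all `z ∈ S_lam ∩ w⁻¹ S_mu w`, where `T_w = T_w^{b,c}` is the element of `L`. -/
def IsAdmissible (lam mu : MultiComp ℓ d) (w : Equiv.Perm (Fin d))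
    (L : List (Fin (ℓ + d - 1))) : Prop :=
  IsDiagram mu.colours lam.colours w L ∧
    ∀ z ∈ interSubgroup lam mu w,
      diagElt q Q lam.colours L * stdElt q Q lam.colours lam.colours z =
        stdElt q Q mu.colours mu.colours (w * z * w⁻¹) * diagElt q Q lam.colours L

/-- `f` is the homomorphism `b^{w,p}`, `p = x^a`, for the diagram `L` of `w`:
`m_lam h ↦ m_mu T_w^{b,c} p (∑_y (-q)^{r - l(y)} T_y) h`. -/
def IsBasisMap {lam mu : MultiComp ℓ d} (w : Equiv.Perm (Fin d)) (a : Fin d → ℤ)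
    (L : List (Fin (ℓ + d - 1))) (f : HomSpace q Q lam mu) : Prop :=
  ∀ h, (f (mMul q Q lam h) : Hecke q Q d) =
    mElt q Q mu * diagElt q Q lam.colours L * xMon q Q a *
      signedSum q Q lam.colours
        (leftMin (interSubgroup lam mu w ⊓ fibreSubgroup a) lam.young) * h

end Schur

end HigherSchur

namespace HigherSchur

open Equiv

/-! ### Lengths and reduced words -/

section Length

variable {n : ℕ}

/-! A homomorphism out of `m_lam H` is determined by the image x of `m_lam`. This image is a sign
vector: x = x e(c_lam), and x T_s = -x for all simple s in S_lam. Conversely every sign vector lies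
in H m_lam (`IsSign.exists_eq_mul`), so each sign vector of `m_mu H` is the image of `m_lam` under a
left multiplication. Part (1) is therefore the computation of the sign vectors of `m_mu H`.

The computation rests on a basis theorem for e(b) H e(c): diagrams, one reduced word for each w in
S_d, with Laurent polynomials inserted. For spanning, H is filtered by the number of crossings
(`flt`). Replacing one reduced word by another (Matsumoto's theorem), moving a polynomial past a
diagram, or shortening an unreduced word costs only terms with fewer crossings (`exists_pbw`). For
independence, H acts on functions on S_{ℓ+d} with values in a field of rational functions, each T_r
being a combination of the identity and of s_r. Applied to the delta function at 1, a reduced word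
for π gives a function that is nonzero at π and otherwise lives on shorter permutations
(`pbw_unique`). The polynomial may be inserted in the middle of a word. Hence the basis can be
adapted to factorizations v = z w u with z in S_mu, w a shortest double coset representative and u a
shortest representative of a coset of S_lam ∩ w⁻¹ S_mu w in S_lam.

The element m_mu absorbs z up to a sign. So m_mu H e(c_lam) is the direct sum over w of the spans of
the elements m_mu T_w p T_u, and admissibility makes m_mu T_w a sign vector for S_lam ∩ w⁻¹ S_mu w.
Each summand looks like an induced module. Its sign vectors are n times the signed sum over all u,
where n = m_mu T_w p is itself a sign vector for the smaller group (`eq_mul_signSum`). By a divided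
difference computation n is a sign vector exactly when p is symmetric (`rho_eq_neg_iff`). The
symmetrizations of the dominant monomials form a basis of these symmetric polynomials, being
triangular with respect to the norm of the exponents. The signed sum over D_{w,p} factors into the
sum that performs the symmetrization and the sum over u, which gives the stated formula up to a
nonzero scalar (`exists_basis`).

Admissible diagrams and part (2) come from thick strands. A shortest double coset representative w
maps the blocks of a refinement of lam increasingly onto the blocks of a refinement of mu. Such a
permutation factors, with additive numbers of crossings, into exchanges of two neighbouring blocks
and moves of one red strand across one block (`thick_of_matchFib`). Each factor intertwines the
Young subgroups, hence so does the product. Each factor is also, up to shorter diagrams, left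
multiplication by a generated map: an exchange is the longest term of a merge followed by a split,
and the red moves are the crossings themselves. With polynomials, splits and merges around it, this
gives a generated map for every w and every symmetric p with the prescribed leading term
(`exists_leftGen`). Subtracting leading terms and induction on the filtration show that every
homomorphism is generated (`extend_mem_genAlg`). -/

theorem lo_lt_hi (r : Fin (n - 1)) : lo r < hi r := by simp [lo, hi, Fin.lt_def]

theorem simple_lo (r : Fin (n - 1)) : simple r (lo r) = hi r := by simp [simple]

theorem simple_hi (r : Fin (n - 1)) : simple r (hi r) = lo r := by simp [simple]

theorem simple_of_ne (r : Fin (n - 1)) {i : Fin n} (h : i ≠ lo r) (h' : i ≠ hi r) :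
    simple r i = i := swap_apply_of_ne_of_ne h h'

theorem perm_inv_apply (w : Perm (Fin n)) (i : Fin n) : w⁻¹ (w i) = i := w.symm_apply_apply i

theorem perm_apply_inv (w : Perm (Fin n)) (i : Fin n) : w (w⁻¹ i) = i := w.apply_symm_apply i

theorem simple_inv (r : Fin (n - 1)) : (simple r)⁻¹ = simple r := swap_inv _ _

theorem simple_mul_self (r : Fin (n - 1)) : simple r * simple r = 1 := swap_mul_self _ _

theorem mul_simple_mul_simple (w : Perm (Fin n)) (r : Fin (n - 1)) :
    w * simple r * simple r = w := by rw [mul_assoc, simple_mul_self, mul_one]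

theorem simple_mul_simple_mul (w : Perm (Fin n)) (r : Fin (n - 1)) :
    simple r * (simple r * w) = w := by rw [← mul_assoc, simple_mul_self, one_mul]

theorem len_one : len (1 : Perm (Fin n)) = 0 := by
  unfold len
  rw [Finset.card_eq_zero, Finset.filter_eq_empty_iff]
  rintro ⟨i, j⟩ _ ⟨h1, h2⟩
  exact absurd h1 (not_lt.mpr (le_of_lt h2))

theorem len_inv (w : Perm (Fin n)) : len w⁻¹ = len w := by
  unfold len
  refine Finset.card_bij' (fun ij _ => (w⁻¹ ij.2, w⁻¹ ij.1)) (fun ij _ => (w ij.2, w ij.1))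
    ?_ ?_ ?_ ?_
  · rintro ⟨i, j⟩ h; simpa using (Finset.mem_filter.mp h).2.symm
  · rintro ⟨i, j⟩ h; simpa using (Finset.mem_filter.mp h).2.symm
  · rintro ⟨i, j⟩ _; simp
  · rintro ⟨i, j⟩ _; simp

/-- Lengths add when no two strands cross twice. -/
theorem len_mul_of_no_double_crossing (z u : Perm (Fin n))
    (h : ∀ i j, i < j → u j < u i → z (u j) < z (u i)) : len (z * u) = len z + len u := by
  unfold len
  rw [← Finset.card_filter_add_card_filter_not (fun ij : Fin n × Fin n => u ij.2 < u ij.1),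
    add_comm]
  congr 1
  · refine Finset.card_bij' (fun ij _ => (u ij.1, u ij.2)) (fun ij _ => (u⁻¹ ij.1, u⁻¹ ij.2))
      ?_ ?_ ?_ ?_
    · rintro ⟨i, j⟩ hij
      rw [Finset.mem_filter, Finset.mem_filter] at hij
      refine Finset.mem_filter.mpr ⟨Finset.mem_univ _, ?_⟩
      replace hij := And.intro hij.1.2 hij.2
      exact ⟨lt_of_le_of_ne (not_lt.mp hij.2) fun e => hij.1.1.ne (u.injective e), hij.1.2⟩
    · rintro ⟨p, q⟩ hpq
      replace hpq := (Finset.mem_filter.mp hpq).2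
      refine Finset.mem_filter.mpr ⟨Finset.mem_filter.mpr ⟨Finset.mem_univ _, ?_, ?_⟩, ?_⟩
      rotate_left
      · simpa only [Perm.mul_apply, perm_apply_inv] using hpq.2
      · simpa only [perm_apply_inv, not_lt] using hpq.1.le
      by_contra hc
      have hne : u⁻¹ q ≠ u⁻¹ p := fun e => hpq.1.ne' (u⁻¹.injective e)
      have := h _ _ (lt_of_le_of_ne (not_lt.mp hc) hne) (by simpa only [perm_apply_inv] using hpq.1)
      simp only [perm_apply_inv] at this
      exact absurd this (not_lt.mpr hpq.2.le)
    · rintro ⟨i, j⟩ _; simp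
    · rintro ⟨i, j⟩ _; simp
  · congr 1
    ext ⟨i, j⟩
    rw [Finset.mem_filter, Finset.mem_filter, Finset.mem_filter]
    exact ⟨fun hh => ⟨Finset.mem_univ _, hh.1.2.1, hh.2⟩,
      fun hh => ⟨⟨Finset.mem_univ _, hh.2.1, h _ _ hh.2.1 hh.2.2⟩, hh.2.2⟩⟩

theorem len_mul_simple_of_lt (w : Perm (Fin n)) (r : Fin (n - 1)) (h : w (lo r) < w (hi r)) :
    len (w * simple r) = len w + 1 := by
  have := len_mul_simple (w * simple r) r (by simpa [simple_lo, simple_hi] using h)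
  rwa [mul_simple_mul_simple] at this

theorem lt_or_gt_lo_hi (w : Perm (Fin n)) (r : Fin (n - 1)) :
    w (lo r) < w (hi r) ∨ w (hi r) < w (lo r) :=
  lt_or_gt_of_ne fun e => (lo_lt_hi r).ne (w.injective e)

theorem len_mul_simple_le (w : Perm (Fin n)) (r : Fin (n - 1)) :
    len (w * simple r) ≤ len w + 1 := by
  rcases lt_or_gt_lo_hi w r with h | h
  · exact (len_mul_simple_of_lt w r h).le
  · have := len_mul_simple w r h; omega

theorem len_simple_mul (w : Perm (Fin n)) (r : Fin (n - 1)) :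
    len (simple r * w) = len (w⁻¹ * simple r) := by
  rw [← len_inv, mul_inv_rev, simple_inv]

theorem len_simple_mul_le (w : Perm (Fin n)) (r : Fin (n - 1)) :
    len (simple r * w) ≤ len w + 1 := by
  rw [len_simple_mul, ← len_inv w]
  exact len_mul_simple_le _ _

theorem len_simple_mul_of_gt (w : Perm (Fin n)) (r : Fin (n - 1))
    (h : w⁻¹ (hi r) < w⁻¹ (lo r)) : len w = len (simple r * w) + 1 := by
  rw [len_simple_mul, ← len_inv w]
  exact len_mul_simple _ _ h

theorem lt_of_len_mul_simple (w : Perm (Fin n)) (r : Fin (n - 1))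
    (h : len w < len (w * simple r)) : w (lo r) < w (hi r) := by
  rcases lt_or_gt_lo_hi w r with h' | h'
  · exact h'
  · have := len_mul_simple w r h'; omega

theorem len_simple (r : Fin (n - 1)) : len (simple r) = 1 := by
  have := len_mul_simple_of_lt 1 r (lo_lt_hi r)
  rwa [one_mul, len_one] at this

theorem eq_one_of_len (w : Perm (Fin n)) (h : len w = 0) : w = 1 :=
  eq_one_of_no_descent w fun r hr => by have := len_mul_simple w r hr; omega

theorem len_prod_le (L : List (Fin (n - 1))) : len (L.map simple).prod ≤ L.length := by
  induction L with
  | nil => simp [len_one]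
  | cons r L ih =>
    rw [List.map_cons, List.prod_cons, List.length_cons]
    exact (len_simple_mul_le _ _).trans (by omega)

theorem isReducedWord_nil : IsReducedWord (1 : Perm (Fin n)) [] := ⟨rfl, by simp [len_one]⟩

theorem isReducedWord_singleton (r : Fin (n - 1)) : IsReducedWord (simple r) [r] :=
  ⟨by simp, by simp [len_simple]⟩

theorem IsReducedWord.append {z u : Perm (Fin n)} {A B : List (Fin (n - 1))}
    (hA : IsReducedWord z A) (hB : IsReducedWord u B) (h : len (z * u) = len z + len u) :
    IsReducedWord (z * u) (A ++ B) :=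
  ⟨by rw [List.map_append, List.prod_append, hA.1, hB.1],
    by rw [List.length_append, hA.2, hB.2, h]⟩

theorem IsReducedWord.snoc {w : Perm (Fin n)} {A : List (Fin (n - 1))} {r : Fin (n - 1)}
    (hA : IsReducedWord (w * simple r) A) (h : w (hi r) < w (lo r)) :
    IsReducedWord w (A ++ [r]) := by
  have := hA.append (isReducedWord_singleton r)
    (by rw [mul_simple_mul_simple, len_simple]; exact len_mul_simple w r h)
  rwa [mul_simple_mul_simple] at this

/-- Each letter changes the length by at most one. A factor whose permutation is shorter than its
word would therefore make the whole word longer than `len w`. -/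
theorem IsReducedWord.of_append {w : Perm (Fin n)} {A B : List (Fin (n - 1))}
    (h : IsReducedWord w (A ++ B)) :
    IsReducedWord (A.map simple).prod A ∧ IsReducedWord (B.map simple).prod B := by
  have h1 := len_prod_le A
  have h2 := len_prod_le B
  have hB : len w ≤ len (A.map simple).prod + B.length := by
    rw [← h.1, List.map_append, List.prod_append]
    clear h h1 h2
    induction B using List.reverseRecOn with
    | nil => simp
    | append_singleton B r ih =>
      rw [List.map_append, List.prod_append, ← mul_assoc]
      simp only [List.map_cons, List.map_nil, List.prod_cons, List.prod_nil, mul_one,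
        List.length_append, List.length_cons, List.length_nil]
      exact (len_mul_simple_le _ _).trans (by omega)
  have hA : len w ≤ A.length + len (B.map simple).prod := by
    rw [← h.1, List.map_append, List.prod_append]
    clear h h1 h2 hB
    induction A with
    | nil => simp
    | cons r A ih =>
      rw [List.map_cons, List.prod_cons, mul_assoc, List.length_cons]
      exact (len_simple_mul_le _ _).trans (by omega)
  have h3 := h.2
  rw [List.length_append] at h3
  exact ⟨⟨rfl, by omega⟩, ⟨rfl, by omega⟩⟩

theorem IsReducedWord.of_snoc {w : Perm (Fin n)} {A : List (Fin (n - 1))} {r : Fin (n - 1)}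
    (h : IsReducedWord w (A ++ [r])) : IsReducedWord (w * simple r) A ∧ w (hi r) < w (lo r) := by
  have h1 := h.of_append.1
  have hw : w = (A.map simple).prod * simple r := by
    rw [← h.1]; simp
  have h2 : w * simple r = (A.map simple).prod := by rw [hw, mul_simple_mul_simple]
  refine ⟨by rw [h2]; exact h1, ?_⟩
  rcases lt_or_gt_lo_hi w r with h' | h'
  · have h3 := len_mul_simple_of_lt w r h'
    have h4 := h.2
    have h5 := h1.2
    rw [h2] at h3
    simp only [List.length_append, List.length_cons, List.length_nil] at h4
    omega
  · exact h'

theorem redWord_spec (w : Perm (Fin n)) : IsReducedWord w (redWord w) :=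
  (exists_isReducedWord w).choose_spec

theorem simple_comm {r s : Fin (n - 1)} (h : (r : ℕ) + 1 < s) :
    simple r * simple s = simple s * simple r := by
  unfold simple
  refine (Perm.disjoint_iff_disjoint_support.mpr ?_).commute
  rw [Perm.support_swap (lo_lt_hi r).ne, Perm.support_swap (lo_lt_hi s).ne]
  simp only [lo, hi, Finset.disjoint_insert_left, Finset.disjoint_singleton_left,
    Finset.mem_insert, Finset.mem_singleton, Fin.ext_iff]
  omega

theorem simple_braid {r s : Fin (n - 1)} (h : (s : ℕ) = r + 1) :
    simple r * simple s * simple r = simple s * simple r * simple s := by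
  have e : hi r = lo s := Fin.ext (by simp [hi, lo, h])
  have h1 : lo r ≠ lo s := by simp [lo, Fin.ext_iff]; omega
  have h2 : lo r ≠ hi s := by simp [lo, hi, Fin.ext_iff]; omega
  have h3 : lo s ≠ hi s := (lo_lt_hi s).ne
  unfold simple
  rw [e]
  rw [swap_comm (lo s) (hi s), swap_comm (lo r) (lo s), swap_mul_swap_mul_swap h3.symm h2.symm,
    swap_comm (hi s) (lo s), swap_comm (lo s) (lo r), swap_mul_swap_mul_swap h1 h2, swap_comm]

/-- Matsumoto's theorem: a relation between reduced words that is compatible with appending a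
letter and contains the braid moves at the end of a word relates all reduced words. -/
theorem matsumoto (P : Perm (Fin n) → List (Fin (n - 1)) → List (Fin (n - 1)) → Prop)
    (refl : ∀ w A, IsReducedWord w A → P w A A)
    (symm : ∀ w A B, P w A B → P w B A)
    (trans : ∀ w A B C, P w A B → P w B C → P w A C)
    (app : ∀ w r A B, w (hi r) < w (lo r) → IsReducedWord (w * simple r) A →
      IsReducedWord (w * simple r) B → P (w * simple r) A B → P w (A ++ [r]) (B ++ [r]))
    (far : ∀ w (r s : Fin (n - 1)) A, (r : ℕ) + 1 < s → w (hi r) < w (lo r) → w (hi s) < w (lo s) →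
      IsReducedWord w (A ++ [r, s]) → P w (A ++ [r, s]) (A ++ [s, r]))
    (braid : ∀ w (r s : Fin (n - 1)) A, (s : ℕ) = r + 1 → w (hi r) < w (lo r) →
      w (hi s) < w (lo s) → IsReducedWord w (A ++ [r, s, r]) →
      P w (A ++ [r, s, r]) (A ++ [s, r, s]))
    (w : Perm (Fin n)) (A B : List (Fin (n - 1))) (hA : IsReducedWord w A)
    (hB : IsReducedWord w B) : P w A B := by
  obtain ⟨m, hm⟩ : ∃ m, len w = m := ⟨_, rfl⟩
  induction m using Nat.strong_induction_on generalizing w A B with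
  | _ m ih =>
  rcases List.eq_nil_or_concat' A with rfl | ⟨A', r, rfl⟩
  · have : B = [] := by
      rw [← List.length_eq_zero_iff, hB.2, ← hA.2]; rfl
    subst this
    exact refl _ _ hA
  rcases List.eq_nil_or_concat' B with rfl | ⟨B', s, rfl⟩
  · have h1 := hA.2
    have h2 := hB.2
    simp at h1 h2
    omega
  obtain ⟨hA', dr⟩ := hA.of_snoc
  obtain ⟨hB', ds⟩ := hB.of_snoc
  have lr := len_mul_simple w r dr
  have ls := len_mul_simple w s ds
  have step : ∀ r A' C, w (hi r) < w (lo r) → IsReducedWord (w * simple r) A' →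
      IsReducedWord (w * simple r) C → P w (A' ++ [r]) (C ++ [r]) := fun r A' C dr h h' =>
    app w r A' C dr h h' (ih _ (by have := len_mul_simple w r dr; omega) _ _ _ h h' rfl)
  -- If the last letters r and s differ, both are right descents of w. So w has reduced words that
  -- end in the two forms of the longest element of the group generated by `simple r` and `simple
  -- s`. The induction hypothesis compares the given words with these two, and one braid move joins
  -- them.
  have key : ∀ (r s : Fin (n - 1)) (A' B' : List (Fin (n - 1))), r < s →
      w (hi r) < w (lo r) → w (hi s) < w (lo s) → IsReducedWord (w * simple r) A' →
      IsReducedWord (w * simple s) B' → P w (A' ++ [r]) (B' ++ [s]) := by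
    intro r s A' B' hrs dr ds hA' hB'
    by_cases hfar : (r : ℕ) + 1 < s
    · have n1 : lo s ≠ lo r := by simp [lo, Fin.ext_iff]; omega
      have n2 : lo s ≠ hi r := by simp [lo, hi, Fin.ext_iff]; omega
      have n3 : hi s ≠ lo r := by simp [lo, hi, Fin.ext_iff]; omega
      have n4 : hi s ≠ hi r := by simp [hi, Fin.ext_iff]; omega
      have d1 : (w * simple r) (hi s) < (w * simple r) (lo s) := by
        simpa [simple_of_ne r n1 n2, simple_of_ne r n3 n4] using ds
      have d2 : (w * simple s) (hi r) < (w * simple s) (lo r) := by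
        simpa [simple_of_ne s n1.symm n3.symm, simple_of_ne s n2.symm n4.symm] using dr
      obtain ⟨C, hC⟩ := exists_isReducedWord (w * simple r * simple s)
      have c1 : IsReducedWord (w * simple r) (C ++ [s]) := hC.snoc d1
      have hC' := hC
      rw [mul_assoc, simple_comm hfar, ← mul_assoc] at hC'
      have c2 : IsReducedWord (w * simple s) (C ++ [r]) := hC'.snoc d2
      have p1 := step r A' _ dr hA' c1
      have p2 := step s B' _ ds hB' c2
      have p3 := far w r s C hfar dr ds (by simpa using c2.snoc ds)
      simp only [List.append_assoc, List.cons_append, List.nil_append] at p1 p2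
      exact trans _ _ _ _ p1 (trans _ _ _ _ (symm _ _ _ p3) (symm _ _ _ p2))
    · have hs : (s : ℕ) = r + 1 := by have : (r : ℕ) < s := hrs; omega
      have e : hi r = lo s := Fin.ext (by simp [hi, lo, hs])
      have h1 : lo r ≠ lo s := by simp [lo, Fin.ext_iff]; omega
      have h2 : lo r ≠ hi s := by simp [lo, hi, Fin.ext_iff]; omega
      have h3 : lo s ≠ hi s := (lo_lt_hi s).ne
      have q1 : simple r (lo r) = lo s := by rw [simple_lo, e]
      have q2 : simple r (lo s) = lo r := by rw [← e, simple_hi]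
      have q3 : simple r (hi s) = hi s := simple_of_ne r h2.symm (by rw [e]; exact h3.symm)
      have q4 : simple s (lo r) = lo r := simple_of_ne s h1 h2
      have q5 := simple_lo s
      have q6 := simple_hi s
      rw [e] at dr
      have d1 : (w * simple r) (hi s) < (w * simple r) (lo s) := by
        simp only [Perm.mul_apply, q2, q3]; exact ds.trans dr
      have d2 : (w * simple s) (hi r) < (w * simple s) (lo r) := by
        rw [e]; simp only [Perm.mul_apply, q4, q5]; exact ds.trans dr
      have d3 : (w * simple r * simple s) (hi r) < (w * simple r * simple s) (lo r) := by
        rw [e]; simp only [Perm.mul_apply, q4, q5, q1, q3]; exact ds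
      have d4 : (w * simple s * simple r) (hi s) < (w * simple s * simple r) (lo s) := by
        simp only [Perm.mul_apply, q2, q3, q4, q6]; exact dr
      obtain ⟨C, hC⟩ := exists_isReducedWord (w * simple r * simple s * simple r)
      have c1 : IsReducedWord (w * simple r) (C ++ [r] ++ [s]) := (hC.snoc d3).snoc d1
      have hC' : IsReducedWord (w * simple s * simple r * simple s) C := by
        have : w * simple s * simple r * simple s = w * simple r * simple s * simple r := by
          have := simple_braid hs
          simp only [mul_assoc] at this ⊢
          rw [this]
        rwa [this]
      have c2 : IsReducedWord (w * simple s) (C ++ [s] ++ [r]) := (hC'.snoc d4).snoc d2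
      rw [← e] at dr
      have p1 := step r A' _ dr hA' c1
      have p2 := step s B' _ ds hB' c2
      have p3 := braid w r s C hs dr ds (by simpa using c1.snoc dr)
      simp only [List.append_assoc, List.cons_append, List.nil_append] at p1 p2
      exact trans _ _ _ _ p1 (trans _ _ _ _ p3 (symm _ _ _ p2))
  rcases lt_trichotomy r s with h | h | h
  · exact key r s A' B' h dr ds hA' hB'
  · subst h
    exact step r A' B' dr hA' hB'
  · exact symm _ _ _ (key s r B' A' h ds dr hB' hA')

end Length

/-! ### Parabolic subgroups and coset representatives -/

section Parabolic

variable {d : ℕ} {α β : Type*}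

/-- The fibres of `g` are intervals. -/
def IntervalFibres (g : Fin d → α) : Prop :=
  ∀ i j m, i ≤ j → j ≤ m → g i = g m → g j = g i

/-- `u` is increasing on the fibres of `g`. -/
def MonoFib (g : Fin d → α) (u : Perm (Fin d)) : Prop :=
  ∀ i j, i < j → g i = g j → u i < u j

theorem intervalFibres_of_monotone [PartialOrder α] {g : Fin d → α} (h : Monotone g) :
    IntervalFibres g := fun _ _ _ h1 h2 e => le_antisymm ((h h2).trans e.ge) (h h1)

theorem simple_mem_fibreSubgroup {g : Fin d → α} {r : Fin (d - 1)} :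
    simple r ∈ fibreSubgroup g ↔ g (lo r) = g (hi r) := by
  constructor
  · intro h
    have := h (hi r)
    rwa [simple_hi] at this
  · intro h i
    by_cases h1 : i = lo r
    · rw [h1, simple_lo, h]
    by_cases h2 : i = hi r
    · rw [h2, simple_hi, h]
    rw [simple_of_ne r h1 h2]

/-- Different fibres are intervals one of which lies to the left of the other, and z permutes each
fibre within itself. -/
theorem lt_of_mem_fibreSubgroup {g : Fin d → α} (hg : IntervalFibres g) {z : Perm (Fin d)}
    (hz : z ∈ fibreSubgroup g) {i j : Fin d} (hij : i < j) (h : g i ≠ g j) : z i < z j := by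
  by_contra hc
  push Not at hc
  have hi' := hz i
  have hj' := hz j
  rcases le_or_gt i (z j) with h1 | h1
  · exact h (by rw [← hg i (z j) (z i) h1 hc hi'.symm, hj'])
  · exact h (by rw [hg (z j) i j h1.le hij.le hj', hj'])

theorem simple_mem_of_descent {g : Fin d → α} (hg : IntervalFibres g) {z : Perm (Fin d)}
    (hz : z ∈ fibreSubgroup g) {r : Fin (d - 1)} (h : z (hi r) < z (lo r)) :
    simple r ∈ fibreSubgroup g := by
  rw [simple_mem_fibreSubgroup]
  by_contra hc
  exact absurd (lt_of_mem_fibreSubgroup hg hz (lo_lt_hi r) hc) (not_lt.mpr h.le)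

/-- Neighbours suffice: all elements between two elements of a fibre belong to that fibre, so the
inequality is obtained by induction on the distance. -/
theorem monoFib_of_simple {g : Fin d → α} (hg : IntervalFibres g) {u : Perm (Fin d)}
    (h : ∀ r, simple r ∈ fibreSubgroup g → u (lo r) < u (hi r)) : MonoFib g u := by
  have key : ∀ m : ℕ, ∀ i j : Fin d, (j : ℕ) = i + m + 1 → g i = g j → u i < u j := by
    intro m
    induction m with
    | zero =>
      intro i j hij e
      have hr : (i : ℕ) < d - 1 := by have := j.2; omega
      have e1 : i = lo (⟨i, hr⟩ : Fin (d - 1)) := rfl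
      have e2 : j = hi (⟨i, hr⟩ : Fin (d - 1)) := Fin.ext (by simp [hi, hij])
      have := h ⟨i, hr⟩ (by rw [simple_mem_fibreSubgroup, ← e1, ← e2, e])
      rwa [← e1, ← e2] at this
    | succ m ih =>
      intro i j hij e
      have hj := j.2
      let j' : Fin d := ⟨i + m + 1, by omega⟩
      have hr : (j' : ℕ) < d - 1 := by simp only [j']; omega
      have e1 : j' = lo (⟨j', hr⟩ : Fin (d - 1)) := rfl
      have e2 : j = hi (⟨j', hr⟩ : Fin (d - 1)) := Fin.ext (by simp [hi, j', hij]; omega)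
      have e3 : g j' = g i := hg i j' j (by simp [Fin.le_def, j']; omega)
        (by simp [Fin.le_def, j']; omega) e
      have h2 := h ⟨j', hr⟩ (by rw [simple_mem_fibreSubgroup, ← e1, ← e2, e3, e])
      rw [← e1, ← e2] at h2
      exact (ih i j' rfl e3.symm).trans h2
  intro i j hij e
  have hij' : (i : ℕ) < j := hij
  exact key (j - i - 1) i j (by omega) e

/-- `MonoFib g u⁻¹` says that u is shortest in its coset S_g u. Then u inverts no pair whose images
lie in one fibre, and z does not invert pairs from different fibres, so no pair is inverted twice.
-/
theorem len_mul_of_monoFib {g : Fin d → α} (hg : IntervalFibres g) {z u : Perm (Fin d)}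
    (hz : z ∈ fibreSubgroup g) (hu : MonoFib g u⁻¹) : len (z * u) = len z + len u := by
  refine len_mul_of_no_double_crossing z u fun i j hij h => ?_
  refine lt_of_mem_fibreSubgroup hg hz h fun e => ?_
  have := hu _ _ h e
  simp only [perm_inv_apply] at this
  exact absurd hij (not_lt.mpr this.le)

theorem len_mul_of_monoFib' {g : Fin d → α} (hg : IntervalFibres g) {z u : Perm (Fin d)}
    (hz : z ∈ fibreSubgroup g) (hu : MonoFib g u) : len (u * z) = len u + len z := by
  rw [← len_inv, mul_inv_rev, len_mul_of_monoFib hg (inv_mem hz) (by rwa [inv_inv]), len_inv,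
    len_inv, add_comm]

theorem exists_mul_monoFib {g : Fin d → α} (hg : IntervalFibres g) (v : Perm (Fin d)) :
    ∃ z ∈ fibreSubgroup g, ∃ u, MonoFib g u⁻¹ ∧ v = z * u := by
  obtain ⟨m, hm⟩ : ∃ m, len v = m := ⟨_, rfl⟩
  induction m using Nat.strong_induction_on generalizing v with
  | _ m ih =>
  by_cases h : ∀ r, simple r ∈ fibreSubgroup g → v⁻¹ (lo r) < v⁻¹ (hi r)
  · exact ⟨1, one_mem _, v, monoFib_of_simple hg h, (one_mul v).symm⟩
  · push Not at h
    obtain ⟨r, hr, h⟩ := h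
    have h' := (lt_or_gt_lo_hi v⁻¹ r).resolve_left (not_lt.mpr h)
    have hl := len_simple_mul_of_gt v r h'
    obtain ⟨z, hz, u, hu, e⟩ := ih _ (by omega) (simple r * v) rfl
    refine ⟨simple r * z, mul_mem hr hz, u, hu, ?_⟩
    rw [mul_assoc, ← e, simple_mul_simple_mul]

/-- Uniqueness of the shortest element of a coset. At a descent of z⁻¹ the inverses of u and of z u
would order the same two elements of a fibre in opposite ways. -/
theorem eq_one_of_monoFib {g : Fin d → α} (hg : IntervalFibres g) {z u : Perm (Fin d)}
    (hz : z ∈ fibreSubgroup g) (hu : MonoFib g u⁻¹) (hu' : MonoFib g (z * u)⁻¹) : z = 1 := by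
  have hz' := inv_mem hz
  rw [← inv_eq_one]
  refine eq_one_of_no_descent _ fun r hr => ?_
  have e := simple_mem_fibreSubgroup.mp (simple_mem_of_descent hg hz' hr)
  have h1 := hu' _ _ (lo_lt_hi r) e
  rw [mul_inv_rev, Perm.mul_apply, Perm.mul_apply] at h1
  have h2 := hu _ _ hr (by rw [hz', hz', e])
  exact absurd h1 (not_lt.mpr h2.le)

theorem mem_leftMin_iff {g : Fin d → α} (hg : IntervalFibres g) {B : Subgroup (Perm (Fin d))}
    {y : Perm (Fin d)} : y ∈ leftMin (fibreSubgroup g) B ↔ y ∈ B ∧ MonoFib g y⁻¹ := by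
  refine and_congr_right fun _ => ⟨fun h => monoFib_of_simple hg fun r hr => ?_, fun h x hx => ?_⟩
  · by_contra hc
    have h' := (lt_or_gt_lo_hi y⁻¹ r).resolve_left hc
    have := len_simple_mul_of_gt y r h'
    have := h _ hr
    omega
  · rw [len_mul_of_monoFib hg hx h]
    omega

/-- `w` is increasing on the fibres of `g`, and `w⁻¹` on those of `f`. -/
def LocalMin (f : Fin d → β) (g : Fin d → α) (w : Perm (Fin d)) : Prop :=
  MonoFib g w ∧ MonoFib f w⁻¹

/-- The pairs encode S_g ∩ w⁻¹ S_f w. Since w is increasing on each fibre of g, the fibres of f pull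
back to intervals there, and the intersection is again a standard parabolic subgroup. -/
theorem LocalMin.intervalFibres {f : Fin d → β} {g : Fin d → α} (hf : IntervalFibres f)
    (hg : IntervalFibres g) {w : Perm (Fin d)} (hw : LocalMin f g w) :
    IntervalFibres fun i => (g i, f (w i)) := by
  have hle : ∀ i j, i ≤ j → g i = g j → w i ≤ w j := fun i j h e => by
    rcases h.eq_or_lt with rfl | h
    · exact le_rfl
    · exact (hw.1 i j h e).le
  intro i j m hij hjm e
  have e1 := congrArg Prod.fst e
  have e2 := congrArg Prod.snd e
  have h1 := hg i j m hij hjm e1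
  exact Prod.ext h1 (hf _ _ _ (hle i j hij h1.symm) (hle j m hjm (h1.trans e1)) e2)

/-- Two elements of one fibre of f are kept in order by w⁻¹. If they land in one fibre of g,
minimality of u keeps their order; otherwise every element of S_g does. -/
theorem LocalMin.monoFib_mul {f : Fin d → β} {g : Fin d → α} (hg : IntervalFibres g)
    {w u : Perm (Fin d)} (hw : LocalMin f g w) (hu : u ∈ fibreSubgroup g)
    (hu' : MonoFib (fun i => (g i, f (w i))) u⁻¹) : MonoFib f (w * u)⁻¹ := by
  intro i j hij e
  rw [mul_inv_rev, Perm.mul_apply, Perm.mul_apply]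
  have h1 := hw.2 i j hij e
  by_cases h : g (w⁻¹ i) = g (w⁻¹ j)
  · exact hu' _ _ h1 (Prod.ext h (by simpa only [perm_apply_inv] using e))
  · exact lt_of_mem_fibreSubgroup hg (inv_mem hu) h1 h

theorem exists_double_decomp {f : Fin d → β} {g : Fin d → α} (hf : IntervalFibres f)
    (hg : IntervalFibres g) (v : Perm (Fin d)) :
    ∃ z ∈ fibreSubgroup f, ∃ w, LocalMin f g w ∧ ∃ u ∈ fibreSubgroup g,
      MonoFib (fun i => (g i, f (w i))) u⁻¹ ∧ v = z * w * u := by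
  have key : ∃ z ∈ fibreSubgroup f, ∃ w, LocalMin f g w ∧ ∃ u ∈ fibreSubgroup g,
      v = z * w * u := by
    obtain ⟨m, hm⟩ : ∃ m, len v = m := ⟨_, rfl⟩
    induction m using Nat.strong_induction_on generalizing v with
    | _ m ih =>
    by_cases h : MonoFib g v
    · by_cases h' : MonoFib f v⁻¹
      · exact ⟨1, one_mem _, v, ⟨h, h'⟩, 1, one_mem _, by simp⟩
      · have := mt (monoFib_of_simple hf) h'
        push Not at this
        obtain ⟨r, hr, h1⟩ := this
        have h2 := (lt_or_gt_lo_hi v⁻¹ r).resolve_left (not_lt.mpr h1)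
        have hl := len_simple_mul_of_gt v r h2
        obtain ⟨z, hz, w, hw, u, hu, e⟩ := ih _ (by omega) (simple r * v) rfl
        exact ⟨simple r * z, mul_mem hr hz, w, hw, u, hu, by
          rw [mul_assoc, mul_assoc, ← mul_assoc z, ← e, simple_mul_simple_mul]⟩
    · have := mt (monoFib_of_simple hg) h
      push Not at this
      obtain ⟨r, hr, h1⟩ := this
      have h2 := (lt_or_gt_lo_hi v r).resolve_left (not_lt.mpr h1)
      have hl := len_mul_simple v r h2
      obtain ⟨z, hz, w, hw, u, hu, e⟩ := ih _ (by omega) (v * simple r) rfl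
      exact ⟨z, hz, w, hw, u * simple r, mul_mem hu hr, by
        rw [← mul_assoc, ← e, mul_simple_mul_simple]⟩
  obtain ⟨z, hz, w, hw, y, hy, e⟩ := key
  obtain ⟨x, hx, u, hu, e'⟩ := exists_mul_monoFib (hw.intervalFibres hf hg) y
  have hx1 : x ∈ fibreSubgroup g := fun i => congrArg Prod.fst (hx i)
  -- The part x of the right factor lies in S_g ∩ w⁻¹ S_f w. It is conjugated by w and absorbed in
  -- the left factor, which leaves a shortest coset representative on the right.
  refine ⟨z * (w * x * w⁻¹), mul_mem hz fun i => ?_, w, hw, u, ?_, hu, ?_⟩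
  · have := congrArg Prod.snd (hx (w⁻¹ i))
    simpa using this
  · have : u = x⁻¹ * y := by rw [e']; simp
    rw [this]
    exact mul_mem (inv_mem hx1) hy
  · rw [e, e']; group

/-- Writing y = y₁ u as above and moving y₁ to the left, the uniqueness of shortest elements for S_f
removes the whole left factor. Uniqueness for S_g then removes u. -/
theorem LocalMin.eq {f : Fin d → β} {g : Fin d → α} (hf : IntervalFibres f)
    (hg : IntervalFibres g) {w w' x y : Perm (Fin d)} (hw : LocalMin f g w)
    (hw' : LocalMin f g w') (hx : x ∈ fibreSubgroup f) (hy : y ∈ fibreSubgroup g)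
    (e : w' = x * w * y) : w' = w := by
  obtain ⟨y1, hy1, u, hu, e'⟩ := exists_mul_monoFib (hw.intervalFibres hf hg) y
  have hy1' : y1 ∈ fibreSubgroup g := fun i => congrArg Prod.fst (hy1 i)
  have hu1 : u ∈ fibreSubgroup g := by
    have : u = y1⁻¹ * y := by rw [e']; simp
    rw [this]
    exact mul_mem (inv_mem hy1') hy
  have hx1 : x * (w * y1 * w⁻¹) ∈ fibreSubgroup f := mul_mem hx fun i => by
    have := congrArg Prod.snd (hy1 (w⁻¹ i))
    simpa using this
  have e1 : w' = x * (w * y1 * w⁻¹) * (w * u) := by rw [e, e']; group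
  have h1 := eq_one_of_monoFib hf hx1 (hw.monoFib_mul hg hu1 hu) (by rw [← e1]; exact hw'.2)
  rw [h1, one_mul] at e1
  have h2 := eq_one_of_monoFib hg (z := u⁻¹) (u := w⁻¹) (inv_mem hu1) (by rw [inv_inv]; exact hw.1)
    (by rw [← mul_inv_rev, inv_inv, ← e1]; exact hw'.1)
  rw [inv_eq_one] at h2
  rw [e1, h2, mul_one]

theorem double_decomp_unique {f : Fin d → β} {g : Fin d → α} (hf : IntervalFibres f)
    (hg : IntervalFibres g) {z w u z' w' u' : Perm (Fin d)} (hz : z ∈ fibreSubgroup f)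
    (hw : LocalMin f g w) (hu : u ∈ fibreSubgroup g)
    (hum : MonoFib (fun i => (g i, f (w i))) u⁻¹) (hz' : z' ∈ fibreSubgroup f)
    (hw' : LocalMin f g w') (hu' : u' ∈ fibreSubgroup g)
    (hum' : MonoFib (fun i => (g i, f (w' i))) u'⁻¹) (e : z * w * u = z' * w' * u') :
    z = z' ∧ w = w' ∧ u = u' := by
  have h1 : w' = w := hw.eq hf hg hw' (mul_mem (inv_mem hz') hz) (mul_mem hu (inv_mem hu'))
    (by
      have : w' = z'⁻¹ * (z' * w' * u') * u'⁻¹ := by group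
      rw [this, ← e]; group)
  subst h1
  have h2 : z'⁻¹ * z = 1 := eq_one_of_monoFib hf (mul_mem (inv_mem hz') hz)
    (hw.monoFib_mul hg hu hum) (by
      have : z'⁻¹ * z * (w' * u) = w' * u' := by
        have : z'⁻¹ * z * (w' * u) = z'⁻¹ * (z * w' * u) := by group
        rw [this, e]; group
      rw [this]
      exact hw.monoFib_mul hg hu' hum')
  have h3 : z = z' := (inv_mul_eq_one.mp h2).symm
  subst h3
  exact ⟨rfl, rfl, mul_left_cancel e⟩

/-- A violation of the local condition gives a shorter element after one simple reflection.
Conversely, x w y factors as z w u with the same middle factor, and the lengths of the three factors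
add. -/
theorem isDoubleMin_iff {f : Fin d → β} {g : Fin d → α} (hf : IntervalFibres f)
    (hg : IntervalFibres g) {w : Perm (Fin d)} :
    IsDoubleMin (fibreSubgroup f) (fibreSubgroup g) w ↔ LocalMin f g w := by
  constructor
  · intro h
    refine ⟨monoFib_of_simple hg fun r hr => ?_, monoFib_of_simple hf fun r hr => ?_⟩
    · by_contra hc
      have := len_mul_simple w r ((lt_or_gt_lo_hi w r).resolve_left hc)
      have := h 1 (one_mem _) _ hr
      rw [one_mul] at this
      omega
    · by_contra hc
      have := len_simple_mul_of_gt w r ((lt_or_gt_lo_hi w⁻¹ r).resolve_left hc)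
      have := h _ hr 1 (one_mem _)
      rw [mul_one] at this
      omega
  · intro hw x hx y hy
    obtain ⟨z, hz, w', hw', u, hu, hum, e⟩ := exists_double_decomp hf hg (x * w * y)
    have : w = w' := hw'.eq hf hg hw (x := x⁻¹ * z) (y := u * y⁻¹) (mul_mem (inv_mem hx) hz)
      (mul_mem hu (inv_mem hy)) (by
        have : w = x⁻¹ * (x * w * y) * y⁻¹ := by group
        rw [this, e]; group)
    subst this
    rw [e, mul_assoc, len_mul_of_monoFib hf hz (hw.monoFib_mul hg hu hum),
      len_mul_of_monoFib' hg hu hw.1]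
    omega

end Parabolic

end HigherSchur

namespace HigherSchur

open Equiv

/-! ### Positions of the red and black strands. -/

namespace ColourSeq

variable {ℓ d : ℕ}

theorem card_reds (c : ColourSeq ℓ d) : c.reds.card = ℓ := c.2

theorem card_compl_reds (c : ColourSeq ℓ d) : c.redsᶜ.card = d := by
  rw [Finset.card_compl, Fintype.card_fin, card_reds]
  omega

theorem redPos_eq (c : ColourSeq ℓ d) (m : Fin ℓ) :
    c.redPos m = c.reds.orderEmbOfFin c.card_reds m := rfl

theorem blackPos_eq (c : ColourSeq ℓ d) (i : Fin d) :
    c.blackPos i = c.redsᶜ.orderEmbOfFin c.card_compl_reds i := rfl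

theorem redPos_strictMono (c : ColourSeq ℓ d) : StrictMono c.redPos := by
  intro m m' h
  simpa [redPos_eq] using h

theorem blackPos_strictMono (c : ColourSeq ℓ d) : StrictMono c.blackPos := by
  intro m m' h
  simpa [blackPos_eq] using h

theorem colour_redPos (c : ColourSeq ℓ d) (m : Fin ℓ) : c.1 (c.redPos m) = true := by
  have : c.redPos m ∈ c.reds := by
    rw [redPos_eq]
    exact Finset.orderEmbOfFin_mem _ _ _
  exact (Finset.mem_filter.mp this).2

theorem colour_blackPos (c : ColourSeq ℓ d) (i : Fin d) : c.1 (c.blackPos i) = false := by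
  have : c.blackPos i ∈ c.redsᶜ := by
    rw [blackPos_eq]
    exact Finset.orderEmbOfFin_mem _ _ _
  simpa [reds] using this

theorem red_or_black (c : ColourSeq ℓ d) (p : Fin (ℓ + d)) :
    (∃ m, c.redPos m = p) ∨ ∃ i, c.blackPos i = p := by
  obtain ⟨s, rfl⟩ := c.place.surjective p
  cases s with
  | inl m => exact Or.inl ⟨m, rfl⟩
  | inr i => exact Or.inr ⟨i, rfl⟩

theorem exists_redPos {c : ColourSeq ℓ d} {p : Fin (ℓ + d)} (h : c.1 p = true) :
    ∃ m, c.redPos m = p := by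
  rcases c.red_or_black p with h' | ⟨i, rfl⟩
  · exact h'
  · rw [colour_blackPos] at h; cases h

theorem exists_blackPos {c : ColourSeq ℓ d} {p : Fin (ℓ + d)} (h : c.1 p = false) :
    ∃ i, c.blackPos i = p := by
  rcases c.red_or_black p with ⟨i, rfl⟩ | h'
  · rw [colour_redPos] at h; cases h
  · exact h'

theorem redPos_ne_blackPos (c : ColourSeq ℓ d) (m : Fin ℓ) (i : Fin d) :
    c.redPos m ≠ c.blackPos i := fun h => by
  have := colour_redPos c m
  rw [h, colour_blackPos] at this
  cases this

theorem act_apply (π : Perm (Fin (ℓ + d))) (c : ColourSeq ℓ d) (p : Fin (ℓ + d)) :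
    (c.act π).1 (π p) = c.1 p := by
  simp [act]

theorem act_apply' (π : Perm (Fin (ℓ + d))) (c : ColourSeq ℓ d) (p : Fin (ℓ + d)) :
    (c.act π).1 p = c.1 (π⁻¹ p) := rfl

theorem act_one (c : ColourSeq ℓ d) : c.act 1 = c := rfl

theorem act_mul (π ρ : Perm (Fin (ℓ + d))) (c : ColourSeq ℓ d) :
    c.act (π * ρ) = (c.act ρ).act π := by
  apply Subtype.ext
  funext p
  simp [act]

theorem act_simple_act_simple (r : Fin (ℓ + d - 1)) (c : ColourSeq ℓ d) :
    (c.act (simple r)).act (simple r) = c := by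
  rw [← act_mul, simple_mul_self, act_one]

end ColourSeq

open ColourSeq

/-! ### Permutations of all the strands. -/

section StrandPerm

variable {ℓ d : ℕ}

theorem strandPerm_redPos (b c : ColourSeq ℓ d) (w : Perm (Fin d)) (m : Fin ℓ) :
    strandPerm b c w (c.redPos m) = b.redPos m := by
  simp [strandPerm, redPos]

theorem strandPerm_blackPos (b c : ColourSeq ℓ d) (w : Perm (Fin d)) (i : Fin d) :
    strandPerm b c w (c.blackPos i) = b.blackPos (w i) := by
  simp [strandPerm, blackPos]

theorem perm_ext_strands (c : ColourSeq ℓ d) {π ρ : Perm (Fin (ℓ + d))}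
    (h1 : ∀ m, π (c.redPos m) = ρ (c.redPos m))
    (h2 : ∀ i, π (c.blackPos i) = ρ (c.blackPos i)) : π = ρ := by
  ext p : 1
  rcases c.red_or_black p with ⟨m, rfl⟩ | ⟨i, rfl⟩
  · exact h1 m
  · exact h2 i

theorem strandPerm_mul (a b c : ColourSeq ℓ d) (z u : Perm (Fin d)) :
    strandPerm a b z * strandPerm b c u = strandPerm a c (z * u) :=
  perm_ext_strands c (fun m => by simp only [Perm.mul_apply, strandPerm_redPos])
    (fun i => by simp only [Perm.mul_apply, strandPerm_blackPos])

theorem strandPerm_self_one (c : ColourSeq ℓ d) : strandPerm c c 1 = 1 :=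
  perm_ext_strands c (fun m => by simp only [strandPerm_redPos, Perm.one_apply])
    (fun i => by simp only [strandPerm_blackPos, Perm.one_apply])

theorem strandPerm_inv (b c : ColourSeq ℓ d) (w : Perm (Fin d)) :
    (strandPerm b c w)⁻¹ = strandPerm c b w⁻¹ := by
  rw [inv_eq_iff_mul_eq_one, strandPerm_mul, mul_inv_cancel, strandPerm_self_one]

theorem act_strandPerm (b c : ColourSeq ℓ d) (w : Perm (Fin d)) :
    c.act (strandPerm b c w) = b := by
  apply Subtype.ext
  funext p
  rw [act_apply', strandPerm_inv]
  rcases b.red_or_black p with ⟨m, rfl⟩ | ⟨i, rfl⟩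
  · rw [strandPerm_redPos, colour_redPos, colour_redPos]
  · rw [strandPerm_blackPos, colour_blackPos, colour_blackPos]

theorem strandPerm_injective (b c : ColourSeq ℓ d) : Function.Injective (strandPerm b c) := by
  intro w w' h
  ext i : 1
  have := congrArg (fun π : Perm (Fin (ℓ + d)) => π (c.blackPos i)) h
  simp only [strandPerm_blackPos] at this
  exact b.blackPos_strictMono.injective this

/-- `π` does not cross any two red strands of `c`. -/
def RedMono (c : ColourSeq ℓ d) (π : Perm (Fin (ℓ + d))) : Prop :=
  ∀ m m', m < m' → π (c.redPos m) < π (c.redPos m')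

theorem redMono_strandPerm (b c : ColourSeq ℓ d) (w : Perm (Fin d)) :
    RedMono c (strandPerm b c w) := fun m m' h => by
  rw [strandPerm_redPos, strandPerm_redPos]
  exact b.redPos_strictMono h

theorem RedMono.redPos_act {c : ColourSeq ℓ d} {π : Perm (Fin (ℓ + d))} (h : RedMono c π)
    (m : Fin ℓ) : (c.act π).redPos m = π (c.redPos m) := by
  have := congrFun (Finset.orderEmbOfFin_unique (s := (c.act π).reds) (card_reds _)
    (f := fun m => π (c.redPos m)) (fun m => by
      simp [reds, act_apply, colour_redPos]) (fun m m' hm => h m m' hm)) m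
  exact this.symm

/-- Once the red strands keep their order, the only remaining freedom is a permutation of the black
ones. -/
theorem RedMono.exists_strandPerm {c : ColourSeq ℓ d} {π : Perm (Fin (ℓ + d))}
    (h : RedMono c π) : ∃ w, π = strandPerm (c.act π) c w := by
  have hb : ∀ i, ∃ j, (c.act π).blackPos j = π (c.blackPos i) := fun i =>
    exists_blackPos (by rw [act_apply, colour_blackPos])
  choose f hf using hb
  have hinj : Function.Injective f := fun i j e => by
    have h1 := hf i
    rw [e, hf j] at h1
    exact (c.blackPos_strictMono.injective (π.injective h1)).symm
  refine ⟨Equiv.ofBijective f (Finite.injective_iff_bijective.mp hinj), ?_⟩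
  refine perm_ext_strands c (fun m => ?_) fun i => ?_
  · rw [strandPerm_redPos, h.redPos_act]
  · rw [strandPerm_blackPos, Equiv.ofBijective_apply, hf]

theorem redMono_simple {c : ColourSeq ℓ d} {r : Fin (ℓ + d - 1)}
    (h : ¬ (c.1 (lo r) = true ∧ c.1 (hi r) = true)) : RedMono c (simple r) := by
  intro m m' hm
  refine simple_lt r (c.redPos_strictMono hm) fun hh => h ?_
  rw [← hh.1, ← hh.2]
  exact ⟨colour_redPos c m, colour_redPos c m'⟩

theorem act_simple_of_same {c : ColourSeq ℓ d} {r : Fin (ℓ + d - 1)}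
    (h : c.1 (lo r) = c.1 (hi r)) : c.act (simple r) = c := by
  apply Subtype.ext
  funext p
  rw [act_apply', simple_inv]
  by_cases h1 : p = lo r
  · rw [h1, simple_lo, h]
  by_cases h2 : p = hi r
  · rw [h2, simple_hi, h]
  rw [simple_of_ne r h1 h2]

/-- Two neighbouring black positions belong to neighbouring black strands. -/
theorem exists_black_neighbours {c : ColourSeq ℓ d} {r : Fin (ℓ + d - 1)}
    (h : c.1 (lo r) = false) (h' : c.1 (hi r) = false) :
    ∃ j : Fin (d - 1), c.blackPos (lo j) = lo r ∧ c.blackPos (hi j) = hi r := by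
  obtain ⟨i, hi'⟩ := exists_blackPos h
  obtain ⟨i', hi''⟩ := exists_blackPos h'
  have hlt : i < i' := c.blackPos_strictMono.lt_iff_lt.mp (by rw [hi', hi'']; exact lo_lt_hi r)
  have hs : (i' : ℕ) = i + 1 := by
    by_contra hne
    have h1 : (i : ℕ) < i' := hlt
    have h2 : (i : ℕ) + 1 < d := by have := i'.2; omega
    have h3 : c.blackPos i < c.blackPos ⟨i + 1, h2⟩ :=
      c.blackPos_strictMono (by simp [Fin.lt_def])
    have h4 : c.blackPos ⟨i + 1, h2⟩ < c.blackPos i' :=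
      c.blackPos_strictMono (by simp only [Fin.lt_def]; omega)
    rw [hi'] at h3
    rw [hi''] at h4
    simp only [lo, hi, Fin.lt_def] at h3 h4
    omega
  refine ⟨⟨i, by have := i'.2; omega⟩, ?_, ?_⟩
  · rw [← hi']; rfl
  · rw [← hi'']
    congr 1
    exact Fin.ext (by simp [hi, hs])

theorem strandPerm_simple {c : ColourSeq ℓ d} {r : Fin (ℓ + d - 1)} {j : Fin (d - 1)}
    (h : c.blackPos (lo j) = lo r) (h' : c.blackPos (hi j) = hi r) :
    strandPerm c c (simple j) = simple r := by
  refine perm_ext_strands c (fun m => ?_) fun i => ?_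
  · rw [strandPerm_redPos, simple_of_ne]
    · rw [← h]; exact redPos_ne_blackPos c _ _
    · rw [← h']; exact redPos_ne_blackPos c _ _
  · rw [strandPerm_blackPos]
    by_cases h1 : i = lo j
    · rw [h1, simple_lo, h, simple_lo, h']
    by_cases h2 : i = hi j
    · rw [h2, simple_hi, h', simple_hi, h]
    rw [simple_of_ne j h1 h2, simple_of_ne]
    · rw [← h]; exact fun e => h1 (c.blackPos_strictMono.injective e)
    · rw [← h']; exact fun e => h2 (c.blackPos_strictMono.injective e)

theorem blackPos_act_simple {c : ColourSeq ℓ d} {r : Fin (ℓ + d - 1)}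
    (h : c.1 (lo r) ≠ c.1 (hi r)) (i : Fin d) :
    (c.act (simple r)).blackPos i = simple r (c.blackPos i) := by
  have hm : StrictMono fun i => simple r (c.blackPos i) := fun i i' hi' => by
    refine simple_lt r (c.blackPos_strictMono hi') fun hh => h ?_
    rw [← hh.1, ← hh.2, colour_blackPos, colour_blackPos]
  have := congrFun (Finset.orderEmbOfFin_unique (s := (c.act (simple r)).redsᶜ) (card_compl_reds _)
    (f := fun i => simple r (c.blackPos i)) (fun m => by
      simp [reds, act_apply, colour_blackPos]) hm) i
  exact this.symm

theorem redPos_act_simple {c : ColourSeq ℓ d} {r : Fin (ℓ + d - 1)}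
    (h : ¬ (c.1 (lo r) = true ∧ c.1 (hi r) = true)) (m : Fin ℓ) :
    (c.act (simple r)).redPos m = simple r (c.redPos m) := (redMono_simple h).redPos_act m

theorem strandPerm_act_simple {c : ColourSeq ℓ d} {r : Fin (ℓ + d - 1)}
    (h : c.1 (lo r) ≠ c.1 (hi r)) : strandPerm (c.act (simple r)) c 1 = simple r := by
  refine perm_ext_strands c (fun m => ?_) fun i => ?_
  · rw [strandPerm_redPos, redPos_act_simple]
    rintro ⟨h1, h2⟩
    exact h (h1.trans h2.symm)
  · rw [strandPerm_blackPos, Perm.one_apply, blackPos_act_simple h]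

/-! ### Counting black strands to the left of a red one -/

/-- An initial segment of `Fin d` is determined by its cardinality; this turns positions relative to
a red strand into inequalities with `cnt`. -/
theorem card_filter_of_isLowerSet (S : Finset (Fin d)) (h : ∀ i ∈ S, ∀ j, j ≤ i → j ∈ S)
    (i : Fin d) : i ∈ S ↔ (i : ℕ) < S.card := by
  constructor
  · intro hi'
    have : (Finset.Iic i).card ≤ S.card :=
      Finset.card_le_card fun j hj => h i hi' j (Finset.mem_Iic.mp hj)
    rw [Fin.card_Iic] at this
    omega
  · intro hc
    by_contra hi'
    have : S.card ≤ (Finset.Iio i).card := Finset.card_le_card fun j hj => by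
      rw [Finset.mem_Iio]
      by_contra hij
      exact hi' (h j hj i (not_lt.mp hij))
    rw [Fin.card_Iio] at this
    omega

/-- The number of black strands to the left of the `m`-th red strand. -/
noncomputable def cnt (c : ColourSeq ℓ d) (m : Fin ℓ) : ℕ :=
  (Finset.univ.filter fun i => c.blackPos i < c.redPos m).card

theorem blackPos_lt_redPos (c : ColourSeq ℓ d) (m : Fin ℓ) (i : Fin d) :
    c.blackPos i < c.redPos m ↔ (i : ℕ) < cnt c m := by
  have := card_filter_of_isLowerSet (Finset.univ.filter fun i => c.blackPos i < c.redPos m)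
    (fun i hi' j hj => by
      simp only [Finset.mem_filter, Finset.mem_univ, true_and] at hi' ⊢
      exact (c.blackPos_strictMono.monotone hj).trans_lt hi') i
  rw [Finset.mem_filter] at this
  exact ⟨fun h => this.1 ⟨Finset.mem_univ _, h⟩, fun h => (this.2 h).2⟩

theorem redPos_lt_blackPos (c : ColourSeq ℓ d) (m : Fin ℓ) (i : Fin d) :
    c.redPos m < c.blackPos i ↔ cnt c m ≤ i := by
  rw [← not_lt, ← blackPos_lt_redPos, not_lt]
  exact ⟨fun h => h.le, fun h => lt_of_le_of_ne h (redPos_ne_blackPos c m i)⟩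

theorem redPos_val (c : ColourSeq ℓ d) (m : Fin ℓ) : (c.redPos m : ℕ) = m + cnt c m := by
  have h : Finset.Iio (c.redPos m) = (Finset.Iio m).image c.redPos ∪
      (Finset.univ.filter fun i => c.blackPos i < c.redPos m).image c.blackPos := by
    ext p
    simp only [Finset.mem_union, Finset.mem_image, Finset.mem_Iio, Finset.mem_filter,
      Finset.mem_univ, true_and]
    constructor
    · intro hp
      rcases c.red_or_black p with ⟨m', rfl⟩ | ⟨i, rfl⟩
      · exact Or.inl ⟨m', c.redPos_strictMono.lt_iff_lt.mp hp, rfl⟩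
      · exact Or.inr ⟨i, hp, rfl⟩
    · rintro (⟨m', hm, rfl⟩ | ⟨i, hi', rfl⟩)
      · exact c.redPos_strictMono hm
      · exact hi'
  have h2 := congrArg Finset.card h
  rw [Finset.card_union_of_disjoint, Finset.card_image_of_injective _ c.redPos_strictMono.injective,
    Finset.card_image_of_injective _ c.blackPos_strictMono.injective, Fin.card_Iio,
    Fin.card_Iio] at h2
  · exact h2
  · rw [Finset.disjoint_left]
    intro p hp hp'
    obtain ⟨m', _, rfl⟩ := Finset.mem_image.mp hp
    obtain ⟨i, _, e⟩ := Finset.mem_image.mp hp'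
    exact redPos_ne_blackPos c _ _ e.symm

/-- The m-th red strand stands at position m plus the number of black strands to its left, so these
numbers determine the set of red positions. -/
theorem colourSeq_ext {b c : ColourSeq ℓ d} (h : ∀ m, cnt b m = cnt c m) : b = c := by
  have h1 : ∀ m, b.redPos m = c.redPos m := fun m => Fin.ext (by rw [redPos_val, redPos_val, h])
  apply Subtype.ext
  funext p
  rw [Bool.eq_iff_iff]
  constructor
  · intro hp
    obtain ⟨m, rfl⟩ := exists_redPos hp
    rw [h1, colour_redPos]
  · intro hp
    obtain ⟨m, rfl⟩ := exists_redPos hp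
    rw [← h1, colour_redPos]

/-- No red strand separates the neighbouring black strands `j` and `j + 1`. -/
def Adj (c : ColourSeq ℓ d) (j : Fin (d - 1)) : Prop := ∀ m, cnt c m ≠ j + 1

theorem Adj.exists_pos {c : ColourSeq ℓ d} {j : Fin (d - 1)} (h : Adj c j) :
    ∃ r : Fin (ℓ + d - 1), c.blackPos (lo j) = lo r ∧ c.blackPos (hi j) = hi r := by
  have h1 := c.blackPos_strictMono (lo_lt_hi j)
  have hp : (c.blackPos (lo j) : ℕ) + 1 < ℓ + d := by
    have := (c.blackPos (hi j)).2
    have h1 : (c.blackPos (lo j) : ℕ) < c.blackPos (hi j) := h1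
    omega
  have hh : c.blackPos (hi j) = ⟨c.blackPos (lo j) + 1, hp⟩ := by
    by_contra hne
    have h2 : (⟨c.blackPos (lo j) + 1, hp⟩ : Fin (ℓ + d)) < c.blackPos (hi j) := by
      refine lt_of_le_of_ne ?_ (Ne.symm hne)
      simp only [Fin.le_def]
      exact h1
    have h3 : c.blackPos (lo j) < ⟨c.blackPos (lo j) + 1, hp⟩ := by simp [Fin.lt_def]
    rcases c.red_or_black ⟨c.blackPos (lo j) + 1, hp⟩ with ⟨m, hm⟩ | ⟨i, hi'⟩
    · rw [← hm] at h2 h3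
      rw [redPos_lt_blackPos] at h2
      rw [blackPos_lt_redPos] at h3
      have := h m
      simp only [lo, hi] at h2 h3
      omega
    · rw [← hi'] at h2 h3
      have h2' := c.blackPos_strictMono.lt_iff_lt.mp h2
      have h3' := c.blackPos_strictMono.lt_iff_lt.mp h3
      simp only [lo, hi, Fin.lt_def] at h2' h3'
      omega
  refine ⟨⟨c.blackPos (lo j), by omega⟩, rfl, ?_⟩
  rw [hh]
  rfl

theorem adj_of_neighbours {c : ColourSeq ℓ d} {r : Fin (ℓ + d - 1)} {j : Fin (d - 1)}
    (h : c.blackPos (lo j) = lo r) (h' : c.blackPos (hi j) = hi r) : Adj c j := by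
  intro m hm
  have h1 := (redPos_lt_blackPos c m (hi j)).mpr (by simp [hi, hm])
  have h2 := (blackPos_lt_redPos c m (lo j)).mpr (by simp [lo, hm])
  rw [h'] at h1
  rw [h] at h2
  simp only [lo, hi, Fin.lt_def] at h1 h2
  omega

/-- Lengths of strand permutations add if neither two black strands nor a red and a black strand
cross twice. -/
theorem len_strandPerm_mul (a b c : ColourSeq ℓ d) (z u : Perm (Fin d))
    (h : ∀ i j, i < j → u j < u i → z (u j) < z (u i))
    (h' : ∀ (m : Fin ℓ) (i : Fin d), (cnt c m ≤ i ↔ cnt b m ≤ u i) ∨ (cnt b m ≤ u i ↔ cnt a m ≤ z (u i))) :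
    len (strandPerm a c (z * u)) = len (strandPerm a b z) + len (strandPerm b c u) := by
  rw [← strandPerm_mul a b c]
  refine len_mul_of_no_double_crossing _ _ fun p q hpq hc => ?_
  -- Two red strands never cross. Black pairs are controlled by `h`, and for a mixed pair `h'` says
  -- that one of the two factors does not cross it.
  rcases c.red_or_black p with ⟨m, rfl⟩ | ⟨i, rfl⟩ <;>
    rcases c.red_or_black q with ⟨m', rfl⟩ | ⟨i', rfl⟩
  · simp only [strandPerm_redPos] at hc ⊢
    exact a.redPos_strictMono (b.redPos_strictMono.lt_iff_lt.mp hc)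
  · simp only [strandPerm_redPos, strandPerm_blackPos] at hc ⊢
    rw [redPos_lt_blackPos] at hpq
    rw [blackPos_lt_redPos] at hc ⊢
    have := h' m i'
    omega
  · simp only [strandPerm_redPos, strandPerm_blackPos] at hc ⊢
    rw [blackPos_lt_redPos] at hpq
    rw [redPos_lt_blackPos] at hc ⊢
    have := h' m' i
    omega
  · simp only [strandPerm_blackPos] at hc ⊢
    exact a.blackPos_strictMono (h i i' (c.blackPos_strictMono.lt_iff_lt.mp hpq)
      (b.blackPos_strictMono.lt_iff_lt.mp hc))

/-! ### Blocks of black strands -/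

variable {α : Type*}

/-- The fibres of `g` are sets of consecutive black strands of `c` with no red ones between. -/
def Blocked (c : ColourSeq ℓ d) (g : Fin d → α) : Prop :=
  IntervalFibres g ∧ ∀ j, simple j ∈ fibreSubgroup g → Adj c j

/-- The extension of `g` to all the strands, by which red strands form blocks of their own. -/
noncomputable def strandFib (c : ColourSeq ℓ d) (g : Fin d → α) (p : Fin (ℓ + d)) : Fin ℓ ⊕ α :=
  Sum.map id g (c.place.symm p)

theorem strandFib_redPos (c : ColourSeq ℓ d) (g : Fin d → α) (m : Fin ℓ) :
    strandFib c g (c.redPos m) = Sum.inl m := by simp [strandFib, redPos]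

theorem strandFib_blackPos (c : ColourSeq ℓ d) (g : Fin d → α) (i : Fin d) :
    strandFib c g (c.blackPos i) = Sum.inr (g i) := by simp [strandFib, blackPos]

/-- If a red strand separated two black strands of one fibre, then the two neighbouring black
strands on its sides would lie in this fibre as well, against `Adj`. -/
theorem Blocked.cnt_le_iff {c : ColourSeq ℓ d} {g : Fin d → α} (h : Blocked c g) {i j : Fin d}
    (e : g i = g j) (m : Fin ℓ) : cnt c m ≤ i ↔ cnt c m ≤ j := by
  have key : ∀ i j : Fin d, i < j → g i = g j → cnt c m ≤ j → cnt c m ≤ i := by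
    intro i j hij e hj
    by_contra hi'
    push Not at hi'
    have hj' := j.2
    have hi'' : (i : ℕ) < j := hij
    have hr : cnt c m - 1 < d - 1 := by omega
    have h1 : g (lo ⟨cnt c m - 1, hr⟩) = g i :=
      h.1 i _ j (by simp only [lo, Fin.le_def]; omega) (by simp only [lo, Fin.le_def]; omega) e
    have h2 : g (hi ⟨cnt c m - 1, hr⟩) = g i :=
      h.1 i _ j (by simp only [hi, Fin.le_def]; omega) (by simp only [hi, Fin.le_def]; omega) e
    have := h.2 ⟨cnt c m - 1, hr⟩ (by rw [simple_mem_fibreSubgroup, h1, h2]) m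
    simp only at this
    omega
  rcases lt_trichotomy i j with hij | rfl | hij
  · exact ⟨fun hh => hh.trans hij.le, key i j hij e⟩
  · exact Iff.rfl
  · exact ⟨key j i hij e.symm, fun hh => hh.trans hij.le⟩

theorem Blocked.intervalFibres_strandFib {c : ColourSeq ℓ d} {g : Fin d → α}
    (h : Blocked c g) : IntervalFibres (strandFib c g) := by
  intro p q s hpq hqs e
  rcases c.red_or_black p with ⟨m, rfl⟩ | ⟨i, rfl⟩ <;>
    rcases c.red_or_black s with ⟨m', rfl⟩ | ⟨i', rfl⟩
  · rw [strandFib_redPos, strandFib_redPos, Sum.inl.injEq] at e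
    subst e
    rw [le_antisymm hpq hqs]
  · rw [strandFib_redPos, strandFib_blackPos] at e; cases e
  · rw [strandFib_redPos, strandFib_blackPos] at e; cases e
  · rw [strandFib_blackPos, strandFib_blackPos, Sum.inr.injEq] at e
    rcases c.red_or_black q with ⟨m, rfl⟩ | ⟨j, rfl⟩
    · have h1 := (redPos_lt_blackPos c m i').mp (lt_of_le_of_ne hqs (redPos_ne_blackPos _ _ _))
      rw [← h.cnt_le_iff e, ← redPos_lt_blackPos] at h1
      exact absurd h1 (not_lt.mpr hpq)
    · rw [strandFib_blackPos, strandFib_blackPos,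
        h.1 i j i' (c.blackPos_strictMono.le_iff_le.mp hpq)
          (c.blackPos_strictMono.le_iff_le.mp hqs) e]

theorem strandPerm_mem_fibreSubgroup (c : ColourSeq ℓ d) {g : Fin d → α} {z : Perm (Fin d)}
    (hz : z ∈ fibreSubgroup g) : strandPerm c c z ∈ fibreSubgroup (strandFib c g) := by
  intro p
  rcases c.red_or_black p with ⟨m, rfl⟩ | ⟨i, rfl⟩
  · rw [strandPerm_redPos]
  · rw [strandPerm_blackPos, strandFib_blackPos, strandFib_blackPos, hz]

theorem monoFib_strandPerm (b c : ColourSeq ℓ d) {g : Fin d → α} {u : Perm (Fin d)}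
    (hu : MonoFib g u) : MonoFib (strandFib c g) (strandPerm b c u) := by
  intro p q hpq e
  rcases c.red_or_black p with ⟨m, rfl⟩ | ⟨i, rfl⟩ <;>
    rcases c.red_or_black q with ⟨m', rfl⟩ | ⟨i', rfl⟩
  · rw [strandFib_redPos, strandFib_redPos, Sum.inl.injEq] at e
    rw [e] at hpq
    exact absurd hpq (lt_irrefl _)
  · rw [strandFib_redPos, strandFib_blackPos] at e; cases e
  · rw [strandFib_redPos, strandFib_blackPos] at e; cases e
  · rw [strandFib_blackPos, strandFib_blackPos, Sum.inr.injEq] at e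
    rw [strandPerm_blackPos, strandPerm_blackPos]
    exact b.blackPos_strictMono (hu i i' (c.blackPos_strictMono.lt_iff_lt.mp hpq) e)

/-- Blocks of black strands without red ones between them are intervals among all the strands. So
the additivity of lengths for parabolic subgroups can be applied in S_{ℓ+d}, with `strandFib` as the
fibre function. -/
theorem len_strandPerm_mul_left {b c : ColourSeq ℓ d} {g : Fin d → α} (h : Blocked b g)
    {z u : Perm (Fin d)} (hz : z ∈ fibreSubgroup g) (hu : MonoFib g u⁻¹) :
    len (strandPerm b c (z * u)) = len (strandPerm b b z) + len (strandPerm b c u) := by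
  rw [← strandPerm_mul b b c]
  refine len_mul_of_monoFib h.intervalFibres_strandFib (strandPerm_mem_fibreSubgroup b hz) ?_
  rw [strandPerm_inv]
  exact monoFib_strandPerm c b hu

theorem len_strandPerm_mul_right {b c : ColourSeq ℓ d} {g : Fin d → α} (h : Blocked c g)
    {z u : Perm (Fin d)} (hz : z ∈ fibreSubgroup g) (hu : MonoFib g u) :
    len (strandPerm b c (u * z)) = len (strandPerm b c u) + len (strandPerm c c z) := by
  rw [← strandPerm_mul b c c]
  exact len_mul_of_monoFib' h.intervalFibres_strandFib (strandPerm_mem_fibreSubgroup c hz)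
    (monoFib_strandPerm b c hu)

/-- A permutation within blocks crosses no red strand. A descent at j occurs at two black strands in
neighbouring positions, so removing it lowers both lengths by one. -/
theorem len_strandPerm_self {c : ColourSeq ℓ d} {g : Fin d → α} (h : Blocked c g)
    {y : Perm (Fin d)} (hy : y ∈ fibreSubgroup g) : len (strandPerm c c y) = len y := by
  obtain ⟨m, hm⟩ : ∃ m, len y = m := ⟨_, rfl⟩
  induction m generalizing y with
  | zero => rw [eq_one_of_len y hm, strandPerm_self_one, len_one, len_one]
  | succ m ih =>
    by_cases hd : ∃ j : Fin (d - 1), y (hi j) < y (lo j)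
    · obtain ⟨j, hj⟩ := hd
      have hs := simple_mem_of_descent h.1 hy hj
      obtain ⟨r, hr, hr'⟩ := (h.2 j hs).exists_pos
      have h1 := len_mul_simple y j hj
      have h2 := len_mul_simple (strandPerm c c y) r (by
        rw [← hr, ← hr', strandPerm_blackPos, strandPerm_blackPos]
        exact c.blackPos_strictMono hj)
      rw [← strandPerm_simple hr hr', strandPerm_mul, ih (mul_mem hy hs) (by omega)] at h2
      omega
    · push Not at hd
      rw [eq_one_of_no_descent y fun r => not_lt.mpr (hd r), len_one] at hm
      omega

end StrandPerm

/-! ### Relations in the higher level affine Hecke algebra -/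

section HeckeRelations

variable {k : Type*} [Field k] {ℓ d : ℕ} (q : k) (Q : Fin ℓ → k)

local notation "𝐞" c:max => heckeGen q Q (Gen.e c)
local notation "𝐓" r:max => heckeGen q Q (Gen.T r)
local notation "𝐗" i:max => heckeGen q Q (Gen.X i)
local notation "𝐘" i:max => heckeGen q Q (Gen.X' i)

/-- The canonical map from the free algebra. -/
noncomputable def heckeMk : FreeAlgebra k (Gen ℓ d) →ₐ[k] Hecke q Q d :=
  RingQuot.mkAlgHom k (Rel q Q d)

theorem heckeMk_gen (g : Gen ℓ d) : heckeMk q Q (gen k g) = heckeGen q Q g := rfl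

theorem heckeMk_rel {a b : FreeAlgebra k (Gen ℓ d)} (h : Rel q Q d a b) :
    heckeMk q Q a = heckeMk q Q b := RingQuot.mkAlgHom_rel k h

theorem sum_e : ∑ c : ColourSeq ℓ d, 𝐞 c = 1 := by
  simpa [heckeMk_gen] using heckeMk_rel q Q (Rel.e_sum (q := q) (Q := Q) (d := d))

theorem e_mul_e (c : ColourSeq ℓ d) : 𝐞 c * 𝐞 c = 𝐞 c := by
  simpa [heckeMk_gen] using heckeMk_rel q Q (Rel.e_idem c)

theorem e_mul_e_of_ne {b c : ColourSeq ℓ d} (h : b ≠ c) : 𝐞 b * 𝐞 c = 0 := by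
  simpa [heckeMk_gen] using heckeMk_rel q Q (Rel.e_orth b c h)

theorem X_mul_X (i j : Fin (ℓ + d)) : 𝐗 i * 𝐗 j = 𝐗 j * 𝐗 i := by
  simpa [heckeMk_gen] using heckeMk_rel q Q (Rel.X_comm i j)

theorem X_mul_e (i : Fin (ℓ + d)) (c : ColourSeq ℓ d) : 𝐗 i * 𝐞 c = 𝐞 c * 𝐗 i := by
  simpa [heckeMk_gen] using heckeMk_rel q Q (Rel.X_e i c)

theorem X'_mul_e (i : Fin (ℓ + d)) (c : ColourSeq ℓ d) : 𝐘 i * 𝐞 c = 𝐞 c * 𝐘 i := by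
  simpa [heckeMk_gen] using heckeMk_rel q Q (Rel.X'_e i c)

theorem X_mul_e_red {i : Fin (ℓ + d)} {c : ColourSeq ℓ d} (h : c.1 i = true) :
    𝐗 i * 𝐞 c = 0 := by
  simpa [heckeMk_gen] using heckeMk_rel q Q (Rel.X_red i c h)

theorem X'_mul_e_red {i : Fin (ℓ + d)} {c : ColourSeq ℓ d} (h : c.1 i = true) :
    𝐘 i * 𝐞 c = 0 := by
  simpa [heckeMk_gen] using heckeMk_rel q Q (Rel.X'_red i c h)

theorem X_X'_e {i : Fin (ℓ + d)} {c : ColourSeq ℓ d} (h : c.1 i = false) :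
    𝐗 i * 𝐘 i * 𝐞 c = 𝐞 c := by
  simpa [heckeMk_gen] using heckeMk_rel q Q (Rel.X_X' i c h)

theorem X'_X_e {i : Fin (ℓ + d)} {c : ColourSeq ℓ d} (h : c.1 i = false) :
    𝐘 i * 𝐗 i * 𝐞 c = 𝐞 c := by
  simpa [heckeMk_gen] using heckeMk_rel q Q (Rel.X'_X i c h)

theorem T_mul_T_far {r s : Fin (ℓ + d - 1)} (h : (r : ℕ) + 1 < s) : 𝐓 r * 𝐓 s = 𝐓 s * 𝐓 r := by
  simpa [heckeMk_gen] using heckeMk_rel q Q (Rel.T_far r s h)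

theorem T_mul_X_far {r : Fin (ℓ + d - 1)} {i : Fin (ℓ + d)} (h : i ≠ lo r) (h' : i ≠ hi r) :
    𝐓 r * 𝐗 i = 𝐗 i * 𝐓 r := by
  simpa [heckeMk_gen] using heckeMk_rel q Q (Rel.T_X_far r i h h')

theorem T_mul_e_red {r : Fin (ℓ + d - 1)} {c : ColourSeq ℓ d} (h : c.1 (lo r) = true)
    (h' : c.1 (hi r) = true) : 𝐓 r * 𝐞 c = 0 := by
  simpa [heckeMk_gen] using heckeMk_rel q Q (Rel.T_red r c h h')

theorem T_mul_e (r : Fin (ℓ + d - 1)) (c : ColourSeq ℓ d) :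
    𝐓 r * 𝐞 c = 𝐞 (c.act (simple r)) * 𝐓 r := by
  simpa [heckeMk_gen] using heckeMk_rel q Q (Rel.T_e r c)

theorem T_X_hi_e {r : Fin (ℓ + d - 1)} {c : ColourSeq ℓ d} (h : c.1 (lo r) = false)
    (h' : c.1 (hi r) = false) : 𝐓 r * 𝐗 (hi r) * 𝐞 c =
      𝐗 (lo r) * 𝐓 r * 𝐞 c + (q - 1) • (𝐗 (hi r) * 𝐞 c) := by
  have := heckeMk_rel q Q (Rel.T_X_hi r c h h')
  simp only [map_mul, map_sub, map_smul, heckeMk_gen] at this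
  rw [← this]
  noncomm_ring

theorem T_X_lo_e {r : Fin (ℓ + d - 1)} {c : ColourSeq ℓ d} (h : c.1 (lo r) = false)
    (h' : c.1 (hi r) = false) : 𝐓 r * 𝐗 (lo r) * 𝐞 c =
      𝐗 (hi r) * 𝐓 r * 𝐞 c - (q - 1) • (𝐗 (hi r) * 𝐞 c) := by
  have := heckeMk_rel q Q (Rel.T_X_lo r c h h')
  simp only [map_mul, map_sub, map_smul, map_neg, heckeMk_gen] at this
  rw [sub_eq_add_neg, ← this]
  noncomm_ring

theorem T_X_hi_e_red {r : Fin (ℓ + d - 1)} {c : ColourSeq ℓ d}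
    (h : c.1 (lo r) = true ∨ c.1 (hi r) = true) :
    𝐓 r * 𝐗 (hi r) * 𝐞 c = 𝐗 (lo r) * 𝐓 r * 𝐞 c := by
  have := heckeMk_rel q Q (Rel.T_X_hi_red r c h)
  simp only [map_mul, map_sub, heckeMk_gen, map_zero] at this
  rwa [sub_mul, sub_eq_zero] at this

theorem T_X_lo_e_red {r : Fin (ℓ + d - 1)} {c : ColourSeq ℓ d}
    (h : c.1 (lo r) = true ∨ c.1 (hi r) = true) :
    𝐓 r * 𝐗 (lo r) * 𝐞 c = 𝐗 (hi r) * 𝐓 r * 𝐞 c := by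
  have := heckeMk_rel q Q (Rel.T_X_lo_red r c h)
  simp only [map_mul, map_sub, heckeMk_gen, map_zero] at this
  rwa [sub_mul, sub_eq_zero] at this

theorem T_sq_e {r : Fin (ℓ + d - 1)} {c : ColourSeq ℓ d} (h : c.1 (lo r) = false)
    (h' : c.1 (hi r) = false) : 𝐓 r * 𝐓 r * 𝐞 c = (q - 1) • (𝐓 r * 𝐞 c) + q • 𝐞 c := by
  simpa [heckeMk_gen] using heckeMk_rel q Q (Rel.T_sq r c h h')

theorem T_sq_e_black_red {r : Fin (ℓ + d - 1)} {c : ColourSeq ℓ d} {m : Fin ℓ}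
    (h : c.1 (lo r) = false) (h' : c.redPos m = hi r) :
    𝐓 r * 𝐓 r * 𝐞 c = 𝐗 (lo r) * 𝐞 c - Q m • 𝐞 c := by
  simpa [heckeMk_gen] using heckeMk_rel q Q (Rel.T_sq_black_red r c m h h')

theorem T_sq_e_red_black {r : Fin (ℓ + d - 1)} {c : ColourSeq ℓ d} {m : Fin ℓ}
    (h : c.redPos m = lo r) (h' : c.1 (hi r) = false) :
    𝐓 r * 𝐓 r * 𝐞 c = 𝐗 (hi r) * 𝐞 c - Q m • 𝐞 c := by
  simpa [heckeMk_gen] using heckeMk_rel q Q (Rel.T_sq_red_black r c m h h')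

theorem T_braid_e {r s : Fin (ℓ + d - 1)} (hs : (s : ℕ) = r + 1) {c : ColourSeq ℓ d}
    (h : c.1 (hi r) = false) :
    (𝐓 r * 𝐓 s * 𝐓 r - 𝐓 s * 𝐓 r * 𝐓 s) * 𝐞 c = 0 := by
  simpa [heckeMk_gen] using heckeMk_rel q Q (Rel.braid r s hs c h)

theorem T_braid_e_red {r s : Fin (ℓ + d - 1)} (hs : (s : ℕ) = r + 1) {c : ColourSeq ℓ d}
    (h : c.1 (lo r) = false) (h' : c.1 (hi r) = true) (h'' : c.1 (hi s) = false) :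
    (𝐓 r * 𝐓 s * 𝐓 r - 𝐓 s * 𝐓 r * 𝐓 s) * 𝐞 c = (1 - q) • (𝐗 (hi s) * 𝐞 c) := by
  simpa [heckeMk_gen] using heckeMk_rel q Q (Rel.braid_red r s hs c h h' h'')

theorem ext_e {a b : Hecke q Q d} (h : ∀ c, a * 𝐞 c = b * 𝐞 c) : a = b := by
  rw [← mul_one a, ← mul_one b, ← sum_e, Finset.mul_sum, Finset.mul_sum]
  exact Finset.sum_congr rfl fun c _ => h c

/-- Elements that multiply `e(c)` from the right and are sums of elements `a_c e(c)`. -/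
theorem sum_mul_e_mul_e (f : ColourSeq ℓ d → Hecke q Q d) (c : ColourSeq ℓ d) :
    (∑ b, f b * 𝐞 b) * 𝐞 c = f c * 𝐞 c := by
  rw [Finset.sum_mul, Finset.sum_eq_single c]
  · rw [mul_assoc, e_mul_e]
  · intro b _ hb
    rw [mul_assoc, e_mul_e_of_ne _ _ hb, mul_zero]
  · intro h; exact absurd (Finset.mem_univ _) h

end HeckeRelations

/-! ### The Laurent polynomials -/

/-- Laurent polynomials in `x_1, …, x_d`. -/
abbrev Laurent (k : Type*) [Field k] (d : ℕ) : Type _ := AddMonoidAlgebra k (Fin d → ℤ)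

section LaurentPolynomials

variable {k : Type*} [Field k] {d : ℕ}

/-- The permutation action on exponents, for which `x_i` is sent to `x_{σ i}`. -/
def permExp (σ : Perm (Fin d)) : (Fin d → ℤ) ≃+ (Fin d → ℤ) where
  toFun a := a ∘ ⇑σ⁻¹
  invFun a := a ∘ σ
  left_inv a := by ext i; simp
  right_inv a := by ext i; simp
  map_add' _ _ := rfl

/-- The permutation action on Laurent polynomials, `x_i ↦ x_{σ i}`. -/
noncomputable def permAut (σ : Perm (Fin d)) : Laurent k d ≃ₐ[k] Laurent k d :=
  AddMonoidAlgebra.domCongr k k (permExp σ)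

theorem permAut_single (σ : Perm (Fin d)) (a : Fin d → ℤ) (t : k) :
    permAut σ (AddMonoidAlgebra.single a t) = AddMonoidAlgebra.single (a ∘ ⇑σ⁻¹) t :=
  AddMonoidAlgebra.domCongr_single ..

theorem permAut_one (f : Laurent k d) : permAut 1 f = f := by
  induction f using AddMonoidAlgebra.induction_linear with
  | zero => simp
  | add f g hf hg => rw [map_add, hf, hg]
  | single a t => rw [permAut_single]; rfl

theorem permAut_mul (σ τ : Perm (Fin d)) (f : Laurent k d) :
    permAut (σ * τ) f = permAut σ (permAut τ f) := by
  induction f using AddMonoidAlgebra.induction_linear with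
  | zero => simp
  | add f g hf hg => rw [map_add, map_add, map_add, hf, hg]
  | single a t => rw [permAut_single, permAut_single, permAut_single, mul_inv_rev]; rfl

theorem permAut_simple_simple (j : Fin (d - 1)) (f : Laurent k d) :
    permAut (simple j) (permAut (simple j) f) = f := by
  rw [← permAut_mul, simple_mul_self, permAut_one]

/-- The Laurent monomial `x^a`. -/
noncomputable def mon (k : Type*) [Field k] {d : ℕ} (a : Fin d → ℤ) : Laurent k d :=
  AddMonoidAlgebra.single a 1

theorem mon_add (a b : Fin d → ℤ) : mon k (a + b) = mon k a * mon k b := by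
  simp [mon, AddMonoidAlgebra.single_mul_single]

theorem mon_zero : mon k (0 : Fin d → ℤ) = 1 := rfl

theorem permAut_mon (σ : Perm (Fin d)) (a : Fin d → ℤ) :
    permAut σ (mon k a) = mon k (a ∘ ⇑σ⁻¹) := permAut_single σ a 1

/-- The variable `x_i`. -/
noncomputable def xv (k : Type*) [Field k] {d : ℕ} (i : Fin d) : Laurent k d :=
  mon k (Pi.single i 1)

/-- The inverse of the variable `x_i`. -/
noncomputable def xvInv (k : Type*) [Field k] {d : ℕ} (i : Fin d) : Laurent k d :=
  mon k (Pi.single i (-1))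

theorem xv_mul_xvInv (i : Fin d) : xv k i * xvInv k i = 1 := by
  rw [xv, xvInv, ← mon_add, ← Pi.single_add, add_neg_cancel, Pi.single_zero, mon_zero]

theorem single_comp_inv (σ : Perm (Fin d)) (i : Fin d) (n : ℤ) :
    (Pi.single i n : Fin d → ℤ) ∘ ⇑σ⁻¹ = Pi.single (σ i) n := by
  ext j
  simp only [Function.comp_apply, Pi.single_apply]
  refine if_congr ⟨fun h => ?_, fun h => ?_⟩ rfl rfl
  · rw [← h, perm_apply_inv]
  · rw [h, perm_inv_apply]

theorem permAut_xv (σ : Perm (Fin d)) (i : Fin d) : permAut σ (xv k i) = xv k (σ i) := by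
  rw [xv, permAut_mon, single_comp_inv, xv]

/-- Induction principle for Laurent polynomials. -/
theorem laurent_induction {p : Laurent k d → Prop} (hadd : ∀ f g, p f → p g → p (f + g))
    (hsmul : ∀ (t : k) f, p f → p (t • f)) (hmul : ∀ f g, p f → p g → p (f * g)) (hone : p 1)
    (hx : ∀ i, p (xv k i)) (hx' : ∀ i, p (xvInv k i)) (f : Laurent k d) : p f := by
  -- Monomials are built one variable at a time, by powers of that variable or of its inverse.
  have hmon : ∀ a : Fin d → ℤ, p (mon k a) := by
    intro a
    have h1 : ∀ (i : Fin d) (n : ℕ), p (mon k (Pi.single i (n : ℤ))) := by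
      intro i n
      induction n with
      | zero => simpa [mon_zero] using hone
      | succ n ih =>
        rw [Nat.cast_succ, Pi.single_add, mon_add]
        exact hmul _ _ ih (hx i)
    have h2 : ∀ (i : Fin d) (n : ℕ), p (mon k (Pi.single i (-(n : ℤ)))) := by
      intro i n
      induction n with
      | zero => simpa [mon_zero] using hone
      | succ n ih =>
        rw [Nat.cast_succ, neg_add, Pi.single_add, mon_add]
        exact hmul _ _ ih (hx' i)
    have h3 : ∀ (i : Fin d) (n : ℤ), p (mon k (Pi.single i n)) := by
      intro i n
      obtain ⟨m, rfl | rfl⟩ := Int.eq_nat_or_neg n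
      · exact h1 i m
      · exact h2 i m
    rw [← Finset.univ_sum_single a]
    refine Finset.sum_induction _ (fun b => p (mon k b)) (fun b b' hb hb' => ?_) ?_ fun i _ => h3 i _
    · rw [mon_add]; exact hmul _ _ hb hb'
    · rw [mon_zero]; exact hone
  induction f using AddMonoidAlgebra.induction_linear with
  | zero => simpa using hsmul 0 1 hone
  | add f g hf hg => exact hadd f g hf hg
  | single a t =>
    have := hsmul t _ (hmon a)
    rwa [mon, AddMonoidAlgebra.smul_single, smul_eq_mul, mul_one] at this

end LaurentPolynomials

/-! ### Laurent polynomials in the Hecke algebra -/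

section Phi

variable {k : Type*} [Field k] {ℓ d : ℕ} (q : k) (Q : Fin ℓ → k)

local notation "𝐞" c:max => heckeGen q Q (Gen.e c)
local notation "𝐓" r:max => heckeGen q Q (Gen.T r)
local notation "𝐗" i:max => heckeGen q Q (Gen.X i)
local notation "𝐘" i:max => heckeGen q Q (Gen.X' i)

/-- The element `x_i = ∑_c X_{i_c} e(c)`. -/
noncomputable def xElt (i : Fin d) : Hecke q Q d := ∑ c : ColourSeq ℓ d, 𝐗 (c.blackPos i) * 𝐞 c

/-- The inverse of `x_i`. -/
noncomputable def xElt' (i : Fin d) : Hecke q Q d := ∑ c : ColourSeq ℓ d, 𝐘 (c.blackPos i) * 𝐞 c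

theorem xElt_mul_e (i : Fin d) (c : ColourSeq ℓ d) :
    xElt q Q i * 𝐞 c = 𝐗 (c.blackPos i) * 𝐞 c := sum_mul_e_mul_e q Q _ c

theorem xElt'_mul_e (i : Fin d) (c : ColourSeq ℓ d) :
    xElt' q Q i * 𝐞 c = 𝐘 (c.blackPos i) * 𝐞 c := sum_mul_e_mul_e q Q _ c

theorem e_mul_xElt (i : Fin d) (c : ColourSeq ℓ d) : 𝐞 c * xElt q Q i = xElt q Q i * 𝐞 c := by
  refine ext_e q Q fun b => ?_
  rw [mul_assoc, xElt_mul_e, ← mul_assoc, ← X_mul_e, mul_assoc, mul_assoc]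
  by_cases h : c = b
  · subst h; rw [e_mul_e, xElt_mul_e]
  · rw [e_mul_e_of_ne _ _ h, mul_zero, mul_zero]

theorem e_mul_xElt' (i : Fin d) (c : ColourSeq ℓ d) : 𝐞 c * xElt' q Q i = xElt' q Q i * 𝐞 c := by
  refine ext_e q Q fun b => ?_
  rw [mul_assoc, xElt'_mul_e, ← mul_assoc, ← X'_mul_e, mul_assoc, mul_assoc]
  by_cases h : c = b
  · subst h; rw [e_mul_e, xElt'_mul_e]
  · rw [e_mul_e_of_ne _ _ h, mul_zero, mul_zero]

theorem xElt_mul_xElt' (i : Fin d) : xElt (ℓ := ℓ) q Q i * xElt' q Q i = 1 := by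
  refine ext_e q Q fun c => ?_
  rw [mul_assoc, xElt'_mul_e, one_mul, X'_mul_e, ← mul_assoc, xElt_mul_e, mul_assoc, ← X'_mul_e,
    ← mul_assoc, X_X'_e _ _ (colour_blackPos c i)]

theorem xElt'_mul_xElt (i : Fin d) : xElt' (ℓ := ℓ) q Q i * xElt q Q i = 1 := by
  refine ext_e q Q fun c => ?_
  rw [mul_assoc, xElt_mul_e, one_mul, X_mul_e, ← mul_assoc, xElt'_mul_e, mul_assoc, ← X_mul_e,
    ← mul_assoc, X'_X_e _ _ (colour_blackPos c i)]

theorem xElt_mul_xElt (i j : Fin d) : xElt (ℓ := ℓ) q Q i * xElt q Q j =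
    xElt q Q j * xElt q Q i := by
  refine ext_e q Q fun c => ?_
  have key : ∀ i j, xElt q Q i * xElt q Q j * 𝐞 c = 𝐗 (c.blackPos i) * 𝐗 (c.blackPos j) * 𝐞 c :=
    fun i j => by
      rw [mul_assoc, xElt_mul_e, X_mul_e, ← mul_assoc, xElt_mul_e, mul_assoc, ← X_mul_e, mul_assoc]
  rw [key, key, X_mul_X]

/-- `x_i` as a unit. -/
noncomputable def xUnit (i : Fin d) : (Hecke q Q d)ˣ :=
  ⟨xElt q Q i, xElt' q Q i, xElt_mul_xElt' q Q i, xElt'_mul_xElt q Q i⟩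

theorem xPow_eq (i : Fin d) (n : ℤ) : xPow q Q i n = ((xUnit q Q i ^ n : (Hecke q Q d)ˣ)) := by
  cases n with
  | ofNat n => simp only [Int.ofNat_eq_natCast, zpow_natCast, Units.val_pow_eq_pow_val]; rfl
  | negSucc n =>
    rw [zpow_negSucc, ← inv_pow, Units.val_pow_eq_pow_val]
    rfl

theorem commute_xUnit (i j : Fin d) : Commute (xUnit (ℓ := ℓ) q Q i) (xUnit q Q j) :=
  Units.ext (xElt_mul_xElt q Q i j)

theorem commute_xPow (i j : Fin d) (m n : ℤ) :
    Commute (xPow (ℓ := ℓ) q Q i m) (xPow q Q j n) := by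
  rw [xPow_eq, xPow_eq]
  exact ((commute_xUnit q Q i j).zpow_zpow m n).units_val

theorem prod_ofFn_mul {M : Type*} [Monoid M] {n : ℕ} (f g : Fin n → M)
    (h : ∀ i j, Commute (f i) (g j)) :
    (List.ofFn fun i => f i * g i).prod = (List.ofFn f).prod * (List.ofFn g).prod := by
  induction n with
  | zero => simp
  | succ n ih =>
    have hc : Commute (List.ofFn fun i : Fin n => f i.succ).prod (g 0) :=
      Commute.list_prod_left _ _ fun x hx => by
        obtain ⟨i, rfl⟩ := (List.mem_ofFn' _ _).mp hx
        exact h _ _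
    rw [List.ofFn_succ, List.ofFn_succ, List.ofFn_succ, List.prod_cons, List.prod_cons,
      List.prod_cons, ih _ _ fun i j => h _ _]
    simp only [mul_assoc]
    rw [← mul_assoc (g 0), ← hc.eq, mul_assoc]

theorem xMon_add (a b : Fin d → ℤ) : xMon (ℓ := ℓ) q Q (a + b) = xMon q Q a * xMon q Q b := by
  unfold xMon
  rw [← prod_ofFn_mul _ _ fun i j => commute_xPow q Q i j _ _]
  congr 2
  funext i
  rw [xPow_eq, xPow_eq, xPow_eq, Pi.add_apply, zpow_add, Units.val_mul]

theorem xMon_zero : xMon (ℓ := ℓ) (d := d) q Q 0 = 1 := by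
  unfold xMon
  refine List.prod_eq_one fun x hx => ?_
  obtain ⟨i, rfl⟩ := (List.mem_ofFn' _ _).mp hx
  simp [xPow_eq]

/-- The embedding of the Laurent polynomials. -/
noncomputable def phi : Laurent k d →ₐ[k] Hecke q Q d :=
  AddMonoidAlgebra.lift k _ (Fin d → ℤ)
    { toFun := fun a => xMon q Q a.toAdd
      map_one' := xMon_zero q Q
      map_mul' := fun _ _ => xMon_add q Q _ _ }

theorem phi_mon (a : Fin d → ℤ) : phi (ℓ := ℓ) q Q (mon k a) = xMon q Q a := by
  simp [phi, mon]

theorem xPoly_eq (f : Laurent k d) : xPoly (ℓ := ℓ) q Q f = phi q Q f := by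
  rw [phi, AddMonoidAlgebra.lift_apply]
  rfl

theorem xMon_single (i : Fin d) (n : ℤ) :
    xMon (ℓ := ℓ) q Q (Pi.single i n) = (xUnit q Q i ^ n : (Hecke q Q d)ˣ) := by
  have : ∀ (m : ℕ) (f : Fin m → Hecke q Q d) (i : Fin m), (∀ j, j ≠ i → f j = 1) →
      (List.ofFn f).prod = f i := by
    intro m
    induction m with
    | zero => intro f i; exact i.elim0
    | succ m ih =>
      intro f i hf
      rw [List.ofFn_succ, List.prod_cons]
      rcases Fin.eq_zero_or_eq_succ i with rfl | ⟨i, rfl⟩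
      · rw [List.prod_eq_one, mul_one]
        intro x hx
        obtain ⟨i, rfl⟩ := (List.mem_ofFn' _ _).mp hx
        exact hf _ (Fin.succ_ne_zero i)
      · rw [ih _ i fun j hj => hf _ fun e => hj (Fin.succ_injective _ e),
          hf 0 (Fin.succ_ne_zero i).symm, one_mul]
  unfold xMon
  rw [this d _ i fun j hj => by rw [Pi.single_eq_of_ne hj, xPow_eq, zpow_zero, Units.val_one],
    Pi.single_eq_same, xPow_eq]

theorem phi_xv (i : Fin d) : phi (ℓ := ℓ) q Q (xv k i) = xElt q Q i := by
  rw [xv, phi_mon, xMon_single, zpow_one]; rfl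

theorem phi_xvInv (i : Fin d) : phi (ℓ := ℓ) q Q (xvInv k i) = xElt' q Q i := by
  rw [xvInv, phi_mon, xMon_single, zpow_neg_one]; rfl

theorem phi_mul_e (f : Laurent k d) (c : ColourSeq ℓ d) :
    phi q Q f * 𝐞 c = 𝐞 c * phi q Q f := by
  induction f using laurent_induction with
  | hadd f g hf hg => rw [map_add, add_mul, mul_add, hf, hg]
  | hsmul t f hf => rw [map_smul, smul_mul_assoc, hf, mul_smul_comm]
  | hmul f g hf hg => rw [map_mul, mul_assoc, hg, ← mul_assoc, hf, mul_assoc]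
  | hone => simp
  | hx i => rw [phi_xv, e_mul_xElt]
  | hx' i => rw [phi_xvInv, e_mul_xElt']

/-- Past a crossing of a red and a black strand. -/
theorem T_phi_e_mixed {c : ColourSeq ℓ d} {r : Fin (ℓ + d - 1)} (h : c.1 (lo r) ≠ c.1 (hi r))
    (f : Laurent k d) : 𝐓 r * phi q Q f * 𝐞 c = phi q Q f * 𝐓 r * 𝐞 c := by
  have hor : c.1 (lo r) = true ∨ c.1 (hi r) = true := by
    revert h; cases c.1 (lo r) <;> cases c.1 (hi r) <;> simp
  have hx : ∀ i, 𝐓 r * xElt q Q i * 𝐞 c = xElt q Q i * 𝐓 r * 𝐞 c := by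
    intro i
    rw [mul_assoc, xElt_mul_e, mul_assoc, T_mul_e, ← mul_assoc, ← mul_assoc, xElt_mul_e,
      blackPos_act_simple h, mul_assoc _ _ (𝐓 r), ← T_mul_e, ← mul_assoc]
    by_cases h1 : c.blackPos i = lo r
    · rw [h1, simple_lo, T_X_lo_e_red _ _ hor]
    by_cases h2 : c.blackPos i = hi r
    · rw [h2, simple_hi, T_X_hi_e_red _ _ hor]
    rw [simple_of_ne r h1 h2, T_mul_X_far _ _ h1 h2]
  induction f using laurent_induction with
  | hadd f g hf hg => rw [map_add, mul_add, add_mul, hf, hg, add_mul, add_mul]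
  | hsmul t f hf => rw [map_smul, mul_smul_comm, smul_mul_assoc, hf, smul_mul_assoc, smul_mul_assoc]
  | hmul f g hf hg =>
    rw [map_mul, ← mul_assoc, mul_assoc _ (phi q Q g), phi_mul_e, ← mul_assoc, hf, mul_assoc,
      ← phi_mul_e, mul_assoc, ← mul_assoc (𝐓 r), hg, mul_assoc, mul_assoc, mul_assoc]
  | hone => simp
  | hx i => rw [phi_xv, hx]
  | hx' i =>
    rw [phi_xvInv]
    -- The relation for x_i is multiplied by the inverse of x_i on both sides.
    have h1 : 𝐓 r * xElt q Q i * xElt' q Q i * 𝐞 c = 𝐓 r * 𝐞 c := by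
      rw [mul_assoc (𝐓 r), xElt_mul_xElt', mul_one]
    rw [mul_assoc _ _ (𝐞 c), ← e_mul_xElt', ← mul_assoc, hx] at h1
    rw [mul_assoc (xElt' q Q i), ← h1]
    simp only [mul_assoc]
    rw [← mul_assoc (xElt' q Q i) (xElt q Q i), xElt'_mul_xElt, one_mul, e_mul_xElt']

/-- The divided difference `x_{j+1} (f - s_j f) / (x_{j+1} - x_j)`, and the commutation relation
between Laurent polynomials and a crossing of two black strands. -/
theorem exists_divDiff (j : Fin (d - 1)) (f : Laurent k d) :
    ∃ g : Laurent k d, (xv k (hi j) - xv k (lo j)) * g =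
      xv k (hi j) * (f - permAut (simple j) f) ∧
      ∀ (c : ColourSeq ℓ d) (r : Fin (ℓ + d - 1)), c.blackPos (lo j) = lo r →
        c.blackPos (hi j) = hi r → 𝐓 r * phi q Q f * 𝐞 c =
          phi q Q (permAut (simple j) f) * 𝐓 r * 𝐞 c + (q - 1) • (phi q Q g * 𝐞 c) := by
  have hcol : ∀ (c : ColourSeq ℓ d) (r : Fin (ℓ + d - 1)), c.blackPos (lo j) = lo r →
        c.blackPos (hi j) = hi r → c.1 (lo r) = false ∧ c.1 (hi r) = false := by
    intro c r h1 h2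
    rw [← h1, ← h2]
    exact ⟨colour_blackPos _ _, colour_blackPos _ _⟩
  have hTe : ∀ (c : ColourSeq ℓ d) (r : Fin (ℓ + d - 1)), c.blackPos (lo j) = lo r →
        c.blackPos (hi j) = hi r → 𝐓 r * 𝐞 c = 𝐞 c * 𝐓 r := by
    intro c r h1 h2
    obtain ⟨h3, h4⟩ := hcol c r h1 h2
    rw [T_mul_e, act_simple_of_same (h3.trans h4.symm)]
  have hx : ∀ i, ∃ g : Laurent k d, (xv k (hi j) - xv k (lo j)) * g =
      xv k (hi j) * (xv k i - permAut (simple j) (xv k i)) ∧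
      ∀ (c : ColourSeq ℓ d) (r : Fin (ℓ + d - 1)), c.blackPos (lo j) = lo r →
        c.blackPos (hi j) = hi r → 𝐓 r * phi q Q (xv k i) * 𝐞 c =
          phi q Q (permAut (simple j) (xv k i)) * 𝐓 r * 𝐞 c + (q - 1) • (phi q Q g * 𝐞 c) := by
    intro i
    by_cases hi1 : i = lo j
    · refine ⟨-xv k (hi j), by rw [permAut_xv, hi1, simple_lo]; ring, fun c r h1 h2 => ?_⟩
      obtain ⟨h3, h4⟩ := hcol c r h1 h2
      rw [permAut_xv, map_neg, phi_xv, phi_xv, hi1, simple_lo, phi_xv, mul_assoc, xElt_mul_e,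
        mul_assoc (xElt q Q _), hTe c r h1 h2, ← mul_assoc, ← mul_assoc, xElt_mul_e, neg_mul,
        xElt_mul_e, h1, h2, T_X_lo_e _ _ h3 h4, smul_neg, ← sub_eq_add_neg, mul_assoc,
        hTe c r h1 h2, mul_assoc]
    by_cases hi2 : i = hi j
    · refine ⟨xv k (hi j), by rw [permAut_xv, hi2, simple_hi]; ring, fun c r h1 h2 => ?_⟩
      obtain ⟨h3, h4⟩ := hcol c r h1 h2
      rw [permAut_xv, phi_xv, phi_xv, hi2, simple_hi, mul_assoc, xElt_mul_e, phi_xv,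
        mul_assoc (xElt q Q _), hTe c r h1 h2, ← mul_assoc, ← mul_assoc, xElt_mul_e,
        xElt_mul_e, h1, h2, T_X_hi_e _ _ h3 h4, mul_assoc,
        hTe c r h1 h2, mul_assoc]
    · refine ⟨0, by rw [permAut_xv, simple_of_ne j hi1 hi2]; ring, fun c r h1 h2 => ?_⟩
      rw [permAut_xv, simple_of_ne j hi1 hi2, phi_xv, map_zero, zero_mul, smul_zero, add_zero,
        mul_assoc, xElt_mul_e, mul_assoc (xElt q Q _), hTe c r h1 h2, ← mul_assoc, ← mul_assoc,
        xElt_mul_e, mul_assoc (𝐗 _), ← hTe c r h1 h2, T_mul_X_far, mul_assoc]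
      · rw [← h1]; exact fun e => hi1 (c.blackPos_strictMono.injective e)
      · rw [← h2]; exact fun e => hi2 (c.blackPos_strictMono.injective e)
  induction f using laurent_induction with
  | hadd f f' hf hf' =>
    obtain ⟨g, h1, h2⟩ := hf
    obtain ⟨g', h1', h2'⟩ := hf'
    refine ⟨g + g', by rw [map_add, mul_add, h1, h1']; ring, fun c r h h' => ?_⟩
    simp only [map_add, mul_add, add_mul, h2 c r h h', h2' c r h h', smul_add]
    abel
  | hsmul t f hf =>
    obtain ⟨g, h1, h2⟩ := hf
    refine ⟨t • g, by rw [map_smul, mul_smul_comm, h1, ← smul_sub, mul_smul_comm], fun c r h h' => ?_⟩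
    simp only [map_smul, mul_smul_comm, smul_mul_assoc, h2 c r h h', smul_add]
    rw [smul_comm t]
  | hmul f f' hf hf' =>
    obtain ⟨g, h1, h2⟩ := hf
    obtain ⟨g', h1', h2'⟩ := hf'
    -- The twisted Leibniz rule ∂(f f') = ∂(f) f' + s(f) ∂(f').
    refine ⟨g * f' + permAut (simple j) f * g', ?_, fun c r h h' => ?_⟩
    · rw [map_mul]
      linear_combination f' * h1 + permAut (simple j) f * h1'
    · rw [map_mul, ← mul_assoc, mul_assoc _ _ (𝐞 c), phi_mul_e, ← mul_assoc, h2 c r h h',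
        add_mul, mul_assoc _ (𝐞 c), ← phi_mul_e, smul_mul_assoc, mul_assoc _ (𝐞 c), ← phi_mul_e,
        mul_assoc (phi q Q _) (𝐓 r), ← mul_assoc (𝐓 r), h2' c r h h']
      simp only [map_mul, map_add, mul_add, add_mul, smul_add, mul_assoc, mul_smul_comm]
      abel
  | hone => exact ⟨0, by simp, fun c r _ _ => by simp⟩
  | hx i => exact hx i
  | hx' i =>
    obtain ⟨g, h1, h2⟩ := hx i
    have hi1 := xv_mul_xvInv (k := k) i
    have hi2 := congrArg (permAut (simple j)) hi1
    rw [map_mul, map_one] at hi2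
    -- Forced by the Leibniz rule applied to x⁻¹ x = 1.
    refine ⟨-(permAut (simple j) (xvInv k i) * g * xvInv k i), ?_, fun c r h h' => ?_⟩
    · linear_combination -(permAut (simple j) (xvInv k i) * xvInv k i) * h1 +
        xv k (hi j) * xvInv k i * hi2 - xv k (hi j) * permAut (simple j) (xvInv k i) * hi1
    · have h3 := h2 c r h h'
      have e1 : phi (ℓ := ℓ) q Q (permAut (simple j) (xvInv k i)) *
          phi q Q (permAut (simple j) (xv k i)) = 1 := by
        rw [← map_mul, mul_comm, hi2, map_one]
      have e2 : phi (ℓ := ℓ) q Q (xv k i) * phi q Q (xvInv k i) = 1 := by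
        rw [← map_mul, hi1, map_one]
      have h4 := congrArg (fun y => phi q Q (permAut (simple j) (xvInv k i)) * y *
        phi q Q (xvInv k i)) h3
      simp only [mul_add, add_mul] at h4
      rw [map_neg, map_mul, map_mul]
      simp only [mul_assoc, mul_smul_comm, smul_mul_assoc, ← phi_mul_e] at h4 ⊢
      rw [← mul_assoc (phi q Q (xv k i)) (phi q Q (xvInv k i)), e2, one_mul,
        ← mul_assoc (phi q Q (permAut (simple j) (xvInv k i)))
          (phi q Q (permAut (simple j) (xv k i))), e1, one_mul] at h4
      rw [h4]
      simp only [neg_mul, smul_neg, mul_assoc]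
      abel

/-- The divided difference `x_{j+1} (f - s_j f) / (x_{j+1} - x_j)`. -/
noncomputable def divDiff (j : Fin (d - 1)) (f : Laurent k d) : Laurent k d :=
  -- The quotient is intrinsic to the Laurent polynomials, so arbitrary parameters serve to extract
  -- it.
  (exists_divDiff (ℓ := 0) (0 : k) Fin.elim0 j f).choose

theorem divDiff_spec (j : Fin (d - 1)) (f : Laurent k d) :
    (xv k (hi j) - xv k (lo j)) * divDiff j f = xv k (hi j) * (f - permAut (simple j) f) :=
  (exists_divDiff (ℓ := 0) (0 : k) Fin.elim0 j f).choose_spec.1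

theorem xv_sub_ne_zero (j : Fin (d - 1)) {s t : k} (ht : t ≠ 0) :
    s • xv k (hi j) - t • xv k (lo j) ≠ 0 := by
  intro h
  have := congrArg (fun f : Laurent k d => f.coeff (Pi.single (lo j) 1)) h
  have hne : (Pi.single (hi j) 1 : Fin d → ℤ) ≠ Pi.single (lo j) 1 := fun e => by
    have := congrFun e (lo j)
    simp [(lo_lt_hi j).ne] at this
  simp [xv, mon, hne, ht] at this

/-- The Laurent polynomials form a domain. Uniqueness of the quotient makes one operator valid for
all parameters and colour sequences. -/
theorem divDiff_unique {j : Fin (d - 1)} {f g : Laurent k d}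
    (h : (xv k (hi j) - xv k (lo j)) * g = xv k (hi j) * (f - permAut (simple j) f)) :
    g = divDiff j f := by
  have := xv_sub_ne_zero (k := k) j (s := 1) one_ne_zero
  rw [one_smul, one_smul] at this
  exact mul_left_cancel₀ this (h.trans (divDiff_spec j f).symm)

theorem T_phi_e {c : ColourSeq ℓ d} {r : Fin (ℓ + d - 1)} {j : Fin (d - 1)}
    (h : c.blackPos (lo j) = lo r) (h' : c.blackPos (hi j) = hi r) (f : Laurent k d) :
    𝐓 r * phi q Q f * 𝐞 c = phi q Q (permAut (simple j) f) * 𝐓 r * 𝐞 c +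
      (q - 1) • (phi q Q (divDiff j f) * 𝐞 c) := by
  obtain ⟨g, h1, h2⟩ := exists_divDiff q Q j f
  rw [h2 c r h h', divDiff_unique h1]

theorem phi_T_e {c : ColourSeq ℓ d} {r : Fin (ℓ + d - 1)} {j : Fin (d - 1)}
    (h : c.blackPos (lo j) = lo r) (h' : c.blackPos (hi j) = hi r) (f : Laurent k d) :
    phi q Q f * 𝐓 r * 𝐞 c = 𝐓 r * phi q Q (permAut (simple j) f) * 𝐞 c -
      (q - 1) • (phi q Q (divDiff j (permAut (simple j) f)) * 𝐞 c) := by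
  rw [T_phi_e q Q h h', permAut_simple_simple, add_sub_cancel_right]

end Phi

/-! ### Words in the crossings, and the filtration by the number of crossings -/

section Words

variable {k : Type*} [Field k] {ℓ d : ℕ} (q : k) (Q : Fin ℓ → k)

local notation "𝐞" c:max => heckeGen q Q (Gen.e c)
local notation "𝐓" r:max => heckeGen q Q (Gen.T r)
local notation "𝐗" i:max => heckeGen q Q (Gen.X i)
local notation "𝐘" i:max => heckeGen q Q (Gen.X' i)

/-- The product of the crossings of a word. -/
noncomputable def tw (L : List (Fin (ℓ + d - 1))) : Hecke q Q d := (L.map fun r => 𝐓 r).prod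

theorem diagElt_eq (c : ColourSeq ℓ d) (L : List (Fin (ℓ + d - 1))) :
    diagElt q Q c L = tw q Q L * 𝐞 c := rfl

theorem tw_nil : tw (d := d) q Q [] = 1 := rfl

theorem tw_cons (r : Fin (ℓ + d - 1)) (L : List (Fin (ℓ + d - 1))) :
    tw q Q (r :: L) = 𝐓 r * tw q Q L := by simp [tw]

theorem tw_append (A B : List (Fin (ℓ + d - 1))) :
    tw q Q (A ++ B) = tw q Q A * tw q Q B := by simp [tw]

theorem tw_singleton (r : Fin (ℓ + d - 1)) : tw q Q [r] = 𝐓 r := by simp [tw]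

theorem tw_mul_e (L : List (Fin (ℓ + d - 1))) (c : ColourSeq ℓ d) :
    tw q Q L * 𝐞 c = 𝐞 (c.act (L.map simple).prod) * tw q Q L := by
  induction L with
  | nil => simp [tw_nil, act_one]
  | cons r L ih =>
    rw [tw_cons, mul_assoc, ih, ← mul_assoc, T_mul_e, List.map_cons, List.prod_cons, act_mul,
      mul_assoc]

theorem e_mul_tw (L : List (Fin (ℓ + d - 1))) (c : ColourSeq ℓ d) :
    𝐞 c * tw q Q L = tw q Q L * 𝐞 (c.act (L.map simple).prod⁻¹) := by
  rw [tw_mul_e, ← act_mul, mul_inv_cancel, act_one]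

/-- A crossing of two red strands kills the idempotent. In a nonzero word each letter therefore
keeps the order of the red strands. -/
theorem redMono_of_tw_ne_zero {L : List (Fin (ℓ + d - 1))} {c : ColourSeq ℓ d}
    (h : tw q Q L * 𝐞 c ≠ 0) : RedMono c (L.map simple).prod := by
  induction L with
  | nil => intro m m' hm; simpa using c.redPos_strictMono hm
  | cons r L ih =>
    rw [tw_cons, mul_assoc] at h
    have ih' := ih fun h0 => h (by rw [h0, mul_zero])
    rw [tw_mul_e, ← mul_assoc] at h
    have hr := redMono_simple (c := c.act (L.map simple).prod) (r := r) fun hh =>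
      h (by rw [T_mul_e_red _ _ hh.1 hh.2, zero_mul])
    intro m m' hm
    have := hr m m' hm
    rwa [ih'.redPos_act, ih'.redPos_act] at this

theorem exists_strandPerm_of_tw_ne_zero {L : List (Fin (ℓ + d - 1))} {c : ColourSeq ℓ d}
    (h : tw q Q L * 𝐞 c ≠ 0) :
    ∃ w, (L.map simple).prod = strandPerm (c.act (L.map simple).prod) c w :=
  (redMono_of_tw_ne_zero q Q h).exists_strandPerm

/-- The span of the elements with fewer than `N` crossings. -/
noncomputable def flt (N : ℕ) : Submodule k (Hecke q Q d) :=
  Submodule.span k {h | ∃ (L : List (Fin (ℓ + d - 1))) (f : Laurent k d) (c : ColourSeq ℓ d),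
    L.length < N ∧ h = tw q Q L * phi q Q f * 𝐞 c}

variable {q Q}

theorem mem_flt {N : ℕ} {L : List (Fin (ℓ + d - 1))} (h : L.length < N) (f : Laurent k d)
    (c : ColourSeq ℓ d) : tw q Q L * phi q Q f * 𝐞 c ∈ flt q Q N :=
  Submodule.subset_span ⟨L, f, c, h, rfl⟩

theorem flt_mono {M N : ℕ} (h : M ≤ N) : flt (d := d) q Q M ≤ flt q Q N := by
  refine Submodule.span_mono ?_
  rintro _ ⟨L, f, c, hL, rfl⟩
  exact ⟨L, f, c, hL.trans_le h, rfl⟩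

theorem flt_induction {N : ℕ} {p : (x : Hecke q Q d) → x ∈ flt q Q N → Prop}
    (hp : ∀ (L : List (Fin (ℓ + d - 1))) (f : Laurent k d) (c : ColourSeq ℓ d) (hL : L.length < N),
      p (tw q Q L * phi q Q f * 𝐞 c) (mem_flt hL f c)) (h0 : p 0 (zero_mem _))
    (hadd : ∀ x y hx hy, p x hx → p y hy → p (x + y) (add_mem hx hy))
    (hsmul : ∀ (t : k) x hx, p x hx → p (t • x) (Submodule.smul_mem _ t hx))
    {x : Hecke q Q d} (hx : x ∈ flt q Q N) : p x hx := by
  induction hx using Submodule.span_induction with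
  | mem x hx =>
    obtain ⟨L, f, c, hL, rfl⟩ := hx
    exact hp L f c hL
  | zero => exact h0
  | add x y hx hy ihx ihy => exact hadd x y hx hy ihx ihy
  | smul t x hx ih => exact hsmul t x hx ih

theorem flt_mul_e {N : ℕ} {x : Hecke q Q d} (hx : x ∈ flt q Q N) (c : ColourSeq ℓ d) :
    x * 𝐞 c ∈ flt q Q N := by
  induction hx using flt_induction with
  | hp L f b hL =>
    rw [mul_assoc]
    by_cases h : b = c
    · subst h; rw [e_mul_e]; exact mem_flt hL f b
    · rw [e_mul_e_of_ne _ _ h, mul_zero]; exact zero_mem _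
  | h0 => rw [zero_mul]; exact zero_mem _
  | hadd x y _ _ hx hy => rw [add_mul]; exact add_mem hx hy
  | hsmul t x _ hx => rw [smul_mul_assoc]; exact Submodule.smul_mem _ _ hx

theorem flt_mul_phi {N : ℕ} {x : Hecke q Q d} (hx : x ∈ flt q Q N) (g : Laurent k d) :
    x * phi q Q g ∈ flt q Q N := by
  induction hx using flt_induction with
  | hp L f b hL =>
    rw [mul_assoc, ← phi_mul_e, ← mul_assoc, mul_assoc _ (phi q Q f), ← map_mul]
    exact mem_flt hL _ b
  | h0 => rw [zero_mul]; exact zero_mem _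
  | hadd x y _ _ hx hy => rw [add_mul]; exact add_mem hx hy
  | hsmul t x _ hx => rw [smul_mul_assoc]; exact Submodule.smul_mem _ _ hx

theorem T_mul_flt {N : ℕ} {x : Hecke q Q d} (hx : x ∈ flt q Q N) (r : Fin (ℓ + d - 1)) :
    𝐓 r * x ∈ flt q Q (N + 1) := by
  induction hx using flt_induction with
  | hp L f b hL =>
    rw [← mul_assoc, ← mul_assoc, ← tw_cons]
    exact mem_flt (by simpa using hL) _ b
  | h0 => rw [mul_zero]; exact zero_mem _
  | hadd x y _ _ hx hy => rw [mul_add]; exact add_mem hx hy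
  | hsmul t x _ hx => rw [mul_smul_comm]; exact Submodule.smul_mem _ _ hx

theorem tw_mul_flt {N : ℕ} {x : Hecke q Q d} (hx : x ∈ flt q Q N)
    (L : List (Fin (ℓ + d - 1))) : tw q Q L * x ∈ flt q Q (N + L.length) := by
  induction L with
  | nil => rwa [tw_nil, one_mul]
  | cons r L ih =>
    rw [tw_cons, mul_assoc, List.length_cons, ← add_assoc]
    exact T_mul_flt ih r

theorem e_mul_flt {N : ℕ} {x : Hecke q Q d} (hx : x ∈ flt q Q N) (c : ColourSeq ℓ d) :
    𝐞 c * x ∈ flt q Q N := by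
  induction hx using flt_induction with
  | hp L f b hL =>
    rw [← mul_assoc, ← mul_assoc, e_mul_tw, mul_assoc _ (𝐞 _), ← phi_mul_e, ← mul_assoc]
    exact flt_mul_e (mem_flt hL f _) b
  | h0 => rw [mul_zero]; exact zero_mem _
  | hadd x y _ _ hx hy => rw [mul_add]; exact add_mem hx hy
  | hsmul t x _ hx => rw [mul_smul_comm]; exact Submodule.smul_mem _ _ hx

theorem phi_mul_T_e (r : Fin (ℓ + d - 1)) (c : ColourSeq ℓ d) (f : Laurent k d) :
    ∃ g g' : Laurent k d, phi q Q f * 𝐓 r * 𝐞 c = 𝐓 r * phi q Q g * 𝐞 c + phi q Q g' * 𝐞 c := by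
  by_cases h : c.1 (lo r) = c.1 (hi r)
  · cases h' : c.1 (lo r) with
    | true =>
      refine ⟨0, 0, ?_⟩
      rw [mul_assoc, T_mul_e_red _ _ h' (h.symm.trans h')]
      simp
    | false =>
      obtain ⟨j, h1, h2⟩ := exists_black_neighbours h' (h.symm.trans h')
      refine ⟨permAut (simple j) f, -((q - 1) • divDiff j (permAut (simple j) f)), ?_⟩
      rw [phi_T_e q Q h1 h2, map_neg, map_smul, neg_mul, smul_mul_assoc, ← sub_eq_add_neg]
  · exact ⟨f, 0, by rw [T_phi_e_mixed _ _ h, map_zero, zero_mul, add_zero]⟩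

/-- Passing a crossing changes a polynomial and adds a term without that crossing, so multiplication
by polynomials on the left does not increase the number of crossings. -/
theorem phi_mul_flt {N : ℕ} {x : Hecke q Q d} (hx : x ∈ flt q Q N) (g : Laurent k d) :
    phi q Q g * x ∈ flt q Q N := by
  induction hx using flt_induction with
  | hp L f b hL =>
    induction L generalizing N g with
    | nil =>
      rw [tw_nil, one_mul, ← mul_assoc, ← map_mul, ← one_mul (phi q Q _), ← tw_nil]
      exact mem_flt hL _ b
    | cons r L ih =>
      obtain ⟨g₁, g₂, h⟩ := phi_mul_T_e (q := q) (Q := Q) r (b.act (L.map simple).prod) g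
      obtain ⟨N, rfl⟩ : ∃ N', N = N' + 1 := ⟨N - 1, by omega⟩
      have e : phi q Q g * (tw q Q (r :: L) * phi q Q f * 𝐞 b) =
          𝐓 r * (phi q Q g₁ * (tw q Q L * phi q Q f * 𝐞 b)) +
          phi q Q g₂ * (tw q Q L * phi q Q f * 𝐞 b) := by
        have e1 : tw q Q L * phi q Q f * 𝐞 b =
            𝐞 (b.act (L.map simple).prod) * (tw q Q L * phi q Q f) := by
          rw [mul_assoc, phi_mul_e, ← mul_assoc, tw_mul_e, mul_assoc]
        have e2 : ∀ y : Hecke q Q d, phi q Q g * (𝐓 r * (𝐞 (b.act (L.map simple).prod) * y)) =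
            phi q Q g * 𝐓 r * 𝐞 (b.act (L.map simple).prod) * y := fun y => by
          simp only [mul_assoc]
        rw [tw_cons, mul_assoc (𝐓 r), mul_assoc (𝐓 r), e1, e2, h, add_mul]
        simp only [mul_assoc]
      rw [e]
      have hL' : L.length < N := by simpa using hL
      exact add_mem (T_mul_flt (ih g₁ hL') r) (flt_mono (Nat.le_succ N) (ih g₂ hL'))
  | h0 => rw [mul_zero]; exact zero_mem _
  | hadd x y _ _ hx hy => rw [mul_add]; exact add_mem hx hy
  | hsmul t x _ hx => rw [mul_smul_comm]; exact Submodule.smul_mem _ _ hx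

/-- `flt` has a strict bound: fewer than M crossings times at most N crossings give fewer than M +
N. -/
theorem flt_mul_flt {M N : ℕ} {x y : Hecke q Q d} (hx : x ∈ flt q Q M)
    (hy : y ∈ flt q Q (N + 1)) : x * y ∈ flt q Q (M + N) := by
  induction hx using flt_induction with
  | hp L f b hL =>
    rw [mul_assoc, mul_assoc]
    exact flt_mono (by omega) (tw_mul_flt (phi_mul_flt (e_mul_flt hy b) f) L)
  | h0 => rw [zero_mul]; exact zero_mem _
  | hadd x y _ _ hx hy => rw [add_mul]; exact add_mem hx hy
  | hsmul t x _ hx => rw [smul_mul_assoc]; exact Submodule.smul_mem _ _ hx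

theorem mem_flt_of_mul_e {N : ℕ} {x : Hecke q Q d} (h : ∀ c, x * 𝐞 c ∈ flt q Q N) :
    x ∈ flt q Q N := by
  rw [← mul_one x, ← sum_e, Finset.mul_sum]
  exact sum_mem fun c _ => h c

theorem tw_mem_flt {L : List (Fin (ℓ + d - 1))} {N : ℕ} (h : L.length < N) :
    tw q Q L ∈ flt q Q N :=
  mem_flt_of_mul_e fun c => by
    have := mem_flt (q := q) (Q := Q) h 1 c
    rwa [map_one, mul_one] at this

theorem phi_mem_flt (f : Laurent k d) {N : ℕ} : phi q Q f ∈ flt q Q (N + 1) :=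
  mem_flt_of_mul_e fun c => by
    have := mem_flt (q := q) (Q := Q) (L := []) (Nat.succ_pos N) f c
    rwa [tw_nil, one_mul] at this

theorem e_mem_flt (c : ColourSeq ℓ d) {N : ℕ} : 𝐞 c ∈ flt q Q (N + 1) := by
  have := flt_mul_e (q := q) (Q := Q) (phi_mem_flt 1 (N := N)) c
  rwa [map_one, one_mul] at this

theorem flt_mul_tw {N : ℕ} {x : Hecke q Q d} (hx : x ∈ flt q Q N)
    (L : List (Fin (ℓ + d - 1))) : x * tw q Q L ∈ flt q Q (N + L.length) :=
  flt_mul_flt hx (tw_mem_flt (Nat.lt_succ_self _))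

theorem X_mul_e_eq (i : Fin (ℓ + d)) (c : ColourSeq ℓ d) :
    ∃ f : Laurent k d, 𝐗 i * 𝐞 c = phi q Q f * 𝐞 c := by
  rcases c.red_or_black i with ⟨m, rfl⟩ | ⟨j, rfl⟩
  · exact ⟨0, by rw [X_mul_e_red _ _ (colour_redPos c m), map_zero, zero_mul]⟩
  · exact ⟨xv k j, by rw [phi_xv, xElt_mul_e]⟩

theorem X'_mul_e_eq (i : Fin (ℓ + d)) (c : ColourSeq ℓ d) :
    ∃ f : Laurent k d, 𝐘 i * 𝐞 c = phi q Q f * 𝐞 c := by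
  rcases c.red_or_black i with ⟨m, rfl⟩ | ⟨j, rfl⟩
  · exact ⟨0, by rw [X'_mul_e_red _ _ (colour_redPos c m), map_zero, zero_mul]⟩
  · exact ⟨xvInv k j, by rw [phi_xvInv, xElt'_mul_e]⟩

theorem heckeGen_mem_flt (g : Gen ℓ d) : heckeGen q Q g ∈ flt q Q 2 := by
  cases g with
  | e c => exact e_mem_flt c
  | T r =>
    rw [← tw_singleton]
    exact tw_mem_flt (by simp)
  | X i =>
    refine mem_flt_of_mul_e fun c => ?_
    obtain ⟨f, hf⟩ := X_mul_e_eq (q := q) (Q := Q) i c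
    rw [hf]
    exact flt_mul_e (phi_mem_flt f) c
  | X' i =>
    refine mem_flt_of_mul_e fun c => ?_
    obtain ⟨f, hf⟩ := X'_mul_e_eq (q := q) (Q := Q) i c
    rw [hf]
    exact flt_mul_e (phi_mem_flt f) c

/-- The filtration is exhaustive, since each generator is a sum of terms with at most one crossing
and the filtration is multiplicative. -/
theorem exists_mem_flt (x : Hecke q Q d) : ∃ N, x ∈ flt q Q (N + 1) := by
  obtain ⟨y, rfl⟩ : ∃ y, heckeMk q Q y = x := RingQuot.mkAlgHom_surjective k (Rel q Q d) x
  induction y using FreeAlgebra.induction with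
  | grade0 t =>
    refine ⟨0, ?_⟩
    rw [AlgHom.commutes, Algebra.algebraMap_eq_smul_one, ← map_one (phi q Q)]
    exact Submodule.smul_mem _ _ (phi_mem_flt 1)
  | grade1 g => exact ⟨1, heckeGen_mem_flt g⟩
  | mul a b ha hb =>
    obtain ⟨M, hM⟩ := ha
    obtain ⟨N, hN⟩ := hb
    refine ⟨M + N, ?_⟩
    rw [map_mul]
    exact flt_mono (by omega) (flt_mul_flt hM hN)
  | add a b ha hb =>
    obtain ⟨M, hM⟩ := ha
    obtain ⟨N, hN⟩ := hb
    refine ⟨M + N, ?_⟩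
    rw [map_add]
    exact add_mem (flt_mono (by omega) hM) (flt_mono (by omega) hN)

/-! ### Reduced words -/

/-- With two of the three strands red, among them the middle one, each of the two words crosses red
strands with each other and vanishes. -/
theorem T_braid_e_of_red {r s : Fin (ℓ + d - 1)} (hs : (s : ℕ) = r + 1) {c : ColourSeq ℓ d}
    (h1 : c.1 (hi r) = true) (h : c.1 (lo r) = true ∨ c.1 (hi s) = true) :
    (𝐓 r * 𝐓 s * 𝐓 r - 𝐓 s * 𝐓 r * 𝐓 s) * 𝐞 c = 0 := by
  have e : hi r = lo s := Fin.ext (by simp [hi, lo, hs])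
  have h1' : c.1 (lo s) = true := by rw [← e, h1]
  have n1 : lo r ≠ lo s := by simp [lo, Fin.ext_iff]; omega
  have n2 : lo r ≠ hi s := by simp [lo, hi, Fin.ext_iff]; omega
  have n3 : hi s ≠ lo r := n2.symm
  have n4 : hi s ≠ hi r := by simp [hi, Fin.ext_iff]; omega
  rcases h with h0 | h2
  · have z1 : 𝐓 r * 𝐓 s * 𝐓 r * 𝐞 c = 0 := by
      rw [mul_assoc, T_mul_e_red _ _ h0 h1, mul_zero]
    have z2 : 𝐓 s * 𝐓 r * 𝐓 s * 𝐞 c = 0 := by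
      rw [mul_assoc, T_mul_e, mul_assoc, ← mul_assoc (𝐓 r), T_mul_e, mul_assoc (𝐞 _),
        ← mul_assoc (𝐓 s), T_mul_e_red, zero_mul]
      · simp only [act_apply', simple_inv]
        rw [← e, simple_hi, simple_of_ne s n1 n2, h0]
      · simp only [act_apply', simple_inv]
        rw [simple_of_ne r n3 n4, simple_hi, h1']
    rw [sub_mul, z1, z2, sub_zero]
  · have z1 : 𝐓 s * 𝐓 r * 𝐓 s * 𝐞 c = 0 := by
      rw [mul_assoc, T_mul_e_red _ _ h1' h2, mul_zero]
    have z2 : 𝐓 r * 𝐓 s * 𝐓 r * 𝐞 c = 0 := by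
      rw [mul_assoc, T_mul_e, mul_assoc, ← mul_assoc (𝐓 s), T_mul_e, mul_assoc (𝐞 _),
        ← mul_assoc (𝐓 r), T_mul_e_red, zero_mul]
      · simp only [act_apply', simple_inv]
        rw [simple_of_ne s n1 n2, simple_lo, h1]
      · simp only [act_apply', simple_inv]
        rw [e, simple_lo, simple_of_ne r n3 n4, h2]
    rw [sub_mul, z1, z2, sub_zero]

/-- The braid relation fails only for the colours black, red, black, and there the error is a
polynomial without crossings. -/
theorem braid_sub_mem_flt {r s : Fin (ℓ + d - 1)} (hs : (s : ℕ) = r + 1) :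
    𝐓 r * 𝐓 s * 𝐓 r - 𝐓 s * 𝐓 r * 𝐓 s ∈ flt q Q 3 := by
  refine mem_flt_of_mul_e fun c => ?_
  cases h1 : c.1 (hi r) with
  | false => rw [T_braid_e _ _ hs h1]; exact zero_mem _
  | true =>
    by_cases h : c.1 (lo r) = true ∨ c.1 (hi s) = true
    · rw [T_braid_e_of_red hs h1 h]; exact zero_mem _
    · simp only [not_or, Bool.not_eq_true] at h
      rw [T_braid_e_red _ _ hs h.1 h1 h.2]
      obtain ⟨f, hf⟩ := X_mul_e_eq (q := q) (Q := Q) (hi s) c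
      rw [hf]
      exact Submodule.smul_mem _ _ (flt_mul_e (phi_mem_flt f) c)

/-- By Matsumoto's theorem it suffices to check far commutations, which hold exactly, and braid
moves, which hold up to fewer crossings. Thus the leading term of a reduced word depends only on its
permutation. -/
theorem tw_sub_tw_mem_flt {w : Perm (Fin (ℓ + d))} {A B : List (Fin (ℓ + d - 1))}
    (hA : IsReducedWord w A) (hB : IsReducedWord w B) :
    tw q Q A - tw q Q B ∈ flt q Q (len w) := by
  refine matsumoto (fun w A B => tw q Q A - tw q Q B ∈ flt q Q (len w)) ?_ ?_ ?_ ?_ ?_ ?_ w A B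
    hA hB
  · intro w A _; rw [sub_self]; exact zero_mem _
  · intro w A B h; rw [← neg_sub]; exact neg_mem h
  · intro w A B C h h'; rw [← sub_add_sub_cancel _ (tw q Q B)]; exact add_mem h h'
  · intro w r A B hw _ _ h
    rw [tw_append, tw_append, ← sub_mul, len_mul_simple w r hw]
    exact flt_mul_tw h [r]
  · intro w r s A hrs _ _ _
    rw [tw_append, tw_append, tw_cons, tw_cons, tw_cons, tw_cons, ← mul_assoc (𝐓 r),
      T_mul_T_far _ _ hrs, mul_assoc, sub_self]
    exact zero_mem _
  · intro w r s A hs _ _ h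
    have hl := h.2
    rw [List.length_append] at hl
    rw [tw_append, tw_append, ← mul_sub, ← hl, add_comm]
    refine tw_mul_flt ?_ A
    have := braid_sub_mem_flt (q := q) (Q := Q) hs
    simpa [tw_cons, tw_nil, mul_assoc] using this

theorem T_sq_mem_flt (r : Fin (ℓ + d - 1)) : 𝐓 r * 𝐓 r ∈ flt q Q 2 := by
  have hX : ∀ i (c : ColourSeq ℓ d) (t : k), 𝐗 i * 𝐞 c - t • 𝐞 c ∈ flt q Q 2 := fun i c t => by
    obtain ⟨f, hf⟩ := X_mul_e_eq (q := q) (Q := Q) i c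
    rw [hf]
    exact sub_mem (flt_mul_e (phi_mem_flt f) c) (Submodule.smul_mem _ _ (e_mem_flt c))
  refine mem_flt_of_mul_e fun c => ?_
  cases h0 : c.1 (lo r) <;> cases h1 : c.1 (hi r)
  · rw [T_sq_e _ _ h0 h1]
    exact add_mem (Submodule.smul_mem _ _ (flt_mul_e (heckeGen_mem_flt _) c))
      (Submodule.smul_mem _ _ (e_mem_flt c))
  · obtain ⟨m, hm⟩ := exists_redPos h1
    rw [T_sq_e_black_red _ _ h0 hm]
    exact hX _ _ _
  · obtain ⟨m, hm⟩ := exists_redPos h0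
    rw [T_sq_e_red_black _ _ hm h1]
    exact hX _ _ _
  · rw [mul_assoc, T_mul_e_red _ _ h0 h1, mul_zero]; exact zero_mem _

theorem tw_mem_flt_of_not_reduced {L : List (Fin (ℓ + d - 1))}
    (h : ¬ IsReducedWord (L.map simple).prod L) : tw q Q L ∈ flt q Q L.length := by
  induction L using List.reverseRecOn with
  | nil => exact absurd isReducedWord_nil h
  | append_singleton A r ih =>
    rw [tw_append, List.length_append]
    by_cases hA : IsReducedWord (A.map simple).prod A
    · set w := (A.map simple).prod with hw
      have hd : w (hi r) < w (lo r) := by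
        refine (lt_or_gt_lo_hi w r).resolve_left fun hlt => h ?_
        have := hA.append (isReducedWord_singleton r)
          (by rw [len_simple]; exact len_mul_simple_of_lt w r hlt)
        rw [List.map_append, List.prod_append]
        simpa using this
      obtain ⟨A', hA'⟩ := exists_isReducedWord (w * simple r)
      have h1 := tw_sub_tw_mem_flt (q := q) (Q := Q) hA (hA'.snoc hd)
      -- The reduced prefix A has r as a descent, so up to shorter terms it may be replaced by a
      -- word A' r. Then the square of the crossing r appears, which is a sum of terms with at most
      -- one crossing.
      have h2 : tw q Q A * tw q Q [r] = (tw q Q A - tw q Q (A' ++ [r])) * tw q Q [r] +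
          tw q Q A' * (𝐓 r * 𝐓 r) := by
        rw [sub_mul, tw_append, tw_singleton, mul_assoc (tw q Q A')]; abel
      rw [h2]
      have h3 := hA.2
      have h4 := hA'.2
      have h5 := len_mul_simple w r hd
      refine add_mem ?_ ?_
      · exact flt_mono (by simp; omega) (flt_mul_tw h1 [r])
      · exact flt_mono (by simp; omega) (tw_mul_flt (T_sq_mem_flt r) A')
    · exact flt_mul_tw (ih hA) [r]

/-- Laurent polynomials can be moved past a diagram, up to diagrams with fewer crossings. -/
theorem phi_mul_tw_sub_mem_flt {L : List (Fin (ℓ + d - 1))} {b c : ColourSeq ℓ d}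
    {w : Perm (Fin d)} (h : (L.map simple).prod = strandPerm b c w) (f : Laurent k d) :
    phi q Q f * tw q Q L * 𝐞 c - tw q Q L * phi q Q (permAut w⁻¹ f) * 𝐞 c ∈
      flt q Q L.length := by
  induction L generalizing b w f with
  | nil =>
    have hb : b = c := by
      have := act_strandPerm b c w
      rw [← h] at this
      simpa [act_one] using this.symm
    subst hb
    have hw : w = 1 := strandPerm_injective b b (by rw [← h, strandPerm_self_one]; simp)
    rw [hw, inv_one, permAut_one, tw_nil, one_mul, mul_one, sub_self]
    exact zero_mem _
  | cons r L ih =>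
    by_cases h0 : tw q Q L * 𝐞 c = 0
    · have e1 : phi q Q f * tw q Q (r :: L) * 𝐞 c = 0 := by
        rw [tw_cons, mul_assoc, mul_assoc, h0, mul_zero, mul_zero]
      have e2 : tw q Q (r :: L) * phi q Q (permAut w⁻¹ f) * 𝐞 c = 0 := by
        rw [mul_assoc, phi_mul_e, ← mul_assoc, tw_cons, mul_assoc (𝐓 r), h0, mul_zero, zero_mul]
      rw [e1, e2, sub_zero]
      exact zero_mem _
    obtain ⟨w', hw'⟩ := exists_strandPerm_of_tw_ne_zero q Q h0
    set b' := c.act (L.map simple).prod with hb'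
    have hTL : ∀ x : Hecke q Q d, x * tw q Q L * 𝐞 c = x * 𝐞 b' * tw q Q L := fun x => by
      rw [mul_assoc, tw_mul_e, mul_assoc]
    have hTL' : ∀ (x : Hecke q Q d) g, x * tw q Q L * phi q Q g * 𝐞 c =
        x * 𝐞 b' * tw q Q L * phi q Q g := fun x g => by
      rw [mul_assoc, phi_mul_e, ← mul_assoc, hTL]
    rw [List.map_cons, List.prod_cons, hw'] at h
    rw [List.length_cons, tw_cons, ← mul_assoc]
    by_cases hc : b'.1 (lo r) = b'.1 (hi r)
    · cases hlo : b'.1 (lo r) with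
      | true =>
        have z := T_mul_e_red q Q hlo (hc.symm.trans hlo)
        rw [hTL, hTL', z, mul_assoc (phi q Q f), z]
        simp
      | false =>
        obtain ⟨j, h1, h2⟩ := exists_black_neighbours hlo (hc.symm.trans hlo)
        rw [← strandPerm_simple h1 h2, strandPerm_mul] at h
        have hb : b' = b := by
          have e1 := act_strandPerm b' c (simple j * w')
          rw [h, act_strandPerm] at e1
          exact e1.symm
        have hw : w = simple j * w' := by
          rw [← hb] at h
          exact (strandPerm_injective _ _ h).symm
        have e : phi q Q f * 𝐓 r * tw q Q L * 𝐞 c =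
            𝐓 r * (phi q Q (permAut (simple j) f) * tw q Q L * 𝐞 c) -
            (q - 1) • (phi q Q (divDiff j (permAut (simple j) f)) * tw q Q L * 𝐞 c) := by
          rw [hTL, phi_T_e q Q h1 h2, sub_mul, smul_mul_assoc, hTL, hTL]
          simp only [mul_assoc]
        have := ih hw' (permAut (simple j) f)
        rw [← permAut_mul, ← simple_inv j, ← mul_inv_rev, simple_inv, ← hw] at this
        rw [e, sub_right_comm]
        refine sub_mem ?_ (Submodule.smul_mem _ _ ?_)
        · rw [mul_assoc (𝐓 r), mul_assoc (𝐓 r), ← mul_sub]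
          exact T_mul_flt this r
        · exact flt_mul_e (phi_mul_flt (tw_mem_flt (Nat.lt_succ_self _)) _) c
    · rw [← strandPerm_act_simple hc, strandPerm_mul, one_mul] at h
      have hb : b'.act (simple r) = b := by
        have e1 := act_strandPerm (b'.act (simple r)) c w'
        rw [h, act_strandPerm] at e1
        exact e1.symm
      have hw : w = w' := by
        rw [← hb] at h
        exact (strandPerm_injective _ _ h).symm
      have := ih hw' f
      rw [hTL, ← T_phi_e_mixed q Q hc, ← hTL, mul_assoc (𝐓 r), mul_assoc (𝐓 r), mul_assoc (𝐓 r),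
        mul_assoc (𝐓 r), ← mul_sub, hw]
      exact T_mul_flt this r

/-- Three strands, black, red and black, any two of which cross. -/
def BadTriple (π : Perm (Fin (ℓ + d))) (c : ColourSeq ℓ d) : Prop :=
  ∃ i j m, i < j ∧ j < m ∧ π m < π j ∧ π j < π i ∧ c.1 i = false ∧ c.1 j = true ∧ c.1 m = false

/-- All diagrams of a permutation without bad triples have the same element. -/
theorem tw_mul_e_unique {π : Perm (Fin (ℓ + d))} {c : ColourSeq ℓ d} (h : ¬ BadTriple π c)
    {A B : List (Fin (ℓ + d - 1))} (hA : IsReducedWord π A) (hB : IsReducedWord π B) :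
    tw q Q A * 𝐞 c = tw q Q B * 𝐞 c := by
  refine matsumoto (fun π A B => ∀ c, ¬ BadTriple π c → tw q Q A * 𝐞 c = tw q Q B * 𝐞 c)
    ?_ ?_ ?_ ?_ ?_ ?_ π A B hA hB c h
  · intro w A _ c _; rfl
  · intro w A B h c hc; exact (h c hc).symm
  · intro w A B C h h' c hc; exact (h c hc).trans (h' c hc)
  · intro w r A B hw _ _ h c hc
    rw [tw_append, tw_append, tw_singleton, mul_assoc, mul_assoc, T_mul_e, ← mul_assoc,
      ← mul_assoc, h]
    rintro ⟨i, j, m, hij, hjm, h1, h2, c1, c2, c3⟩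
    rw [act_apply', simple_inv] at c1 c2 c3
    simp only [Perm.mul_apply] at h1 h2
    -- Since r is a descent of w, the pair at r and r + 1 is not inverted by w s_r. Hence s_r
    -- preserves the order of the pairs of a bad triple of w s_r, which becomes a bad triple of w.
    have hlt : ∀ {i j : Fin (ℓ + d)}, i < j → w (simple r j) < w (simple r i) →
        simple r i < simple r j := fun {i j} hij hji => by
      refine simple_lt r hij fun hh => ?_
      rw [hh.1, hh.2, simple_lo, simple_hi] at hji
      exact absurd hw (not_lt.mpr hji.le)
    exact hc ⟨_, _, _, hlt hij h2, hlt hjm h1, h1, h2, c1, c2, c3⟩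
  · intro w r s A hrs _ _ _ c _
    rw [tw_append, tw_append, tw_cons, tw_cons, tw_cons, tw_cons, ← mul_assoc (𝐓 r),
      T_mul_T_far _ _ hrs, mul_assoc (𝐓 s)]
  · intro w r s A hs h1 h2 _ c hc
    have e : hi r = lo s := Fin.ext (by simp [hi, lo, hs])
    have key : (𝐓 r * 𝐓 s * 𝐓 r - 𝐓 s * 𝐓 r * 𝐓 s) * 𝐞 c = 0 := by
      cases hr : c.1 (hi r) with
      | false => exact T_braid_e _ _ hs hr
      | true =>
        refine T_braid_e_of_red hs hr ?_
        by_contra hne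
        simp only [not_or, Bool.not_eq_true] at hne
        exact hc ⟨lo r, hi r, hi s, lo_lt_hi r, by rw [e]; exact lo_lt_hi s, by rw [e]; exact h2,
          h1, hne.1, hr, hne.2⟩
    rw [sub_mul, sub_eq_zero] at key
    rw [tw_append, tw_append, mul_assoc, mul_assoc]
    simp only [tw_cons, tw_nil, mul_one]
    rw [← mul_assoc (𝐓 r), key, ← mul_assoc (𝐓 s)]

end Words

/-! ### The generic representation -/

section Representation

variable {k : Type*} [Field k] {ℓ d : ℕ} (q : k) (Q : Fin ℓ → k)

/-- The rational functions in `n` variables. -/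
abbrev RatK (k : Type*) [Field k] (n : ℕ) : Type _ := FractionRing (Laurent k n)

/-- The variables. -/
noncomputable def rx (k : Type*) [Field k] {n : ℕ} (i : Fin n) : RatK k n :=
  algebraMap (Laurent k n) (RatK k n) (xv k i)

theorem rx_ne_zero {n : ℕ} (i : Fin n) : rx k i ≠ 0 := by
  refine (map_ne_zero_iff _ (IsFractionRing.injective (Laurent k n) _)).mpr ?_
  exact left_ne_zero_of_mul_eq_one (xv_mul_xvInv i)

theorem smul_rx_sub_ne_zero {n : ℕ} {i j : Fin n} (h : i ≠ j) (t : k) :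
    t • rx k i - rx k j ≠ 0 := by
  have e : t • rx k i - rx k j =
      algebraMap (Laurent k n) (RatK k n) (t • xv k i - xv k j) := by
    rw [map_sub, rx, rx]
    congr 1
    exact (map_smul (IsScalarTower.toAlgHom k (Laurent k n) (RatK k n)) t _).symm
  rw [e]
  refine (map_ne_zero_iff _ (IsFractionRing.injective (Laurent k n) _)).mpr fun h0 => ?_
  have := congrArg (fun f : Laurent k n => f.coeff (Pi.single j 1)) h0
  have hne : (Pi.single i 1 : Fin n → ℤ) ≠ Pi.single j 1 := fun e => by
    have := congrFun e i
    simp [h] at this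
  simp [xv, mon, hne] at this

theorem rx_sub_ne_zero {n : ℕ} {i j : Fin n} (h : i ≠ j) : rx k i - rx k j ≠ 0 := by
  have := smul_rx_sub_ne_zero h (1 : k)
  rwa [one_smul] at this

/-- The parameter of the red strand at a position. -/
noncomputable def redParam (c : ColourSeq ℓ d) (i : Fin (ℓ + d)) : k :=
  ∑ m, if c.redPos m = i then Q m else 0

theorem redParam_redPos (c : ColourSeq ℓ d) (m : Fin ℓ) : redParam Q c (c.redPos m) = Q m := by
  unfold redParam
  simp [c.redPos_strictMono.injective.eq_iff]

theorem redParam_act_simple {c : ColourSeq ℓ d} {r : Fin (ℓ + d - 1)}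
    (h : ¬ (c.1 (lo r) = true ∧ c.1 (hi r) = true)) (i : Fin (ℓ + d)) :
    redParam Q (c.act (simple r)) i = redParam Q c (simple r i) := by
  unfold redParam
  refine Finset.sum_congr rfl fun m _ => if_congr ?_ rfl rfl
  rw [redPos_act_simple h]
  exact ⟨fun e => by rw [← e, simple_simple], fun e => by rw [e, simple_simple]⟩

/-- The diagonal coefficient of a crossing. -/
noncomputable def coefA {n : ℕ} (a b : Bool) (x y : RatK k n) : RatK k n :=
  if a = false ∧ b = false then (q - 1) • y / (y - x) else 0

/-- The other coefficient of a crossing. -/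
noncomputable def coefB {n : ℕ} (a b : Bool) (x y : RatK k n) (t : k) : RatK k n :=
  match a, b with
  | false, false => - (q • y - x) / (y - x)
  | false, true => 1
  | true, false => y - algebraMap k _ t
  | true, true => 0

variable (c : ColourSeq ℓ d)

/-- The value of the variable at a position, at a point of the orbit. -/
noncomputable def yv (k : Type*) [Field k] {n : ℕ} (ρ : Perm (Fin n)) (i : Fin n) : RatK k n :=
  rx k (ρ⁻¹ i)

/-- The action of a crossing on functions on the orbit. -/
noncomputable def opT (r : Fin (ℓ + d - 1)) :
    Module.End k (Perm (Fin (ℓ + d)) → RatK k (ℓ + d)) where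
  -- The Demazure–Lusztig formula at the point ρ, where position i carries the variable of the
  -- strand ρ⁻¹ i. For a mixed crossing one direction has the coefficient 1 and the other one X -
  -- Q_m, so that going back and forth multiplies by X - Q_m.
  toFun G ρ := coefA q ((c.act ρ).1 (lo r)) ((c.act ρ).1 (hi r)) (yv k ρ (lo r)) (yv k ρ (hi r)) *
      G ρ + coefB q ((c.act ρ).1 (lo r)) ((c.act ρ).1 (hi r)) (yv k ρ (lo r)) (yv k ρ (hi r))
        (redParam Q (c.act ρ) (lo r)) * G (simple r * ρ)
  map_add' F G := by ext ρ; simp only [Pi.add_apply]; ring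
  map_smul' t G := by
    ext ρ
    simp only [Pi.smul_apply, RingHom.id_apply, smul_add, mul_smul_comm]

/-- The multiplication with a function. -/
noncomputable def opM {n : ℕ} (f : Perm (Fin n) → RatK k n) :
    Module.End k (Perm (Fin n) → RatK k n) where
  toFun G ρ := f ρ * G ρ
  map_add' F G := by ext ρ; simp only [Pi.add_apply]; ring
  map_smul' t G := by
    ext ρ
    simp only [Pi.smul_apply, RingHom.id_apply, mul_smul_comm]

/-- The action of the generators. -/
noncomputable def opGen : Gen ℓ d → Module.End k (Perm (Fin (ℓ + d)) → RatK k (ℓ + d))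
  | Gen.e b => opM fun ρ => if c.act ρ = b then 1 else 0
  | Gen.T r => opT q Q c r
  | Gen.X i => opM fun ρ => if (c.act ρ).1 i = true then 0 else yv k ρ i
  | Gen.X' i => opM fun ρ => if (c.act ρ).1 i = true then 0 else (yv k ρ i)⁻¹

theorem opT_apply (r : Fin (ℓ + d - 1)) (G : Perm (Fin (ℓ + d)) → RatK k (ℓ + d))
    (ρ : Perm (Fin (ℓ + d))) : opT q Q c r G ρ =
    coefA q ((c.act ρ).1 (lo r)) ((c.act ρ).1 (hi r)) (yv k ρ (lo r)) (yv k ρ (hi r)) *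
      G ρ + coefB q ((c.act ρ).1 (lo r)) ((c.act ρ).1 (hi r)) (yv k ρ (lo r)) (yv k ρ (hi r))
        (redParam Q (c.act ρ) (lo r)) * G (simple r * ρ) := rfl

theorem opM_apply {n : ℕ} (f G : Perm (Fin n) → RatK k n) (ρ : Perm (Fin n)) :
    opM f G ρ = f ρ * G ρ := rfl

theorem yv_simple_mul {n : ℕ} (ρ : Perm (Fin n)) (r : Fin (n - 1)) (i : Fin n) :
    yv k (simple r * ρ) i = yv k ρ (simple r i) := by
  rw [yv, yv, mul_inv_rev, simple_inv, Perm.mul_apply]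

theorem col_simple_mul (ρ : Perm (Fin (ℓ + d))) (r : Fin (ℓ + d - 1)) (i : Fin (ℓ + d)) :
    (c.act (simple r * ρ)).1 i = (c.act ρ).1 (simple r i) := by
  rw [act_apply', act_apply', mul_inv_rev, simple_inv, Perm.mul_apply]

theorem yv_sub_ne_zero {n : ℕ} (ρ : Perm (Fin n)) {i j : Fin n} (h : i ≠ j) :
    yv k ρ i - yv k ρ j ≠ 0 := rx_sub_ne_zero fun e => h (ρ⁻¹.injective e)

theorem opT_far {r s : Fin (ℓ + d - 1)} (h : (r : ℕ) + 1 < s) :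
    opT q Q c r * opT q Q c s = opT q Q c s * opT q Q c r := by
  have n1 : lo r ≠ lo s := by simp [lo, Fin.ext_iff]; omega
  have n2 : lo r ≠ hi s := by simp [lo, hi, Fin.ext_iff]; omega
  have n3 : hi r ≠ lo s := by simp [lo, hi, Fin.ext_iff]; omega
  have n4 : hi r ≠ hi s := by simp [hi, Fin.ext_iff]; omega
  have s1 := simple_of_ne s n1 n2
  have s2 := simple_of_ne s n3 n4
  have s3 := simple_of_ne r n1.symm n3.symm
  have s4 := simple_of_ne r n2.symm n4.symm
  refine LinearMap.ext fun G => funext fun ρ => ?_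
  simp only [Module.End.mul_apply, opT_apply, col_simple_mul, yv_simple_mul, s1, s2, s3, s4]
  rw [← mul_assoc (simple r), ← mul_assoc (simple s), simple_comm h]
  by_cases hr : (c.act ρ).1 (lo r) = true ∧ (c.act ρ).1 (hi r) = true
  · simp [hr.1, hr.2, coefA, coefB]
  by_cases hs : (c.act ρ).1 (lo s) = true ∧ (c.act ρ).1 (hi s) = true
  · simp [hs.1, hs.2, coefA, coefB]
  rw [act_mul, act_mul, redParam_act_simple Q hr, redParam_act_simple Q hs, s1, s3]
  ring

theorem opT_sq (r : Fin (ℓ + d - 1)) (G : Perm (Fin (ℓ + d)) → RatK k (ℓ + d))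
    (ρ : Perm (Fin (ℓ + d))) : opT q Q c r (opT q Q c r G) ρ =
      match (c.act ρ).1 (lo r), (c.act ρ).1 (hi r) with
      | false, false => (q - 1) • opT q Q c r G ρ + q • G ρ
      | false, true => (yv k ρ (lo r) - algebraMap k _ (redParam Q (c.act ρ) (hi r))) * G ρ
      | true, false => (yv k ρ (hi r) - algebraMap k _ (redParam Q (c.act ρ) (lo r))) * G ρ
      | true, true => 0 := by
  have hy := yv_sub_ne_zero (k := k) ρ (lo_lt_hi r).ne'
  have hy' := yv_sub_ne_zero (k := k) ρ (lo_lt_hi r).ne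
  have ht : ¬ ((c.act ρ).1 (lo r) = true ∧ (c.act ρ).1 (hi r) = true) →
      redParam Q (c.act (simple r * ρ)) (lo r) = redParam Q (c.act ρ) (hi r) := fun h => by
    rw [act_mul, redParam_act_simple Q h, simple_lo]
  simp only [opT_apply, col_simple_mul, yv_simple_mul, simple_lo, simple_hi, simple_mul_simple_mul]
  cases h0 : (c.act ρ).1 (lo r) <;> cases h1 : (c.act ρ).1 (hi r)
  · simp only [coefA, coefB, and_self, if_true, Algebra.smul_def, map_sub, map_one]
    field_simp
    ring
  · rw [ht (by simp [h0])]
    simp [coefA, coefB]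
  · simp [coefA, coefB]
  · simp [coefA, coefB]

/-- At each point of the orbit this is an identity of rational functions in three variables, one for
each colour pattern. Only the pattern black, red, black leaves a remainder. -/
theorem opT_braid {r s : Fin (ℓ + d - 1)} (hs : (s : ℕ) = r + 1)
    (G : Perm (Fin (ℓ + d)) → RatK k (ℓ + d)) (ρ : Perm (Fin (ℓ + d))) :
    opT q Q c r (opT q Q c s (opT q Q c r G)) ρ - opT q Q c s (opT q Q c r (opT q Q c s G)) ρ =
      if (c.act ρ).1 (lo r) = false ∧ (c.act ρ).1 (hi r) = true ∧ (c.act ρ).1 (hi s) = false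
      then (1 - q) • (yv k ρ (hi s) * G ρ) else 0 := by
  have e : lo s = hi r := Fin.ext (by simp [hi, lo, hs])
  have n1 : lo r ≠ lo s := by simp [lo, Fin.ext_iff]; omega
  have n2 : lo r ≠ hi s := by simp [lo, hi, Fin.ext_iff]; omega
  have n3 : hi s ≠ hi r := by simp [hi, Fin.ext_iff]; omega
  have s1 := simple_lo r
  have s2 := simple_hi r
  have s3 := simple_of_ne r n2.symm n3
  have s4 := simple_of_ne s n1 n2
  have s5 := simple_lo s
  have s6 := simple_hi s
  rw [e] at s5 s6
  have hy1 := yv_sub_ne_zero (k := k) ρ (lo_lt_hi r).ne'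
  have hy2 := yv_sub_ne_zero (k := k) ρ n3
  have hy3 := yv_sub_ne_zero (k := k) ρ n2.symm
  have hy1' := yv_sub_ne_zero (k := k) ρ (lo_lt_hi r).ne
  have hy2' := yv_sub_ne_zero (k := k) ρ n3.symm
  have hy3' := yv_sub_ne_zero (k := k) ρ n2
  have hb : simple s * (simple r * (simple s * ρ)) = simple r * (simple s * (simple r * ρ)) := by
    simp only [← mul_assoc, simple_braid hs]
  have ht : ∀ (π : Perm (Fin (ℓ + d))) (j : Fin (ℓ + d - 1)) i,
      ¬ ((c.act π).1 (lo j) = true ∧ (c.act π).1 (hi j) = true) →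
      redParam Q (c.act (simple j * π)) i = redParam Q (c.act π) (simple j i) := fun π j i h => by
    rw [act_mul, redParam_act_simple Q h]
  simp only [opT_apply, col_simple_mul, yv_simple_mul, e, s1, s2, s3, s4, s5, s6,
    simple_mul_simple_mul, hb]
  cases h0 : (c.act ρ).1 (lo r) <;> cases h1 : (c.act ρ).1 (hi r) <;>
    cases h2 : (c.act ρ).1 (hi s)
  · simp only [coefA, coefB, and_self, if_true, Algebra.smul_def, map_sub, map_one]
    simp only [Bool.false_eq_true, false_and, and_false, if_false]
    field_simp
    ring
  · simp [coefA, coefB, Algebra.smul_def]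
  · have t1 : redParam Q (c.act (simple r * ρ)) (lo r) = redParam Q (c.act ρ) (hi r) := by
      rw [ht _ _ _ (by simp [h0]), s1]
    have t2 : redParam Q (c.act (simple s * (simple r * ρ))) (lo r) =
        redParam Q (c.act ρ) (hi r) := by
      rw [ht _ _ _ (by simp [e, col_simple_mul, s2, s3, h0]), s4, t1]
    simp only [coefA, coefB, Algebra.smul_def, map_sub, map_one, t1, t2, Bool.false_eq_true,
      reduceCtorEq, and_self, and_false, false_and, if_true, if_false]
    field_simp
    ring
  · simp [coefA, coefB]
  · have t1 : ∀ i, redParam Q (c.act (simple r * ρ)) i = redParam Q (c.act ρ) (simple r i) :=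
      fun i => ht _ _ _ (by simp [h1])
    have t2 : ∀ i, redParam Q (c.act (simple s * ρ)) i = redParam Q (c.act ρ) (simple s i) :=
      fun i => ht _ _ _ (by simp [h2])
    have t3 : redParam Q (c.act (simple r * (simple s * ρ))) (hi r) =
        redParam Q (c.act ρ) (lo r) := by
      rw [ht _ _ _ (by simp [col_simple_mul, s5, h2]), s2, t2, s4]
    simp only [coefA, coefB, Algebra.smul_def, map_sub, map_one, t1, t2, t3, s1, s2, s4,
      Bool.false_eq_true, reduceCtorEq, and_self, and_false, false_and, if_true, if_false]
    ring
  · simp [coefA, coefB]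
  · simp [coefA, coefB]
  · simp [coefA, coefB]

theorem act_simple_mul_eq_iff (r : Fin (ℓ + d - 1)) (b : ColourSeq ℓ d)
    (ρ : Perm (Fin (ℓ + d))) : c.act (simple r * ρ) = b ↔ c.act ρ = b.act (simple r) := by
  rw [act_mul]
  exact ⟨fun h => by rw [← h, act_simple_act_simple], fun h => by rw [h, act_simple_act_simple]⟩

theorem coefA_act (r : Fin (ℓ + d - 1)) (b : ColourSeq ℓ d) {n : ℕ} (x y z : RatK k n)
    (h : b.act (simple r) ≠ b) : coefA q (b.1 (lo r)) (b.1 (hi r)) x y * z = 0 := by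
  rw [coefA, if_neg, zero_mul]
  exact fun hh => h (act_simple_of_same (hh.1.trans hh.2.symm))

/-- A crossing moves the colour sequence b to s_r b. The diagonal coefficient matters only when both
strands are black, and then s_r b = b. -/
theorem opT_supp (r : Fin (ℓ + d - 1)) {b : ColourSeq ℓ d}
    {F : Perm (Fin (ℓ + d)) → RatK k (ℓ + d)} (hF : ∀ π, c.act π ≠ b → F π = 0)
    (ρ : Perm (Fin (ℓ + d))) (h : c.act ρ ≠ b.act (simple r)) : opT q Q c r F ρ = 0 := by
  rw [opT_apply, hF (simple r * ρ) (fun hh => h ((act_simple_mul_eq_iff c r b ρ).mp hh)), mul_zero,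
    add_zero]
  by_cases hb : c.act ρ = b
  · rw [hb]
    exact coefA_act q r b _ _ _ fun e => h (hb.trans e.symm)
  · rw [hF _ hb, mul_zero]

set_option maxHeartbeats 1000000 in
theorem opGen_rel {x y : FreeAlgebra k (Gen ℓ d)} (h : Rel q Q d x y) :
    FreeAlgebra.lift k (opGen q Q c) x = FreeAlgebra.lift k (opGen q Q c) y := by
  refine LinearMap.ext fun G => funext fun ρ => ?_
  have he : ∀ (b : ColourSeq ℓ d) (F : Perm (Fin (ℓ + d)) → RatK k (ℓ + d)) (π : Perm _),
      (opM fun ρ => if c.act ρ = b then 1 else 0) F π = if c.act π = b then F π else 0 :=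
    fun b F π => by rw [opM_apply]; split_ifs <;> simp
  -- A relation that ends in e(b) needs to be tested only on functions supported at the points with
  -- colours b.
  have hsupp : ∀ (b : ColourSeq ℓ d) (A B : Module.End k (Perm (Fin (ℓ + d)) → RatK k (ℓ + d)))
      (_ : ∀ F : Perm (Fin (ℓ + d)) → RatK k (ℓ + d), (∀ π, c.act π ≠ b → F π = 0) →
        A F ρ = B F ρ), (A * opGen q Q c (Gen.e b)) G ρ = (B * opGen q Q c (Gen.e b)) G ρ :=
    fun b A B hAB => hAB _ fun π hπ => by rw [opGen, he, if_neg hπ]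
  cases h with
  | e_sum =>
    simp only [map_sum, gen, FreeAlgebra.lift_ι_apply, LinearMap.sum_apply, Finset.sum_apply,
      map_one, Module.End.one_apply, opGen, he]
    rw [Finset.sum_ite_eq]
    simp
  | e_idem b =>
    simp only [map_mul, gen, FreeAlgebra.lift_ι_apply, Module.End.mul_apply, opGen, he]
    split_ifs <;> rfl
  | e_orth a b h =>
    simp only [map_mul, map_zero, gen, FreeAlgebra.lift_ι_apply, Module.End.mul_apply, opGen, he]
    split_ifs with h1 h2
    · exact absurd (h1.symm.trans h2) h
    · rfl
    · rfl
  | X_red i b h =>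
    simp only [map_mul, map_zero, gen, FreeAlgebra.lift_ι_apply, Module.End.mul_apply, opGen, he,
      opM_apply]
    by_cases hb : c.act ρ = b
    · subst hb; simp [h]
    · simp [hb]
  | X'_red i b h =>
    simp only [map_mul, map_zero, gen, FreeAlgebra.lift_ι_apply, Module.End.mul_apply, opGen, he,
      opM_apply]
    by_cases hb : c.act ρ = b
    · subst hb; simp [h]
    · simp [hb]
  | X_X' i b h =>
    simp only [map_mul, gen, FreeAlgebra.lift_ι_apply, Module.End.mul_apply, opGen, he, opM_apply]
    have : yv k ρ i ≠ 0 := rx_ne_zero (k := k) (ρ⁻¹ i)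
    split_ifs with h1 h2
    · subst h2; rw [h] at h1; cases h1
    · simp
    · rw [mul_inv_cancel_left₀ this]
    · simp
  | X'_X i b h =>
    simp only [map_mul, gen, FreeAlgebra.lift_ι_apply, Module.End.mul_apply, opGen, he, opM_apply]
    have : yv k ρ i ≠ 0 := rx_ne_zero (k := k) (ρ⁻¹ i)
    split_ifs with h1 h2
    · subst h2; rw [h] at h1; cases h1
    · simp
    · rw [inv_mul_cancel_left₀ this]
    · simp
  | X_e i b =>
    simp only [map_mul, gen, FreeAlgebra.lift_ι_apply, Module.End.mul_apply, opGen, opM_apply]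
    ring
  | X'_e i b =>
    simp only [map_mul, gen, FreeAlgebra.lift_ι_apply, Module.End.mul_apply, opGen, opM_apply]
    ring
  | X_comm i j =>
    simp only [map_mul, gen, FreeAlgebra.lift_ι_apply, Module.End.mul_apply, opGen, opM_apply]
    ring
  | X'_comm i j =>
    simp only [map_mul, gen, FreeAlgebra.lift_ι_apply, Module.End.mul_apply, opGen, opM_apply]
    ring
  | T_far r s h =>
    simp only [map_mul, gen, FreeAlgebra.lift_ι_apply, opGen]
    rw [opT_far q Q c h]
  | T_X_far r i h h' =>
    simp only [map_mul, gen, FreeAlgebra.lift_ι_apply, Module.End.mul_apply, opGen, opM_apply,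
      opT_apply, col_simple_mul, yv_simple_mul, simple_of_ne r h h']
    ring
  | T_red r b h h' =>
    simp only [map_mul, map_zero, gen, FreeAlgebra.lift_ι_apply]
    rw [← zero_mul (opGen q Q c (Gen.e b))]
    refine hsupp b _ _ fun F hF => ?_
    rw [opGen]
    by_cases hb : c.act ρ = b.act (simple r)
    · rw [act_simple_of_same (h.trans h'.symm)] at hb
      subst hb
      rw [opT_apply]
      simp [h, h', coefA, coefB]
    · rw [opT_supp q Q c r hF ρ hb]; rfl
  | T_e r b =>
    simp only [map_mul, gen, FreeAlgebra.lift_ι_apply, Module.End.mul_apply, opGen, opT_apply, he,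
      act_simple_mul_eq_iff]
    by_cases h : b.act (simple r) = b
    · rw [h]; split_ifs <;> simp
    · by_cases hb : c.act ρ = b
      · have hn : ¬ c.act ρ = b.act (simple r) := fun e => h (e.symm.trans hb)
        rw [if_pos hb, if_neg hn, if_neg hn, hb, coefA_act q r b _ _ _ h, mul_zero, add_zero]
      · by_cases hb' : c.act ρ = b.act (simple r)
        · rw [if_neg hb, if_pos hb', if_pos hb', mul_zero, coefA_act]
          rw [hb', act_simple_act_simple]
          exact fun e => h e.symm
        · simp [hb, hb']
  | T_X_hi r b h h' =>
    simp only [map_mul, map_sub, map_smul, gen, FreeAlgebra.lift_ι_apply]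
    rw [← smul_mul_assoc]
    refine hsupp b _ _ fun F hF => ?_
    by_cases hb : c.act ρ = b
    · subst hb
      simp only [LinearMap.sub_apply, LinearMap.smul_apply, Pi.sub_apply, Pi.smul_apply,
        Module.End.mul_apply, opGen, opT_apply, opM_apply, col_simple_mul, yv_simple_mul, simple_lo,
        simple_hi, h, h', coefA, coefB]
      have := yv_sub_ne_zero (k := k) ρ (lo_lt_hi r).ne'
      simp only [Bool.false_eq_true, if_false, and_self, if_true, Algebra.smul_def]
      field_simp
      ring
    · have hb' : c.act (simple r * ρ) ≠ b := by
        rwa [Ne, act_simple_mul_eq_iff, act_simple_of_same (h.trans h'.symm)]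
      simp [opGen, opT_apply, opM_apply, hF _ hb, hF _ hb']
  | T_X_lo r b h h' =>
    simp only [map_mul, map_sub, map_neg, map_smul, gen, FreeAlgebra.lift_ι_apply]
    rw [← smul_mul_assoc]
    refine (hsupp b _ (-((q - 1) • opGen q Q c (Gen.X (hi r)))) fun F hF => ?_).trans
      (by simp only [Module.End.mul_apply, LinearMap.neg_apply])
    by_cases hb : c.act ρ = b
    · subst hb
      simp only [LinearMap.sub_apply, LinearMap.neg_apply, LinearMap.smul_apply, Pi.sub_apply,
        Pi.neg_apply, Pi.smul_apply,
        Module.End.mul_apply, opGen, opT_apply, opM_apply, col_simple_mul, yv_simple_mul, simple_lo,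
        simple_hi, h, h', coefA, coefB]
      have := yv_sub_ne_zero (k := k) ρ (lo_lt_hi r).ne'
      simp only [Bool.false_eq_true, if_false, and_self, if_true, Algebra.smul_def]
      field_simp
      ring
    · have hb' : c.act (simple r * ρ) ≠ b := by
        rwa [Ne, act_simple_mul_eq_iff, act_simple_of_same (h.trans h'.symm)]
      simp [opGen, opT_apply, opM_apply, hF _ hb, hF _ hb']
  | T_X_hi_red r b h =>
    simp only [map_mul, map_sub, map_zero, gen, FreeAlgebra.lift_ι_apply]
    rw [← zero_mul (opGen q Q c (Gen.e b))]
    refine hsupp b _ _ fun F hF => ?_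
    simp only [LinearMap.sub_apply, Pi.sub_apply, Module.End.mul_apply, opGen, opT_apply, opM_apply,
      col_simple_mul, yv_simple_mul, simple_hi]
    by_cases hb : c.act ρ = b
    · subst hb
      have : coefA q ((c.act ρ).1 (lo r)) ((c.act ρ).1 (hi r)) (yv k ρ (lo r)) (yv k ρ (hi r)) = 0 := by
        rcases h with h | h <;> simp [coefA, h]
      rw [this]
      simp only [zero_mul, zero_add, LinearMap.zero_apply, Pi.zero_apply]
      ring
    · rw [hF _ hb]
      simp only [mul_zero, zero_add, LinearMap.zero_apply, Pi.zero_apply]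
      ring
  | T_X_lo_red r b h =>
    simp only [map_mul, map_sub, map_zero, gen, FreeAlgebra.lift_ι_apply]
    rw [← zero_mul (opGen q Q c (Gen.e b))]
    refine hsupp b _ _ fun F hF => ?_
    simp only [LinearMap.sub_apply, Pi.sub_apply, Module.End.mul_apply, opGen, opT_apply, opM_apply,
      col_simple_mul, yv_simple_mul, simple_lo]
    by_cases hb : c.act ρ = b
    · subst hb
      have : coefA q ((c.act ρ).1 (lo r)) ((c.act ρ).1 (hi r)) (yv k ρ (lo r)) (yv k ρ (hi r)) = 0 := by
        rcases h with h | h <;> simp [coefA, h]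
      rw [this]
      simp only [zero_mul, zero_add, LinearMap.zero_apply, Pi.zero_apply]
      ring
    · rw [hF _ hb]
      simp only [mul_zero, zero_add, LinearMap.zero_apply, Pi.zero_apply]
      ring
  | T_sq r b h h' =>
    simp only [map_mul, map_add, map_smul, gen, FreeAlgebra.lift_ι_apply]
    rw [← smul_mul_assoc, ← smul_one_mul q (opGen q Q c (Gen.e b)), ← add_mul]
    refine hsupp b _ _ fun F hF => ?_
    have h1 := opT_supp q Q c r hF
    rw [Module.End.mul_apply, opGen, opT_sq, LinearMap.add_apply, Pi.add_apply,
      LinearMap.smul_apply, LinearMap.smul_apply, Module.End.one_apply, Pi.smul_apply, Pi.smul_apply]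
    by_cases hb : c.act ρ = b
    · subst hb
      rw [h, h']
    · rw [act_simple_of_same (h.trans h'.symm)] at h1
      rw [h1 _ hb, hF _ hb]
      split <;> simp
  | T_sq_black_red r b m h h' =>
    simp only [map_mul, map_sub, map_smul, gen, FreeAlgebra.lift_ι_apply]
    rw [← smul_one_mul (Q m) (opGen q Q c (Gen.e b)), ← sub_mul]
    refine hsupp b _ _ fun F hF => ?_
    have h1 := opT_supp q Q c r (opT_supp q Q c r hF)
    rw [act_simple_act_simple] at h1
    rw [Module.End.mul_apply, opGen, opGen]
    by_cases hb : c.act ρ = b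
    · subst hb
      have h2 := colour_redPos (c.act ρ) m
      rw [h'] at h2
      rw [opT_sq, h, h2, ← h', redParam_redPos]
      simp only [LinearMap.sub_apply, Pi.sub_apply, opM_apply, LinearMap.smul_apply,
        Pi.smul_apply, Module.End.one_apply, h, Bool.false_eq_true, if_false]
      rw [Algebra.smul_def, sub_mul]
    · rw [h1 _ hb]
      simp [opM_apply, hF _ hb]
  | T_sq_red_black r b m h h' =>
    simp only [map_mul, map_sub, map_smul, gen, FreeAlgebra.lift_ι_apply]
    rw [← smul_one_mul (Q m) (opGen q Q c (Gen.e b)), ← sub_mul]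
    refine hsupp b _ _ fun F hF => ?_
    have h1 := opT_supp q Q c r (opT_supp q Q c r hF)
    rw [act_simple_act_simple] at h1
    rw [Module.End.mul_apply, opGen, opGen]
    by_cases hb : c.act ρ = b
    · subst hb
      have h2 := colour_redPos (c.act ρ) m
      rw [h] at h2
      rw [opT_sq, h2, h', ← h, redParam_redPos]
      simp only [LinearMap.sub_apply, Pi.sub_apply, opM_apply, LinearMap.smul_apply,
        Pi.smul_apply, Module.End.one_apply, h', Bool.false_eq_true, if_false]
      rw [Algebra.smul_def, sub_mul]
    · rw [h1 _ hb]
      simp [opM_apply, hF _ hb]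
  | braid r s hs b h =>
    simp only [map_mul, map_sub, map_zero, gen, FreeAlgebra.lift_ι_apply]
    rw [← zero_mul (opGen q Q c (Gen.e b))]
    refine hsupp b _ _ fun F hF => ?_
    simp only [LinearMap.sub_apply, Pi.sub_apply, Module.End.mul_apply, opGen]
    rw [opT_braid q Q c hs, LinearMap.zero_apply, Pi.zero_apply]
    split_ifs with hh
    · rw [hF ρ, mul_zero, smul_zero]
      rintro rfl
      rw [hh.2.1] at h
      cases h
    · rfl
  | braid_red r s hs b h h' h'' =>
    simp only [map_mul, map_sub, map_smul, gen, FreeAlgebra.lift_ι_apply]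
    rw [← smul_mul_assoc]
    refine hsupp b _ _ fun F hF => ?_
    simp only [LinearMap.sub_apply, Pi.sub_apply, Module.End.mul_apply, opGen]
    rw [opT_braid q Q c hs, LinearMap.smul_apply, Pi.smul_apply, opM_apply]
    by_cases hb : c.act ρ = b
    · subst hb
      rw [if_pos ⟨h, h', h''⟩, if_neg (by rw [h'']; simp)]
    · rw [hF _ hb]
      simp

/-- The generic representation. -/
noncomputable def rep : Hecke q Q d →ₐ[k] Module.End k (Perm (Fin (ℓ + d)) → RatK k (ℓ + d)) :=
  RingQuot.liftAlgHom k ⟨FreeAlgebra.lift k (opGen q Q c), fun _ _ h => opGen_rel q Q c h⟩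

theorem rep_heckeGen (g : Gen ℓ d) : rep q Q c (heckeGen q Q g) = opGen q Q c g := by
  unfold rep heckeGen
  exact (RingQuot.liftAlgHom_mkAlgHom_apply ..).trans (FreeAlgebra.lift_ι_apply _ _)

/-- The embedding of the exponents. -/
noncomputable def extExp {n : ℕ} (σ : Fin d → Fin n) (hσ : Function.Injective σ) :
    (Fin d → ℤ) →+ (Fin n → ℤ) where
  toFun a := Function.extend σ a 0
  map_zero' := by ext i; by_cases h : ∃ j, σ j = i <;> simp [Function.extend]
  map_add' a b := by rw [← Function.extend_add, add_zero]

/-- The value of a Laurent polynomial, at a point of the orbit. -/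
noncomputable def evalAt {n : ℕ} (σ : Fin d → Fin n) (hσ : Function.Injective σ) :
    Laurent k d →ₐ[k] RatK k n :=
  (IsScalarTower.toAlgHom k (Laurent k n) (RatK k n)).comp
    (AddMonoidAlgebra.mapDomainAlgHom k k (extExp σ hσ))

/-- At every point of the orbit distinct black strands carry distinct variables, so evaluation of a
Laurent polynomial there loses nothing. -/
theorem evalAt_injective {n : ℕ} (σ : Fin d → Fin n) (hσ : Function.Injective σ) :
    Function.Injective (evalAt (k := k) σ hσ) := by
  have h1 : Function.Injective (extExp σ hσ) := fun a b h => funext fun i => by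
    have := congrFun h (σ i)
    simpa [extExp, hσ.extend_apply] using this
  intro f g h
  exact AddMonoidAlgebra.mapDomain_injective h1 (IsFractionRing.injective (Laurent k n) (RatK k n) h)

theorem evalAt_xv {n : ℕ} (σ : Fin d → Fin n) (hσ : Function.Injective σ) (i : Fin d) :
    evalAt (k := k) σ hσ (xv k i) = rx k (σ i) := by
  have : extExp σ hσ (Pi.single i 1) = Pi.single (σ i) 1 := by
    ext j
    by_cases h : ∃ m, σ m = j
    · obtain ⟨m, rfl⟩ := h
      simp [extExp, hσ.extend_apply, Pi.single_apply, hσ.eq_iff]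
    · simp only [extExp, AddMonoidHom.coe_mk, ZeroHom.coe_mk]
      rw [Function.extend_apply' _ _ _ h, Pi.single_apply, if_neg fun e => h ⟨i, e.symm⟩]
      rfl
  simp [evalAt, xv, mon, rx, this]

theorem rep_phi (f : Laurent k d) (G : Perm (Fin (ℓ + d)) → RatK k (ℓ + d))
    (ρ : Perm (Fin (ℓ + d))) : rep q Q c (phi q Q f) G ρ =
      evalAt (fun i => ρ⁻¹ ((c.act ρ).blackPos i))
        (ρ⁻¹.injective.comp (c.act ρ).blackPos_strictMono.injective) f * G ρ := by
  have hx : ∀ i (G : Perm (Fin (ℓ + d)) → RatK k (ℓ + d)), rep q Q c (phi q Q (xv k i)) G ρ =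
      evalAt (fun i => ρ⁻¹ ((c.act ρ).blackPos i))
        (ρ⁻¹.injective.comp (c.act ρ).blackPos_strictMono.injective) (xv k i) * G ρ := by
    intro i G
    rw [phi_xv, evalAt_xv, xElt, map_sum, LinearMap.sum_apply, Finset.sum_apply,
      Finset.sum_eq_single (c.act ρ)]
    · rw [map_mul, rep_heckeGen, rep_heckeGen]
      simp [opGen, opM_apply, colour_blackPos, yv]
    · intro b _ hb
      rw [map_mul, rep_heckeGen, rep_heckeGen]
      simp [opGen, opM_apply, hb.symm]
    · simp
  induction f using laurent_induction generalizing G with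
  | hadd f g hf hg =>
    rw [map_add, map_add, map_add, LinearMap.add_apply, Pi.add_apply, hf, hg, add_mul]
  | hsmul t f hf =>
    rw [map_smul, map_smul, map_smul, LinearMap.smul_apply, Pi.smul_apply, hf, smul_mul_assoc]
  | hmul f g hf hg =>
    rw [map_mul, map_mul, map_mul, Module.End.mul_apply, hf, hg, mul_assoc]
  | hone => simp
  | hx i => exact hx i G
  | hx' i =>
    have h1 := hx i (rep q Q c (phi q Q (xvInv k i)) G)
    rw [← Module.End.mul_apply, ← map_mul, ← map_mul, xv_mul_xvInv, map_one, map_one,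
      Module.End.one_apply] at h1
    rw [h1, ← mul_assoc, ← map_mul, mul_comm (xvInv k i), xv_mul_xvInv, map_one, one_mul]

end Representation

/-! ### The basis theorem for the higher level affine Hecke algebra -/

section PBW

variable {k : Type*} [Field k] {ℓ d : ℕ} {q : k} {Q : Fin ℓ → k}

local notation "𝐞" c:max => heckeGen q Q (Gen.e c)
local notation "𝐓" r:max => heckeGen q Q (Gen.T r)

theorem rx_sub_const_ne_zero {n : ℕ} (i : Fin n) (t : k) :
    rx k i - algebraMap k (RatK k n) t ≠ 0 := by
  have e : rx k i - algebraMap k (RatK k n) t =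
      algebraMap (Laurent k n) (RatK k n) (xv k i - t • mon k 0) := by
    rw [map_sub, rx, mon_zero, ← Algebra.algebraMap_eq_smul_one]
    congr 1
  rw [e]
  refine (map_ne_zero_iff _ (IsFractionRing.injective (Laurent k n) _)).mpr fun h0 => ?_
  have := congrArg (fun f : Laurent k n => f.coeff (Pi.single i 1)) h0
  have hne : (0 : Fin n → ℤ) ≠ Pi.single i 1 := fun e => by
    have := congrFun e i
    simp at this
  simp [xv, mon, hne] at this

theorem RedMono.of_simple_mul {c : ColourSeq ℓ d} {ρ : Perm (Fin (ℓ + d))}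
    {r : Fin (ℓ + d - 1)} (h : RedMono c (simple r * ρ))
    (hl : len (simple r * ρ) = len ρ + 1) : RedMono c ρ := by
  intro m m' hm
  by_contra hc
  have h1 := lt_of_le_of_ne (not_lt.mp hc)
    fun e => hm.ne (c.redPos_strictMono.injective (ρ.injective e.symm))
  by_cases h2 : ρ (c.redPos m') = lo r ∧ ρ (c.redPos m) = hi r
  · have h3 := len_simple_mul_of_gt ρ r (by
      rw [← h2.1, ← h2.2, perm_inv_apply, perm_inv_apply]; exact c.redPos_strictMono hm)
    omega
  · exact absurd (h m m' hm) (not_lt.mpr (simple_lt r h1 h2).le)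

theorem not_red_of_redMono {c : ColourSeq ℓ d} {ρ : Perm (Fin (ℓ + d))}
    {r : Fin (ℓ + d - 1)} (h : RedMono c (simple r * ρ))
    (hl : len (simple r * ρ) = len ρ + 1) :
    ¬ ((c.act ρ).1 (lo r) = true ∧ (c.act ρ).1 (hi r) = true) := by
  rintro ⟨h0, h1⟩
  have h2 : ρ⁻¹ (lo r) < ρ⁻¹ (hi r) := by
    by_contra hc
    have := len_simple_mul_of_gt ρ r (lt_of_le_of_ne (not_lt.mp hc)
      fun e => (lo_lt_hi r).ne (ρ⁻¹.injective e.symm))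
    omega
  obtain ⟨m, hm⟩ := exists_redPos (c := c) (p := ρ⁻¹ (lo r)) h0
  obtain ⟨m', hm'⟩ := exists_redPos (c := c) (p := ρ⁻¹ (hi r)) h1
  rw [← hm, ← hm'] at h2
  have := h m m' (c.redPos_strictMono.lt_iff_lt.mp h2)
  rw [hm, hm', Perm.mul_apply, Perm.mul_apply, perm_apply_inv, perm_apply_inv, simple_lo,
    simple_hi] at this
  exact absurd this (not_lt.mpr (lo_lt_hi r).le)

theorem len_prod_mul_le {n : ℕ} (L : List (Fin (n - 1))) (ρ : Perm (Fin n)) :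
    len ((L.map simple).prod * ρ) ≤ L.length + len ρ := by
  induction L with
  | nil => simp
  | cons s L ih =>
    have := len_simple_mul_le ((L.map simple).prod * ρ) s
    rw [List.map_cons, List.prod_cons, mul_assoc, List.length_cons]
    omega

theorem RedMono.of_prod_mul {c : ColourSeq ℓ d} {L : List (Fin (ℓ + d - 1))}
    {ρ : Perm (Fin (ℓ + d))} (h : RedMono c ((L.map simple).prod * ρ))
    (hl : len ((L.map simple).prod * ρ) = L.length + len ρ) : RedMono c ρ := by
  induction L with
  | nil => simpa using h
  | cons r L ih =>
    have h1 := len_simple_mul_le ((L.map simple).prod * ρ) r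
    rw [List.map_cons, List.prod_cons, mul_assoc] at h hl
    have h2 := len_prod_mul_le L ρ
    rw [List.length_cons] at hl
    exact ih (h.of_simple_mul (by omega)) (by omega)

/-- Between the two parts of a reduced diagram without red-red crossings there is a well-defined
colour sequence: a crossing of two red strands in the lower part could not be undone without losing
length. -/
theorem exists_strandPerm_of_append {b c : ColourSeq ℓ d} {w : Perm (Fin d)}
    {A B : List (Fin (ℓ + d - 1))} (h : IsReducedWord (strandPerm b c w) (A ++ B)) :
    ∃ a v u, (A.map simple).prod = strandPerm b a v ∧ (B.map simple).prod = strandPerm a c u ∧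
      w = v * u := by
  have e : strandPerm b c w = (A.map simple).prod * (B.map simple).prod := by
    rw [← h.1, List.map_append, List.prod_append]
  have h1 : RedMono c (B.map simple).prod := by
    refine RedMono.of_prod_mul (L := A) ?_ ?_
    · rw [← e]; exact redMono_strandPerm b c w
    · rw [← e, ← h.2, List.length_append, h.of_append.2.2]
  obtain ⟨u, hu⟩ := h1.exists_strandPerm
  refine ⟨_, w * u⁻¹, u, ?_, hu, by rw [inv_mul_cancel_right]⟩
  rw [← strandPerm_mul b c _ w, ← strandPerm_inv, ← hu, e, mul_inv_cancel_right]

theorem e_mul_tw_phi_tw_mul_e {b c : ColourSeq ℓ d} {w : Perm (Fin d)}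
    {A B : List (Fin (ℓ + d - 1))} (h : IsReducedWord (strandPerm b c w) (A ++ B))
    (f : Laurent k d) : 𝐞 b * (tw q Q A * phi q Q f * tw q Q B * 𝐞 c) =
      tw q Q A * phi q Q f * tw q Q B * 𝐞 c := by
  obtain ⟨a, v, u, hA, hB, -⟩ := exists_strandPerm_of_append h
  have h1 : 𝐞 b * (tw q Q A * 𝐞 a) = tw q Q A * 𝐞 a := by
    rw [tw_mul_e, hA, act_strandPerm, ← mul_assoc, e_mul_e]
  have h2 : tw q Q A * phi q Q f * tw q Q B * 𝐞 c =
      tw q Q A * 𝐞 a * phi q Q f * tw q Q B := by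
    rw [mul_assoc, tw_mul_e, hB, act_strandPerm, ← mul_assoc, mul_assoc _ (phi q Q f), phi_mul_e]
    simp only [mul_assoc]
  have h3 : 𝐞 b * (tw q Q A * 𝐞 a * phi q Q f * tw q Q B) =
      𝐞 b * (tw q Q A * 𝐞 a) * phi q Q f * tw q Q B := by simp only [mul_assoc]
  rw [h2, h3, h1]

/-- The function `G` is supported at `π` and at elements that are shorter than `π`, and does
not vanish at `π`. -/
def Leads (G : Perm (Fin (ℓ + d)) → RatK k (ℓ + d)) (π : Perm (Fin (ℓ + d))) : Prop :=
  G π ≠ 0 ∧ ∀ ρ, G ρ ≠ 0 → ρ = π ∨ len ρ < len π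

/-- The diagonal term stays on the old support, while the other one carries the leading point π to
s_r π. Its coefficient there is nonzero because the variables are generic and the pair is not
red-red. -/
theorem Leads.opT {c : ColourSeq ℓ d} {G : Perm (Fin (ℓ + d)) → RatK k (ℓ + d)}
    {π : Perm (Fin (ℓ + d))} (h : Leads G π) {r : Fin (ℓ + d - 1)}
    (hl : len (simple r * π) = len π + 1)
    (hr : ¬ ((c.act π).1 (lo r) = true ∧ (c.act π).1 (hi r) = true)) :
    Leads (opT q Q c r G) (simple r * π) := by
  have hG : G (simple r * π) = 0 := by
    by_contra h0
    rcases h.2 _ h0 with h1 | h1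
    · rw [h1] at hl; omega
    · omega
  constructor
  · rw [opT_apply, hG, mul_zero, zero_add, simple_mul_simple_mul]
    refine mul_ne_zero ?_ h.1
    simp only [col_simple_mul, simple_lo, simple_hi]
    have hne : (simple r * π)⁻¹ (lo r) ≠ (simple r * π)⁻¹ (hi r) := fun e =>
      (lo_lt_hi r).ne ((simple r * π)⁻¹.injective e)
    cases h0 : (c.act π).1 (lo r) <;> cases h1 : (c.act π).1 (hi r)
    · exact div_ne_zero (neg_ne_zero.mpr (smul_rx_sub_ne_zero hne.symm q)) (rx_sub_ne_zero hne.symm)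
    · exact rx_sub_const_ne_zero _ _
    · simp [coefB]
    · exact absurd ⟨h0, h1⟩ hr
  · intro ρ hρ
    rw [opT_apply] at hρ
    by_cases h1 : G ρ = 0
    · rw [h1, mul_zero, zero_add] at hρ
      have h2 := right_ne_zero_of_mul hρ
      rcases h.2 _ h2 with h3 | h3
      · left; rw [← h3, simple_mul_simple_mul]
      · right
        have := len_simple_mul_le (simple r * ρ) r
        rw [simple_mul_simple_mul] at this
        omega
    · right
      rcases h.2 _ h1 with rfl | h3 <;> omega

theorem Leads.phi {c : ColourSeq ℓ d} {G : Perm (Fin (ℓ + d)) → RatK k (ℓ + d)}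
    {π : Perm (Fin (ℓ + d))} (h : Leads G π) {f : Laurent k d} (hf : f ≠ 0) :
    Leads (rep q Q c (phi q Q f) G) π := by
  constructor
  · rw [rep_phi]
    exact mul_ne_zero ((map_ne_zero_iff _ (evalAt_injective _ _)).mpr hf) h.1
  · intro ρ hρ
    rw [rep_phi] at hρ
    exact h.2 ρ (right_ne_zero_of_mul hρ)

theorem Leads.tw {c : ColourSeq ℓ d} {G : Perm (Fin (ℓ + d)) → RatK k (ℓ + d)}
    {π : Perm (Fin (ℓ + d))} (h : Leads G π) {L : List (Fin (ℓ + d - 1))}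
    (hl : len ((L.map simple).prod * π) = L.length + len π)
    (hr : RedMono c ((L.map simple).prod * π)) :
    Leads (rep q Q c (tw q Q L) G) ((L.map simple).prod * π) := by
  induction L with
  | nil => simpa [tw_nil] using h
  | cons r L ih =>
    have h1 := len_simple_mul_le ((L.map simple).prod * π) r
    have h2 := len_prod_mul_le L π
    rw [List.map_cons, List.prod_cons, mul_assoc] at hr hl ⊢
    rw [List.length_cons] at hl
    have h3 : len (simple r * ((L.map simple).prod * π)) = len ((L.map simple).prod * π) + 1 := by
      omega
    rw [tw_cons, map_mul, Module.End.mul_apply, rep_heckeGen]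
    exact (ih (by omega) (hr.of_simple_mul h3)).opT h3 (not_red_of_redMono hr h3)

/-- The basis theorem: linear independence. -/
theorem pbw_unique {b c : ColourSeq ℓ d} {A B : Perm (Fin d) → List (Fin (ℓ + d - 1))}
    (hAB : ∀ w, IsReducedWord (strandPerm b c w) (A w ++ B w)) {f : Perm (Fin d) → Laurent k d}
    (h : ∑ w, tw q Q (A w) * phi q Q (f w) * tw q Q (B w) * 𝐞 c = 0) : f = 0 := by
  classical
  by_contra hf
  obtain ⟨w₁, hw₁⟩ : ∃ w, f w ≠ 0 := by
    by_contra h0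
    push Not at h0
    exact hf (funext h0)
  -- Among the nonzero coefficients one with the longest diagram is chosen. At its permutation the
  -- contributions of all the other terms vanish.
  obtain ⟨w, hw, hmax⟩ := Finset.exists_max_image (Finset.univ.filter fun w => f w ≠ 0)
    (fun w => len (strandPerm b c w)) ⟨w₁, by simp [hw₁]⟩
  have hw := (Finset.mem_filter.mp hw).2
  -- The delta function at the identity, a point with colours c. The product of the letters moves
  -- its support to `strandPerm b c v`, and the polynomial in between contributes a nonzero factor.
  set δ : Perm (Fin (ℓ + d)) → RatK k (ℓ + d) := Pi.single 1 1 with hδ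
  have hlead : ∀ v, f v ≠ 0 →
      Leads (rep q Q c (tw q Q (A v) * phi q Q (f v) * tw q Q (B v) * 𝐞 c) δ)
        (strandPerm b c v) := by
    intro v hv
    have h1 : rep q Q c (𝐞 c) δ = δ := by
      rw [rep_heckeGen]
      funext ρ
      simp only [opGen, opM_apply, hδ, Pi.single_apply]
      split_ifs with h2 h3 <;> simp_all [act_one]
    have h2 : Leads δ 1 := ⟨by simp [hδ], fun ρ hρ => Or.inl (by
      by_contra h3
      exact hρ (by simp [hδ, h3]))⟩
    rw [map_mul, map_mul, map_mul, Module.End.mul_apply, Module.End.mul_apply,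
      Module.End.mul_apply, h1]
    have h3 := hAB v
    have h4 := h3.of_append
    have hpr : strandPerm b c v = ((A v).map simple).prod * ((B v).map simple).prod := by
      rw [← h3.1, List.map_append, List.prod_append]
    have hB : RedMono c ((B v).map simple).prod := by
      obtain ⟨a, _, u, -, hB, -⟩ := exists_strandPerm_of_append h3
      rw [hB]
      exact redMono_strandPerm a c u
    have h5 := (h2.tw (q := q) (Q := Q) (c := c) (L := B v) (by
      rw [mul_one, len_one, add_zero]; exact h4.2.2.symm) (by rwa [mul_one]))
    rw [mul_one] at h5
    rw [hpr]
    refine (h5.phi hv).tw ?_ ?_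
    · rw [← hpr, ← h3.2, List.length_append, h4.2.2]
    · rw [← hpr]; exact redMono_strandPerm b c v
  have h0 := congrFun (LinearMap.congr_fun (congrArg (rep q Q c) h) δ) (strandPerm b c w)
  rw [map_sum, LinearMap.sum_apply, Finset.sum_apply, Finset.sum_eq_single w] at h0
  · exact (hlead w hw).1 (by rw [h0, map_zero]; rfl)
  · intro v _ hv
    by_contra h1
    have hfv : f v ≠ 0 := fun e => h1 (by rw [e]; simp)
    rcases (hlead v hfv).2 _ h1 with h2 | h2
    · exact hv (strandPerm_injective b c h2).symm
    · exact absurd (hmax v (by simp [hfv])) (not_le.mpr h2)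
  · simp

theorem tw_mul_e_eq_zero_or {L : List (Fin (ℓ + d - 1))} {c : ColourSeq ℓ d} :
    tw q Q L * 𝐞 c = 0 ∨ ∃ b w, (L.map simple).prod = strandPerm b c w := by
  by_cases h : tw q Q L * 𝐞 c = 0
  · exact Or.inl h
  · obtain ⟨w, hw⟩ := exists_strandPerm_of_tw_ne_zero q Q h
    exact Or.inr ⟨_, w, hw⟩

theorem exists_tw_mul_phi_sub_mem_flt (L : List (Fin (ℓ + d - 1))) (c : ColourSeq ℓ d)
    (f : Laurent k d) :
    ∃ g, tw q Q L * phi q Q f * 𝐞 c - phi q Q g * tw q Q L * 𝐞 c ∈ flt q Q L.length := by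
  rcases tw_mul_e_eq_zero_or (q := q) (Q := Q) (L := L) (c := c) with h | ⟨b, w, h⟩
  · refine ⟨0, ?_⟩
    rw [mul_assoc, phi_mul_e, ← mul_assoc, h, map_zero]
    simp
  · refine ⟨permAut w f, ?_⟩
    have := phi_mul_tw_sub_mem_flt (q := q) (Q := Q) h (permAut w f)
    rw [← permAut_mul, inv_mul_cancel, permAut_one] at this
    rw [← neg_sub]
    exact neg_mem this

/-- The basis theorem: the elements of `e(b) H e(c)` with few crossings. -/
theorem exists_pbw {b c : ColourSeq ℓ d} {A B : Perm (Fin d) → List (Fin (ℓ + d - 1))}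
    (hAB : ∀ w, IsReducedWord (strandPerm b c w) (A w ++ B w)) {N : ℕ} {h : Hecke q Q d}
    (hh : h ∈ flt q Q N) : ∃ f : Perm (Fin d) → Laurent k d,
      𝐞 b * h * 𝐞 c = ∑ w, tw q Q (A w) * phi q Q (f w) * tw q Q (B w) * 𝐞 c ∧
        ∀ w, N ≤ len (strandPerm b c w) → f w = 0 := by
  have hadd : ∀ (N : ℕ) (x y : Hecke q Q d), (∃ f : Perm (Fin d) → Laurent k d,
      𝐞 b * x * 𝐞 c = ∑ w, tw q Q (A w) * phi q Q (f w) * tw q Q (B w) * 𝐞 c ∧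
        ∀ w, N ≤ len (strandPerm b c w) → f w = 0) → (∃ f : Perm (Fin d) → Laurent k d,
      𝐞 b * y * 𝐞 c = ∑ w, tw q Q (A w) * phi q Q (f w) * tw q Q (B w) * 𝐞 c ∧
        ∀ w, N ≤ len (strandPerm b c w) → f w = 0) → (∃ f : Perm (Fin d) → Laurent k d,
      𝐞 b * (x + y) * 𝐞 c = ∑ w, tw q Q (A w) * phi q Q (f w) * tw q Q (B w) * 𝐞 c ∧
        ∀ w, N ≤ len (strandPerm b c w) → f w = 0) := by
    rintro N x y ⟨f, hf, hf'⟩ ⟨g, hg, hg'⟩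
    refine ⟨f + g, ?_, fun w hw => by rw [Pi.add_apply, hf' w hw, hg' w hw, add_zero]⟩
    rw [mul_add, add_mul, hf, hg, ← Finset.sum_add_distrib]
    refine Finset.sum_congr rfl fun w _ => ?_
    rw [Pi.add_apply, map_add, mul_add, add_mul, add_mul]
  induction N generalizing h with
  | zero =>
    refine ⟨0, ?_, fun _ _ => rfl⟩
    have : h = 0 := by
      induction hh using flt_induction with
      | hp L f c hL => exact absurd hL (Nat.not_lt_zero _)
      | h0 => rfl
      | hadd x y _ _ hx hy => rw [hx, hy, add_zero]
      | hsmul t x _ hx => rw [hx, smul_zero]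
    rw [this]
    simp
  | succ N ih =>
    have hlow : ∀ x : Hecke q Q d, x ∈ flt q Q N → ∃ f : Perm (Fin d) → Laurent k d,
        𝐞 b * x * 𝐞 c = ∑ w, tw q Q (A w) * phi q Q (f w) * tw q Q (B w) * 𝐞 c ∧
        ∀ w, N + 1 ≤ len (strandPerm b c w) → f w = 0 := fun x hx => by
      obtain ⟨f, hf, hf'⟩ := ih hx
      exact ⟨f, hf, fun w hw => hf' w (by omega)⟩
    induction hh using flt_induction with
    | h0 => exact ⟨0, by simp, fun _ _ => rfl⟩
    | hadd x y _ _ hx hy => exact hadd _ _ _ hx hy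
    | hsmul t x _ hx =>
      obtain ⟨f, hf, hf'⟩ := hx
      refine ⟨t • f, ?_, fun w hw => by rw [Pi.smul_apply, hf' w hw, smul_zero]⟩
      rw [mul_smul_comm, smul_mul_assoc, hf, Finset.smul_sum]
      refine Finset.sum_congr rfl fun w _ => ?_
      rw [Pi.smul_apply, map_smul, mul_smul_comm, smul_mul_assoc, smul_mul_assoc]
    | hp L f c' hL =>
      rcases Nat.lt_succ_iff_lt_or_eq.mp hL with hL | hL
      · exact hlow _ (mem_flt hL f c')
      by_cases hred : IsReducedWord (L.map simple).prod L
      swap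
      · have := tw_mem_flt_of_not_reduced (q := q) (Q := Q) hred
        rw [hL] at this
        exact hlow _ (flt_mul_e (flt_mul_phi this f) c')
      by_cases hc : c' = c
      swap
      · refine ⟨0, ?_, fun _ _ => rfl⟩
        rw [mul_assoc, mul_assoc (tw q Q L * phi q Q f), e_mul_e_of_ne _ _ hc]
        simp
      subst hc
      rcases tw_mul_e_eq_zero_or (q := q) (Q := Q) (L := L) (c := c') with h0 | ⟨b', w, hw⟩
      · refine ⟨0, ?_, fun _ _ => rfl⟩
        rw [mul_assoc (tw q Q L), phi_mul_e, ← mul_assoc (tw q Q L), h0]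
        simp
      by_cases hb : b' = b
      swap
      · refine ⟨0, ?_, fun _ _ => rfl⟩
        rw [mul_assoc (tw q Q L), phi_mul_e, ← mul_assoc (tw q Q L), tw_mul_e, hw, act_strandPerm,
          mul_assoc (𝐞 b'), ← mul_assoc (𝐞 b), e_mul_e_of_ne _ _ (Ne.symm hb)]
        simp
      subst hb
      rw [hw] at hred
      have h1 := tw_sub_tw_mem_flt (q := q) (Q := Q) hred (hAB w)
      obtain ⟨g, hg⟩ := exists_tw_mul_phi_sub_mem_flt (q := q) (Q := Q) (B w) c' f
      have h2 := hAB w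
      have h3 := h2.2
      have h4 := hred.2
      rw [List.length_append] at h3
      -- The word L is replaced by the prescribed word, and the polynomial is moved to the left of
      -- its second part. Both corrections have fewer crossings; the last term is of the required
      -- form.
      have e : tw q Q L * phi q Q f * 𝐞 c' =
          (tw q Q L - tw q Q (A w ++ B w)) * phi q Q f * 𝐞 c' +
          tw q Q (A w) * (tw q Q (B w) * phi q Q f * 𝐞 c' - phi q Q g * tw q Q (B w) * 𝐞 c') +
          tw q Q (A w) * phi q Q g * tw q Q (B w) * 𝐞 c' := by
        rw [tw_append]
        simp only [sub_mul, mul_sub, mul_assoc]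
        abel
      rw [e]
      refine hadd _ _ _ (hadd _ _ _ (hlow _ ?_) (hlow _ ?_)) ?_
      · rw [← hL, h4]
        exact flt_mul_e (flt_mul_phi h1 f) c'
      · refine flt_mono ?_ (tw_mul_flt hg (A w))
        omega
      · classical
        refine ⟨Pi.single w g, ?_, fun v hv => ?_⟩
        · rw [Finset.sum_eq_single w]
          · rw [Pi.single_eq_same, e_mul_tw_phi_tw_mul_e (hAB w), mul_assoc _ (𝐞 c'), e_mul_e]
          · intro v _ hv
            rw [Pi.single_eq_of_ne hv]
            simp
          · simp
        · rw [Pi.single_eq_of_ne]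
          rintro rfl
          omega

/-- The spanning statement with its length bound gives an expansion without the long permutations,
and by independence it is the given one. -/
theorem pbw_eq_zero_of_mem_flt {b c : ColourSeq ℓ d}
    {A B : Perm (Fin d) → List (Fin (ℓ + d - 1))}
    (hAB : ∀ w, IsReducedWord (strandPerm b c w) (A w ++ B w)) {f : Perm (Fin d) → Laurent k d}
    {N : ℕ} (h : ∑ w, tw q Q (A w) * phi q Q (f w) * tw q Q (B w) * 𝐞 c ∈ flt q Q N) :
    ∀ w, N ≤ len (strandPerm b c w) → f w = 0 := by
  obtain ⟨g, hg, hg'⟩ := exists_pbw hAB h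
  have e : 𝐞 b * (∑ w, tw q Q (A w) * phi q Q (f w) * tw q Q (B w) * 𝐞 c) * 𝐞 c =
      ∑ w, tw q Q (A w) * phi q Q (f w) * tw q Q (B w) * 𝐞 c := by
    rw [Finset.mul_sum, Finset.sum_mul]
    refine Finset.sum_congr rfl fun w _ => ?_
    rw [e_mul_tw_phi_tw_mul_e (hAB w), mul_assoc, e_mul_e]
  rw [e, ← sub_eq_zero, ← Finset.sum_sub_distrib] at hg
  have := pbw_unique (q := q) (Q := Q) (f := f - g) hAB (by
    rw [← hg]
    refine Finset.sum_congr rfl fun w _ => ?_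
    rw [Pi.sub_apply, map_sub, mul_sub, sub_mul, sub_mul])
  rw [sub_eq_zero] at this
  rw [this]
  exact hg'

end PBW

/-! ### Families of elements that multiply as in a finite Hecke algebra -/

section HeckeFamilies

variable {k : Type*} [Field k] {R : Type*} [Ring R] [Algebra k R] {d : ℕ} {α β : Type*}

/-- The elements `τ z`, for `z` that preserve the fibres of `g`, multiply as the standard basis
elements of a finite Hecke algebra. -/
structure HeckeFam (q : k) (g : Fin d → α) (τ : Perm (Fin d) → R) : Prop where
  one_mul : ∀ z ∈ fibreSubgroup g, τ 1 * τ z = τ z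
  mul_one : ∀ z ∈ fibreSubgroup g, τ z * τ 1 = τ z
  mul_simple : ∀ z ∈ fibreSubgroup g, ∀ r, simple r ∈ fibreSubgroup g → z (lo r) < z (hi r) →
    τ z * τ (simple r) = τ (z * simple r)
  sq : ∀ r, simple r ∈ fibreSubgroup g →
    τ (simple r) * τ (simple r) = (q - 1) • τ (simple r) + q • τ 1

variable {q : k} {g : Fin d → α} {τ : Perm (Fin d) → R}

/-- The right factor is built up letter by letter; as the lengths add, each letter is an ascent on
both sides. -/
theorem HeckeFam.mul (hτ : HeckeFam q g τ) (hg : IntervalFibres g) {z u : Perm (Fin d)}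
    (hz : z ∈ fibreSubgroup g) (hu : u ∈ fibreSubgroup g) (h : len (z * u) = len z + len u) :
    τ z * τ u = τ (z * u) := by
  obtain ⟨m, hm⟩ : ∃ m, len u = m := ⟨_, rfl⟩
  induction m generalizing u with
  | zero => rw [eq_one_of_len u hm, hτ.mul_one z hz, _root_.mul_one]
  | succ m ih =>
    obtain ⟨r, hr⟩ : ∃ r, u (hi r) < u (lo r) := by
      by_contra hc
      push Not at hc
      rw [eq_one_of_no_descent u fun r => not_lt.mpr (hc r), len_one] at hm
      omega
    have hs := simple_mem_of_descent hg hu hr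
    have h1 := len_mul_simple u r hr
    have h2 := mul_mem hu hs
    have h3 := len_mul_simple_le (z * (u * simple r)) r
    rw [mul_assoc z, mul_simple_mul_simple] at h3
    have h4 : len (z * (u * simple r)) ≤ len z + len (u * simple r) := by
      obtain ⟨L, hL⟩ := exists_isReducedWord z
      have := len_prod_mul_le L (u * simple r)
      rwa [hL.1, hL.2] at this
    have h5 := ih h2 (by omega) (by omega)
    have h6 : τ (u * simple r) * τ (simple r) = τ u := by
      rw [hτ.mul_simple _ h2 r hs, mul_simple_mul_simple]
      simpa [simple_lo, simple_hi] using hr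
    rw [← h6, ← mul_assoc, h5, hτ.mul_simple _ (mul_mem hz h2) r hs, mul_assoc z,
      mul_simple_mul_simple]
    refine lt_of_len_mul_simple _ _ ?_
    rw [mul_assoc z, mul_simple_mul_simple]
    omega

theorem HeckeFam.mul_simple_of_gt (hτ : HeckeFam q g τ) {z : Perm (Fin d)}
    (hz : z ∈ fibreSubgroup g) {r : Fin (d - 1)} (hs : simple r ∈ fibreSubgroup g)
    (h : z (hi r) < z (lo r)) : τ z * τ (simple r) = (q - 1) • τ z + q • τ (z * simple r) := by
  have h1 : τ (z * simple r) * τ (simple r) = τ z := by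
    rw [hτ.mul_simple _ (mul_mem hz hs) r hs, mul_simple_mul_simple]
    simpa [simple_lo, simple_hi] using h
  rw [← h1, mul_assoc, hτ.sq r hs, mul_add, mul_smul_comm, mul_smul_comm,
    hτ.mul_one _ (mul_mem hz hs)]

/-- For a shortest coset representative `u` and a simple transposition `s`, either `u s` is a
shortest representative, or it is equal to `t u` for a simple transposition `t`. -/
theorem monoFib_mul_simple_or {f : Fin d → β} (hf : IntervalFibres f) {u : Perm (Fin d)}
    (hu : MonoFib f u⁻¹) (r : Fin (d - 1)) :
    MonoFib f (u * simple r)⁻¹ ∨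
      u (lo r) < u (hi r) ∧ ∃ t, simple t ∈ fibreSubgroup f ∧ u * simple r = simple t * u := by
  by_cases h : MonoFib f (u * simple r)⁻¹
  · exact Or.inl h
  right
  unfold MonoFib at h
  push Not at h
  obtain ⟨i, j, hij, e, h1⟩ := h
  rw [mul_inv_rev, simple_inv, Perm.mul_apply, Perm.mul_apply] at h1
  have h2 := hu i j hij e
  have h3 : u⁻¹ i = lo r ∧ u⁻¹ j = hi r := by
    by_contra hc
    exact absurd (simple_lt r h2 hc) (not_lt.mpr h1)
  have hi' : i = u (lo r) := by rw [← h3.1, perm_apply_inv]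
  have hj' : j = u (hi r) := by rw [← h3.2, perm_apply_inv]
  -- A value strictly between i and j would lie in the same fibre of f, and u⁻¹ would place it
  -- strictly between the neighbours r and r + 1.
  have hadj : (j : ℕ) = i + 1 := by
    by_contra hne
    have hlt : (i : ℕ) + 1 < j := by
      have : (i : ℕ) < j := hij
      omega
    set m : Fin d := ⟨i + 1, hlt.trans j.2⟩ with hm
    have him : i < m := by simp [hm, Fin.lt_def]
    have hmj : m < j := by simp [hm, Fin.lt_def, hlt]
    have e1 := hf i m j him.le hmj.le e
    have h4 := hu i m him e1.symm
    have h5 := hu m j hmj (e1.trans e)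
    rw [h3.1] at h4
    rw [h3.2] at h5
    simp only [lo, hi, Fin.lt_def] at h4 h5
    omega
  refine ⟨by rw [← hi', ← hj']; exact hij, ⟨i, by omega⟩, ?_, ?_⟩
  · rw [simple_mem_fibreSubgroup]
    have e1 : lo (⟨i, by omega⟩ : Fin (d - 1)) = i := rfl
    have e2 : hi (⟨i, by omega⟩ : Fin (d - 1)) = j := Fin.ext hadj.symm
    rw [e1, e2, e]
  · have e1 : lo (⟨i, by omega⟩ : Fin (d - 1)) = i := rfl
    have e2 : hi (⟨i, by omega⟩ : Fin (d - 1)) = j := Fin.ext hadj.symm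
    rw [simple, simple, e1, e2, mul_swap_eq_swap_mul, ← hi', ← hj']

open Classical in
/-- The shortest representatives `u` of the cosets `S_f u` in `S_g`. -/
noncomputable def minReps (f : Fin d → β) (g : Fin d → α) : Finset (Perm (Fin d)) :=
  Finset.univ.filter fun u => u ∈ fibreSubgroup g ∧ MonoFib f u⁻¹

theorem mem_minReps {f : Fin d → β} {g : Fin d → α} {u : Perm (Fin d)} :
    u ∈ minReps f g ↔ u ∈ fibreSubgroup g ∧ MonoFib f u⁻¹ := by
  classical
  exact ⟨fun h => (Finset.mem_filter.mp h).2, fun h => Finset.mem_filter.mpr ⟨Finset.mem_univ _, h⟩⟩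

theorem one_mem_minReps (f : Fin d → β) (g : Fin d → α) : 1 ∈ minReps f g :=
  mem_minReps.mpr ⟨one_mem _, fun _ _ h _ => by simpa using h⟩

open Classical in
/-- The coefficients of `(∑ n_u τ_u) τ_s`. -/
noncomputable def actCoef (q : k) (f : Fin d → β) (τ : Perm (Fin d) → R) (r : Fin (d - 1))
    (n : Perm (Fin d) → R) (u : Perm (Fin d)) : R :=
  if MonoFib f (u * simple r)⁻¹ then
    if u (lo r) < u (hi r) then q • n (u * simple r) else n (u * simple r) + (q - 1) • n u
  else n u * τ (u * simple r * u⁻¹)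

/-- If u s is again a shortest representative, then u and u s form a pair, on which τ_s acts by the
quadratic relation. Otherwise u s = t u with a simple t in S_f, and t joins the coefficient. -/
theorem sum_mul_simple {f : Fin d → β} (hτ : HeckeFam q g τ) (hg : IntervalFibres g)
    (hf : IntervalFibres f) (hfg : fibreSubgroup f ≤ fibreSubgroup g) {r : Fin (d - 1)}
    (hr : simple r ∈ fibreSubgroup g) (n : Perm (Fin d) → R) :
    (∑ u ∈ minReps f g, n u * τ u) * τ (simple r) =
      ∑ u ∈ minReps f g, actCoef q f τ r n u * τ u := by
  classical
  rw [Finset.sum_mul, ← Finset.sum_filter_add_sum_filter_not (minReps f g)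
    (fun u => MonoFib f (u * simple r)⁻¹), ← Finset.sum_filter_add_sum_filter_not (minReps f g)
    (fun u => MonoFib f (u * simple r)⁻¹) (fun u => actCoef q f τ r n u * τ u)]
  congr 1
  · have h1 : ∀ u ∈ (minReps f g).filter (fun u => MonoFib f (u * simple r)⁻¹),
        n u * τ u * τ (simple r) =
          n u * ((if u (lo r) < u (hi r) then (1 : k) else q) • τ (u * simple r)) +
          n u * ((if u (lo r) < u (hi r) then (0 : k) else q - 1) • τ u) := by
      intro u hu
      have hu' := (mem_minReps.mp (Finset.mem_filter.mp hu).1).1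
      split_ifs with h
      · rw [mul_assoc, hτ.mul_simple u hu' r hr h]; simp
      · have h' := (lt_or_gt_lo_hi u r).resolve_left h
        rw [mul_assoc, hτ.mul_simple_of_gt hu' hr h', mul_add, add_comm]
    rw [Finset.sum_congr rfl h1, Finset.sum_add_distrib]
    have h2 : ∑ u ∈ (minReps f g).filter (fun u => MonoFib f (u * simple r)⁻¹),
          n u * ((if u (lo r) < u (hi r) then (1 : k) else q) • τ (u * simple r)) =
        ∑ u ∈ (minReps f g).filter (fun u => MonoFib f (u * simple r)⁻¹),
          n (u * simple r) * ((if u (lo r) < u (hi r) then q else (1 : k)) • τ u) := by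
      have hmap : ∀ u ∈ (minReps f g).filter (fun u => MonoFib f (u * simple r)⁻¹),
          u * simple r ∈ (minReps f g).filter (fun u => MonoFib f (u * simple r)⁻¹) := by
        intro u hu
        have hu' := Finset.mem_filter.mp hu
        have hu'' := mem_minReps.mp hu'.1
        refine Finset.mem_filter.mpr ⟨mem_minReps.mpr ⟨mul_mem hu''.1 hr, hu'.2⟩, ?_⟩
        rw [mul_simple_mul_simple]
        exact hu''.2
      refine Finset.sum_nbij' (fun u => u * simple r) (fun u => u * simple r) hmap hmap
        (fun u _ => mul_simple_mul_simple u r) (fun u _ => mul_simple_mul_simple u r) ?_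
      intro u _
      rw [mul_simple_mul_simple, Perm.mul_apply, Perm.mul_apply, simple_lo, simple_hi]
      congr 2
      rcases lt_or_gt_lo_hi u r with h | h
      · rw [if_pos h, if_neg (not_lt.mpr h.le)]
      · rw [if_neg (not_lt.mpr h.le), if_pos h]
    rw [h2, ← Finset.sum_add_distrib]
    refine Finset.sum_congr rfl fun u hu => ?_
    rw [actCoef, if_pos (Finset.mem_filter.mp hu).2]
    split_ifs with h
    · rw [zero_smul, mul_zero, add_zero, mul_smul_comm, smul_mul_assoc]
    · rw [one_smul, add_mul, mul_smul_comm, smul_mul_assoc]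
  · refine Finset.sum_congr rfl fun u hu => ?_
    have hu1 := Finset.mem_filter.mp hu
    have hu2 := mem_minReps.mp hu1.1
    obtain ⟨h1, t, ht, e⟩ := (monoFib_mul_simple_or hf hu2.2 r).resolve_left hu1.2
    rw [actCoef, if_neg hu1.2, mul_assoc, hτ.mul_simple u hu2.1 r hr h1, e, mul_inv_cancel_right,
      mul_assoc, hτ.mul hg (hfg ht) hu2.1]
    rw [← e, len_mul_simple_of_lt u r h1, len_simple, add_comm]

/-- The signed sum, normalized in such a way that the coefficient of `τ 1` is `1`. -/
noncomputable def signSum (q : k) (τ : Perm (Fin d) → R) (S : Finset (Perm (Fin d))) : R :=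
  ∑ y ∈ S, ((-q)⁻¹) ^ len y • τ y

theorem neg_q_inv_mul (hq : q ≠ 0) : q * (-q)⁻¹ = -1 := by
  rw [inv_neg, mul_neg, mul_inv_cancel₀ hq]

/-- Induction of sign-invariant elements. -/
theorem mul_signSum_mul_simple {f : Fin d → β} (hq : q ≠ 0) (hτ : HeckeFam q g τ)
    (hg : IntervalFibres g) (hf : IntervalFibres f) (hfg : fibreSubgroup f ≤ fibreSubgroup g)
    {n : R} (hn : ∀ t, simple t ∈ fibreSubgroup f → n * τ (simple t) = -n) {r : Fin (d - 1)}
    (hr : simple r ∈ fibreSubgroup g) :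
    n * signSum q τ (minReps f g) * τ (simple r) = -(n * signSum q τ (minReps f g)) := by
  have h : n * signSum q τ (minReps f g) =
      ∑ u ∈ minReps f g, ((-q)⁻¹ ^ len u • n) * τ u := by
    rw [signSum, Finset.mul_sum]
    exact Finset.sum_congr rfl fun u _ => by rw [mul_smul_comm, smul_mul_assoc]
  rw [h, sum_mul_simple hτ hg hf hfg hr, ← Finset.sum_neg_distrib]
  refine Finset.sum_congr rfl fun u hu => ?_
  rw [← neg_mul]
  congr 1
  have hq' := neg_q_inv_mul hq
  unfold actCoef
  beta_reduce
  split_ifs with h1 h2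
  · rw [len_mul_simple_of_lt u r h2, pow_succ, smul_smul, ← neg_smul]
    congr 1
    linear_combination (-q)⁻¹ ^ len u * hq'
  · have h3 := (lt_or_gt_lo_hi u r).resolve_left h2
    rw [len_mul_simple u r h3, pow_succ, smul_smul, ← add_smul, ← neg_smul]
    congr 1
    linear_combination (-q)⁻¹ ^ len (u * simple r) * hq'
  · obtain ⟨_, t, ht, e⟩ := (monoFib_mul_simple_or hf (mem_minReps.mp hu).2 r).resolve_left h1
    rw [e, mul_inv_cancel_right, smul_mul_assoc, hn t ht, smul_neg]

/-- All sign-invariant elements of an induced module are induced. -/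
theorem eq_mul_signSum {f : Fin d → β} (hq : q ≠ 0) (hτ : HeckeFam q g τ)
    (hg : IntervalFibres g) (hf : IntervalFibres f) (hfg : fibreSubgroup f ≤ fibreSubgroup g)
    (N : Submodule k R) (hN : ∀ n ∈ N, ∀ t, simple t ∈ fibreSubgroup f → n * τ (simple t) ∈ N)
    (huniq : ∀ n : Perm (Fin d) → R, (∀ u ∈ minReps f g, n u ∈ N) →
      ∑ u ∈ minReps f g, n u * τ u = 0 → ∀ u ∈ minReps f g, n u = 0)
    {n : Perm (Fin d) → R} (hn : ∀ u ∈ minReps f g, n u ∈ N)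
    (hs : ∀ r, simple r ∈ fibreSubgroup g → (∑ u ∈ minReps f g, n u * τ u) * τ (simple r) =
      -∑ u ∈ minReps f g, n u * τ u) :
    ∑ u ∈ minReps f g, n u * τ u = n 1 * signSum q τ (minReps f g) ∧
      ∀ t, simple t ∈ fibreSubgroup f → n 1 * τ (simple t) = -n 1 := by
  -- Uniqueness of the coefficients turns the sign condition on the sum into a condition on each
  -- coefficient.
  have key : ∀ r, simple r ∈ fibreSubgroup g → ∀ u ∈ minReps f g, actCoef q f τ r n u = -n u := by
    intro r hr u hu
    have h1 := hs r hr
    rw [sum_mul_simple hτ hg hf hfg hr, ← sub_eq_zero, sub_neg_eq_add,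
      ← Finset.sum_add_distrib] at h1
    have h2 := huniq (fun u => actCoef q f τ r n u + n u) (fun u hu => ?_) ?_ u hu
    · exact eq_neg_of_add_eq_zero_left h2
    · refine add_mem ?_ (hn u hu)
      have hu' := mem_minReps.mp hu
      unfold actCoef
      split_ifs with h2 h3
      · exact Submodule.smul_mem _ _ (hn _ (mem_minReps.mpr ⟨mul_mem hu'.1 hr, h2⟩))
      · exact add_mem (hn _ (mem_minReps.mpr ⟨mul_mem hu'.1 hr, h2⟩))
          (Submodule.smul_mem _ _ (hn u hu))
      · obtain ⟨_, t, ht, e⟩ := (monoFib_mul_simple_or hf hu'.2 r).resolve_left h2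
        rw [e, mul_inv_cancel_right]
        exact hN _ (hn u hu) t ht
    · rw [← h1]
      exact Finset.sum_congr rfl fun u _ => add_mul _ _ _
  -- For an ascent v < v s within the representatives the sign condition reads q n(v s) = -n(v). So
  -- all the coefficients are determined by the one at 1.
  have hpow : ∀ m, ∀ u ∈ minReps f g, len u = m → n u = (-q)⁻¹ ^ len u • n 1 := by
    intro m
    induction m with
    | zero =>
      intro u _ hm
      rw [eq_one_of_len u hm, len_one, pow_zero, one_smul]
    | succ m ih =>
      intro u hu hm
      have hu' := mem_minReps.mp hu
      obtain ⟨r, hr⟩ : ∃ r, u (hi r) < u (lo r) := by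
        by_contra hc
        push Not at hc
        rw [eq_one_of_no_descent u fun r => not_lt.mpr (hc r), len_one] at hm
        omega
      have hsr := simple_mem_of_descent hg hu'.1 hr
      have h1 := len_mul_simple u r hr
      have hmono : MonoFib f (u * simple r)⁻¹ :=
        (monoFib_mul_simple_or hf hu'.2 r).resolve_right fun hh => absurd hh.1 (not_lt.mpr hr.le)
      have hmem : u * simple r ∈ minReps f g := mem_minReps.mpr ⟨mul_mem hu'.1 hsr, hmono⟩
      have h2 := key r hsr _ hmem
      rw [actCoef, mul_simple_mul_simple, if_pos hu'.2, if_pos (by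
        simpa [simple_lo, simple_hi] using hr), ih _ hmem (by omega)] at h2
      rw [h1, pow_succ, mul_comm, mul_smul, ← smul_right_injective R hq |>.eq_iff]
      rw [h2, smul_smul, neg_q_inv_mul hq, neg_smul, one_smul]
  constructor
  · rw [signSum, Finset.mul_sum]
    refine Finset.sum_congr rfl fun u hu => ?_
    rw [hpow _ u hu rfl, smul_mul_assoc, mul_smul_comm]
  · intro t ht
    have h1 := key t (hfg ht) 1 (one_mem_minReps f g)
    rw [actCoef, if_neg, one_mul, inv_one, mul_one] at h1
    · exact h1
    · intro h2
      rw [one_mul, simple_inv] at h2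
      have := h2 (lo t) (hi t) (lo_lt_hi t) (simple_mem_fibreSubgroup.mp ht)
      rw [simple_lo, simple_hi] at this
      exact absurd this (not_lt.mpr (lo_lt_hi t).le)

/-- The transposition of two elements of one fibre of f is a test element of the subgroup. -/
theorem fibre_le_iff {f : Fin d → β} {g : Fin d → α} :
    fibreSubgroup f ≤ fibreSubgroup g ↔ ∀ i j, f i = f j → g i = g j := by
  constructor
  · intro h i j e
    have h1 : swap i j ∈ fibreSubgroup f := by
      intro m
      rw [swap_apply_def]
      split_ifs with h1 h2
      · rw [h1, e]
      · rw [h2, e]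
      · rfl
    have h2 := h h1 i
    rw [swap_apply_left] at h2
    exact h2.symm
  · intro h z hz i
    exact h _ _ (hz i)

/-- Shortest representatives are transitive: those of S_e in S_g are the products of those of S_e in
S_f and of S_f in S_g, uniquely and with additive lengths. -/
theorem HeckeFam.signSum_mul_signSum {γ : Type*} {e : Fin d → γ} {f : Fin d → β}
    (hτ : HeckeFam q g τ) (hg : IntervalFibres g) (hf : IntervalFibres f)
    (hef : fibreSubgroup e ≤ fibreSubgroup f) (hfg : fibreSubgroup f ≤ fibreSubgroup g) :
    signSum q τ (minReps e f) * signSum q τ (minReps f g) = signSum q τ (minReps e g) := by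
  unfold signSum
  rw [Finset.sum_mul_sum, ← Finset.sum_product']
  refine Finset.sum_bij (fun zu _ => zu.1 * zu.2) ?_ ?_ ?_ ?_
  · rintro ⟨z, u⟩ h
    obtain ⟨hz, hu⟩ := Finset.mem_product.mp h
    have hz' := mem_minReps.mp hz
    have hu' := mem_minReps.mp hu
    refine mem_minReps.mpr ⟨mul_mem (hfg hz'.1) hu'.1, fun i j hij he => ?_⟩
    rw [mul_inv_rev, Perm.mul_apply, Perm.mul_apply]
    refine hu'.2 _ _ (hz'.2 i j hij he) ?_
    have h1 := inv_mem hz'.1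
    rw [h1 i, h1 j]
    exact fibre_le_iff.mp hef i j he
  · rintro ⟨z, u⟩ h ⟨z', u'⟩ h' e1
    obtain ⟨hz, hu⟩ := Finset.mem_product.mp h
    obtain ⟨hz', hu'⟩ := Finset.mem_product.mp h'
    replace hz := mem_minReps.mp hz
    replace hu := mem_minReps.mp hu
    replace hz' := mem_minReps.mp hz'
    replace hu' := mem_minReps.mp hu'
    have e1 : z * u = z' * u' := e1
    have e2 : z'⁻¹ * z * u = u' := by rw [mul_assoc, e1, inv_mul_cancel_left]
    have h1 := eq_one_of_monoFib hf (mul_mem (inv_mem hz'.1) hz.1) hu.2 (by rw [e2]; exact hu'.2)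
    rw [h1, _root_.one_mul] at e2
    rw [inv_mul_eq_one] at h1
    exact Prod.ext h1.symm e2
  · intro y hy
    have hy' := mem_minReps.mp hy
    obtain ⟨z, hz, u, hu, rfl⟩ := exists_mul_monoFib hf y
    have hug : u ∈ fibreSubgroup g := by
      have := mul_mem (inv_mem (hfg hz)) hy'.1
      rwa [inv_mul_cancel_left] at this
    refine ⟨(z, u), Finset.mem_product.mpr ⟨mem_minReps.mpr ⟨hz, fun i j hij he => ?_⟩,
      mem_minReps.mpr ⟨hug, hu⟩⟩, rfl⟩
    by_contra hc
    have h1 := lt_of_le_of_ne (not_lt.mp hc) fun e => hij.ne (z⁻¹.injective e.symm)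
    have h2 := hy'.2 i j hij he
    rw [mul_inv_rev, Perm.mul_apply, Perm.mul_apply] at h2
    have h3 := inv_mem hz
    have h4 := hu _ _ h1 (by rw [h3 i, h3 j]; exact (fibre_le_iff.mp hef i j he).symm)
    exact absurd h2 (not_lt.mpr h4.le)
  · rintro ⟨z, u⟩ h
    obtain ⟨hz, hu⟩ := Finset.mem_product.mp h
    replace hz := mem_minReps.mp hz
    replace hu := mem_minReps.mp hu
    have h1 := len_mul_of_monoFib hf hz.1 hu.2
    rw [smul_mul_smul_comm, hτ.mul hg (hfg hz.1) hu.1 h1, h1, pow_add]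

/-- The opposite family. -/
theorem HeckeFam.op (hτ : HeckeFam q g τ) (hg : IntervalFibres g) :
    HeckeFam q g (fun z => MulOpposite.op (τ z⁻¹)) where
  one_mul z hz := by
    rw [← MulOpposite.op_mul, inv_one, hτ.mul_one _ (inv_mem hz)]
  mul_one z hz := by
    rw [← MulOpposite.op_mul, inv_one, hτ.one_mul _ (inv_mem hz)]
  mul_simple z hz r hr h := by
    rw [← MulOpposite.op_mul, simple_inv, mul_inv_rev, simple_inv, hτ.mul hg hr (inv_mem hz)]
    rw [len_simple_mul, inv_inv, len_mul_simple_of_lt z r h, len_simple, len_inv, add_comm]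
  sq r hr := by
    rw [← MulOpposite.op_mul, simple_inv, hτ.sq r hr, inv_one]
    rfl

/-- All the permutations that preserve the fibres of `g`. -/
noncomputable def allReps (g : Fin d → α) : Finset (Perm (Fin d)) :=
  minReps (id : Fin d → Fin d) g

theorem mem_allReps {u : Perm (Fin d)} : u ∈ allReps g ↔ u ∈ fibreSubgroup g := by
  refine mem_minReps.trans ⟨fun h => h.1, fun h => ⟨h, fun i j hij e => ?_⟩⟩
  exact absurd e hij.ne

theorem fibreSubgroup_id_le (g : Fin d → α) :
    fibreSubgroup (id : Fin d → Fin d) ≤ fibreSubgroup g :=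
  fibre_le_iff.mpr fun _ _ e => congrArg g e

theorem intervalFibres_id : IntervalFibres (id : Fin d → Fin d) :=
  intervalFibres_of_monotone monotone_id

theorem signSum_op (g : Fin d → α) (τ : Perm (Fin d) → R) :
    signSum q (fun z => MulOpposite.op (τ z⁻¹)) (allReps g) =
      MulOpposite.op (signSum q τ (allReps g)) := by
  unfold signSum
  rw [← MulOpposite.opAddEquiv_apply, map_sum]
  refine Finset.sum_nbij' (fun z => z⁻¹) (fun z => z⁻¹) ?_ ?_ ?_ ?_ ?_
  · intro z hz; exact mem_allReps.mpr (inv_mem (mem_allReps.mp hz))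
  · intro z hz; exact mem_allReps.mpr (inv_mem (mem_allReps.mp hz))
  · intro z _; exact inv_inv z
  · intro z _; exact inv_inv z
  · intro z _; rw [len_inv]; rfl

theorem HeckeFam.signSum_mul_simple (hq : q ≠ 0) (hτ : HeckeFam q g τ) (hg : IntervalFibres g)
    {r : Fin (d - 1)} (hr : simple r ∈ fibreSubgroup g) :
    signSum q τ (allReps g) * τ (simple r) = -signSum q τ (allReps g) := by
  have := mul_signSum_mul_simple (n := (1 : R)) hq hτ hg intervalFibres_id (fibreSubgroup_id_le g)
    (fun t ht => ?_) hr
  · rwa [_root_.one_mul] at this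
  · exact absurd (simple_mem_fibreSubgroup.mp ht) (lo_lt_hi t).ne

/-- The same factorization on the other side, read off in the opposite algebra. It exhibits the
larger sign element as a left multiple of the smaller one, which is what a merge needs. -/
theorem HeckeFam.exists_mul_signSum {f : Fin d → β}
    (hτ : HeckeFam q g τ) (hg : IntervalFibres g) (hf : IntervalFibres f)
    (hfg : fibreSubgroup f ≤ fibreSubgroup g) :
    signSum q τ (allReps g) =
      (∑ u ∈ minReps f g, (-q)⁻¹ ^ len u • τ u⁻¹) * signSum q τ (allReps f) := by
  have := (hτ.op hg).signSum_mul_signSum hg hf (fibreSubgroup_id_le f) hfg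
  rw [← allReps, ← allReps, signSum_op, signSum_op] at this
  have h2 := congrArg MulOpposite.unop this
  rw [MulOpposite.unop_mul, MulOpposite.unop_op, MulOpposite.unop_op] at h2
  rw [← h2]
  congr 1
  unfold signSum
  rw [← MulOpposite.opAddEquiv_symm_apply, map_sum]
  rfl

theorem HeckeFam.mul_signSum (hτ : HeckeFam q g τ) {f : Fin d → β} (hg : IntervalFibres g)
    (hf : IntervalFibres f) (hfg : fibreSubgroup f ≤ fibreSubgroup g) :
    signSum q τ (allReps f) * signSum q τ (minReps f g) = signSum q τ (allReps g) :=
  hτ.signSum_mul_signSum hg hf (fibreSubgroup_id_le f) hfg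

end HeckeFamilies

/-! ### Standard elements of the finite Hecke algebras of blocks of black strands. -/

section StandardFamily

variable {k : Type*} [Field k] {ℓ d : ℕ} (q : k) (Q : Fin ℓ → k) {α : Type*}

local notation "𝐞" c:max => heckeGen q Q (Gen.e c)
local notation "𝐓" r:max => heckeGen q Q (Gen.T r)

theorem stdElt_eq {b c : ColourSeq ℓ d} {w : Perm (Fin d)}
    (h : ¬ BadTriple (strandPerm b c w) c) {L : List (Fin (ℓ + d - 1))}
    (hL : IsReducedWord (strandPerm b c w) L) : stdElt q Q b c w = tw q Q L * 𝐞 c :=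
  tw_mul_e_unique h (redWord_spec _) hL

/-- A permutation within the blocks crosses no red strand at all. -/
theorem Blocked.not_badTriple {c : ColourSeq ℓ d} {g : Fin d → α} (h : Blocked c g)
    {z : Perm (Fin d)} (hz : z ∈ fibreSubgroup g) : ¬ BadTriple (strandPerm c c z) c := by
  rintro ⟨i, j, m, hij, -, -, h2, hi, hj, -⟩
  obtain ⟨i, rfl⟩ := exists_blackPos hi
  obtain ⟨p, rfl⟩ := exists_redPos hj
  rw [strandPerm_redPos, strandPerm_blackPos, redPos_lt_blackPos, h.cnt_le_iff (hz i),
    ← redPos_lt_blackPos] at h2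
  exact absurd hij (not_lt.mpr h2.le)

theorem e_mul_stdElt (b c : ColourSeq ℓ d) (w : Perm (Fin d)) :
    𝐞 b * stdElt q Q b c w = stdElt q Q b c w := by
  unfold stdElt
  rw [diagElt_eq, tw_mul_e, (redWord_spec _).1, act_strandPerm, ← mul_assoc, e_mul_e]

theorem stdElt_mul_e (b c : ColourSeq ℓ d) (w : Perm (Fin d)) :
    stdElt q Q b c w * 𝐞 c = stdElt q Q b c w := by
  unfold stdElt
  rw [diagElt_eq, mul_assoc, e_mul_e]

theorem stdElt_one (c : ColourSeq ℓ d) : stdElt q Q c c 1 = 𝐞 c := by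
  have h := redWord_spec (strandPerm c c 1)
  have h1 := h.2
  rw [strandPerm_self_one, len_one] at h1
  unfold stdElt
  rw [strandPerm_self_one, diagElt_eq, List.eq_nil_of_length_eq_zero h1, tw_nil, one_mul]

theorem Blocked.adj {c : ColourSeq ℓ d} {g : Fin d → α} (h : Blocked c g) {j : Fin (d - 1)}
    (hj : simple j ∈ fibreSubgroup g) :
    ∃ r : Fin (ℓ + d - 1), c.blackPos (lo j) = lo r ∧ c.blackPos (hi j) = hi r ∧
      stdElt q Q c c (simple j) = 𝐓 r * 𝐞 c := by
  obtain ⟨r, h1, h2⟩ := (h.2 j hj).exists_pos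
  refine ⟨r, h1, h2, ?_⟩
  rw [stdElt_eq q Q (h.not_badTriple hj) (L := [r]), tw_singleton]
  rw [strandPerm_simple h1 h2]
  exact isReducedWord_singleton r

/-- Concatenation of the chosen reduced words gives a reduced word when the lengths add. Without bad
triples the resulting element does not depend on the word. -/
theorem tw_mul_e_mul_stdElt (a : ColourSeq ℓ d) {b c : ColourSeq ℓ d} {z u : Perm (Fin d)}
    (hu : ¬ BadTriple (strandPerm b c u) c) (h : ¬ BadTriple (strandPerm a c (z * u)) c)
    (hz : ¬ BadTriple (strandPerm a b z) b) (hl : len (strandPerm a c (z * u)) =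
      len (strandPerm a b z) + len (strandPerm b c u)) :
    stdElt q Q a b z * stdElt q Q b c u = stdElt q Q a c (z * u) := by
  have h1 := redWord_spec (strandPerm a b z)
  have h2 := redWord_spec (strandPerm b c u)
  have h3 := h1.append h2 (by rw [strandPerm_mul, hl])
  rw [strandPerm_mul] at h3
  rw [stdElt_eq q Q h h3, stdElt_eq q Q hz h1, mul_assoc, e_mul_stdElt, stdElt_eq q Q hu h2,
    tw_append, mul_assoc]

theorem heckeFam_stdElt {c : ColourSeq ℓ d} {g : Fin d → α} (h : Blocked c g) :
    HeckeFam q g (stdElt q Q c c) where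
  one_mul z _ := by rw [stdElt_one, e_mul_stdElt]
  mul_one z _ := by rw [stdElt_one, stdElt_mul_e]
  mul_simple z hz r hr hlt := by
    refine tw_mul_e_mul_stdElt q Q c (h.not_badTriple hr) (h.not_badTriple (mul_mem hz hr))
      (h.not_badTriple hz) ?_
    rw [len_strandPerm_self h hz, len_strandPerm_self h hr, len_strandPerm_self h (mul_mem hz hr),
      len_mul_simple_of_lt z r hlt, len_simple]
  sq r hr := by
    obtain ⟨j, h1, h2, h3⟩ := h.adj q Q hr
    have c1 : c.1 (lo j) = false := by rw [← h1, colour_blackPos]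
    have c2 : c.1 (hi j) = false := by rw [← h2, colour_blackPos]
    rw [h3, stdElt_one, mul_assoc, ← mul_assoc (𝐞 c), ← T_sq_e q Q c1 c2]
    have : 𝐞 c * 𝐓 j = 𝐓 j * 𝐞 c := by
      rw [T_mul_e, act_simple_of_same (c1.trans c2.symm)]
    rw [this, mul_assoc (𝐓 j) (𝐞 c), e_mul_e, mul_assoc]

-- The normalization with exponent r - l(y) differs from the one with coefficient 1 at the identity
-- by the nonzero factor (-q)^r. The latter is multiplicative along chains of subgroups.
open Classical in
theorem signedSum_eq (c : ColourSeq ℓ d) (S : Set (Perm (Fin d))) (hq : q ≠ 0) :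
    signedSum q Q c S = (-q) ^ ((Finset.univ.filter (fun y => y ∈ S)).sup len) •
      signSum q (stdElt q Q c c) (Finset.univ.filter (fun y => y ∈ S)) := by
  unfold signedSum signSum
  rw [Finset.smul_sum]
  refine Finset.sum_congr rfl fun y hy => ?_
  rw [smul_smul]
  congr 1
  have h1 : len y ≤ (Finset.univ.filter (fun y => y ∈ S)).sup len := Finset.le_sup hy
  rw [inv_pow, pow_sub₀ _ (neg_ne_zero.mpr hq) h1]

/-- The signed sum is a multiple of the normalized one. -/
theorem exists_signedSum_eq (c : ColourSeq ℓ d) {S : Set (Perm (Fin d))} (hq : q ≠ 0)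
    {T : Finset (Perm (Fin d))} (h : ∀ y, y ∈ S ↔ y ∈ T) :
    ∃ t : k, t ≠ 0 ∧ signedSum q Q c S = t • signSum q (stdElt q Q c c) T := by
  classical
  have hT : Finset.univ.filter (fun y => y ∈ S) = T := by
    ext y
    rw [Finset.mem_filter, h]
    simp
  refine ⟨(-q) ^ T.sup len, pow_ne_zero _ (neg_ne_zero.mpr hq), ?_⟩
  rw [← hT]
  convert signedSum_eq q Q c S hq

end StandardFamily

/-! ### Symmetric Laurent polynomials -/

section SymmetricLaurent

variable {k : Type*} [Field k] {d : ℕ} {α : Type*}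

theorem coeff_permAut (σ : Perm (Fin d)) (f : Laurent k d) (a : Fin d → ℤ) :
    (permAut σ f).coeff a = f.coeff (a ∘ σ) := by
  induction f using AddMonoidAlgebra.induction_linear with
  | zero => simp
  | add f g hf hg => simp [hf, hg]
  | single b t =>
    rw [permAut_single]
    simp only [AddMonoidAlgebra.coeff_single, Finsupp.single_apply]
    refine if_congr ⟨?_, ?_⟩ rfl rfl
    · rintro rfl; ext i; simp
    · rintro rfl; ext i; simp

/-- The Laurent polynomials with exponents in a set. -/
noncomputable def suppIn (k : Type*) [Field k] {d : ℕ} (S : Set (Fin d → ℤ)) :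
    Submodule k (Laurent k d) where
  carrier := {f | ∀ b, b ∉ S → f.coeff b = 0}
  zero_mem' := fun _ _ => by simp
  add_mem' := fun {f g} hf hg b hb => by simp [hf b hb, hg b hb]
  smul_mem' := fun t f hf b hb => by simp [hf b hb]

theorem coeff_mon (a b : Fin d → ℤ) [Decidable (a = b)] :
    (mon k a).coeff b = if a = b then 1 else 0 := by
  simp only [mon, AddMonoidAlgebra.coeff_single, Finsupp.single_apply]

theorem mon_mem_suppIn {S : Set (Fin d → ℤ)} {a : Fin d → ℤ} (h : a ∈ S) :
    mon k a ∈ suppIn k S := fun b hb => by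
  classical
  rw [coeff_mon, if_neg]
  rintro rfl
  exact hb h

theorem suppIn_mono {S T : Set (Fin d → ℤ)} (h : S ⊆ T) : suppIn k S ≤ suppIn k T :=
  fun _ hf b hb => hf b fun hb' => hb (h hb')

theorem sum_coeff_smul_mon (f : Laurent k d) : ∑ b ∈ f.coeff.support, f.coeff b • mon k b = f := by
  classical
  ext b
  simp only [AddMonoidAlgebra.coeff_sum, Finsupp.finset_sum_apply, AddMonoidAlgebra.coeff_smul,
    Finsupp.smul_apply, coeff_mon, smul_eq_mul, mul_ite, mul_one, mul_zero, Finset.sum_ite_eq']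
  simp only [Finsupp.mem_support_iff, ite_eq_left_iff, not_not]
  exact fun h => h.symm

theorem map_mem_of_suppIn {S : Set (Fin d → ℤ)} {M : Type*} [AddCommGroup M] [Module k M]
    (φ : Laurent k d →ₗ[k] M) (V : Submodule k M) (h : ∀ b ∈ S, φ (mon k b) ∈ V) {f : Laurent k d}
    (hf : f ∈ suppIn k S) : φ f ∈ V := by
  rw [← sum_coeff_smul_mon f, map_sum]
  refine sum_mem fun b hb => ?_
  rw [map_smul]
  refine V.smul_mem _ (h b ?_)
  by_contra hb'
  exact (Finsupp.mem_support_iff.mp hb) (hf b hb')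

/-- The square of the norm of an exponent. -/
def nsq (a : Fin d → ℤ) : ℤ := ∑ i, a i ^ 2

theorem nsq_comp (a : Fin d → ℤ) (z : Perm (Fin d)) : nsq (a ∘ z) = nsq a :=
  Equiv.sum_comp z fun i => a i ^ 2

theorem permAut_simple_mon (j : Fin (d - 1)) (b : Fin d → ℤ) :
    permAut (simple j) (mon k b) = mon k (b ∘ simple j) := by
  rw [permAut_mon, simple_inv]

/-- The divided difference, as a linear map. -/
noncomputable def divDiffₗ (j : Fin (d - 1)) : Laurent k d →ₗ[k] Laurent k d where
  toFun := divDiff j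
  map_add' f g := (divDiff_unique (by
    rw [mul_add, divDiff_spec, divDiff_spec, map_add]; ring)).symm
  map_smul' t f := (divDiff_unique (by
    rw [RingHom.id_apply, mul_smul_comm, divDiff_spec, map_smul, ← smul_sub, mul_smul_comm])).symm

/-- The quotient is a geometric sum over the exponents on the segment from b to s_j b, with b
included and s_j b excluded. By strict convexity of the norm the interior points have smaller norm
than b. -/
theorem divDiff_mon_lt {j : Fin (d - 1)} {b : Fin d → ℤ} (h : b (lo j) < b (hi j)) :
    divDiff j (mon k b) - mon k b ∈ suppIn k {b' | nsq b' < nsq b} := by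
  have hne : lo j ≠ hi j := (lo_lt_hi j).ne
  obtain ⟨m, hm⟩ : ∃ m : ℕ, b (hi j) = b (lo j) + m + 1 := by
    obtain ⟨n, hn⟩ := Int.eq_ofNat_of_zero_le (sub_nonneg.mpr (Int.add_one_le_iff.mpr h))
    exact ⟨n, by linarith⟩
  set δ : Fin d → ℤ := Pi.single (lo j) 1 - Pi.single (hi j) 1 with hδ
  set S : ℕ → Laurent k d := fun i => mon k (b + i • δ) with hS
  have h1 : ∀ i : ℕ, xv k (lo j) * S i = xv k (hi j) * S (i + 1) := by
    intro i
    simp only [hS, xv, ← mon_add]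
    congr 1
    rw [succ_nsmul, hδ]
    abel
  have h2 : b + (m + 1) • δ = b ∘ simple j := by
    ext i
    simp only [hδ, Pi.add_apply, Pi.smul_apply, Pi.sub_apply, Function.comp_apply]
    by_cases h1 : i = lo j
    · subst h1
      rw [simple_lo, hm]
      simp [hne]; ring
    · by_cases h2 : i = hi j
      · subst h2
        rw [simple_hi, hm]
        simp [hne.symm]
      · rw [simple_of_ne j h1 h2]
        simp [h1, h2]
  have h3 : divDiff j (mon k b) = ∑ i ∈ Finset.range (m + 1), S i := by
    symm
    refine divDiff_unique ?_
    rw [permAut_simple_mon, ← h2, sub_mul, Finset.mul_sum, Finset.mul_sum]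
    simp only [h1]
    rw [← Finset.mul_sum, ← Finset.mul_sum, ← mul_sub, ← Finset.sum_sub_distrib,
      Finset.sum_range_sub']
    simp [hS]
  rw [h3, Finset.sum_range_succ']
  have h4 : S 0 = mon k b := by simp [hS]
  rw [h4, add_sub_cancel_right]
  refine sum_mem fun i hi' => mon_mem_suppIn ?_
  have him : i < m := Finset.mem_range.mp hi'
  -- The term with index 0 was x^b, so the index is shifted by one. With n = i + 1 the difference of
  -- the norms is 2n(n - m - 1).
  have h5 : nsq (b + (i + 1) • δ) - nsq b = 2 * (i + 1) * (i - m) := by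
    unfold nsq
    rw [← Finset.sum_sub_distrib, ← Finset.sum_subset (Finset.subset_univ {lo j, hi j}),
      Finset.sum_pair hne]
    · have e1 : δ (lo j) = 1 := by simp [hδ, hne]
      have e2 : δ (hi j) = -1 := by simp [hδ, hne.symm]
      rw [Pi.add_apply, Pi.add_apply, Pi.smul_apply, Pi.smul_apply, e1, e2, hm, nsmul_eq_mul,
        nsmul_eq_mul]
      push_cast
      ring
    · intro x _ hx
      simp only [Finset.mem_insert, Finset.mem_singleton, not_or] at hx
      simp [hδ, hx.1, hx.2]
  have h6 : (i : ℤ) - m < 0 := by omega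
  have h7 : 2 * ((i : ℤ) + 1) * (i - m) < 0 := mul_neg_of_pos_of_neg (by positivity) h6
  simp only [Set.mem_setOf_eq]
  linarith

theorem divDiff_simple (j : Fin (d - 1)) (f : Laurent k d) :
    divDiff j (permAut (simple j) f) = -divDiff j f := by
  symm
  refine divDiff_unique ?_
  rw [mul_neg, divDiff_spec, permAut_simple_simple]
  ring

/-- The action of a crossing on Laurent polynomials, twisted by the sign representation. -/
noncomputable def rho (q : k) (j : Fin (d - 1)) : Laurent k d →ₗ[k] Laurent k d :=
  (q - 1) • divDiffₗ j - (permAut (simple j)).toLinearMap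

theorem rho_apply (q : k) (j : Fin (d - 1)) (f : Laurent k d) :
    rho q j f = (q - 1) • divDiff j f - permAut (simple j) f := rfl

/-- After multiplication by x_{j+1} - x_j, the polynomial ρ(f) + f becomes (q x_{j+1} - x_j)(f - s_j
f), and both linear factors are nonzero. This is why sign vectors correspond to symmetric
polynomials. -/
theorem rho_eq_neg_iff {q : k} {j : Fin (d - 1)} {f : Laurent k d} :
    rho q j f = -f ↔ permAut (simple j) f = f := by
  have h0 : xv k (hi j) - xv k (lo j) ≠ 0 := by
    have := xv_sub_ne_zero (k := k) j (s := 1) one_ne_zero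
    rwa [one_smul, one_smul] at this
  have h1 : q • xv k (hi j) - xv k (lo j) ≠ 0 := by
    have := xv_sub_ne_zero (k := k) j (s := q) one_ne_zero
    rwa [one_smul] at this
  have key : (xv k (hi j) - xv k (lo j)) * (rho q j f + f) =
      (q • xv k (hi j) - xv k (lo j)) * (f - permAut (simple j) f) := by
    rw [rho_apply, mul_add, mul_sub, mul_smul_comm, divDiff_spec]
    simp only [Algebra.smul_def, map_sub, map_one]
    ring
  rw [eq_neg_iff_add_eq_zero]
  constructor
  · intro h
    rw [h, mul_zero] at key
    exact (sub_eq_zero.mp ((mul_eq_zero.mp key.symm).resolve_left h1)).symm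
  · intro h
    rw [h, sub_self, mul_zero] at key
    exact (mul_eq_zero.mp key).resolve_left h0

theorem rho_mon_lt (q : k) {j : Fin (d - 1)} {b : Fin d → ℤ} (h : b (lo j) < b (hi j)) :
    rho q j (mon k b) - ((q - 1) • mon k b - mon k (b ∘ simple j)) ∈
      suppIn k {b' | nsq b' < nsq b} := by
  have := Submodule.smul_mem _ (q - 1) (divDiff_mon_lt (k := k) h)
  rw [smul_sub] at this
  rw [rho_apply, permAut_simple_mon]
  convert this using 1
  abel

theorem rho_mon_mem (q : k) {j : Fin (d - 1)} {b : Fin d → ℤ} {S : Set (Fin d → ℤ)}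
    (h1 : b ∈ S) (h2 : b ∘ simple j ∈ S) (h3 : {b' | nsq b' < nsq b} ⊆ S) :
    rho q j (mon k b) ∈ suppIn k S := by
  have m1 := mon_mem_suppIn (k := k) h1
  have m2 := mon_mem_suppIn (k := k) h2
  rw [rho_apply, permAut_simple_mon]
  refine sub_mem (Submodule.smul_mem _ _ ?_) m2
  rcases lt_trichotomy (b (lo j)) (b (hi j)) with h | h | h
  · have := suppIn_mono h3 (divDiff_mon_lt (k := k) h)
    have := add_mem this m1
    rwa [sub_add_cancel] at this
  · have : b ∘ simple j = b := by
      ext i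
      simp only [Function.comp_apply]
      by_cases e1 : i = lo j
      · rw [e1, simple_lo, h]
      · by_cases e2 : i = hi j
        · rw [e2, simple_hi, h]
        · rw [simple_of_ne j e1 e2]
    rw [← divDiff_unique (g := 0) (by rw [permAut_simple_mon, this, sub_self, mul_zero, mul_zero])]
    exact zero_mem _
  · have h' : (b ∘ simple j) (lo j) < (b ∘ simple j) (hi j) := by
      simp only [Function.comp_apply, simple_lo, simple_hi, h]
    have hS : {b' | nsq b' < nsq (b ∘ simple j)} ⊆ S := by rwa [nsq_comp]
    have := suppIn_mono hS (divDiff_mon_lt (k := k) h')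
    have := neg_mem (add_mem this m2)
    rwa [sub_add_cancel, ← permAut_simple_mon, divDiff_simple, neg_neg] at this

/-- The twisted action of a word. -/
noncomputable def rhoWord (q : k) (L : List (Fin (d - 1))) (f : Laurent k d) : Laurent k d :=
  L.foldl (fun f j => rho q j f) f

theorem rhoWord_append_singleton (q : k) (L : List (Fin (d - 1))) (j : Fin (d - 1))
    (f : Laurent k d) : rhoWord q (L ++ [j]) f = rho q j (rhoWord q L f) := by
  simp [rhoWord]

/-- The exponents that are non-decreasing inside each block. -/
def Dominant (g : Fin d → α) (a : Fin d → ℤ) : Prop :=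
  ∀ j, simple j ∈ fibreSubgroup g → a (lo j) ≤ a (hi j)

theorem Dominant.le {g : Fin d → α} (hg : IntervalFibres g) {a : Fin d → ℤ} (h : Dominant g a)
    {i j : Fin d} (hij : i ≤ j) (e : g i = g j) : a i ≤ a j := by
  have key : ∀ m : ℕ, ∀ i j : Fin d, (j : ℕ) = i + m → g i = g j → a i ≤ a j := by
    intro m
    induction m with
    | zero => intro i j hj _; rw [Fin.ext (show (i : ℕ) = j by omega)]
    | succ m ih =>
      intro i j hj e
      set j' : Fin d := ⟨i + m, by omega⟩ with hj'
      have e1 : g j' = g i := hg i j' j (by simp [hj', Fin.le_def]) (by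
        simp only [hj', Fin.le_def]; omega) e
      have h1 := ih i j' rfl e1.symm
      have e2 : lo (⟨i + m, by omega⟩ : Fin (d - 1)) = j' := rfl
      have e3 : hi (⟨i + m, by omega⟩ : Fin (d - 1)) = j := Fin.ext (by simp [hi]; omega)
      have h2 := h ⟨i + m, by omega⟩ (by
        rw [simple_mem_fibreSubgroup, e2, e3, e1, e])
      rw [e2, e3] at h2
      exact h1.trans h2
  exact key (j - i) i j (by have : (i : ℕ) ≤ j := hij; omega) e

theorem exists_dominant (g : Fin d → α) (b : Fin d → ℤ) :
    ∃ z ∈ fibreSubgroup g, Dominant g (b ∘ z) := by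
  classical
  -- The rearrangement inequality: a permutation that maximizes the sum of i b(z i) sorts b
  -- increasingly inside each block.
  obtain ⟨z, hz, hmax⟩ := Finset.exists_max_image
    (Finset.univ.filter fun z : Perm (Fin d) => z ∈ fibreSubgroup g)
    (fun z => ∑ i : Fin d, ((i : ℕ) : ℤ) * b (z i)) ⟨1, by simp [one_mem]⟩
  have hz := (Finset.mem_filter.mp hz).2
  refine ⟨z, hz, fun j hj => ?_⟩
  by_contra hc
  push Not at hc
  simp only [Function.comp_apply] at hc
  have h1 := hmax (z * simple j) (Finset.mem_filter.mpr ⟨Finset.mem_univ _, mul_mem hz hj⟩)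
  have hne : lo j ≠ hi j := (lo_lt_hi j).ne
  have h2 : ∑ i : Fin d, ((i : ℕ) : ℤ) * b ((z * simple j) i) - ∑ i : Fin d, ((i : ℕ) : ℤ) * b (z i) =
      b (z (lo j)) - b (z (hi j)) := by
    rw [← Finset.sum_sub_distrib, ← Finset.sum_subset (Finset.subset_univ {lo j, hi j}),
      Finset.sum_pair hne]
    · have e1 : ((lo j : Fin d) : ℕ) = j := rfl
      have e2 : ((hi j : Fin d) : ℕ) = j + 1 := rfl
      rw [Perm.mul_apply, Perm.mul_apply, simple_lo, simple_hi, e1, e2]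
      push_cast
      ring
    · intro x _ hx
      simp only [Finset.mem_insert, Finset.mem_singleton, not_or] at hx
      rw [Perm.mul_apply, simple_of_ne j hx.1 hx.2, sub_self]
  linarith

/-- At a descent r of z both exponents force equality of the two values concerned, so z may be
replaced by the shorter z s_r. -/
theorem Dominant.eq {g : Fin d → α} (hg : IntervalFibres g) {a a' : Fin d → ℤ}
    (h : Dominant g a) (h' : Dominant g a') {z : Perm (Fin d)} (hz : z ∈ fibreSubgroup g)
    (e : a' = a ∘ z) : a' = a := by
  obtain ⟨m, hm⟩ : ∃ m, len z = m := ⟨_, rfl⟩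
  induction m generalizing z with
  | zero => rw [e, eq_one_of_len z hm]; rfl
  | succ m ih =>
    obtain ⟨r, hr⟩ : ∃ r, z (hi r) < z (lo r) := by
      by_contra hc
      push Not at hc
      rw [eq_one_of_no_descent z fun r => not_lt.mpr (hc r), len_one] at hm
      omega
    have hs := simple_mem_of_descent hg hz hr
    have h1 := len_mul_simple z r hr
    refine ih (mul_mem hz hs) ?_ (by omega)
    have h2 : a (z (hi r)) ≤ a (z (lo r)) := h.le hg hr.le (by
      rw [hz, hz, simple_mem_fibreSubgroup.mp hs])
    have h3 := h' r hs
    rw [e] at h3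
    simp only [Function.comp_apply] at h3
    rw [e]
    ext i
    simp only [Function.comp_apply, Perm.mul_apply]
    by_cases e1 : i = lo r
    · rw [e1, simple_lo]; exact le_antisymm h3 h2
    · by_cases e2 : i = hi r
      · rw [e2, simple_hi]; exact le_antisymm h2 h3
      · rw [simple_of_ne r e1 e2]

/-- The Laurent polynomials that are symmetric in the variables of each block. -/
def IsSymm (g : Fin d → α) (f : Laurent k d) : Prop :=
  ∀ j, simple j ∈ fibreSubgroup g → permAut (simple j) f = f

theorem IsSymm.permAut_eq {g : Fin d → α} (hg : IntervalFibres g) {f : Laurent k d}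
    (h : IsSymm g f) {z : Perm (Fin d)} (hz : z ∈ fibreSubgroup g) : permAut z f = f := by
  obtain ⟨m, hm⟩ : ∃ m, len z = m := ⟨_, rfl⟩
  induction m generalizing z with
  | zero => rw [eq_one_of_len z hm, permAut_one]
  | succ m ih =>
    obtain ⟨r, hr⟩ : ∃ r, z (hi r) < z (lo r) := by
      by_contra hc
      push Not at hc
      rw [eq_one_of_no_descent z fun r => not_lt.mpr (hc r), len_one] at hm
      omega
    have hs := simple_mem_of_descent hg hz hr
    have h1 := len_mul_simple z r hr
    have h2 := ih (mul_mem hz hs) (by omega)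
    rwa [permAut_mul, h r hs] at h2

theorem IsSymm.coeff_comp {g : Fin d → α} (hg : IntervalFibres g) {f : Laurent k d}
    (h : IsSymm g f) {z : Perm (Fin d)} (hz : z ∈ fibreSubgroup g) (a : Fin d → ℤ) :
    f.coeff (a ∘ z) = f.coeff a := by
  rw [← coeff_permAut, h.permAut_eq hg hz]

/-- The space of symmetric Laurent polynomials. -/
noncomputable def symmSub (k : Type*) [Field k] {d : ℕ} (g : Fin d → α) :
    Submodule k (Laurent k d) where
  carrier := {f | IsSymm g f}
  zero_mem' := fun _ _ => map_zero _
  add_mem' := fun {f f'} h h' j hj => by rw [map_add, h j hj, h' j hj]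
  smul_mem' := fun t f h j hj => by rw [map_smul, h j hj]

/-- In a relation take an exponent a of largest norm. Its leading coefficient cannot be cancelled,
since another orbit of the same norm is disjoint and smaller norms do not reach it. -/
theorem linearIndependent_of_triangular {g : Fin d → α} (hg : IntervalFibres g)
    {F : (Fin d → ℤ) → Laurent k d}
    (hsupp : ∀ a, Dominant g a → ∀ b, (F a).coeff b ≠ 0 →
      nsq b < nsq a ∨ ∃ z ∈ fibreSubgroup g, b = a ∘ z)
    (hlead : ∀ a, Dominant g a → ∃ z ∈ fibreSubgroup g, (F a).coeff (a ∘ z) ≠ 0) :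
    LinearIndependent k fun a : {a // Dominant g a} => F a.1 := by
  classical
  rw [linearIndependent_iff']
  intro s t hst
  by_contra hc
  push Not at hc
  obtain ⟨a₁, ha₁, hta₁⟩ := hc
  obtain ⟨a, ha, hmax⟩ := Finset.exists_max_image (s.filter fun a => t a ≠ 0)
    (fun a => nsq a.1) ⟨a₁, Finset.mem_filter.mpr ⟨ha₁, hta₁⟩⟩
  have ha' := Finset.mem_filter.mp ha
  obtain ⟨z, hz, hza⟩ := hlead a.1 a.2
  have h1 := congrArg (fun f : Laurent k d => f.coeff (a.1 ∘ z)) hst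
  simp only [AddMonoidAlgebra.coeff_sum, AddMonoidAlgebra.coeff_zero, Finsupp.coe_zero,
    Pi.zero_apply, Finsupp.finset_sum_apply, AddMonoidAlgebra.coeff_smul, Finsupp.smul_apply] at h1
  rw [Finset.sum_eq_single a] at h1
  · exact (smul_ne_zero ha'.2 hza) h1
  · intro a' ha's hne
    by_contra h2
    have h3 : t a' ≠ 0 := fun e => h2 (by rw [e, zero_smul])
    have h4 : (F a'.1).coeff (a.1 ∘ z) ≠ 0 := fun e => h2 (by rw [e, smul_zero])
    rcases hsupp a'.1 a'.2 _ h4 with h5 | ⟨z', hz', e⟩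
    · rw [nsq_comp] at h5
      exact absurd (hmax a' (Finset.mem_filter.mpr ⟨ha's, h3⟩)) (not_le.mpr h5)
    · refine hne (Subtype.ext (a'.2.eq hg a.2 (mul_mem hz' (inv_mem hz)) ?_).symm)
      ext i
      have := congrFun e (z⁻¹ i)
      simp only [Function.comp_apply, perm_apply_inv] at this
      rw [this]
      rfl
  · intro h; exact absurd ha'.1 h

/-- Induction on a bound for the norms: the exponents of maximal norm of a symmetric polynomial form
orbits, and subtracting multiples of F for their dominant representatives removes them. -/
theorem span_of_triangular {g : Fin d → α} (hg : IntervalFibres g)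
    {F : (Fin d → ℤ) → Laurent k d}
    (hsymm : ∀ a, Dominant g a → IsSymm g (F a))
    (hsupp : ∀ a, Dominant g a → ∀ b, (F a).coeff b ≠ 0 →
      nsq b < nsq a ∨ ∃ z ∈ fibreSubgroup g, b = a ∘ z)
    (hlead : ∀ a, Dominant g a → ∃ z ∈ fibreSubgroup g, (F a).coeff (a ∘ z) ≠ 0) :
    Submodule.span k (Set.range fun a : {a // Dominant g a} => F a.1) = symmSub k g := by
  classical
  refine le_antisymm ?_ ?_
  · rw [Submodule.span_le]
    rintro _ ⟨a, rfl⟩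
    exact hsymm a.1 a.2
  · intro f hf
    have key : ∀ N : ℕ, ∀ f ∈ symmSub k g, (∀ b, f.coeff b ≠ 0 → nsq b < N) →
        f ∈ Submodule.span k (Set.range fun a : {a // Dominant g a} => F a.1) := by
      intro N
      induction N with
      | zero =>
        intro f _ h
        have : f = 0 := by
          ext b
          by_contra hb
          have h1 := h b hb
          have h2 : 0 ≤ nsq b := Finset.sum_nonneg fun i _ => sq_nonneg _
          simp only [Nat.cast_zero] at h1
          omega
        rw [this]
        exact zero_mem _
      | succ N ih =>
        intro f hf h
        choose! z hz hza using hlead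
        set A := f.coeff.support.filter fun a => Dominant g a ∧ nsq a = N with hA
        set f' := ∑ a ∈ A, (f.coeff a / (F a).coeff (a ∘ z a)) • F a with hf'
        have hA' : ∀ a ∈ A, f.coeff a ≠ 0 ∧ Dominant g a ∧ nsq a = N := fun a ha => by
          have := Finset.mem_filter.mp ha
          exact ⟨Finsupp.mem_support_iff.mp this.1, this.2⟩
        have h1 : f' ∈ Submodule.span k (Set.range fun a : {a // Dominant g a} => F a.1) :=
          sum_mem fun a ha => Submodule.smul_mem _ _
            (Submodule.subset_span ⟨⟨a, (hA' a ha).2.1⟩, rfl⟩)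
        have h2 : f' ∈ symmSub k g := sum_mem fun a ha => Submodule.smul_mem _ _
          (hsymm a (hA' a ha).2.1)
        have h3 := ih (f - f') (sub_mem hf h2) fun b hb => ?_
        · have := add_mem h3 h1
          rwa [sub_add_cancel] at this
        · have hc : ∀ b, f'.coeff b = ∑ a ∈ A, (f.coeff a / (F a).coeff (a ∘ z a)) * (F a).coeff b :=
            fun b => by simp [hf']
          have hle : nsq b < N + 1 := by
            by_cases hfb : f.coeff b = 0
            · have h4 : f'.coeff b ≠ 0 := fun e => hb (by simp [hfb, e])
              rw [hc] at h4
              obtain ⟨a, ha, h5⟩ := Finset.exists_ne_zero_of_sum_ne_zero h4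
              have h6 := hA' a ha
              rcases hsupp a h6.2.1 b (right_ne_zero_of_mul h5) with h7 | ⟨y, _, rfl⟩
              · omega
              · rw [nsq_comp]; omega
            · have := h b hfb
              push_cast at this
              exact this
          refine lt_of_le_of_ne (Int.lt_add_one_iff.mp hle) fun hbN => hb ?_
          -- By symmetry the coefficient at b equals the one at the dominant exponent a of its
          -- orbit. There only the term F a of the correction contributes.
          obtain ⟨y, hy, hdom⟩ := exists_dominant g b
          set a := b ∘ y with ha
          have hba : b = a ∘ ⇑y⁻¹ := by ext i; simp [ha]
          have haN : nsq a = N := by rw [ha, nsq_comp, hbN]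
          have e1 : (f - f').coeff b = (f - f').coeff a :=
            (((sub_mem hf h2 : f - f' ∈ symmSub k g) : IsSymm g (f - f')).coeff_comp hg hy b).symm
          rw [e1]
          have e2 : ∀ a' ∈ A, a' ≠ a → (F a').coeff a = 0 := by
            intro a' ha' hne
            by_contra h8
            have h9 := hA' a' ha'
            rcases hsupp a' h9.2.1 a h8 with h10 | ⟨y', hy', h10⟩
            · omega
            · exact hne (h9.2.1.eq hg hdom hy' h10).symm
          rw [AddMonoidAlgebra.coeff_sub, Finsupp.sub_apply, hc]
          by_cases haA : a ∈ A
          · rw [Finset.sum_eq_single a (fun a' h1 h2 => by rw [e2 a' h1 h2, mul_zero])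
              (fun h => absurd haA h), ← (hsymm a hdom).coeff_comp hg (hz a hdom) a,
              div_mul_cancel₀ _ (hza a hdom), sub_self]
          · rw [Finset.sum_eq_zero fun a' h1 => by
              rw [e2 a' h1 (fun e => haA (e ▸ h1)), mul_zero], sub_zero]
            by_contra h8
            exact haA (Finset.mem_filter.mpr ⟨Finsupp.mem_support_iff.mpr h8, hdom, haN⟩)
    obtain ⟨N, hN⟩ : ∃ N : ℕ, ∀ b ∈ f.coeff.support, nsq b < N := by
      refine ⟨(∑ b ∈ f.coeff.support, nsq b).toNat + 1, fun b hb => ?_⟩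
      have h1 : nsq b ≤ ∑ b ∈ f.coeff.support, nsq b :=
        Finset.single_le_sum (f := nsq) (fun b _ => Finset.sum_nonneg fun i _ => sq_nonneg _) hb
      have h2 := Int.self_le_toNat (∑ b ∈ f.coeff.support, nsq b)
      push_cast
      linarith
    exact key N f hf fun b hb => hN b (Finsupp.mem_support_iff.mpr hb)

end SymmetricLaurent

/-! ### Symmetrization of Laurent monomials -/

section Symmetrization

variable {k : Type*} [Field k] {d : ℕ} {α : Type*}

/-- The fibres of `g` on which moreover `a` is constant. -/
abbrev withExp (g : Fin d → α) (a : Fin d → ℤ) (i : Fin d) : α × ℤ := (g i, a i)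

theorem Dominant.intervalFibres {g : Fin d → α} (hg : IntervalFibres g) {a : Fin d → ℤ}
    (h : Dominant g a) : IntervalFibres (withExp g a) := by
  intro i j m hij hjm e
  obtain ⟨e1, e2⟩ := Prod.ext_iff.mp e
  simp only at e1 e2
  have e3 := hg i j m hij hjm e1
  have h1 := h.le hg hij e3.symm
  have h2 := h.le hg hjm (e3.trans e1)
  exact Prod.ext e3 (le_antisymm (h2.trans e2.ge) h1)

theorem withExp_le (g : Fin d → α) (a : Fin d → ℤ) :
    fibreSubgroup (withExp g a) ≤ fibreSubgroup g :=
  fibre_le_iff.mpr fun _ _ e => (Prod.ext_iff.mp e).1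

/-- The symmetrization of the monomial `x^a` over the orbit of `a`. -/
noncomputable def symmMon (q : k) (g : Fin d → α) (a : Fin d → ℤ) : Laurent k d :=
  ∑ y ∈ minReps (withExp g a) g, (-q)⁻¹ ^ len y • rhoWord q (redWord y) (mon k a)

/-- The exponents of smaller norm and those obtained from `a` by a permutation of length less
than `l`. -/
def expBelow (g : Fin d → α) (a : Fin d → ℤ) (l : ℕ) : Set (Fin d → ℤ) :=
  {b | nsq b < nsq a ∨ ∃ z ∈ fibreSubgroup g, len z < l ∧ b = a ∘ z}

theorem expBelow_mono {g : Fin d → α} {a : Fin d → ℤ} {l l' : ℕ} (h : l ≤ l') :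
    expBelow g a l ⊆ expBelow g a l' := by
  rintro b (hb | ⟨z, hz, hl, e⟩)
  · exact Or.inl hb
  · exact Or.inr ⟨z, hz, hl.trans_le h, e⟩

theorem rho_mem_expBelow (q : k) {g : Fin d → α} {a : Fin d → ℤ} {l : ℕ} {j : Fin (d - 1)}
    (hj : simple j ∈ fibreSubgroup g) {f : Laurent k d} (hf : f ∈ suppIn k (expBelow g a l)) :
    rho q j f ∈ suppIn k (expBelow g a (l + 1)) := by
  refine map_mem_of_suppIn (rho q j) _ (fun b hb => rho_mon_mem q (expBelow_mono l.le_succ hb) ?_ ?_)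
    hf
  · rcases hb with hb | ⟨z, hz, hl, e⟩
    · left; rwa [nsq_comp]
    · refine Or.inr ⟨z * simple j, mul_mem hz hj, ?_, ?_⟩
      · have := len_mul_simple_le z j; omega
      · rw [e]; rfl
  · intro b' hb'
    left
    rcases hb with hb | ⟨z, _, _, e⟩
    · exact lt_trans hb' hb
    · rw [e] at hb'
      simpa [nsq_comp] using hb'

/-- Along a reduced word of a shortest representative, each letter exchanges two strictly increasing
exponents. It produces minus the exchanged monomial and, beyond that, only exponents of smaller norm
or reached by shorter permutations. -/
theorem rhoWord_mon_sub_mem (q : k) {g : Fin d → α} (hg : IntervalFibres g) {a : Fin d → ℤ}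
    (ha : Dominant g a) (L : List (Fin (d - 1))) : ∀ y, IsReducedWord y L →
      y ∈ minReps (withExp g a) g →
      rhoWord q L (mon k a) - (-1 : k) ^ len y • mon k (a ∘ y) ∈ suppIn k (expBelow g a (len y)) := by
  induction L using List.reverseRecOn with
  | nil =>
    intro y hy _
    have : y = 1 := hy.1.symm
    subst this
    simp [rhoWord, len_one]
  | append_singleton A r ih =>
    intro y hy hmem
    obtain ⟨h1, h2⟩ := hy.of_snoc
    obtain ⟨hyg, hym⟩ := mem_minReps.mp hmem
    have hr := simple_mem_of_descent hg hyg h2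
    have hl := len_mul_simple y r h2
    have hf := ha.intervalFibres hg
    set y' := y * simple r with hy'
    have hyy : y = y' * simple r := (mul_simple_mul_simple y r).symm
    have hmem' : y' ∈ minReps (withExp g a) g := mem_minReps.mpr ⟨mul_mem hyg hr,
      (monoFib_mul_simple_or hf hym r).resolve_right fun h => absurd h.1 (not_lt.mpr h2.le)⟩
    have h3 := ih y' h1 hmem'
    have e1 : y' (lo r) = y (hi r) := by rw [hy', Perm.mul_apply, simple_lo]
    have e2 : y' (hi r) = y (lo r) := by rw [hy', Perm.mul_apply, simple_hi]
    -- Dominance gives the weak inequality. Equality would contradict that y is shortest in its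
    -- coset of the stabilizer of a.
    have hlt : (a ∘ y') (lo r) < (a ∘ y') (hi r) := by
      have e3 : g (y (hi r)) = g (y (lo r)) := by
        rw [hyg, hyg, simple_mem_fibreSubgroup.mp hr]
      simp only [Function.comp_apply, e1, e2]
      refine lt_of_le_of_ne (ha.le hg h2.le e3) fun e4 => ?_
      have := hym _ _ h2 (Prod.ext e3 e4)
      rw [perm_inv_apply, perm_inv_apply] at this
      exact absurd this (not_lt.mpr (lo_lt_hi r).le)
    have h4 := rho_mem_expBelow q hr h3
    have h5 := rho_mon_lt q hlt
    rw [nsq_comp] at h5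
    have h6 : {b' | nsq b' < nsq a} ⊆ expBelow g a (len y) := fun b hb => Or.inl hb
    have h7 := Submodule.smul_mem _ ((-1 : k) ^ len y') (suppIn_mono h6 h5)
    have h8 : mon k (a ∘ y') ∈ suppIn k (expBelow g a (len y)) :=
      mon_mem_suppIn (Or.inr ⟨y', (mem_minReps.mp hmem').1, by omega, rfl⟩)
    rw [← hl] at h4
    have h9 := add_mem (add_mem h4 h7)
      (Submodule.smul_mem _ ((-1 : k) ^ len y' * (q - 1)) h8)
    rw [rhoWord_append_singleton]
    convert h9 using 1
    have e5 : (a ∘ y') ∘ simple r = a ∘ y := by rw [hyy]; rfl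
    rw [map_sub, map_smul, e5, hl, pow_succ]
    module

theorem symmMon_mem (q : k) {g : Fin d → α} (hg : IntervalFibres g) {a : Fin d → ℤ}
    (ha : Dominant g a) (b : Fin d → ℤ) (hb : (symmMon q g a).coeff b ≠ 0) :
    nsq b < nsq a ∨ ∃ z ∈ fibreSubgroup g, b = a ∘ z := by
  by_contra hc
  have key : symmMon q g a ∈ suppIn k {b | nsq b < nsq a ∨ ∃ z ∈ fibreSubgroup g, b = a ∘ z} := by
    refine sum_mem fun y hy => Submodule.smul_mem _ _ ?_
    have h1 := rhoWord_mon_sub_mem q hg ha _ y (redWord_spec y) hy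
    have h2 : expBelow g a (len y) ⊆ {b | nsq b < nsq a ∨ ∃ z ∈ fibreSubgroup g, b = a ∘ z} := by
      rintro b (hb | ⟨z, hz, -, e⟩)
      · exact Or.inl hb
      · exact Or.inr ⟨z, hz, e⟩
    have h3 := add_mem (suppIn_mono h2 h1) (Submodule.smul_mem _ ((-1 : k) ^ len y)
      (mon_mem_suppIn (k := k) (Or.inr ⟨y, (mem_minReps.mp hy).1, rfl⟩)))
    rwa [sub_add_cancel] at h3
  exact hb (key b hc)

/-- For the longest representative y₀ the exponent a ∘ y₀ is reached only by permutations that are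
at least as long as y₀. Hence the other summands have no such term. -/
theorem symmMon_lead {q : k} (hq : q ≠ 0) {g : Fin d → α} (hg : IntervalFibres g) {a : Fin d → ℤ}
    (ha : Dominant g a) : ∃ z ∈ fibreSubgroup g, (symmMon q g a).coeff (a ∘ z) ≠ 0 := by
  classical
  obtain ⟨y0, hy0, hmax⟩ := Finset.exists_max_image (minReps (withExp g a) g) len
    ⟨1, one_mem_minReps _ _⟩
  have hf := ha.intervalFibres hg
  have h0 := mem_minReps.mp hy0
  have key : ∀ z ∈ fibreSubgroup g, a ∘ z = a ∘ y0 → ∃ x ∈ fibreSubgroup (withExp g a),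
      z = x * y0 := by
    intro z hz e
    refine ⟨z * y0⁻¹, fun i => ?_, by group⟩
    have h1 := congrFun e (y0⁻¹ i)
    simp only [Function.comp_apply, perm_apply_inv] at h1
    exact Prod.ext (mul_mem hz (inv_mem h0.1) i) h1
  refine ⟨y0, h0.1, ?_⟩
  have hc : ∀ y ∈ minReps (withExp g a) g,
      (rhoWord q (redWord y) (mon k a)).coeff (a ∘ y0) = if y = y0 then (-1 : k) ^ len y else 0 := by
    intro y hy
    have hy' := mem_minReps.mp hy
    have h1 := rhoWord_mon_sub_mem q hg ha _ y (redWord_spec y) hy (a ∘ y0) (by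
      rintro (h | ⟨z, hz, hl, e⟩)
      · rw [nsq_comp] at h; exact lt_irrefl _ h
      · obtain ⟨x, hx, rfl⟩ := key z hz e.symm
        rw [len_mul_of_monoFib hf hx h0.2] at hl
        have := hmax y hy
        omega)
    rw [AddMonoidAlgebra.coeff_sub, Finsupp.sub_apply, sub_eq_zero] at h1
    rw [h1, AddMonoidAlgebra.coeff_smul, Finsupp.smul_apply, coeff_mon]
    by_cases h2 : y = y0
    · subst h2; simp
    · rw [if_neg h2, if_neg, smul_zero]
      intro e
      obtain ⟨x, hx, e'⟩ := key y hy'.1 e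
      have := eq_one_of_monoFib hf hx h0.2 (by rw [← e']; exact hy'.2)
      rw [this, one_mul] at e'
      exact h2 e'
  have h1 : (symmMon q g a).coeff (a ∘ y0) = (-q)⁻¹ ^ len y0 * (-1) ^ len y0 := by
    unfold symmMon
    simp only [AddMonoidAlgebra.coeff_sum, Finsupp.finset_sum_apply, AddMonoidAlgebra.coeff_smul,
      Finsupp.smul_apply, smul_eq_mul]
    rw [Finset.sum_eq_single y0]
    · rw [hc y0 hy0, if_pos rfl]
    · intro y hy hne
      rw [hc y hy, if_neg hne, mul_zero]
    · intro h; exact absurd hy0 h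
  rw [h1]
  exact mul_ne_zero (pow_ne_zero _ (inv_ne_zero (neg_ne_zero.mpr hq)))
    (pow_ne_zero _ (neg_ne_zero.mpr one_ne_zero))

end Symmetrization

/-! ### Sign vectors and their polynomial multiples. -/

section SignModules

variable {k : Type*} [Field k] {ℓ d : ℕ} {q : k} {Q : Fin ℓ → k} {α : Type*}

local notation "𝐞" c:max => heckeGen q Q (Gen.e c)
local notation "𝐓" r:max => heckeGen q Q (Gen.T r)

/-- `v` spans a sign representation of the finite Hecke algebra of `S_g`. -/
def IsSign (q : k) (Q : Fin ℓ → k) (c : ColourSeq ℓ d) (g : Fin d → α) (v : Hecke q Q d) : Prop :=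
  v * heckeGen q Q (Gen.e c) = v ∧
    ∀ t, simple t ∈ fibreSubgroup g → v * stdElt q Q c c (simple t) = -v

/-- When T_t is moved to the left through f, it meets v and becomes -1. What remains of the
commutation relation is the operator `rho`. -/
theorem IsSign.mul_phi_mul_simple {c : ColourSeq ℓ d} {g : Fin d → α} (h : Blocked c g)
    {v : Hecke q Q d} (hv : IsSign q Q c g v) {t : Fin (d - 1)} (ht : simple t ∈ fibreSubgroup g)
    (f : Laurent k d) :
    v * phi q Q f * stdElt q Q c c (simple t) = v * phi q Q (rho q t f) := by
  obtain ⟨r, h1, h2, h3⟩ := h.adj q Q ht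
  have h4 := hv.2 t ht
  rw [h3] at h4 ⊢
  have e1 : 𝐓 r * phi q Q (permAut (simple t) f) * 𝐞 c =
      𝐓 r * 𝐞 c * phi q Q (permAut (simple t) f) := by
    rw [mul_assoc, phi_mul_e, ← mul_assoc]
  rw [mul_assoc, ← mul_assoc (phi q Q f), phi_T_e q Q h1 h2, divDiff_simple, map_neg, e1, mul_sub,
    ← mul_assoc, h4, rho_apply, map_sub, map_smul, mul_sub, mul_smul_comm, mul_smul_comm, neg_mul,
    neg_mul, mul_neg, smul_neg, phi_mul_e, ← mul_assoc, hv.1]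
  abel

theorem IsSign.mul_phi_mul_stdElt {c : ColourSeq ℓ d} {g : Fin d → α} (h : Blocked c g)
    {v : Hecke q Q d} (hv : IsSign q Q c g v) (f : Laurent k d) (L : List (Fin (d - 1))) :
    ∀ y, IsReducedWord y L → y ∈ fibreSubgroup g →
      v * phi q Q f * stdElt q Q c c y = v * phi q Q (rhoWord q L f) := by
  induction L using List.reverseRecOn with
  | nil =>
    intro y hy _
    have : y = 1 := hy.1.symm
    rw [this, stdElt_one, mul_assoc, phi_mul_e, ← mul_assoc, hv.1]
    rfl
  | append_singleton A r ih =>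
    intro y hy hyg
    obtain ⟨h1, h2⟩ := hy.of_snoc
    have hr := simple_mem_of_descent h.1 hyg h2
    have h3 := (heckeFam_stdElt q Q h).mul_simple _ (mul_mem hyg hr) r hr (by
      rw [Perm.mul_apply, Perm.mul_apply, simple_lo, simple_hi]; exact h2)
    rw [mul_simple_mul_simple] at h3
    rw [← h3, ← mul_assoc, ih _ h1 (mul_mem hyg hr), hv.mul_phi_mul_simple h hr,
      rhoWord_append_singleton]

theorem IsSign.mul_stdElt {c : ColourSeq ℓ d} {g : Fin d → α} (h : Blocked c g)
    {v : Hecke q Q d} (hv : IsSign q Q c g v) : ∀ y ∈ fibreSubgroup g,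
      v * stdElt q Q c c y = (-1 : k) ^ len y • v := by
  intro y hy
  obtain ⟨m, hm⟩ : ∃ m, len y = m := ⟨_, rfl⟩
  induction m generalizing y with
  | zero => rw [eq_one_of_len y hm, stdElt_one, hv.1, len_one, pow_zero, one_smul]
  | succ m ih =>
    obtain ⟨r, hr⟩ : ∃ r, y (hi r) < y (lo r) := by
      by_contra hc
      push Not at hc
      rw [eq_one_of_no_descent y fun r => not_lt.mpr (hc r), len_one] at hm
      omega
    have hs := simple_mem_of_descent h.1 hy hr
    have h1 := len_mul_simple y r hr
    have h3 := (heckeFam_stdElt q Q h).mul_simple _ (mul_mem hy hs) r hs (by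
      rw [Perm.mul_apply, Perm.mul_apply, simple_lo, simple_hi]; exact hr)
    rw [mul_simple_mul_simple] at h3
    rw [← h3, ← mul_assoc, ih _ (mul_mem hy hs) (by omega), h1, pow_succ, smul_mul_assoc,
      hv.2 r hs]
    module

theorem IsSign.mul_symmMon {c : ColourSeq ℓ d} {g : Fin d → α} (h : Blocked c g)
    {v : Hecke q Q d} (hv : IsSign q Q c g v) (a : Fin d → ℤ) :
    v * phi q Q (mon k a) * signSum q (stdElt q Q c c) (minReps (withExp g a) g) =
      v * phi q Q (symmMon q g a) := by
  rw [signSum, symmMon, map_sum, Finset.mul_sum, Finset.mul_sum]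
  refine Finset.sum_congr rfl fun y hy => ?_
  rw [mul_smul_comm, hv.mul_phi_mul_stdElt h _ _ y (redWord_spec y) (mem_minReps.mp hy).1,
    map_smul, mul_smul_comm]

/-- Symmetry is proved in the Hecke algebra. The element v x^a is a sign vector for the stabilizer
of a, and the signed sum induces it to a sign vector for S_g. Since f ↦ v f is injective, the sign
condition descends to the polynomial. -/
theorem IsSign.symmMon {c : ColourSeq ℓ d} {g : Fin d → α} (hq : q ≠ 0) (h : Blocked c g)
    {v : Hecke q Q d} (hv : IsSign q Q c g v) (hf : ∀ f : Laurent k d, v * phi q Q f = 0 → f = 0)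
    {a : Fin d → ℤ} (ha : Dominant g a) : IsSymm g (symmMon q g a) := by
  intro j hj
  rw [← rho_eq_neg_iff (q := q), ← sub_eq_zero]
  refine hf _ ?_
  rw [map_sub, mul_sub, ← hv.mul_phi_mul_simple h hj, map_neg, mul_neg, sub_neg_eq_add,
    ← hv.mul_symmMon h, ← eq_neg_iff_add_eq_zero]
  refine mul_signSum_mul_simple hq (heckeFam_stdElt q Q h) h.1 (ha.intervalFibres h.1)
    (withExp_le g a) (fun t ht => ?_) hj
  rw [hv.mul_phi_mul_simple h (withExp_le g a ht), ← mul_neg, ← map_neg]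
  congr 2
  rw [rho_eq_neg_iff, permAut_simple_mon]
  congr 1
  ext i
  have h1 := (Prod.ext_iff.mp (simple_mem_fibreSubgroup.mp ht)).2
  simp only at h1
  simp only [Function.comp_apply]
  by_cases e1 : i = lo t
  · rw [e1, simple_lo, h1]
  · by_cases e2 : i = hi t
    · rw [e2, simple_hi, h1]
    · rw [simple_of_ne t e1 e2]

theorem linearIndependent_symmMon {g : Fin d → α} (hq : q ≠ 0) (hg : IntervalFibres g) :
    LinearIndependent k fun a : {a // Dominant g a} => symmMon q g a.1 :=
  linearIndependent_of_triangular hg (fun _ ha => symmMon_mem q hg ha)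
    (fun _ ha => symmMon_lead hq hg ha)

theorem IsSign.span_symmMon {c : ColourSeq ℓ d} {g : Fin d → α} (hq : q ≠ 0) (h : Blocked c g)
    {v : Hecke q Q d} (hv : IsSign q Q c g v) (hf : ∀ f : Laurent k d, v * phi q Q f = 0 → f = 0) :
    Submodule.span k (Set.range fun a : {a // Dominant g a} => HigherSchur.symmMon q g a.1) =
      symmSub k g :=
  span_of_triangular h.1 (fun _ ha => hv.symmMon hq h hf ha)
    (fun _ ha => symmMon_mem q h.1 ha) (fun _ ha => symmMon_lead hq h.1 ha)

end SignModules

/-! ### The right ideals generated by sign elements -/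

section SignIdeals

variable {k : Type*} [Field k] {ℓ d : ℕ} (q : k) (Q : Fin ℓ → k) {α β : Type*}

local notation "𝐞" c:max => heckeGen q Q (Gen.e c)

/-- The sign element of the finite Hecke algebra of `S_g`, with the coefficient of `1` equal
to `1`. -/
noncomputable def signElt (c : ColourSeq ℓ d) (g : Fin d → α) : Hecke q Q d :=
  signSum q (stdElt q Q c c) (allReps g)

/-- The intersection of two Young subgroups, conjugated by `w`, is given by this function. -/
abbrev meet (f : Fin d → β) (g : Fin d → α) (w : Perm (Fin d)) (i : Fin d) : α × β := (g i, f (w i))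

theorem meet_le (f : Fin d → β) (g : Fin d → α) (w : Perm (Fin d)) :
    fibreSubgroup (meet f g w) ≤ fibreSubgroup g :=
  fibre_le_iff.mpr fun _ _ e => (Prod.ext_iff.mp e).1

theorem Blocked.mono {c : ColourSeq ℓ d} {g : Fin d → α} (h : Blocked c g) {g' : Fin d → β}
    (hg' : IntervalFibres g') (hle : fibreSubgroup g' ≤ fibreSubgroup g) : Blocked c g' :=
  ⟨hg', fun j hj => h.2 j (hle hj)⟩

theorem LocalMin.blocked {c : ColourSeq ℓ d} {f : Fin d → β} {g : Fin d → α} (hf : IntervalFibres f)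
    (h : Blocked c g) {w : Perm (Fin d)} (hw : LocalMin f g w) : Blocked c (meet f g w) :=
  h.mono (hw.intervalFibres hf h.1) (meet_le f g w)

theorem conj_mem_of_mem_meet {f : Fin d → β} {g : Fin d → α} {w z : Perm (Fin d)}
    (hz : z ∈ fibreSubgroup (meet f g w)) : w * z * w⁻¹ ∈ fibreSubgroup f := by
  intro i
  have := (Prod.ext_iff.mp (hz (w⁻¹ i))).2
  simp only [perm_apply_inv] at this
  rw [Perm.mul_apply, Perm.mul_apply, this]

/-- Both sides of w z = (w z w⁻¹) w have additive lengths. -/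
theorem LocalMin.len_conj {f : Fin d → β} {g : Fin d → α} (hf : IntervalFibres f)
    (hg : IntervalFibres g) {w z : Perm (Fin d)} (hw : LocalMin f g w)
    (hz : z ∈ fibreSubgroup (meet f g w)) : len (w * z * w⁻¹) = len z := by
  have h1 := len_mul_of_monoFib' hg (meet_le f g w hz) hw.1
  have h2 := len_mul_of_monoFib hf (conj_mem_of_mem_meet hz) hw.2
  rw [inv_mul_cancel_right, h1] at h2
  omega

/-- A choice of reduced words for the shortest double coset representatives that commute with the
finite Hecke algebras. -/
structure IsChoice (b c : ColourSeq ℓ d) (f : Fin d → β) (g : Fin d → α)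
    (D : Perm (Fin d) → List (Fin (ℓ + d - 1))) : Prop where
  reduced : ∀ w, LocalMin f g w → IsReducedWord (strandPerm b c w) (D w)
  inter : ∀ w, LocalMin f g w → ∀ z ∈ fibreSubgroup (meet f g w),
    tw q Q (D w) * 𝐞 c * stdElt q Q c c z = stdElt q Q b b (w * z * w⁻¹) * (tw q Q (D w) * 𝐞 c)

variable {q Q}

theorem isSign_signElt {c : ColourSeq ℓ d} {g : Fin d → α} (hq : q ≠ 0) (h : Blocked c g) :
    IsSign q Q c g (signElt q Q c g) := by
  refine ⟨?_, fun t ht => (heckeFam_stdElt q Q h).signSum_mul_simple hq h.1 ht⟩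
  rw [signElt, signSum, Finset.sum_mul]
  exact Finset.sum_congr rfl fun y _ => by rw [smul_mul_assoc, stdElt_mul_e]

theorem e_mul_signElt (c : ColourSeq ℓ d) (g : Fin d → α) :
    𝐞 c * signElt q Q c g = signElt q Q c g := by
  rw [signElt, signSum, Finset.mul_sum]
  exact Finset.sum_congr rfl fun y _ => by rw [mul_smul_comm, e_mul_stdElt]

open Classical in
/-- The shortest double coset representatives. -/
noncomputable def dmin (f : Fin d → β) (g : Fin d → α) : Finset (Perm (Fin d)) :=
  Finset.univ.filter fun w => LocalMin f g w

theorem mem_dmin {f : Fin d → β} {g : Fin d → α} {w : Perm (Fin d)} :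
    w ∈ dmin f g ↔ LocalMin f g w := by
  classical
  exact ⟨fun h => (Finset.mem_filter.mp h).2, fun h => Finset.mem_filter.mpr ⟨Finset.mem_univ _, h⟩⟩

/-- The three factors of a permutation with respect to double cosets. -/
structure IsDecomp (f : Fin d → β) (g : Fin d → α) (Z W U : Perm (Fin d) → Perm (Fin d)) :
    Prop where
  hz : ∀ v, Z v ∈ fibreSubgroup f
  hw : ∀ v, LocalMin f g (W v)
  hu : ∀ v, U v ∈ minReps (meet f g (W v)) g
  eq : ∀ v, v = Z v * W v * U v

theorem exists_isDecomp {f : Fin d → β} {g : Fin d → α} (hf : IntervalFibres f)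
    (hg : IntervalFibres g) : ∃ Z W U, IsDecomp f g Z W U := by
  choose Z hz W hw U hu hum h using exists_double_decomp hf hg
  exact ⟨Z, W, U, hz, hw, fun v => mem_minReps.mpr ⟨hu v, hum v⟩, h⟩

variable {f : Fin d → β} {g : Fin d → α} {Z W U : Perm (Fin d) → Perm (Fin d)}

theorem IsDecomp.unique (hD : IsDecomp f g Z W U) (hf : IntervalFibres f) (hg : IntervalFibres g)
    {z w u : Perm (Fin d)} (hz : z ∈ fibreSubgroup f) (hw : LocalMin f g w)
    (hu : u ∈ minReps (meet f g w) g) :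
    Z (z * w * u) = z ∧ W (z * w * u) = w ∧ U (z * w * u) = u := by
  have h1 := mem_minReps.mp hu
  have h2 := mem_minReps.mp (hD.hu (z * w * u))
  obtain ⟨e1, e2, e3⟩ := double_decomp_unique hf hg hz hw h1.1 h1.2 (hD.hz _) (hD.hw _) h2.1 h2.2
    (hD.eq (z * w * u))
  exact ⟨e1.symm, e2.symm, e3.symm⟩

theorem IsDecomp.sum_eq (hD : IsDecomp f g Z W U) (hf : IntervalFibres f) (hg : IntervalFibres g)
    {M : Type*} [AddCommMonoid M] (G : Perm (Fin d) → Perm (Fin d) → Perm (Fin d) → M) :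
    ∑ v, G (Z v) (W v) (U v) =
      ∑ w ∈ dmin f g, ∑ u ∈ minReps (meet f g w) g, ∑ z ∈ allReps f, G z w u := by
  rw [Finset.sum_sigma', Finset.sum_sigma']
  refine Finset.sum_nbij' (fun v => ⟨⟨W v, U v⟩, Z v⟩) (fun x => x.2 * x.1.1 * x.1.2) ?_ ?_ ?_ ?_ ?_
  · intro v _
    simp only [Finset.mem_sigma]
    exact ⟨⟨mem_dmin.mpr (hD.hw v), hD.hu v⟩, mem_allReps.mpr (hD.hz v)⟩
  · intro x _; exact Finset.mem_univ _
  · intro v _; exact (hD.eq v).symm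
  · rintro ⟨⟨w, u⟩, z⟩ h
    simp only [Finset.mem_sigma] at h
    obtain ⟨e1, e2, e3⟩ := hD.unique hf hg (mem_allReps.mp h.2) (mem_dmin.mp h.1.1) h.1.2
    simp only [e1, e2, e3]
  · intro v _; rfl

variable {b c : ColourSeq ℓ d} {D : Perm (Fin d) → List (Fin (ℓ + d - 1))}

/-- These words adapt the basis theorem to double cosets: the polynomial is inserted between the
words of z w and of u. -/
theorem IsDecomp.isReducedWord (hD : IsDecomp f g Z W U) (hb : Blocked b f) (hc : Blocked c g)
    (hch : IsChoice q Q b c f g D) (v : Perm (Fin d)) :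
    IsReducedWord (strandPerm b c v)
      ((redWord (strandPerm b b (Z v)) ++ D (W v)) ++ redWord (strandPerm c c (U v))) := by
  have hw := hD.hw v
  have hu := mem_minReps.mp (hD.hu v)
  have h1 := len_strandPerm_mul_left (c := c) hb (hD.hz v) (hw.monoFib_mul hc.1 hu.1 hu.2)
  have h2 := len_strandPerm_mul_right (b := b) hc hu.1 hw.1
  have r1 := (hch.reduced _ hw).append (redWord_spec (strandPerm c c (U v)))
    (by rw [strandPerm_mul, h2])
  rw [strandPerm_mul] at r1
  have r2 := (redWord_spec (strandPerm b b (Z v))).append r1 (by rw [strandPerm_mul, h1])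
  rw [strandPerm_mul, ← mul_assoc (Z v), ← hD.eq v] at r2
  rwa [List.append_assoc]

theorem tw_redWord_mul_e (b c : ColourSeq ℓ d) (w : Perm (Fin d)) :
    tw q Q (redWord (strandPerm b c w)) * 𝐞 c = stdElt q Q b c w := rfl

theorem tw_mul_e_of_isReducedWord {w : Perm (Fin d)} {L : List (Fin (ℓ + d - 1))}
    (h : IsReducedWord (strandPerm b c w) L) : tw q Q L * 𝐞 c = 𝐞 b * tw q Q L := by
  rw [tw_mul_e, h.1, act_strandPerm]

/-- The factors of a basis element of the Hecke algebra. -/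
theorem tw_phi_tw_eq {z w u : Perm (Fin d)} {L : List (Fin (ℓ + d - 1))}
    (h : IsReducedWord (strandPerm b c w) L) (p : Laurent k d) :
    tw q Q (redWord (strandPerm b b z) ++ L) * phi q Q p * tw q Q (redWord (strandPerm c c u)) * 𝐞 c
      = stdElt q Q b b z * (tw q Q L * 𝐞 c) * phi q Q p * stdElt q Q c c u := by
  have h1 : tw q Q L * 𝐞 c = 𝐞 b * (tw q Q L * 𝐞 c) := by
    rw [tw_mul_e_of_isReducedWord h, ← mul_assoc, e_mul_e]
  have h2 : 𝐞 c * phi q Q p * stdElt q Q c c u = phi q Q p * stdElt q Q c c u := by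
    rw [← phi_mul_e, mul_assoc, e_mul_stdElt]
  have h3 : stdElt q Q b b z * (tw q Q L * 𝐞 c) =
      tw q Q (redWord (strandPerm b b z)) * (tw q Q L * 𝐞 c) := by
    rw [← tw_redWord_mul_e, mul_assoc, ← h1]
  rw [h3, mul_assoc _ (tw q Q (redWord (strandPerm c c u))), tw_redWord_mul_e, tw_append]
  simp only [mul_assoc] at h2 ⊢
  rw [h2]

/-- The generators of the sign ideals that belong to double cosets. -/
noncomputable def dcGen (q : k) (Q : Fin ℓ → k) (b c : ColourSeq ℓ d) (f : Fin d → β)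
    (D : Perm (Fin d) → List (Fin (ℓ + d - 1))) (w : Perm (Fin d)) : Hecke q Q d :=
  signElt q Q b f * (tw q Q (D w) * heckeGen q Q (Gen.e c))

/-- The intertwining property moves T_t to the left of T_w, where it becomes T of the conjugate of
t. This conjugate has length one and lies in S_f, so the sign element turns it into -1. -/
theorem IsChoice.isSign (hq : q ≠ 0) (hb : Blocked b f) (hc : Blocked c g)
    (hch : IsChoice q Q b c f g D) {w : Perm (Fin d)} (hw : LocalMin f g w) :
    IsSign q Q c (meet f g w) (dcGen q Q b c f D w) := by
  refine ⟨by rw [dcGen, mul_assoc, mul_assoc, e_mul_e], fun t ht => ?_⟩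
  rw [dcGen, mul_assoc, hch.inter w hw _ ht, ← mul_assoc,
    (isSign_signElt hq hb).mul_stdElt hb _ (conj_mem_of_mem_meet ht), hw.len_conj hb.1 hc.1 ht,
    len_simple, pow_one, neg_one_smul, neg_mul]

/-- In the basis adapted to v = z w u the sign element on the left absorbs T_z with the sign
(-1)^{l(z)}. So only the double coset representatives w and the representatives u remain. -/
theorem IsChoice.exists_eq (hq : q ≠ 0) (hb : Blocked b f) (hc : Blocked c g)
    (hch : IsChoice q Q b c f g D) (h : Hecke q Q d) :
    ∃ F : Perm (Fin d) → Perm (Fin d) → Laurent k d, signElt q Q b f * h * 𝐞 c =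
      ∑ w ∈ dmin f g, ∑ u ∈ minReps (meet f g w) g,
        dcGen q Q b c f D w * phi q Q (F w u) * stdElt q Q c c u := by
  obtain ⟨Z, W, U, hD⟩ := exists_isDecomp hb.1 hc.1
  obtain ⟨N, hN⟩ := exists_mem_flt h
  obtain ⟨p, hp, -⟩ := exists_pbw (hD.isReducedWord hb hc hch) hN
  have hs := isSign_signElt (Q := Q) hq hb
  refine ⟨fun w u => ∑ z ∈ allReps f, (-1 : k) ^ len z • p (z * w * u), ?_⟩
  have h1 : signElt q Q b f * h * 𝐞 c = signElt q Q b f * (𝐞 b * h * 𝐞 c) := by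
    rw [← mul_assoc, ← mul_assoc, hs.1]
  rw [h1, hp, Finset.mul_sum]
  have h2 : ∀ v, signElt q Q b f * (tw q Q (redWord (strandPerm b b (Z v)) ++ D (W v)) *
      phi q Q (p v) * tw q Q (redWord (strandPerm c c (U v))) * 𝐞 c) =
      dcGen q Q b c f D (W v) *
        phi q Q ((-1 : k) ^ len (Z v) • p (Z v * W v * U v)) * stdElt q Q c c (U v) := by
    intro v
    rw [tw_phi_tw_eq (hch.reduced _ (hD.hw v)), ← hD.eq v, mul_assoc (stdElt q Q b b _),
      mul_assoc (stdElt q Q b b _), ← mul_assoc (signElt q Q b f), hs.mul_stdElt hb _ (hD.hz v),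
      dcGen, map_smul, mul_smul_comm, smul_mul_assoc, smul_mul_assoc]
    simp only [mul_assoc]
  rw [Finset.sum_congr rfl fun v _ => h2 v, hD.sum_eq hb.1 hc.1 fun z w u => dcGen q Q b c f D w *
        phi q Q ((-1 : k) ^ len z • p (z * w * u)) * stdElt q Q c c u]
  refine Finset.sum_congr rfl fun w _ => Finset.sum_congr rfl fun u _ => ?_
  rw [map_sum, Finset.mul_sum, Finset.sum_mul]

/-- Expanding the sign element gives back the adapted basis, with coefficient a nonzero multiple of
`F w u` at every z w u. A single long z suffices to make `F w u` vanish. -/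
theorem IsChoice.eq_zero_of_mem_flt (hq : q ≠ 0) (hb : Blocked b f) (hc : Blocked c g)
    (hch : IsChoice q Q b c f g D) {F : Perm (Fin d) → Perm (Fin d) → Laurent k d} {N : ℕ}
    (h : ∑ w ∈ dmin f g, ∑ u ∈ minReps (meet f g w) g,
        dcGen q Q b c f D w * phi q Q (F w u) * stdElt q Q c c u ∈ flt q Q N)
    {z w u : Perm (Fin d)} (hz : z ∈ fibreSubgroup f) (hw : LocalMin f g w)
    (hu : u ∈ minReps (meet f g w) g) (hN : N ≤ len (strandPerm b c (z * w * u))) : F w u = 0 := by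
  obtain ⟨Z, W, U, hD⟩ := exists_isDecomp hb.1 hc.1
  have h1 : ∑ w ∈ dmin f g, ∑ u ∈ minReps (meet f g w) g,
        dcGen q Q b c f D w * phi q Q (F w u) * stdElt q Q c c u =
      ∑ v, tw q Q (redWord (strandPerm b b (Z v)) ++ D (W v)) *
        phi q Q ((-q)⁻¹ ^ len (Z v) • F (W v) (U v)) *
        tw q Q (redWord (strandPerm c c (U v))) * 𝐞 c := by
    simp only [tw_phi_tw_eq (hch.reduced _ (hD.hw _))]
    rw [hD.sum_eq hb.1 hc.1 fun z w u => stdElt q Q b b z * (tw q Q (D w) * 𝐞 c) *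
      phi q Q ((-q)⁻¹ ^ len z • F w u) * stdElt q Q c c u]
    refine Finset.sum_congr rfl fun w _ => Finset.sum_congr rfl fun u _ => ?_
    rw [dcGen, signElt, signSum, Finset.sum_mul, Finset.sum_mul, Finset.sum_mul]
    refine Finset.sum_congr rfl fun z _ => ?_
    rw [map_smul, smul_mul_assoc, mul_smul_comm, smul_mul_assoc]
  rw [h1] at h
  have h2 := pbw_eq_zero_of_mem_flt (hD.isReducedWord hb hc hch) h _ hN
  obtain ⟨e1, e2, e3⟩ := hD.unique hb.1 hc.1 hz hw hu
  beta_reduce at h2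
  rw [e1, e2, e3] at h2
  exact (smul_eq_zero.mp h2).resolve_left (pow_ne_zero _ (inv_ne_zero (neg_ne_zero.mpr hq)))

theorem IsChoice.eq_zero (hq : q ≠ 0) (hb : Blocked b f) (hc : Blocked c g)
    (hch : IsChoice q Q b c f g D) {F : Perm (Fin d) → Perm (Fin d) → Laurent k d}
    (h : ∑ w ∈ dmin f g, ∑ u ∈ minReps (meet f g w) g,
        dcGen q Q b c f D w * phi q Q (F w u) * stdElt q Q c c u = 0)
    {w u : Perm (Fin d)} (hw : LocalMin f g w) (hu : u ∈ minReps (meet f g w) g) : F w u = 0 :=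
  hch.eq_zero_of_mem_flt hq hb hc (N := 0) (by rw [h]; exact zero_mem _) (one_mem _) hw hu
    (Nat.zero_le _)

theorem IsChoice.eq_zero_single (hq : q ≠ 0) (hb : Blocked b f) (hc : Blocked c g)
    (hch : IsChoice q Q b c f g D) {w : Perm (Fin d)} (hw : LocalMin f g w)
    {F : Perm (Fin d) → Laurent k d} (h : ∑ u ∈ minReps (meet f g w) g,
        dcGen q Q b c f D w * phi q Q (F u) * stdElt q Q c c u = 0)
    {u : Perm (Fin d)} (hu : u ∈ minReps (meet f g w) g) : F u = 0 := by
  classical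
  have := hch.eq_zero hq hb hc (F := fun w' u => if w' = w then F u else 0) (w := w) (u := u) ?_ hw hu
  · rwa [if_pos rfl] at this
  · rw [Finset.sum_eq_single w]
    · simpa only [if_true] using h
    · intro w' _ hne
      exact Finset.sum_eq_zero fun u _ => by rw [if_neg hne, map_zero, mul_zero, zero_mul]
    · intro h'; exact absurd (mem_dmin.mpr hw) h'

theorem IsChoice.faithful (hq : q ≠ 0) (hb : Blocked b f) (hc : Blocked c g)
    (hch : IsChoice q Q b c f g D) {w : Perm (Fin d)} (hw : LocalMin f g w) (p : Laurent k d)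
    (h : dcGen q Q b c f D w * phi q Q p = 0) : p = 0 := by
  refine hch.eq_zero_single hq hb hc hw (F := fun _ => p) ?_ (one_mem_minReps _ _)
  exact Finset.sum_eq_zero fun u _ => by rw [h, zero_mul]

theorem mul_signSum_stdElt (v : Hecke q Q d) (p : Laurent k d) (S : Finset (Perm (Fin d))) :
    v * phi q Q p * signSum q (stdElt q Q c c) S =
      ∑ u ∈ S, v * phi q Q ((-q)⁻¹ ^ len u • p) * stdElt q Q c c u := by
  rw [signSum, Finset.mul_sum]
  refine Finset.sum_congr rfl fun u _ => ?_
  rw [map_smul, mul_smul_comm, mul_smul_comm, smul_mul_assoc]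

/-- The sign-invariant elements of the sign ideals. -/
theorem IsChoice.exists_symm (hq : q ≠ 0) (hb : Blocked b f) (hc : Blocked c g)
    (hch : IsChoice q Q b c f g D) {h : Hecke q Q d}
    (hs : IsSign q Q c g (signElt q Q b f * h)) :
    ∃ F : Perm (Fin d) → Laurent k d, (∀ w, LocalMin f g w → IsSymm (meet f g w) (F w)) ∧
      signElt q Q b f * h = ∑ w ∈ dmin f g,
        dcGen q Q b c f D w * phi q Q (F w) *
          signSum q (stdElt q Q c c) (minReps (meet f g w) g) := by
  obtain ⟨F, hF⟩ := hch.exists_eq hq hb hc h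
  rw [hs.1] at hF
  have hτ := heckeFam_stdElt q Q hc
  set N : Perm (Fin d) → Submodule k (Hecke q Q d) := fun w =>
    LinearMap.range ((LinearMap.mulLeft k (dcGen q Q b c f D w)).comp (phi q Q).toLinearMap) with hNdef
  have hmemN : ∀ w p, dcGen q Q b c f D w * phi q Q p ∈ N w := fun w p => ⟨p, rfl⟩
  have hNst : ∀ w, LocalMin f g w → ∀ n ∈ N w, ∀ t, simple t ∈ fibreSubgroup (meet f g w) →
      n * stdElt q Q c c (simple t) ∈ N w := by
    rintro w hw _ ⟨p, rfl⟩ t ht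
    have := (hch.isSign hq hb hc hw).mul_phi_mul_simple (hw.blocked hb.1 hc) ht p
    exact this ▸ hmemN w _
  set x : Perm (Fin d) → Hecke q Q d := fun w => ∑ u ∈ minReps (meet f g w) g,
    dcGen q Q b c f D w * phi q Q (F w u) * stdElt q Q c c u with hx
  -- Right multiplication by T_r preserves the summand of each double coset. By independence the
  -- sign condition therefore holds in every summand separately.
  have hxs : ∀ w, LocalMin f g w → ∀ r, simple r ∈ fibreSubgroup g →
      x w * stdElt q Q c c (simple r) = -x w := by
    intro w hw r hr
    have key : ∀ w, LocalMin f g w → ∃ p : Perm (Fin d) → Laurent k d,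
        x w * stdElt q Q c c (simple r) + x w = ∑ u ∈ minReps (meet f g w) g,
          dcGen q Q b c f D w * phi q Q (p u) * stdElt q Q c c u := by
      intro w hw
      have hmem : ∀ u ∈ minReps (meet f g w) g, actCoef q (meet f g w) (stdElt q Q c c) r
          (fun u => dcGen q Q b c f D w * phi q Q (F w u)) u +
            dcGen q Q b c f D w * phi q Q (F w u) ∈ N w := by
        intro u hu
        refine add_mem ?_ (hmemN w _)
        unfold actCoef
        split_ifs with h2 h3
        · exact Submodule.smul_mem _ _ (hmemN w _)
        · exact add_mem (hmemN w _) (Submodule.smul_mem _ _ (hmemN w _))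
        · obtain ⟨_, t, ht, e⟩ := (monoFib_mul_simple_or (hw.intervalFibres hb.1 hc.1)
            (mem_minReps.mp hu).2 r).resolve_left h2
          rw [e, mul_inv_cancel_right]
          exact hNst w hw _ (hmemN w _) t ht
      choose! p hp using hmem
      refine ⟨p, ?_⟩
      rw [hx]
      beta_reduce
      rw [sum_mul_simple hτ hc.1 (hw.intervalFibres hb.1 hc.1) (meet_le f g w) hr,
        ← Finset.sum_add_distrib]
      refine Finset.sum_congr rfl fun u hu => ?_
      rw [← add_mul, ← hp u hu]
      rfl
    choose! p hp using key
    have h0 : ∑ w ∈ dmin f g, ∑ u ∈ minReps (meet f g w) g,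
        dcGen q Q b c f D w * phi q Q (p w u) * stdElt q Q c c u = 0 := by
      rw [← Finset.sum_congr rfl fun w hw => hp w (mem_dmin.mp hw), Finset.sum_add_distrib,
        ← Finset.sum_mul, ← hF, hs.2 r hr, neg_add_cancel]
    rw [eq_neg_iff_add_eq_zero, hp w hw]
    exact Finset.sum_eq_zero fun u hu => by
      rw [hch.eq_zero hq hb hc h0 hw hu, map_zero, mul_zero, zero_mul]
  -- Each summand behaves as an induced module whose coefficients lie in the space `N w` of the
  -- elements m_f T_w p.
  have hw1 : ∀ w, LocalMin f g w → x w = dcGen q Q b c f D w * phi q Q (F w 1) *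
      signSum q (stdElt q Q c c) (minReps (meet f g w) g) ∧
      ∀ t, simple t ∈ fibreSubgroup (meet f g w) →
        dcGen q Q b c f D w * phi q Q (F w 1) * stdElt q Q c c (simple t) =
          -(dcGen q Q b c f D w * phi q Q (F w 1)) := by
    intro w hw
    refine eq_mul_signSum hq hτ hc.1 (hw.intervalFibres hb.1 hc.1) (meet_le f g w) (N w) (hNst w hw)
      (fun n hn h0 => ?_) (fun u _ => hmemN w (F w u)) (hxs w hw)
    choose! p hp using hn
    intro u hu
    have h1 := hch.eq_zero_single hq hb hc hw (F := p) (by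
      rw [← h0]
      exact Finset.sum_congr rfl fun u hu => by rw [← hp u hu]; rfl) hu
    rw [← hp u hu, h1, map_zero]
  refine ⟨fun w => F w 1, fun w hw j hj => ?_, ?_⟩
  · have h1 := (hw1 w hw).2 j hj
    rw [(hch.isSign hq hb hc hw).mul_phi_mul_simple (hw.blocked hb.1 hc) hj, ← sub_eq_zero, ← mul_neg,
      ← map_neg, ← mul_sub, ← map_sub] at h1
    rw [← rho_eq_neg_iff (q := q), ← sub_eq_zero]
    exact hch.faithful hq hb hc hw _ h1
  · rw [hF]
    exact Finset.sum_congr rfl fun w hw => (hw1 w (mem_dmin.mp hw)).1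

theorem IsChoice.isSign_symm (hq : q ≠ 0) (hb : Blocked b f) (hc : Blocked c g)
    (hch : IsChoice q Q b c f g D) {w : Perm (Fin d)} (hw : LocalMin f g w) {p : Laurent k d}
    (hp : IsSymm (meet f g w) p) :
    IsSign q Q c g (dcGen q Q b c f D w * phi q Q p *
      signSum q (stdElt q Q c c) (minReps (meet f g w) g)) := by
  constructor
  · rw [signSum, mul_assoc, Finset.sum_mul]
    congr 1
    exact Finset.sum_congr rfl fun u _ => by rw [smul_mul_assoc, stdElt_mul_e]
  · intro t ht
    refine mul_signSum_mul_simple hq (heckeFam_stdElt q Q hc) hc.1 (hw.intervalFibres hb.1 hc.1)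
      (meet_le f g w) (fun j hj => ?_) ht
    rw [(hch.isSign hq hb hc hw).mul_phi_mul_simple (hw.blocked hb.1 hc) hj,
      rho_eq_neg_iff.mpr (hp j hj), map_neg, mul_neg]

/-- The coefficient of w vanishes as soon as some element of its double coset has length at least N.
In the generation argument this bounds the whole double coset of each remaining w. -/
theorem IsChoice.symm_eq_zero_of_mem_flt (hq : q ≠ 0) (hb : Blocked b f) (hc : Blocked c g)
    (hch : IsChoice q Q b c f g D) {F : Perm (Fin d) → Laurent k d} {N : ℕ}
    (h : ∑ w ∈ dmin f g, dcGen q Q b c f D w * phi q Q (F w) *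
      signSum q (stdElt q Q c c) (minReps (meet f g w) g) ∈ flt q Q N)
    {z w u : Perm (Fin d)} (hz : z ∈ fibreSubgroup f) (hw : LocalMin f g w)
    (hu : u ∈ minReps (meet f g w) g) (hN : N ≤ len (strandPerm b c (z * w * u))) : F w = 0 := by
  simp only [mul_signSum_stdElt] at h
  have h1 := hch.eq_zero_of_mem_flt hq hb hc (F := fun w u => (-q)⁻¹ ^ len u • F w) h hz hw hu hN
  exact (smul_eq_zero.mp h1).resolve_left (pow_ne_zero _ (inv_ne_zero (neg_ne_zero.mpr hq)))

end SignIdeals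

/-! ### Compositions: partial sums -/

section PartialSums

/-- The partial sums of a list. -/
def psums (l : List ℕ) : Set ℕ := {x | ∃ j, x = (l.take j).sum}

theorem zero_mem_psums (l : List ℕ) : 0 ∈ psums l := ⟨0, by simp⟩

theorem sum_mem_psums (l : List ℕ) : l.sum ∈ psums l := ⟨l.length, by simp⟩

theorem mem_psums_nil {x : ℕ} : x ∈ psums [] ↔ x = 0 := by simp [psums]

theorem mem_psums_append {x : ℕ} {l l' : List ℕ} :
    x ∈ psums (l ++ l') ↔ x ∈ psums l ∨ ∃ y ∈ psums l', x = l.sum + y := by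
  constructor
  · rintro ⟨j, rfl⟩
    rw [List.take_append, List.sum_append]
    rcases le_total j l.length with h | h
    · left
      exact ⟨j, by simp [Nat.sub_eq_zero_of_le h]⟩
    · right
      exact ⟨_, ⟨j - l.length, rfl⟩, by rw [List.take_of_length_le h]⟩
  · rintro (⟨j, rfl⟩ | ⟨y, ⟨j, rfl⟩, rfl⟩)
    · refine ⟨min j l.length, ?_⟩
      rw [List.take_append_of_le_length (min_le_right _ _), ← List.take_eq_take_min]
    · exact ⟨l.length + j, by rw [List.take_length_add_append, List.sum_append]⟩

theorem mem_psums_cons {x a : ℕ} {l : List ℕ} :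
    x ∈ psums (a :: l) ↔ x = 0 ∨ ∃ y ∈ psums l, x = a + y := by
  constructor
  · rintro ⟨_ | j, rfl⟩
    · left; simp
    · right; exact ⟨_, ⟨j, rfl⟩, by simp⟩
  · rintro (rfl | ⟨y, ⟨j, rfl⟩, rfl⟩)
    · exact zero_mem_psums _
    · exact ⟨j + 1, by simp⟩

theorem le_sum_of_mem_psums {x : ℕ} {l : List ℕ} (h : x ∈ psums l) : x ≤ l.sum := by
  obtain ⟨j, rfl⟩ := h
  conv_rhs => rw [← List.take_append_drop j l, List.sum_append]
  omega

theorem psums_injective {l l' : List ℕ} (h : ∀ a ∈ l, 0 < a) (h' : ∀ a ∈ l', 0 < a)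
    (e : ∀ x, x ∈ psums l ↔ x ∈ psums l') : l = l' := by
  induction l generalizing l' with
  | nil =>
    cases l' with
    | nil => rfl
    | cons b r =>
      have h1 := (e b).mpr (mem_psums_cons.mpr (Or.inr ⟨0, zero_mem_psums _, rfl⟩))
      have h2 := h' b (by simp)
      rw [mem_psums_nil] at h1
      omega
  | cons a l ih =>
    cases l' with
    | nil =>
      have h1 := (e a).mp (mem_psums_cons.mpr (Or.inr ⟨0, zero_mem_psums _, rfl⟩))
      have h2 := h a (by simp)
      rw [mem_psums_nil] at h1
      omega
    | cons b r =>
      have ha := h a (by simp)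
      have hb := h' b (by simp)
      have h1 := (e a).mp (mem_psums_cons.mpr (Or.inr ⟨0, zero_mem_psums _, rfl⟩))
      have h2 := (e b).mpr (mem_psums_cons.mpr (Or.inr ⟨0, zero_mem_psums _, rfl⟩))
      rw [mem_psums_cons] at h1 h2
      have hab : a = b := by
        rcases h1 with h1 | ⟨y, -, h1⟩
        · omega
        · rcases h2 with h2 | ⟨y, -, h2⟩ <;> omega
      subst hab
      congr 1
      refine ih (fun c hc => h c (by simp [hc])) (fun c hc => h' c (by simp [hc])) fun x => ?_
      have h3 := e (a + x)
      simp only [mem_psums_cons, Nat.add_eq_zero_iff, ha.ne', false_and, Nat.add_left_cancel_iff,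
        false_or, exists_eq_right'] at h3
      exact h3

/-- A composition of n is the same as a set of boundaries between 0 and n that contains both ends;
the first part is the least positive boundary. -/
theorem exists_psums_eq (n : ℕ) : ∀ S : Set ℕ, 0 ∈ S → n ∈ S → (∀ x ∈ S, x ≤ n) →
    ∃ l : List ℕ, (∀ a ∈ l, 0 < a) ∧ l.sum = n ∧ ∀ x, x ∈ psums l ↔ x ∈ S := by
  classical
  induction n using Nat.strong_induction_on with
  | _ n ih =>
    intro S h0 hn hS
    by_cases hn0 : n = 0
    · subst hn0
      refine ⟨[], by simp, rfl, fun x => ?_⟩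
      rw [mem_psums_nil]
      exact ⟨fun h => h ▸ h0, fun h => Nat.le_zero.mp (hS x h)⟩
    · have hex : ∃ a, 0 < a ∧ a ∈ S := ⟨n, Nat.pos_of_ne_zero hn0, hn⟩
      obtain ⟨ha, haS⟩ := Nat.find_spec hex
      set a := Nat.find hex with had
      have hmin : ∀ x ∈ S, x = 0 ∨ a ≤ x := fun x hx => by
        rcases Nat.eq_zero_or_pos x with h | h
        · exact Or.inl h
        · exact Or.inr (Nat.find_min' hex ⟨h, hx⟩)
      have han := hS a haS
      obtain ⟨l, hl, hsum, hps⟩ := ih (n - a) (by omega) {y | a + y ∈ S} haS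
        (by simpa [Nat.add_sub_cancel' han] using hn) (fun y hy => by
          have := hS _ hy; omega)
      refine ⟨a :: l, ?_, by simp [hsum]; omega, fun x => ?_⟩
      · intro c hc
        rcases List.mem_cons.mp hc with rfl | hc
        · exact ha
        · exact hl c hc
      · rw [mem_psums_cons]
        constructor
        · rintro (rfl | ⟨y, hy, rfl⟩)
          · exact h0
          · exact (hps y).mp hy
        · intro hx
          rcases hmin x hx with h | h
          · exact Or.inl h
          · refine Or.inr ⟨x - a, (hps _).mpr ?_, by omega⟩
            simpa [Nat.add_sub_cancel' h] using hx

theorem exists_split_of_mem_psums {l : List ℕ} {y : ℕ} (h : y ∈ psums l) (h0 : 0 < y)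
    (hs : y < l.sum) : ∃ pre post a b, l = pre ++ a :: b :: post ∧ y = pre.sum + a := by
  induction l generalizing y with
  | nil => simp at hs
  | cons a l ih =>
    rcases mem_psums_cons.mp h with rfl | ⟨z, hz, rfl⟩
    · omega
    · rcases Nat.eq_zero_or_pos z with rfl | hz0
      · cases l with
        | nil => simp at hs
        | cons b l => exact ⟨[], l, a, b, rfl, by simp⟩
      · obtain ⟨pre, post, c, b, rfl, rfl⟩ := ih hz hz0 (by simp at hs; omega)
        exact ⟨a :: pre, post, c, b, rfl, by simp [add_assoc]⟩

theorem mem_psums_merge {pre post : List ℕ} {a b x : ℕ}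
    (h : ∀ c ∈ pre ++ a :: b :: post, 0 < c) : x ∈ psums (pre ++ (a + b) :: post) ↔
      x ∈ psums (pre ++ a :: b :: post) ∧ x ≠ pre.sum + a := by
  have ha := h a (by simp)
  have hb := h b (by simp)
  simp only [mem_psums_append, mem_psums_cons]
  constructor
  · rintro (hx | ⟨y, rfl | ⟨z, hz, rfl⟩, rfl⟩)
    · have := le_sum_of_mem_psums hx
      exact ⟨Or.inl hx, by omega⟩
    · exact ⟨Or.inr ⟨0, Or.inl rfl, rfl⟩, by omega⟩
    · exact ⟨Or.inr ⟨_, Or.inr ⟨b + z, Or.inr ⟨z, hz, rfl⟩, by omega⟩, rfl⟩, by omega⟩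
  · rintro ⟨hx | ⟨y, rfl | ⟨z, rfl | ⟨u, hu, rfl⟩, rfl⟩, rfl⟩, hne⟩
    · exact Or.inl hx
    · exact Or.inr ⟨0, Or.inl rfl, rfl⟩
    · omega
    · exact Or.inr ⟨_, Or.inr ⟨u, hu, rfl⟩, by omega⟩

theorem mem_psums_flatten {n : ℕ} (p : Fin n → List ℕ) (x : ℕ) :
    x ∈ psums (List.ofFn p).flatten ↔ x = 0 ∨ ∃ t : Fin n, ∃ y ∈ psums (p t),
      x = ∑ s ∈ Finset.univ.filter (fun s : Fin n => (s : ℕ) < t), (p s).sum + y := by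
  induction n generalizing x with
  | zero => simp [psums]
  | succ n ih =>
    have key : ∀ t : Fin n, ∑ s ∈ Finset.univ.filter (fun s : Fin (n + 1) => (s : ℕ) < t.succ),
        (p s).sum = (p 0).sum +
          ∑ s ∈ Finset.univ.filter (fun s : Fin n => (s : ℕ) < t), (p s.succ).sum := by
      intro t
      rw [Finset.sum_filter, Finset.sum_filter, Fin.sum_univ_succ]
      simp
    rw [List.ofFn_succ, List.flatten_cons, mem_psums_append]
    simp only [ih, Fin.exists_fin_succ, key]
    simp only [Fin.val_zero, Nat.not_lt_zero, Finset.filter_false, Finset.sum_empty, zero_add,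
      exists_eq_right']
    constructor
    · rintro (h | ⟨y, rfl | ⟨t, z, hz, rfl⟩, rfl⟩)
      · exact Or.inr (Or.inl h)
      · exact Or.inr (Or.inl (by simpa using sum_mem_psums _))
      · exact Or.inr (Or.inr ⟨t, z, hz, by rw [add_assoc]⟩)
    · rintro (rfl | h | ⟨t, z, hz, rfl⟩)
      · exact Or.inl (zero_mem_psums _)
      · exact Or.inl h
      · exact Or.inr ⟨_, Or.inr ⟨t, z, hz, rfl⟩, by rw [add_assoc]⟩

/-- Two positions belong to one block exactly when no partial sum separates them. With this
criterion statements about blocks become arithmetic of boundaries. -/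
theorem index_eq_iff {d : ℕ} (c : Composition d) {i j : Fin d} (hij : i ≤ j) :
    c.index i = c.index j ↔ ∀ x ∈ psums c.blocks, ¬ ((i : ℕ) < x ∧ x ≤ j) := by
  have h1 := c.sizeUpTo_index_le i
  have h2 : (i : ℕ) < c.sizeUpTo (c.index i + 1) := c.lt_sizeUpTo_index_succ i
  have h3 := c.sizeUpTo_index_le j
  have h4 : (j : ℕ) < c.sizeUpTo (c.index j + 1) := c.lt_sizeUpTo_index_succ j
  have hij' : (i : ℕ) ≤ j := hij
  constructor
  · rintro e x ⟨t, rfl⟩ ⟨h5, h6⟩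
    have h5 : (i : ℕ) < c.sizeUpTo t := h5
    have h6 : c.sizeUpTo t ≤ j := h6
    rw [← e] at h4
    rcases lt_or_ge (c.index i : ℕ) t with h | h
    · have : c.sizeUpTo (c.index i + 1) ≤ c.sizeUpTo t :=
        c.monotone_sizeUpTo (Nat.succ_le_of_lt h)
      omega
    · have := c.monotone_sizeUpTo h
      omega
  · intro h
    by_contra hne
    rcases lt_or_gt_of_ne hne with h5 | h5
    · refine h _ ⟨c.index i + 1, rfl⟩ ⟨h2, ?_⟩
      exact (c.monotone_sizeUpTo (Nat.succ_le_of_lt h5)).trans h3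
    · have : c.sizeUpTo (c.index j + 1) ≤ c.sizeUpTo (c.index i) :=
        c.monotone_sizeUpTo (Nat.succ_le_of_lt h5)
      omega

end PartialSums

/-! ### Compositions as sets of boundaries, with the starts of the components marked among them. -/

namespace MultiComp

variable {ℓ d : ℕ}

/-- The number of black strands in the components before the component `t`. -/
def start (nu : MultiComp ℓ d) (t : ℕ) : ℕ :=
  ∑ s ∈ Finset.univ.filter (fun s : Fin (ℓ + 1) => (s : ℕ) < t), (nu.parts s).sum

/-- The boundaries between the parts. -/
def bd (nu : MultiComp ℓ d) : Set ℕ := {x | ∃ t : Fin (ℓ + 1), ∃ y ∈ psums (nu.parts t),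
  x = nu.start t + y}

theorem start_zero (nu : MultiComp ℓ d) : nu.start 0 = 0 := by simp [start]

theorem start_succ (nu : MultiComp ℓ d) (t : Fin (ℓ + 1)) :
    nu.start (t + 1) = nu.start t + (nu.parts t).sum := by
  have h : Finset.univ.filter (fun s : Fin (ℓ + 1) => (s : ℕ) < t + 1) =
      insert t (Finset.univ.filter (fun s : Fin (ℓ + 1) => (s : ℕ) < t)) := by
    ext x
    simp only [Finset.mem_filter, Finset.mem_univ, true_and, Finset.mem_insert, Fin.ext_iff]
    omega
  unfold start
  rw [h, Finset.sum_insert (by simp), add_comm]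

theorem start_last (nu : MultiComp ℓ d) : nu.start (ℓ + 1) = d := by
  refine Eq.trans ?_ nu.sum_parts
  unfold start
  rw [Finset.filter_true_of_mem fun s _ => s.2]

theorem start_mono (nu : MultiComp ℓ d) : Monotone nu.start := fun s t h =>
  Finset.sum_le_sum_of_subset fun x hx => by
    simp only [Finset.mem_filter, Finset.mem_univ, true_and] at hx ⊢
    exact hx.trans_le h

theorem mem_bd_iff (nu : MultiComp ℓ d) (x : ℕ) : x ∈ nu.bd ↔ x ∈ psums nu.concat.blocks := by
  refine Iff.trans ?_ (mem_psums_flatten nu.parts x).symm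
  refine ⟨Or.inr, ?_⟩
  rintro (rfl | h)
  · exact ⟨0, 0, zero_mem_psums _, by simp [start]⟩
  · exact h

theorem start_mem_bd (nu : MultiComp ℓ d) {t : ℕ} (ht : t ≤ ℓ + 1) : nu.start t ∈ nu.bd := by
  rcases Nat.lt_or_eq_of_le ht with h | rfl
  · exact ⟨⟨t, h⟩, 0, zero_mem_psums _, rfl⟩
  · exact ⟨Fin.last ℓ, _, sum_mem_psums _, nu.start_succ (Fin.last ℓ)⟩

theorem zero_mem_bd (nu : MultiComp ℓ d) : 0 ∈ nu.bd := by
  have := nu.start_mem_bd (Nat.zero_le (ℓ + 1))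
  rwa [start_zero] at this

theorem le_of_mem_bd (nu : MultiComp ℓ d) {x : ℕ} (h : x ∈ nu.bd) : x ≤ d := by
  obtain ⟨t, y, hy, rfl⟩ := h
  have h1 := le_sum_of_mem_psums hy
  have h2 := nu.start_succ t
  have h3 := nu.start_mono (Nat.succ_le_of_lt t.2)
  rw [start_last, Nat.succ_eq_add_one] at h3
  omega

/-- Components may be empty, so a boundary can belong to several of them. A boundary that comes from
another component is an end of the present one. -/
theorem mem_psums_parts_iff (nu : MultiComp ℓ d) (t : Fin (ℓ + 1)) (y : ℕ) :
    y ∈ psums (nu.parts t) ↔ nu.start t + y ≤ nu.start (t + 1) ∧ nu.start t + y ∈ nu.bd := by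
  rw [start_succ]
  constructor
  · intro h
    exact ⟨Nat.add_le_add_left (le_sum_of_mem_psums h) _, t, y, h, rfl⟩
  · rintro ⟨h1, t', y', hy', e⟩
    have h2 := le_sum_of_mem_psums hy'
    have h3 := nu.start_succ t'
    have h4 := nu.start_succ t
    rcases lt_trichotomy t t' with h | h | h
    · have h5 : nu.start (t + 1) ≤ nu.start t' := nu.start_mono (Nat.succ_le_of_lt h)
      have : y = (nu.parts t).sum := by omega
      exact this ▸ sum_mem_psums _
    · subst h
      have : y = y' := by omega
      exact this ▸ hy'
    · have h5 : nu.start (t' + 1) ≤ nu.start t := nu.start_mono (Nat.succ_le_of_lt h)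
      have : y = 0 := by omega
      exact this ▸ zero_mem_psums _

theorem parts_eq_of {nu : MultiComp ℓ d} {t : Fin (ℓ + 1)} {l : List ℕ} (hl : ∀ a ∈ l, 0 < a)
    (h : ∀ y, y ∈ psums l ↔ nu.start t + y ≤ nu.start (t + 1) ∧ nu.start t + y ∈ nu.bd) :
    nu.parts t = l :=
  psums_injective (nu.parts_pos t) hl fun y => (nu.mem_psums_parts_iff t y).trans (h y).symm

theorem parts_eq_parts {nu mu : MultiComp ℓ d} {t : Fin (ℓ + 1)} (h0 : nu.start t = mu.start t)
    (h1 : nu.start (t + 1) = mu.start (t + 1))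
    (h : ∀ x, mu.start t ≤ x → x ≤ mu.start (t + 1) → (x ∈ nu.bd ↔ x ∈ mu.bd)) :
    nu.parts t = mu.parts t := by
  refine parts_eq_of (mu.parts_pos t) fun y => ?_
  rw [mu.mem_psums_parts_iff, h0, h1]
  exact and_congr_right fun hy => (h _ (Nat.le_add_right _ _) hy).symm

theorem ext_bd {nu mu : MultiComp ℓ d} (h0 : ∀ t ≤ ℓ + 1, nu.start t = mu.start t)
    (h : ∀ x, x ∈ nu.bd ↔ x ∈ mu.bd) : nu = mu :=
  MultiComp.ext (funext fun t => parts_eq_parts (h0 _ (by omega)) (h0 _ (by omega))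
    fun x _ _ => h x)

theorem exists_between {s : ℕ → ℕ} (hs0 : s 0 = 0) {n x : ℕ} (hx : x ≤ s (n + 1)) :
    ∃ t ≤ n, s t ≤ x ∧ x ≤ s (t + 1) := by
  induction n with
  | zero => exact ⟨0, le_rfl, by omega, hx⟩
  | succ n ih =>
    rcases le_total x (s (n + 1)) with h | h
    · obtain ⟨t, ht, h'⟩ := ih h
      exact ⟨t, by omega, h'⟩
    · exact ⟨n + 1, le_rfl, h, hx⟩

/-- Compositions are constructed by prescribing their boundaries and, among these, the starts of the
components; every component is the composition cut out between two starts. -/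
theorem exists_of_bd {s : ℕ → ℕ} (hs0 : s 0 = 0) (hs : Monotone s) (hsd : s (ℓ + 1) = d)
    {S : Set ℕ} (hS : ∀ t ≤ ℓ + 1, s t ∈ S) (hSd : ∀ x ∈ S, x ≤ d) :
    ∃ nu : MultiComp ℓ d, (∀ t ≤ ℓ + 1, nu.start t = s t) ∧ ∀ x, x ∈ nu.bd ↔ x ∈ S := by
  have h1 : ∀ t : Fin (ℓ + 1), ∃ l : List ℕ, (∀ a ∈ l, 0 < a) ∧ l.sum = s (t + 1) - s t ∧
      ∀ x, x ∈ psums l ↔ x ∈ {y | s t + y ≤ s (t + 1) ∧ s t + y ∈ S} := by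
    intro t
    have h2 := hs (Nat.le_succ t)
    simp only [Nat.succ_eq_add_one] at h2
    refine exists_psums_eq _ _ ⟨by omega, hS t (by omega)⟩ ?_ fun x hx => ?_
    · rw [Set.mem_setOf_eq, Nat.add_sub_cancel' h2]
      exact ⟨le_rfl, hS _ (by omega)⟩
    · have := hx.1
      omega
  choose p hp hsum hps using h1
  have h2 : ∀ t ≤ ℓ + 1,
      ∑ s' ∈ Finset.univ.filter (fun s' : Fin (ℓ + 1) => (s' : ℕ) < t), (p s').sum = s t := by
    intro t
    induction t with
    | zero => intro _; simp [hs0]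
    | succ t ih =>
      intro ht
      have h3 : Finset.univ.filter (fun s' : Fin (ℓ + 1) => (s' : ℕ) < t + 1) =
          insert ⟨t, ht⟩ (Finset.univ.filter (fun s' : Fin (ℓ + 1) => (s' : ℕ) < t)) := by
        ext x
        simp only [Finset.mem_filter, Finset.mem_univ, true_and, Finset.mem_insert, Fin.ext_iff]
        omega
      rw [h3, Finset.sum_insert (by simp), ih (by omega), hsum]
      have : s t ≤ s (t + 1) := hs (Nat.le_succ t)
      simp only
      omega
  set nu : MultiComp ℓ d := ⟨p, hp, by
    rw [← hsd, ← h2 _ le_rfl, Finset.filter_true_of_mem fun s _ => s.2]⟩ with hnu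
  have h3 : ∀ t ≤ ℓ + 1, nu.start t = s t := h2
  refine ⟨nu, h3, fun x => ⟨?_, fun hx => ?_⟩⟩
  · rintro ⟨t, y, hy, rfl⟩
    rw [h3 _ (by omega)]
    exact ((hps t y).mp hy).2
  · obtain ⟨t, ht, h4, h5⟩ := exists_between hs0 ((hSd x hx).trans hsd.ge)
    refine ⟨⟨t, by omega⟩, x - s t, (hps _ _).mpr ?_, by rw [h3 t (by omega)]; omega⟩
    rw [Set.mem_setOf_eq, Nat.add_sub_cancel' h4]
    exact ⟨h5, hx⟩

/-- Equal starts and one additional boundary. The new boundary is not a start, so it lies strictly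
inside exactly one component. -/
theorem isSplit_of {lam mu : MultiComp ℓ d} (h0 : ∀ t ≤ ℓ + 1, lam.start t = mu.start t) {x : ℕ}
    (hx : x ∈ mu.bd) (h : ∀ y, y ∈ lam.bd ↔ y ∈ mu.bd ∧ y ≠ x) : lam.IsSplit mu := by
  have hx' : x ∉ lam.bd := fun hh => ((h x).mp hh).2 rfl
  obtain ⟨t, ht, h1, h2⟩ := exists_between mu.start_zero
    ((mu.le_of_mem_bd hx).trans mu.start_last.ge)
  have hne : ∀ t ≤ ℓ + 1, mu.start t ≠ x := fun t ht e => hx' (by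
    rw [← e, ← h0 t ht]; exact lam.start_mem_bd ht)
  have h3 := lt_of_le_of_ne h1 (hne t (by omega))
  have h4 := lt_of_le_of_ne h2 (hne (t + 1) (by omega)).symm
  set T : Fin (ℓ + 1) := ⟨t, by omega⟩ with hT
  have h5 : x - mu.start t ∈ psums (mu.parts T) := by
    rw [mem_psums_parts_iff]
    simp only [hT, Nat.add_sub_cancel' h1]
    exact ⟨h2, hx⟩
  have h6 : mu.start (t + 1) = mu.start t + (mu.parts T).sum := mu.start_succ T
  obtain ⟨pre, post, a, b, e, e'⟩ := exists_split_of_mem_psums h5 (by omega) (by omega)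
  have hpos := mu.parts_pos T
  rw [e] at hpos
  refine ⟨T, pre, post, a, b, parts_eq_of ?_ fun y => ?_, e, fun s hs => ?_⟩
  · intro c hc
    simp only [List.mem_append, List.mem_cons] at hc
    rcases hc with hc | rfl | hc
    · exact hpos c (by simp [hc])
    · have := hpos a (by simp); omega
    · exact hpos c (by simp [hc])
  · rw [mem_psums_merge hpos, ← e, mem_psums_parts_iff, h0 _ (by omega), h0 _ (by omega), h,
      and_assoc]
    refine and_congr_right fun _ => and_congr_right fun _ => not_congr ?_
    simp only [hT]
    omega
  · refine (parts_eq_parts (h0 _ (by omega)) (h0 _ (by omega)) fun y hy1 hy2 => ?_).symm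
    rw [h]
    refine ⟨fun hh => hh.1, fun hh => ⟨hh, ?_⟩⟩
    rintro rfl
    rcases lt_or_gt_of_ne (fun e => hs (Fin.ext e) : (s : ℕ) ≠ t) with h7 | h7
    · have := mu.start_mono (Nat.succ_le_of_lt h7)
      simp only [Nat.succ_eq_add_one] at this
      omega
    · have := mu.start_mono (Nat.succ_le_of_lt h7)
      simp only [Nat.succ_eq_add_one] at this
      omega

/-- The boundaries stay the same and one start moves to the next boundary. In terms of parts, the
first part of a component joins the end of the preceding one. -/
theorem isLeftCrossing_of {lam mu : MultiComp ℓ d} (m : Fin ℓ)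
    (h0 : ∀ t ≤ ℓ + 1, t ≠ m + 1 → mu.start t = lam.start t)
    (hlt : lam.start (m + 1) < mu.start (m + 1)) (hle : mu.start (m + 1) ≤ lam.start (m + 2))
    (h : ∀ y, y ∈ lam.bd ↔ y ∈ mu.bd)
    (hb : ∀ y ∈ lam.bd, ¬ (lam.start (m + 1) < y ∧ y < mu.start (m + 1))) :
    lam.IsLeftCrossing mu := by
  have hm := m.2
  have e1 : ((m.succ : Fin (ℓ + 1)) : ℕ) = m + 1 := rfl
  have e2 : ((m.castSucc : Fin (ℓ + 1)) : ℕ) = m := rfl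
  have e3 := h0 m (by omega) (by omega)
  have e4 : mu.start (m + 1 + 1) = lam.start (m + 1 + 1) := h0 (m + 2) (by omega) (by omega)
  have hle : mu.start (m + 1) ≤ lam.start (m + 1 + 1) := hle
  set a := mu.start (m + 1) - lam.start (m + 1) with ha
  have hmem1 := lam.start_mem_bd (t := m + 1) (by omega)
  have hmem2 := mu.start_mem_bd (t := m + 1) (by omega)
  have hmono := lam.start_mono (Nat.le_succ m)
  simp only [Nat.succ_eq_add_one] at hmono
  refine ⟨m, a, parts_eq_of ?_ fun y => ?_, parts_eq_of ?_ fun y => ?_, fun s hs1 hs2 => ?_⟩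
  · intro c hc
    rcases List.mem_cons.mp hc with rfl | hc
    · omega
    · exact mu.parts_pos _ c hc
  · rw [mem_psums_cons, e1]
    constructor
    · rintro (rfl | ⟨z, hz, rfl⟩)
      · exact ⟨by omega, hmem1⟩
      · rw [mem_psums_parts_iff, e1, ← h] at hz
        have e5 : lam.start (m + 1) + (a + z) = mu.start (m + 1) + z := by omega
        rw [e5]
        exact ⟨by have := hz.1; rw [e4] at this; exact this, hz.2⟩
    · rintro ⟨h1, h2⟩
      rcases Nat.eq_zero_or_pos y with rfl | hy
      · exact Or.inl rfl
      · right
        have h3 := hb _ h2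
        refine ⟨y - a, ?_, by omega⟩
        rw [mem_psums_parts_iff, e1, ← h]
        have e5 : mu.start (m + 1) + (y - a) = lam.start (m + 1) + y := by omega
        rw [e5]
        exact ⟨by rw [e4]; exact h1, h2⟩
  · intro c hc
    rcases List.mem_append.mp hc with hc | hc
    · exact lam.parts_pos _ c hc
    · rw [List.mem_singleton] at hc
      omega
  · have hsum : (lam.parts m.castSucc).sum = lam.start (m + 1) - lam.start m := by
      have := lam.start_succ m.castSucc
      rw [e2] at this
      omega
    rw [mem_psums_append, mem_psums_parts_iff, e2, e3, hsum, ← h]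
    constructor
    · rintro (⟨h1, h2⟩ | ⟨z, hz, rfl⟩)
      · exact ⟨by omega, h2⟩
      · rw [mem_psums_cons] at hz
        rcases hz with rfl | ⟨z, hz, rfl⟩
        · have e5 : lam.start m + (lam.start (m + 1) - lam.start m + 0) = lam.start (m + 1) := by
            omega
          rw [e5]
          exact ⟨by omega, hmem1⟩
        · rw [mem_psums_nil] at hz
          have e5 : lam.start m + (lam.start (m + 1) - lam.start m + (a + z)) =
            mu.start (m + 1) := by omega
          rw [e5]
          exact ⟨le_rfl, (h _).mpr hmem2⟩
    · rintro ⟨h1, h2⟩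
      have h3 := hb _ h2
      by_cases h4 : lam.start m + y ≤ lam.start (m + 1)
      · exact Or.inl ⟨h4, h2⟩
      · right
        refine ⟨a, mem_psums_cons.mpr (Or.inr ⟨0, zero_mem_psums _, rfl⟩), by omega⟩
  · have h1 : (s : ℕ) ≠ m := fun e => hs1 (Fin.ext e)
    have h2 : (s : ℕ) ≠ m + 1 := fun e => hs2 (Fin.ext e)
    exact parts_eq_parts (h0 _ (by omega) (by omega)) (h0 _ (by omega) (by omega))
      fun x _ _ => (h x).symm

theorem IsSplit.sum_eq {lam mu : MultiComp ℓ d} (h : lam.IsSplit mu) (s : Fin (ℓ + 1)) :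
    (lam.parts s).sum = (mu.parts s).sum := by
  obtain ⟨t, pre, post, a, b, h1, h2, h3⟩ := h
  by_cases e : s = t
  · rw [e, h1, h2]
    simp [add_assoc]
  · rw [h3 s e]

theorem IsSplit.start_eq {lam mu : MultiComp ℓ d} (h : lam.IsSplit mu) (t : ℕ) :
    lam.start t = mu.start t := Finset.sum_congr rfl fun s _ => h.sum_eq s

theorem IsSplit.bd_subset {lam mu : MultiComp ℓ d} (h : lam.IsSplit mu) {x : ℕ} (hx : x ∈ lam.bd) :
    x ∈ mu.bd := by
  obtain ⟨s, y, hy, rfl⟩ := hx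
  rw [h.start_eq]
  obtain ⟨t, pre, post, a, b, h1, h2, h3⟩ := h
  refine ⟨s, y, ?_, rfl⟩
  by_cases e : s = t
  · subst e
    rw [h1, mem_psums_merge] at hy
    · rw [h2]; exact hy.1
    · rw [← h2]; exact mu.parts_pos s
  · rw [h3 s e]; exact hy

theorem IsLeftCrossing.start_eq {lam mu : MultiComp ℓ d} (h : lam.IsLeftCrossing mu) :
    ∃ m : Fin ℓ, ∃ a : ℕ, lam.parts m.succ = a :: mu.parts m.succ ∧
      mu.parts m.castSucc = lam.parts m.castSucc ++ [a] ∧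
      (∀ s, s ≠ m.castSucc → s ≠ m.succ → mu.parts s = lam.parts s) ∧
      (∀ t : ℕ, t ≠ m + 1 → mu.start t = lam.start t) ∧ mu.start (m + 1) = lam.start (m + 1) + a := by
  obtain ⟨m, a, h1, h2, h3⟩ := h
  have e1 : ((m.succ : Fin (ℓ + 1)) : ℕ) = m + 1 := rfl
  have e2 : ((m.castSucc : Fin (ℓ + 1)) : ℕ) = m := rfl
  have key : ∀ t : ℕ, (t ≤ m → mu.start t = lam.start t) ∧
      (m + 1 < t → t ≤ ℓ + 1 → mu.start t = lam.start t) ∧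
      (t = m + 1 → mu.start t = lam.start t + a) := by
    intro t
    induction t with
    | zero => exact ⟨fun _ => by rw [start_zero, start_zero], fun h => by omega, fun h => by omega⟩
    | succ t ih =>
      refine ⟨fun h => ?_, fun h h' => ?_, fun h => ?_⟩
      · have s1 := mu.start_succ ⟨t, by omega⟩
        have s2 := lam.start_succ ⟨t, by omega⟩
        rw [h3 ⟨t, by omega⟩ (fun e => by rw [Fin.ext_iff] at e; simp only [e2] at e; omega)
          (fun e => by rw [Fin.ext_iff] at e; simp only [e1] at e; omega)] at s1
        have := ih.1 (by omega)
        simp only at s1 s2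
        omega
      · by_cases e : t = m + 1
        · have s1 := mu.start_succ m.succ
          have s2 := lam.start_succ m.succ
          rw [h1, List.sum_cons] at s2
          have := ih.2.2 e
          rw [e1, ← e] at s1 s2
          omega
        · have s1 := mu.start_succ ⟨t, by omega⟩
          have s2 := lam.start_succ ⟨t, by omega⟩
          rw [h3 ⟨t, by omega⟩ (fun e => by rw [Fin.ext_iff] at e; simp only [e2] at e; omega)
            (fun e => by rw [Fin.ext_iff] at e; simp only [e1] at e; omega)] at s1
          have := ih.2.1 (by omega) (by omega)
          simp only at s1 s2
          omega
      · have e : t = m := by omega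
        have s1 := mu.start_succ m.castSucc
        have s2 := lam.start_succ m.castSucc
        rw [h2, List.sum_append, List.sum_singleton] at s1
        have := ih.1 (by omega)
        rw [e2, ← e] at s1 s2
        omega
  refine ⟨m, a, h1, h2, h3, fun t ht => ?_, (key _).2.2 rfl⟩
  rcases lt_or_ge (m + 1 : ℕ) t with h | h
  · rcases le_total t (ℓ + 1) with h' | h'
    · exact (key t).2.1 h h'
    · have hs : ∀ nu : MultiComp ℓ d, nu.start t = d := fun nu => by
        refine Eq.trans ?_ nu.start_last
        unfold start
        rw [Finset.filter_true_of_mem fun s _ => s.2.trans_le h',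
          Finset.filter_true_of_mem fun s _ => s.2]
      rw [hs, hs]
  · exact (key t).1 (by omega)

/-- Only the red strand moves across the part; the sequence of all the parts is unchanged. -/
theorem IsLeftCrossing.bd_iff {lam mu : MultiComp ℓ d} (h : lam.IsLeftCrossing mu) (x : ℕ) :
    x ∈ lam.bd ↔ x ∈ mu.bd := by
  obtain ⟨m, a, h1, h2, h3, h4, h5⟩ := h.start_eq
  have e1 : ((m.succ : Fin (ℓ + 1)) : ℕ) = m + 1 := rfl
  have e2 : ((m.castSucc : Fin (ℓ + 1)) : ℕ) = m := rfl
  have s1 := lam.start_succ m.castSucc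
  rw [e2] at s1
  have h6 := h4 m (by omega)
  constructor
  · rintro ⟨t, y, hy, rfl⟩
    by_cases t1 : t = m.succ
    · subst t1
      rw [h1, mem_psums_cons] at hy
      rcases hy with rfl | ⟨z, hz, rfl⟩
      · refine ⟨m.castSucc, (lam.parts m.castSucc).sum, ?_, by rw [e1, e2]; omega⟩
        rw [h2, mem_psums_append]
        exact Or.inl (sum_mem_psums _)
      · exact ⟨m.succ, z, hz, by rw [e1]; omega⟩
    · by_cases t2 : t = m.castSucc
      · subst t2
        refine ⟨m.castSucc, y, ?_, by rw [e2]; omega⟩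
        rw [h2, mem_psums_append]
        exact Or.inl hy
      · refine ⟨t, y, by rw [h3 t t2 t1]; exact hy, ?_⟩
        rw [h4 t fun e => t1 (Fin.ext e)]
  · rintro ⟨t, y, hy, rfl⟩
    by_cases t1 : t = m.succ
    · subst t1
      refine ⟨m.succ, a + y, ?_, by rw [e1]; omega⟩
      rw [h1, mem_psums_cons]
      exact Or.inr ⟨y, hy, rfl⟩
    · by_cases t2 : t = m.castSucc
      · subst t2
        rw [h2, mem_psums_append] at hy
        rcases hy with hy | ⟨z, hz, rfl⟩
        · exact ⟨m.castSucc, y, hy, by rw [e2]; omega⟩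
        · refine ⟨m.succ, z, ?_, by rw [e1, e2]; omega⟩
          rw [mem_psums_cons] at hz
          rw [h1, mem_psums_cons]
          rcases hz with rfl | ⟨u, hu, rfl⟩
          · exact Or.inl rfl
          · rw [mem_psums_nil] at hu
            exact Or.inr ⟨0, zero_mem_psums _, by omega⟩
      · refine ⟨t, y, by rw [← h3 t t2 t1]; exact hy, ?_⟩
        rw [h4 t fun e => t1 (Fin.ext e)]

/-! ### The blocks of a composition -/

theorem index_eq_iff {nu : MultiComp ℓ d} {i j : Fin d} (hij : i ≤ j) :
    nu.concat.index i = nu.concat.index j ↔ ∀ x ∈ nu.bd, ¬ ((i : ℕ) < x ∧ x ≤ j) := by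
  rw [HigherSchur.index_eq_iff _ hij]
  simp only [mem_bd_iff]

theorem intervalFibres_index (nu : MultiComp ℓ d) : IntervalFibres nu.concat.index := by
  intro i j m hij hjm e
  have h1 := (index_eq_iff (hij.trans hjm)).mp e
  exact ((index_eq_iff hij).mpr fun x hx hh => h1 x hx ⟨hh.1, hh.2.trans hjm⟩).symm

theorem simple_mem_young {nu : MultiComp ℓ d} {j : Fin (d - 1)} :
    simple j ∈ nu.young ↔ ((j : ℕ) + 1) ∉ nu.bd := by
  refine simple_mem_fibreSubgroup.trans ((index_eq_iff (lo_lt_hi j).le).trans ?_)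
  have e1 : ((lo j : Fin d) : ℕ) = j := rfl
  have e2 : ((hi j : Fin d) : ℕ) = j + 1 := rfl
  rw [e1, e2]
  refine ⟨fun h hx => h _ hx ⟨by omega, le_rfl⟩, fun h x hx hh => h ?_⟩
  have : x = j + 1 := by omega
  rwa [← this]

/-- The link between compositions and colour sequences: the black strands to the left of the m-th
red one are those of the components up to m. -/
theorem cnt_colours (nu : MultiComp ℓ d) (m : Fin ℓ) : cnt nu.colours m = nu.start (m + 1) := by
  have h1 : (fun m : Fin ℓ => (⟨nu.redPlace m, nu.redPlace_lt m⟩ : Fin (ℓ + d))) =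
      nu.colours.reds.orderEmbOfFin nu.colours.card_reds := by
    refine Finset.orderEmbOfFin_unique _ (fun m => ?_) fun m m' h => nu.redPlace_strictMono h
    refine Finset.mem_filter.mpr ⟨Finset.mem_univ _, ?_⟩
    simp only [colours, decide_eq_true_eq]
    exact ⟨m, rfl⟩
  have h2 := redPos_val nu.colours m
  rw [redPos_eq, ← congrFun h1 m] at h2
  have h3 : nu.redPlace m = m + nu.start (m + 1) := by
    unfold redPlace start
    congr 2
    ext s
    simp [Nat.lt_succ_iff]
  simp only at h2
  omega

theorem blocked (nu : MultiComp ℓ d) : Blocked nu.colours nu.concat.index := by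
  refine ⟨nu.intervalFibres_index, fun j hj m e => ?_⟩
  rw [cnt_colours] at e
  exact simple_mem_young.mp hj (by rw [← e]; exact nu.start_mem_bd (by omega))

theorem young_le_of_bd {nu mu : MultiComp ℓ d} (h : ∀ x ∈ nu.bd, x ∈ mu.bd) :
    mu.young ≤ nu.young := by
  refine fibre_le_iff.mpr fun i j e => ?_
  rcases le_total i j with hij | hij
  · exact (index_eq_iff hij).mpr fun x hx => (index_eq_iff hij).mp e x (h x hx)
  · exact ((index_eq_iff hij).mpr fun x hx => (index_eq_iff hij).mp e.symm x (h x hx)).symm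

theorem colours_eq_of_start {nu mu : MultiComp ℓ d} (h : ∀ t ≤ ℓ + 1, nu.start t = mu.start t) :
    nu.colours = mu.colours :=
  colourSeq_ext fun m => by rw [cnt_colours, cnt_colours, h _ (by omega)]

theorem start_eq_of_colours {nu mu : MultiComp ℓ d} (h : nu.colours = mu.colours) :
    ∀ t ≤ ℓ + 1, nu.start t = mu.start t := by
  intro t ht
  rcases Nat.eq_zero_or_pos t with rfl | h0
  · rw [start_zero, start_zero]
  · rcases Nat.lt_or_eq_of_le ht with h1 | rfl
    · have h2 := cnt_colours nu ⟨t - 1, by omega⟩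
      have h3 := cnt_colours mu ⟨t - 1, by omega⟩
      simp only [Nat.sub_add_cancel h0] at h2 h3
      rw [← h2, ← h3, h]
    · rw [start_last, start_last]

theorem bd_iff_of_index {nu mu : MultiComp ℓ d}
    (h : ∀ j : Fin (d - 1), simple j ∈ nu.young ↔ simple j ∈ mu.young) (x : ℕ) :
    x ∈ nu.bd ↔ x ∈ mu.bd := by
  rcases Nat.eq_zero_or_pos x with rfl | h0
  · exact iff_of_true nu.zero_mem_bd mu.zero_mem_bd
  · rcases lt_trichotomy x d with h1 | rfl | h1
    · have h2 := h ⟨x - 1, by omega⟩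
      rw [simple_mem_young, simple_mem_young, not_iff_not] at h2
      simpa only [Nat.sub_add_cancel h0] using h2
    · refine iff_of_true ?_ ?_
      · have := nu.start_mem_bd le_rfl
        rwa [start_last] at this
      · have := mu.start_mem_bd le_rfl
        rwa [start_last] at this
    · exact iff_of_false (fun h => absurd (nu.le_of_mem_bd h) (by omega))
        (fun h => absurd (mu.le_of_mem_bd h) (by omega))

theorem eq_of_colours {nu mu : MultiComp ℓ d} (hc : nu.colours = mu.colours)
    (h : ∀ j : Fin (d - 1), simple j ∈ nu.young ↔ simple j ∈ mu.young) : nu = mu :=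
  ext_bd (start_eq_of_colours hc) (bd_iff_of_index h)

/-- Finiteness is needed to write an endomorphism of the direct sum as a finite sum of its
components. -/
instance : Finite (MultiComp ℓ d) := by
  refine Finite.of_injective
    (fun nu : MultiComp ℓ d => (nu.colours, {j : Fin (d - 1) | simple j ∈ nu.young})) ?_
  intro nu mu e
  obtain ⟨h1, h2⟩ := Prod.ext_iff.mp e
  exact eq_of_colours h1 fun j => Set.ext_iff.mp h2 j

end MultiComp

/-! ### Homomorphisms between the right ideals -/

section Homs

variable {k : Type*} [Field k] {ℓ d : ℕ} {q : k} {Q : Fin ℓ → k} {α : Type*}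

local notation "𝐞" c:max => heckeGen q Q (Gen.e c)

theorem signElt_id (b : ColourSeq ℓ d) : signElt q Q b (id : Fin d → Fin d) = 𝐞 b := by
  have h : allReps (id : Fin d → Fin d) = {1} := by
    ext z
    rw [mem_allReps, Finset.mem_singleton]
    exact ⟨fun hz => Equiv.ext hz, fun e => e ▸ one_mem _⟩
  rw [signElt, h, signSum, Finset.sum_singleton, len_one, pow_zero, one_smul, stdElt_one]

theorem blocked_id (b : ColourSeq ℓ d) : Blocked b (id : Fin d → Fin d) :=
  ⟨intervalFibres_id, fun j hj => absurd (simple_mem_fibreSubgroup.mp hj) (lo_lt_hi j).ne⟩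

/-- The sign-invariant elements are the left multiples of the sign element. -/
theorem IsSign.exists_eq_mul (hq : q ≠ 0) {c : ColourSeq ℓ d} {g : Fin d → α} (h : Blocked c g)
    {x : Hecke q Q d} (hx : IsSign q Q c g x) : ∃ y, x = y * signElt q Q c g := by
  have key : ∀ b, ∃ y, 𝐞 b * x = y * signElt q Q c g := by
    intro b
    -- With the trivial group on the left all the intersections are trivial. So every choice of
    -- words intertwines, and each signed sum runs over all of S_g, which makes the sign element a
    -- right factor.
    have hch : IsChoice q Q b c (id : Fin d → Fin d) g fun w => redWord (strandPerm b c w) := by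
      refine ⟨fun w _ => redWord_spec _, fun w _ z hz => ?_⟩
      have : z = 1 := by
        refine Equiv.ext fun i => w.injective ?_
        exact (Prod.ext_iff.mp (hz i)).2
      rw [this, mul_one, mul_inv_cancel, stdElt_one, stdElt_one, mul_assoc, e_mul_e,
        tw_redWord_mul_e, e_mul_stdElt]
    have hs : IsSign q Q c g (signElt q Q b (id : Fin d → Fin d) * x) := by
      refine ⟨by rw [mul_assoc, hx.1], fun t ht => by rw [mul_assoc, hx.2 t ht, mul_neg]⟩
    obtain ⟨F, -, hF⟩ := hch.exists_symm hq (blocked_id b) h hs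
    rw [signElt_id] at hF
    have hm : ∀ w : Perm (Fin d), minReps (meet (id : Fin d → Fin d) g w) g = allReps g := by
      intro w
      ext u
      rw [mem_allReps, mem_minReps]
      refine ⟨fun hu => hu.1, fun hu => ⟨hu, fun i j hij e => ?_⟩⟩
      exact absurd (w.injective (Prod.ext_iff.mp e).2) hij.ne
    simp only [hm] at hF
    exact ⟨_, hF.trans (Finset.sum_mul _ _ _).symm⟩
  choose y hy using key
  refine ⟨∑ b, y b, ?_⟩
  rw [Finset.sum_mul, ← Finset.sum_congr rfl fun b _ => hy b, ← Finset.sum_mul, sum_e, one_mul]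

/-- The sign element of a composition. -/
noncomputable abbrev mSign (q : k) (Q : Fin ℓ → k) (nu : MultiComp ℓ d) : Hecke q Q d :=
  signElt q Q nu.colours nu.concat.index

theorem exists_mElt_eq (hq : q ≠ 0) (nu : MultiComp ℓ d) :
    ∃ t : k, t ≠ 0 ∧ mElt q Q nu = t • mSign q Q nu :=
  exists_signedSum_eq q Q nu.colours hq fun _ => mem_allReps.symm

theorem mem_mIdeal_iff (hq : q ≠ 0) {nu : MultiComp ℓ d} {x : Hecke q Q d} :
    x ∈ mIdeal q Q nu ↔ ∃ h, x = mSign q Q nu * h := by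
  obtain ⟨t, ht, e⟩ := exists_mElt_eq (Q := Q) hq nu
  rw [Submodule.mem_span_singleton]
  constructor
  · rintro ⟨a, rfl⟩
    refine ⟨t • a.unop, ?_⟩
    rw [e, mul_smul_comm, ← smul_mul_assoc]
    rfl
  · rintro ⟨h, rfl⟩
    refine ⟨MulOpposite.op (t⁻¹ • h), ?_⟩
    rw [e, op_smul_eq_mul, smul_mul_smul_comm, mul_inv_cancel₀ ht, one_smul]

theorem mSign_mem (hq : q ≠ 0) (nu : MultiComp ℓ d) : mSign q Q nu ∈ mIdeal q Q nu :=
  (mem_mIdeal_iff hq).mpr ⟨1, (mul_one _).symm⟩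

theorem mul_mem_mIdeal {nu : MultiComp ℓ d} {x : Hecke q Q d} (hx : x ∈ mIdeal q Q nu)
    (h : Hecke q Q d) : x * h ∈ mIdeal q Q nu :=
  Submodule.smul_mem _ (MulOpposite.op h) hx

/-- The left multiplication with `y`. -/
noncomputable def leftHom (hq : q ≠ 0) {lam mu : MultiComp ℓ d} (y : Hecke q Q d)
    (hy : y * mSign q Q lam ∈ mIdeal q Q mu) : HomSpace q Q lam mu where
  toFun x := ⟨y * x, by
    obtain ⟨h, e⟩ := (mem_mIdeal_iff hq).mp x.2
    rw [e, ← mul_assoc]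
    exact mul_mem_mIdeal hy h⟩
  map_add' x x' := Subtype.ext (by simp [mul_add])
  map_smul' a x := Subtype.ext (mul_assoc y (x : Hecke q Q d) a.unop).symm

theorem leftHom_apply (hq : q ≠ 0) {lam mu : MultiComp ℓ d} (y : Hecke q Q d)
    (hy : y * mSign q Q lam ∈ mIdeal q Q mu) (x : mIdeal q Q lam) :
    (leftHom hq y hy x : Hecke q Q d) = y * x := rfl

/-- The value of a homomorphism at `m_lam`. -/
noncomputable def evalHom (lam mu : MultiComp ℓ d) : HomSpace q Q lam mu →ₗ[k] Hecke q Q d where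
  toFun f := (f (mMul q Q lam 1) : Hecke q Q d)
  map_add' _ _ := rfl
  map_smul' _ _ := rfl

theorem hom_mMul {lam mu : MultiComp ℓ d} (f : HomSpace q Q lam mu) (h : Hecke q Q d) :
    (f (mMul q Q lam h) : Hecke q Q d) = evalHom lam mu f * h := by
  have e : mMul q Q lam h = MulOpposite.op h • mMul q Q lam 1 :=
    Subtype.ext (by
      change mElt q Q lam * h = mElt q Q lam * 1 * h
      rw [mul_one])
  rw [e, map_smul]
  rfl

theorem exists_eq_mMul {lam : MultiComp ℓ d} (x : mIdeal q Q lam) : ∃ h, x = mMul q Q lam h := by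
  obtain ⟨a, ha⟩ := Submodule.mem_span_singleton.mp x.2
  exact ⟨a.unop, Subtype.ext ha.symm⟩

theorem evalHom_injective (lam mu : MultiComp ℓ d) :
    Function.Injective (evalHom (q := q) (Q := Q) lam mu) := by
  intro f f' e
  refine LinearMap.ext fun x => Subtype.ext ?_
  obtain ⟨h, rfl⟩ := exists_eq_mMul x
  rw [hom_mMul, hom_mMul, e]

theorem isSign_smul {c : ColourSeq ℓ d} {g : Fin d → α} {x : Hecke q Q d} (hx : IsSign q Q c g x)
    (t : k) : IsSign q Q c g (t • x) :=
  ⟨by rw [smul_mul_assoc, hx.1], fun j hj => by rw [smul_mul_assoc, hx.2 j hj, smul_neg]⟩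

theorem isSign_mElt (hq : q ≠ 0) (nu : MultiComp ℓ d) :
    IsSign q Q nu.colours nu.concat.index (mElt q Q nu) := by
  obtain ⟨t, -, e⟩ := exists_mElt_eq (Q := Q) hq nu
  rw [e]
  exact isSign_smul (isSign_signElt hq nu.blocked) t

/-- The sign relations of m_lam are right multiplications, so any homomorphism preserves them. -/
theorem isSign_evalHom (hq : q ≠ 0) {lam mu : MultiComp ℓ d} (f : HomSpace q Q lam mu) :
    IsSign q Q lam.colours lam.concat.index (evalHom lam mu f) := by
  have h := isSign_mElt (Q := Q) hq lam
  refine ⟨?_, fun t ht => ?_⟩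
  · rw [← hom_mMul]
    have : mMul q Q lam (𝐞 lam.colours) = mMul q Q lam 1 := Subtype.ext (by
      change mElt q Q lam * _ = mElt q Q lam * 1
      rw [h.1, mul_one])
    rw [this]
    rfl
  · rw [← hom_mMul]
    have : mMul q Q lam (stdElt q Q lam.colours lam.colours (simple t)) = -mMul q Q lam 1 :=
      Subtype.ext (by
        change mElt q Q lam * _ = -(mElt q Q lam * 1)
        rw [h.2 t ht, mul_one])
    rw [this, map_neg]
    rfl

/-- A sign vector is y times the sign element of lam, and left multiplication by y, suitably scaled,
takes m_lam to it. -/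
theorem exists_evalHom_eq (hq : q ≠ 0) {lam mu : MultiComp ℓ d} {x : Hecke q Q d}
    (hx : x ∈ mIdeal q Q mu) (hs : IsSign q Q lam.colours lam.concat.index x) :
    ∃ f : HomSpace q Q lam mu, evalHom lam mu f = x := by
  obtain ⟨t, ht, e⟩ := exists_mElt_eq (Q := Q) hq lam
  obtain ⟨y, hy⟩ := hs.exists_eq_mul hq lam.blocked
  refine ⟨leftHom hq (t⁻¹ • y) ?_, ?_⟩
  · rw [smul_mul_assoc, ← hy]
    exact Submodule.smul_of_tower_mem _ t⁻¹ hx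
  · change (t⁻¹ • y) * (mElt q Q lam * 1) = x
    rw [mul_one, e, smul_mul_smul_comm, inv_mul_cancel₀ ht, one_smul, ← hy]

theorem interSubgroup_eq (lam mu : MultiComp ℓ d) (w : Perm (Fin d)) :
    interSubgroup lam mu w = fibreSubgroup (meet mu.concat.index lam.concat.index w) := by
  ext z
  constructor
  · rintro ⟨h1, h2⟩ i
    have h3 := h2 (w i)
    refine Prod.ext (h1 i) ?_
    simpa using h3
  · intro h
    exact ⟨meet_le _ _ w h, conj_mem_of_mem_meet h⟩

theorem isChoice_of_isAdmissible {lam mu : MultiComp ℓ d}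
    {D : Perm (Fin d) → List (Fin (ℓ + d - 1))}
    (hD : ∀ w, IsDoubleMin mu.young lam.young w → IsAdmissible q Q lam mu w (D w)) :
    IsChoice q Q mu.colours lam.colours mu.concat.index lam.concat.index D := by
  have h := fun w hw => hD w ((isDoubleMin_iff mu.intervalFibres_index
    lam.intervalFibres_index).mpr hw)
  refine ⟨fun w hw => (h w hw).1, fun w hw z hz => (h w hw).2 z ?_⟩
  rw [interSubgroup_eq]
  exact hz

theorem IsChoice.linearIndependent {β : Type*} (hq : q ≠ 0) {b c : ColourSeq ℓ d} {f : Fin d → β}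
    {g : Fin d → α} (hb : Blocked b f) (hc : Blocked c g)
    {D : Perm (Fin d) → List (Fin (ℓ + d - 1))} (hch : IsChoice q Q b c f g D) :
    LinearIndependent k fun wa : Σ w : {w // LocalMin f g w}, {a // Dominant (meet f g w.1) a} =>
      dcGen q Q b c f D wa.1.1 * phi q Q (symmMon q (meet f g wa.1.1) wa.2.1) *
        signSum q (stdElt q Q c c) (minReps (meet f g wa.1.1) g) := by
  classical
  set L : {w // LocalMin f g w} → Laurent k d →ₗ[k] Hecke q Q d := fun w =>
    (LinearMap.mulRight k (signSum q (stdElt q Q c c) (minReps (meet f g w.1) g))).comp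
      ((LinearMap.mulLeft k (dcGen q Q b c f D w.1)).comp (phi q Q).toLinearMap) with hL
  -- Independence holds first in the product over w of the polynomial rings, and is then carried to
  -- the Hecke algebra by a map that is injective because the double cosets are independent.
  have h1 := Pi.linearIndependent_single
    (fun (w : {w // LocalMin f g w}) (a : {a // Dominant (meet f g w.1) a}) =>
      symmMon q (meet f g w.1) a.1)
    (fun w => linearIndependent_symmMon hq (w.2.intervalFibres hb.1 hc.1))
  have h2 := h1.map' (LinearMap.lsum k (fun _ => Laurent k d) k L) ?_
  · have e : (fun wa : Σ w : {w // LocalMin f g w}, {a // Dominant (meet f g w.1) a} =>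
        dcGen q Q b c f D wa.1.1 * phi q Q (symmMon q (meet f g wa.1.1) wa.2.1) *
          signSum q (stdElt q Q c c) (minReps (meet f g wa.1.1) g)) =
        LinearMap.lsum k (fun _ => Laurent k d) k L ∘ fun ji =>
          Pi.single ji.1 (symmMon q (meet f g ji.1.1) ji.2.1) := by
      funext wa
      rw [Function.comp_apply, LinearMap.lsum_piSingle]
      rfl
    rw [e]
    exact h2
  · rw [LinearMap.ker_eq_bot']
    intro F hF
    have h3 : ∑ w ∈ dmin f g, dcGen q Q b c f D w *
        phi q Q (if h : LocalMin f g w then F ⟨w, h⟩ else 0) *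
        signSum q (stdElt q Q c c) (minReps (meet f g w) g) = 0 := by
      rw [← hF, LinearMap.lsum_apply, LinearMap.sum_apply]
      refine Finset.sum_bij (fun w hw => (⟨w, mem_dmin.mp hw⟩ : {w // LocalMin f g w}))
        (fun _ _ => Finset.mem_univ _) (fun _ _ _ _ e => (Subtype.ext_iff.mp e))
        (fun w _ => ⟨w.1, mem_dmin.mpr w.2, rfl⟩) fun w hw => ?_
      rw [dif_pos (mem_dmin.mp hw)]
      rfl
    ext1 w
    have h4 := hch.symm_eq_zero_of_mem_flt hq hb hc (N := 0) (by rw [h3]; exact zero_mem _)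
      (one_mem _) w.2 (one_mem_minReps _ _) (Nat.zero_le _)
    rw [dif_pos w.2] at h4
    exact h4

theorem IsChoice.mem_span {β : Type*} (hq : q ≠ 0) {b c : ColourSeq ℓ d} {f : Fin d → β}
    {g : Fin d → α} (hb : Blocked b f) (hc : Blocked c g)
    {D : Perm (Fin d) → List (Fin (ℓ + d - 1))} (hch : IsChoice q Q b c f g D) {h : Hecke q Q d}
    (hs : IsSign q Q c g (signElt q Q b f * h)) :
    signElt q Q b f * h ∈ Submodule.span k (Set.range
      fun wa : Σ w : {w // LocalMin f g w}, {a // Dominant (meet f g w.1) a} =>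
      dcGen q Q b c f D wa.1.1 * phi q Q (symmMon q (meet f g wa.1.1) wa.2.1) *
        signSum q (stdElt q Q c c) (minReps (meet f g wa.1.1) g)) := by
  obtain ⟨F, hF, e⟩ := hch.exists_symm hq hb hc hs
  rw [e]
  refine sum_mem fun w hw => ?_
  have hw := mem_dmin.mp hw
  have h1 := (hch.isSign hq hb hc hw).span_symmMon hq (hw.blocked hb.1 hc)
    (hch.faithful hq hb hc hw)
  have h2 : F w ∈ symmSub k (meet f g w) := hF w hw
  rw [← h1] at h2
  set L : Laurent k d →ₗ[k] Hecke q Q d :=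
    (LinearMap.mulRight k (signSum q (stdElt q Q c c) (minReps (meet f g w) g))).comp
      ((LinearMap.mulLeft k (dcGen q Q b c f D w)).comp (phi q Q).toLinearMap) with hL
  have h3 := Submodule.mem_map_of_mem (f := L) h2
  rw [Submodule.map_span] at h3
  refine Submodule.span_mono ?_ h3
  rintro _ ⟨_, ⟨a, rfl⟩, rfl⟩
  exact ⟨⟨⟨w, hw⟩, a⟩, rfl⟩

/-- The basis of the space of homomorphisms. -/
theorem exists_basis (hq : q ≠ 0) (lam mu : MultiComp ℓ d)
    (D : Perm (Fin d) → List (Fin (ℓ + d - 1)))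
    (hD : ∀ w, IsDoubleMin mu.young lam.young w → IsAdmissible q Q lam mu w (D w)) :
    ∃ b : Module.Basis (BasisIndex lam mu) k (HomSpace q Q lam mu),
      ∀ i : BasisIndex lam mu, IsBasisMap q Q i.1.1 i.1.2 (D i.1.1) (b i) := by
  have hch := isChoice_of_isAdmissible hD
  have hb := mu.blocked
  have hc := lam.blocked
  set f := mu.concat.index with hf
  set g := lam.concat.index with hg
  obtain ⟨t, ht, et⟩ := exists_mElt_eq (Q := Q) hq mu
  set x : (Σ w : {w // LocalMin f g w}, {a // Dominant (meet f g w.1) a}) → Hecke q Q d :=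
    fun wa => dcGen q Q mu.colours lam.colours f D wa.1.1 *
      phi q Q (symmMon q (meet f g wa.1.1) wa.2.1) *
        signSum q (stdElt q Q lam.colours lam.colours) (minReps (meet f g wa.1.1) g) with hx
  have hxs : ∀ wa, ∃ v : HomSpace q Q lam mu, evalHom lam mu v = x wa := by
    intro wa
    refine exists_evalHom_eq hq ((mem_mIdeal_iff hq).mpr ⟨_, by
      simp only [hx, dcGen, mul_assoc]; rfl⟩) ?_
    refine hch.isSign_symm hq hb hc wa.1.2 ?_
    exact (hch.isSign hq hb hc wa.1.2).symmMon hq (wa.1.2.blocked hb.1 hc)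
      (hch.faithful hq hb hc wa.1.2) wa.2.2
  choose v hv using hxs
  have hli : LinearIndependent k v := by
    refine LinearIndependent.of_comp (evalHom lam mu) ?_
    have : (evalHom lam mu) ∘ v = x := funext hv
    rw [this]
    exact hch.linearIndependent hq hb hc
  have hsp : ⊤ ≤ Submodule.span k (Set.range v) := by
    intro φ _
    obtain ⟨h, e⟩ := (mem_mIdeal_iff hq).mp (φ (mMul q Q lam 1)).2
    have e' : evalHom lam mu φ = mSign q Q mu * h := e
    have h1 := isSign_evalHom hq φ
    rw [e'] at h1
    have h2 := hch.mem_span hq hb hc h1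
    have h3 : Set.range x = evalHom lam mu '' Set.range v := by
      rw [← Set.range_comp]
      exact congrArg Set.range (funext hv).symm
    rw [← hx, h3, ← Submodule.map_span] at h2
    obtain ⟨φ', h4, h5⟩ := h2
    rw [← evalHom_injective lam mu (h5.trans e'.symm)]
    exact h4
  -- The signed sum over D_{w,p} factors into the sum over the cosets of the stabilizer of a inside
  -- S_lam ∩ w⁻¹ S_mu w, which symmetrizes x^a, and the sum over the cosets of this intersection in
  -- S_lam. The normalizations of the signed sums account for the scalar.
  have hunit : ∀ wa : (Σ w : {w // LocalMin f g w}, {a // Dominant (meet f g w.1) a}),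
      ∃ s : kˣ, mElt q Q mu * diagElt q Q lam.colours (D wa.1.1) * xMon q Q wa.2.1 *
        signedSum q Q lam.colours
          (leftMin (interSubgroup lam mu wa.1.1 ⊓ fibreSubgroup wa.2.1) lam.young) =
        (s : k) • x wa := by
    rintro ⟨⟨w, hw⟩, ⟨a, ha⟩⟩
    have hκ := hw.blocked hb.1 hc
    have ha' := ha.intervalFibres hκ.1
    have e1 : interSubgroup lam mu w ⊓ fibreSubgroup a =
        fibreSubgroup (withExp (meet f g w) a) := by
      rw [interSubgroup_eq]
      ext z
      exact ⟨fun h i => Prod.ext (h.1 i) (h.2 i),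
        fun h => ⟨fun i => (Prod.ext_iff.mp (h i)).1, fun i => (Prod.ext_iff.mp (h i)).2⟩⟩
    obtain ⟨s, hs, es⟩ := exists_signedSum_eq q Q lam.colours hq
      (S := leftMin (fibreSubgroup (withExp (meet f g w) a)) lam.young)
      (T := minReps (withExp (meet f g w) a) g) fun y =>
        (mem_leftMin_iff ha').trans mem_minReps.symm
    refine ⟨Units.mk0 (t * s) (mul_ne_zero ht hs), ?_⟩
    simp only [e1, es, et, hx, Units.val_mk0]
    rw [← (hch.isSign hq hb hc hw).mul_symmMon hκ, mul_assoc (dcGen _ _ _ _ _ _ _ * _),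
      (heckeFam_stdElt q Q hc).signSum_mul_signSum hc.1 hκ.1 (withExp_le _ a) (meet_le f g w),
      mul_smul_comm, phi_mon, dcGen, diagElt_eq]
    simp only [smul_mul_assoc, smul_smul, mul_assoc, mul_comm s t]
    rfl
  choose s hs using hunit
  -- Rescaling by the units makes the basis satisfy the stated formula exactly.
  set B := (Module.Basis.mk hli hsp).unitsSMul s with hB
  have hBv : ∀ wa, evalHom lam mu (B wa) = (s wa : k) • x wa := by
    intro wa
    rw [hB, Module.Basis.unitsSMul_apply, Module.Basis.mk_apply, Units.smul_def, map_smul, hv]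
  have hdom : ∀ w a, IsDominant lam mu w a ↔ Dominant (meet f g w) a := fun w a => by
    unfold IsDominant Dominant
    rw [interSubgroup_eq]
  have hmin : ∀ w, IsDoubleMin mu.young lam.young w ↔ LocalMin f g w := fun w =>
    isDoubleMin_iff hb.1 hc.1
  set E : (Σ w : {w // LocalMin f g w}, {a // Dominant (meet f g w.1) a}) ≃ BasisIndex lam mu :=
    { toFun := fun wa => ⟨(wa.1.1, wa.2.1), (hmin _).mpr wa.1.2, (hdom _ _).mpr wa.2.2⟩
      invFun := fun i => ⟨⟨i.1.1, (hmin _).mp i.2.1⟩, ⟨i.1.2, (hdom _ _).mp i.2.2⟩⟩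
      left_inv := fun _ => rfl
      right_inv := fun _ => rfl } with hE
  refine ⟨B.reindex E, fun i h => ?_⟩
  rw [hom_mMul, Module.Basis.reindex_apply, hBv, ← hs]
  rfl

end Homs

/-! ### The generators of the affine Schur algebra -/

section Generators

variable {k : Type*} [Field k] {ℓ d : ℕ} {q : k} {Q : Fin ℓ → k} {α : Type*}

local notation "𝐞" c:max => heckeGen q Q (Gen.e c)
local notation "𝐓" r:max => heckeGen q Q (Gen.T r)

/-- In a bad triple two black strands cross one red strand from opposite sides. Permutations within
blocks do not reach the red strands, and all of these move in the same direction. -/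
theorem not_badTriple_of_cnt {b c : ColourSeq ℓ d} {g : Fin d → α} (h : Blocked c g)
    (hbc : (∀ m, cnt c m ≤ cnt b m) ∨ ∀ m, cnt b m ≤ cnt c m) {z : Perm (Fin d)}
    (hz : z ∈ fibreSubgroup g) : ¬ BadTriple (strandPerm b c z) c := by
  rintro ⟨i, j, m, hij, hjm, h1, h2, hi, hj, hm⟩
  obtain ⟨i, rfl⟩ := exists_blackPos hi
  obtain ⟨p, rfl⟩ := exists_redPos hj
  obtain ⟨m, rfl⟩ := exists_blackPos hm
  rw [strandPerm_redPos, strandPerm_blackPos] at h1 h2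
  rw [blackPos_lt_redPos] at hij h1
  rw [redPos_lt_blackPos] at hjm h2
  have e1 := h.cnt_le_iff (hz i) p
  have e2 := h.cnt_le_iff (hz m) p
  rcases hbc with hbc | hbc
  · have := hbc p
    omega
  · have := hbc p
    omega

theorem crossing_mul_stdElt {b c : ColourSeq ℓ d} {g : Fin d → α} (hb : Blocked b g)
    (hc : Blocked c g) (hbc : (∀ m, cnt c m ≤ cnt b m) ∨ ∀ m, cnt b m ≤ cnt c m)
    {z : Perm (Fin d)} (hz : z ∈ fibreSubgroup g) :
    stdElt q Q b c 1 * stdElt q Q c c z = stdElt q Q b b z * stdElt q Q b c 1 := by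
  have m1 : MonoFib g (1 : Perm (Fin d)) := fun i j hij _ => hij
  have h1 := tw_mul_e_mul_stdElt q Q b (hc.not_badTriple hz)
    (by rw [one_mul]; exact not_badTriple_of_cnt hc hbc hz)
    (not_badTriple_of_cnt hc hbc (one_mem _)) (len_strandPerm_mul_right hc hz m1)
  have h2 := tw_mul_e_mul_stdElt q Q b (not_badTriple_of_cnt hc hbc (one_mem _))
    (by rw [mul_one]; exact not_badTriple_of_cnt hc hbc hz) (hb.not_badTriple hz)
    (len_strandPerm_mul_left hb hz (by rw [inv_one]; exact m1))
  rw [one_mul] at h1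
  rw [mul_one] at h2
  rw [h1, h2]

theorem crossing_mul_signElt {b c : ColourSeq ℓ d} {g : Fin d → α} (hb : Blocked b g)
    (hc : Blocked c g) (hbc : (∀ m, cnt c m ≤ cnt b m) ∨ ∀ m, cnt b m ≤ cnt c m) :
    stdElt q Q b c 1 * signElt q Q c g = signElt q Q b g * stdElt q Q b c 1 := by
  rw [signElt, signElt, signSum, signSum, Finset.mul_sum, Finset.sum_mul]
  refine Finset.sum_congr rfl fun z hz => ?_
  rw [mul_smul_comm, smul_mul_assoc, crossing_mul_stdElt hb hc hbc (mem_allReps.mp hz)]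

/-- The divided difference of a symmetric polynomial vanishes, so the polynomial commutes with each
black crossing inside its blocks. -/
theorem phi_mul_stdElt {c : ColourSeq ℓ d} {g : Fin d → α} (h : Blocked c g) {p : Laurent k d}
    (hp : IsSymm g p) {y : Perm (Fin d)} (hy : y ∈ fibreSubgroup g) :
    phi q Q p * stdElt q Q c c y = stdElt q Q c c y * phi q Q p := by
  obtain ⟨m, hm⟩ : ∃ m, len y = m := ⟨_, rfl⟩
  induction m generalizing y with
  | zero => rw [eq_one_of_len y hm, stdElt_one, phi_mul_e]
  | succ m ih =>
    obtain ⟨r, hr⟩ : ∃ r, y (hi r) < y (lo r) := by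
      by_contra hc
      push Not at hc
      rw [eq_one_of_no_descent y fun r => not_lt.mpr (hc r), len_one] at hm
      omega
    have hs := simple_mem_of_descent h.1 hy hr
    have h1 := len_mul_simple y r hr
    have h3 := (heckeFam_stdElt q Q h).mul_simple _ (mul_mem hy hs) r hs (by
      rw [Perm.mul_apply, Perm.mul_apply, simple_lo, simple_hi]; exact hr)
    rw [mul_simple_mul_simple] at h3
    obtain ⟨j, e1, e2, e3⟩ := h.adj q Q hs
    have h4 : phi q Q p * stdElt q Q c c (simple r) = stdElt q Q c c (simple r) * phi q Q p := by
      have h5 : divDiff r p = 0 :=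
        (divDiff_unique (by rw [hp r hs, sub_self, mul_zero, mul_zero])).symm
      rw [e3, ← mul_assoc, phi_T_e q Q e1 e2, hp r hs, h5, map_zero, zero_mul, smul_zero, sub_zero,
        mul_assoc, mul_assoc, phi_mul_e]
    rw [← h3, ← mul_assoc, ih (mul_mem hy hs) (by omega), mul_assoc, h4, mul_assoc]

theorem phi_mul_signElt {c : ColourSeq ℓ d} {g : Fin d → α} (h : Blocked c g) {p : Laurent k d}
    (hp : IsSymm g p) : phi q Q p * signElt q Q c g = signElt q Q c g * phi q Q p := by
  rw [signElt, signSum, Finset.mul_sum, Finset.sum_mul]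
  refine Finset.sum_congr rfl fun z hz => ?_
  rw [mul_smul_comm, smul_mul_assoc, phi_mul_stdElt h hp (mem_allReps.mp hz)]

theorem isSymm_of_isInvariant {lam : MultiComp ℓ d} {p : Laurent k d} (h : IsInvariant lam p) :
    IsSymm lam.concat.index p := by
  intro j hj
  ext a
  rw [coeff_permAut]
  exact h _ hj a

theorem isInvariant_of_isSymm {lam : MultiComp ℓ d} {p : Laurent k d}
    (h : IsSymm lam.concat.index p) : IsInvariant lam p := fun _ hw a =>
  h.coeff_comp lam.intervalFibres_index hw a

/-- The factor on the left that turns the sign element of a refinement into a sign element. -/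
noncomputable def mergeElt (q : k) (Q : Fin ℓ → k) (kap lam : MultiComp ℓ d) : Hecke q Q d :=
  ∑ u ∈ minReps kap.concat.index lam.concat.index,
    (-q)⁻¹ ^ len u • stdElt q Q lam.colours lam.colours u⁻¹

theorem mSign_eq_mul {kap lam : MultiComp ℓ d} (hc : kap.colours = lam.colours)
    (h : kap.young ≤ lam.young) : mSign q Q lam = mSign q Q kap *
      signSum q (stdElt q Q lam.colours lam.colours)
        (minReps kap.concat.index lam.concat.index) := by
  have := (heckeFam_stdElt q Q lam.blocked).mul_signSum lam.intervalFibres_index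
    kap.intervalFibres_index h
  rw [mSign, mSign, hc]
  exact this.symm

theorem mSign_eq_mul_left {kap lam : MultiComp ℓ d} (hc : kap.colours = lam.colours)
    (h : kap.young ≤ lam.young) : mergeElt q Q kap lam * mSign q Q kap = mSign q Q lam := by
  have := (heckeFam_stdElt q Q lam.blocked).exists_mul_signSum lam.intervalFibres_index
    kap.intervalFibres_index h
  rw [mSign, mSign, hc]
  exact this.symm

theorem exists_isSplitMap (hq : q ≠ 0) {lam mu : MultiComp ℓ d} (h : lam.IsSplit mu) :
    ∃ f : HomSpace q Q lam mu, IsSplitMap q Q f := by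
  have hc := MultiComp.colours_eq_of_start fun t _ => (h.start_eq t).symm
  have hy := MultiComp.young_le_of_bd fun _ hx => h.bd_subset hx
  refine ⟨leftHom hq 1 ?_, fun x => by rw [leftHom_apply, one_mul]⟩
  rw [one_mul]
  exact (mem_mIdeal_iff hq).mpr ⟨_, mSign_eq_mul hc hy⟩

theorem exists_isMergeMap (hq : q ≠ 0) {lam mu : MultiComp ℓ d} (h : lam.IsSplit mu) :
    ∃ f : HomSpace q Q mu lam, IsMergeMap q Q f := by
  have hc := MultiComp.colours_eq_of_start fun t _ => (h.start_eq t).symm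
  have hy := MultiComp.young_le_of_bd fun _ hx => h.bd_subset hx
  obtain ⟨s, hs, es⟩ := exists_mElt_eq (Q := Q) hq mu
  obtain ⟨t, ht, et⟩ := exists_mElt_eq (Q := Q) hq lam
  have e1 := mSign_eq_mul_left (q := q) (Q := Q) hc hy
  refine ⟨leftHom hq ((t * s⁻¹) • mergeElt q Q mu lam) ?_, fun x => Subtype.ext ?_⟩
  · rw [smul_mul_assoc, e1]
    exact Submodule.smul_of_tower_mem _ _ (mSign_mem hq lam)
  · rw [leftHom_apply]
    change _ * (mElt q Q mu * x) = mElt q Q lam * x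
    rw [← mul_assoc, es, et, smul_mul_smul_comm, e1, mul_assoc t, inv_mul_cancel₀ hs, mul_one]

theorem IsLeftCrossing.colours {lam mu : MultiComp ℓ d} (h : lam.IsLeftCrossing mu) :
    ∀ m, cnt lam.colours m ≤ cnt mu.colours m := by
  obtain ⟨m, a, -, -, -, h4, h5⟩ := h.start_eq
  intro m'
  rw [MultiComp.cnt_colours, MultiComp.cnt_colours]
  by_cases e : (m' : ℕ) + 1 = m + 1
  · rw [e, h5]; omega
  · rw [h4 _ e]

theorem fibreSubgroup_index_eq {lam mu : MultiComp ℓ d} (h : ∀ x, x ∈ lam.bd ↔ x ∈ mu.bd) :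
    fibreSubgroup lam.concat.index = fibreSubgroup mu.concat.index :=
  le_antisymm (MultiComp.young_le_of_bd fun x hx => (h x).mpr hx)
    (MultiComp.young_le_of_bd fun x hx => (h x).mp hx)

theorem signElt_congr {β : Type*} (c : ColourSeq ℓ d) {g : Fin d → α} {g' : Fin d → β}
    (h : fibreSubgroup g = fibreSubgroup g') : signElt q Q c g = signElt q Q c g' := by
  have : allReps g = allReps g' := by
    ext z
    rw [mem_allReps, mem_allReps, h]
  rw [signElt, signElt, this]

theorem crossing_mul_mSign {lam mu : MultiComp ℓ d} (h : ∀ x, x ∈ lam.bd ↔ x ∈ mu.bd)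
    (hcnt : (∀ m, cnt lam.colours m ≤ cnt mu.colours m) ∨
      ∀ m, cnt mu.colours m ≤ cnt lam.colours m) :
    stdElt q Q mu.colours lam.colours 1 * mSign q Q lam =
      mSign q Q mu * stdElt q Q mu.colours lam.colours 1 := by
  have e := fibreSubgroup_index_eq h
  have hb : Blocked mu.colours lam.concat.index := mu.blocked.mono lam.intervalFibres_index e.le
  rw [mSign, mSign, crossing_mul_signElt hb lam.blocked hcnt, signElt_congr mu.colours e]

theorem exists_isCrossingMap (hq : q ≠ 0) {lam mu : MultiComp ℓ d}
    (h : lam.IsLeftCrossing mu ∨ mu.IsLeftCrossing lam) :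
    ∃ f : HomSpace q Q lam mu, IsCrossingMap q Q f := by
  refine ⟨leftHom hq (stdElt q Q mu.colours lam.colours 1) ?_, fun x => leftHom_apply hq _ _ x⟩
  rcases h with h | h
  · rw [crossing_mul_mSign (fun x => h.bd_iff x) (Or.inl (IsLeftCrossing.colours h))]
    exact mul_mem_mIdeal (mSign_mem hq mu) _
  · rw [crossing_mul_mSign (fun x => (h.bd_iff x).symm) (Or.inr (IsLeftCrossing.colours h))]
    exact mul_mem_mIdeal (mSign_mem hq mu) _

theorem exists_isPolyMap (hq : q ≠ 0) {lam : MultiComp ℓ d} {p : Laurent k d}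
    (h : IsInvariant lam p) : ∃ f : HomSpace q Q lam lam, IsPolyMap q Q p f := by
  refine ⟨leftHom hq (phi q Q p) ?_, fun x => by rw [leftHom_apply, xPoly_eq]⟩
  rw [phi_mul_signElt lam.blocked (isSymm_of_isInvariant h)]
  exact mul_mem_mIdeal (mSign_mem hq lam) _

/-! ### The subalgebra that they generate -/

/-- The subalgebra generated by idempotents, splits, merges, crossings and polynomials. -/
noncomputable abbrev genAlg (q : k) (Q : Fin ℓ → k) (d : ℕ) : Subalgebra k (SchurAlg q Q d) :=
  Algebra.adjoin k {φ : SchurAlg q Q d | IsGenerator q Q φ}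

theorem extend_mul_extend {lam mu nu : MultiComp ℓ d} (g : HomSpace q Q mu nu)
    (f : HomSpace q Q lam mu) : extend q Q g * extend q Q f = extend q Q (g ∘ₗ f) := by
  classical
  refine LinearMap.ext fun x => ?_
  simp only [extend, Module.End.mul_apply, LinearMap.comp_apply]
  congr 2
  exact DirectSum.component.lof_self _ _ _

theorem extend_add {lam mu : MultiComp ℓ d} (f g : HomSpace q Q lam mu) :
    extend q Q (f + g) = extend q Q f + extend q Q g := by
  refine LinearMap.ext fun x => ?_
  simp only [extend, LinearMap.comp_apply, LinearMap.add_apply, map_add]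

theorem extend_smul {lam mu : MultiComp ℓ d} (t : k) (f : HomSpace q Q lam mu) :
    extend q Q (t • f) = t • extend q Q f := by
  classical
  refine LinearMap.ext fun x => ?_
  simp only [extend, LinearMap.comp_apply, LinearMap.smul_apply]
  rw [← algebraMap_smul (Hecke q Q d)ᵐᵒᵖ t (f _), map_smul, algebraMap_smul]

/-- The left multiplication with `y` is a homomorphism in the generated subalgebra. -/
def LeftGen (q : k) (Q : Fin ℓ → k) (lam mu : MultiComp ℓ d) (y : Hecke q Q d) : Prop :=
  ∃ f : HomSpace q Q lam mu, (∀ x, (f x : Hecke q Q d) = y * x) ∧ extend q Q f ∈ genAlg q Q d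

theorem LeftGen.mul {lam mu nu : MultiComp ℓ d} {y y' : Hecke q Q d}
    (h' : LeftGen q Q mu nu y') (h : LeftGen q Q lam mu y) : LeftGen q Q lam nu (y' * y) := by
  obtain ⟨f', h1', h2'⟩ := h'
  obtain ⟨f, h1, h2⟩ := h
  refine ⟨f' ∘ₗ f, fun x => ?_, ?_⟩
  · rw [LinearMap.comp_apply, h1', h1, mul_assoc]
  · rw [← extend_mul_extend]
    exact mul_mem h2' h2

theorem LeftGen.smul {lam mu : MultiComp ℓ d} {y : Hecke q Q d} (h : LeftGen q Q lam mu y) (t : k) :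
    LeftGen q Q lam mu (t • y) := by
  obtain ⟨f, h1, h2⟩ := h
  refine ⟨t • f, fun x => ?_, ?_⟩
  · rw [smul_mul_assoc, ← h1]
    rfl
  · rw [extend_smul]
    exact Subalgebra.smul_mem _ h2 t

theorem LeftGen.add {lam mu : MultiComp ℓ d} {y y' : Hecke q Q d} (h : LeftGen q Q lam mu y)
    (h' : LeftGen q Q lam mu y') : LeftGen q Q lam mu (y + y') := by
  obtain ⟨f, h1, h2⟩ := h
  obtain ⟨f', h1', h2'⟩ := h'
  refine ⟨f + f', fun x => ?_, ?_⟩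
  · rw [add_mul, ← h1, ← h1']
    rfl
  · rw [extend_add]
    exact add_mem h2 h2'

/-- A homomorphism from `m_lam H` depends only on its value at the generator, so left multipliers
matter only through their product with the sign element. -/
theorem LeftGen.congr (hq : q ≠ 0) {lam mu : MultiComp ℓ d} {y y' : Hecke q Q d}
    (h : LeftGen q Q lam mu y) (e : y * mSign q Q lam = y' * mSign q Q lam) :
    LeftGen q Q lam mu y' := by
  obtain ⟨f, h1, h2⟩ := h
  refine ⟨f, fun x => ?_, h2⟩
  obtain ⟨a, ha⟩ := (mem_mIdeal_iff hq).mp x.2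
  rw [h1, ha, ← mul_assoc, ← mul_assoc, e]

theorem LeftGen.zero (lam mu : MultiComp ℓ d) : LeftGen q Q lam mu 0 := by
  refine ⟨0, fun x => by rw [zero_mul]; rfl, ?_⟩
  have : extend q Q (0 : HomSpace q Q lam mu) = 0 := by
    have := extend_smul (0 : k) (0 : HomSpace q Q lam mu)
    rwa [zero_smul, zero_smul] at this
  rw [this]
  exact zero_mem _

theorem LeftGen.sum {ι : Type*} {lam mu : MultiComp ℓ d} {y : ι → Hecke q Q d} (S : Finset ι)
    (h : ∀ i ∈ S, LeftGen q Q lam mu (y i)) : LeftGen q Q lam mu (∑ i ∈ S, y i) :=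
  Finset.sum_induction y (LeftGen q Q lam mu) (fun _ _ => LeftGen.add) (LeftGen.zero lam mu) h

theorem LeftGen.mem {lam mu : MultiComp ℓ d} {y : Hecke q Q d} (h : LeftGen q Q lam mu y)
    {f : HomSpace q Q lam mu} (hf : ∀ x, (f x : Hecke q Q d) = y * x) :
    extend q Q f ∈ genAlg q Q d := by
  obtain ⟨f', h1, h2⟩ := h
  have : f = f' := LinearMap.ext fun x => Subtype.ext ((hf x).trans (h1 x).symm)
  rw [this]
  exact h2

theorem LeftGen.one (lam : MultiComp ℓ d) : LeftGen q Q lam lam 1 :=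
  ⟨LinearMap.id, fun x => (one_mul _).symm, Algebra.subset_adjoin (IsGenerator.idem lam)⟩

theorem LeftGen.poly (hq : q ≠ 0) {lam : MultiComp ℓ d} {p : Laurent k d}
    (hp : IsSymm lam.concat.index p) : LeftGen q Q lam lam (phi q Q p) := by
  have h := isInvariant_of_isSymm hp
  obtain ⟨f, hf⟩ := exists_isPolyMap (Q := Q) hq h
  refine ⟨f, fun x => ?_, Algebra.subset_adjoin (IsGenerator.poly lam p h f hf)⟩
  rw [hf, xPoly_eq]

theorem LeftGen.leftCrossing (hq : q ≠ 0) {lam mu : MultiComp ℓ d} (h : lam.IsLeftCrossing mu) :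
    LeftGen q Q lam mu (stdElt q Q mu.colours lam.colours 1) := by
  obtain ⟨f, hf⟩ := exists_isCrossingMap (q := q) (Q := Q) hq (Or.inl h)
  exact ⟨f, hf, Algebra.subset_adjoin (IsGenerator.leftCrossing lam mu h f hf)⟩

theorem LeftGen.rightCrossing (hq : q ≠ 0) {lam mu : MultiComp ℓ d} (h : mu.IsLeftCrossing lam) :
    LeftGen q Q lam mu (stdElt q Q mu.colours lam.colours 1) := by
  obtain ⟨f, hf⟩ := exists_isCrossingMap (q := q) (Q := Q) hq (Or.inr h)
  exact ⟨f, hf, Algebra.subset_adjoin (IsGenerator.rightCrossing mu lam h f hf)⟩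

theorem LeftGen.split (hq : q ≠ 0) {lam mu : MultiComp ℓ d} (h : lam.IsSplit mu) :
    LeftGen q Q lam mu 1 := by
  obtain ⟨f, hf⟩ := exists_isSplitMap (q := q) (Q := Q) hq h
  exact ⟨f, fun x => by rw [hf, one_mul],
    Algebra.subset_adjoin (IsGenerator.split lam mu h f hf)⟩

theorem LeftGen.merge (hq : q ≠ 0) {lam mu : MultiComp ℓ d} (h : lam.IsSplit mu) :
    LeftGen q Q mu lam (mergeElt q Q mu lam) := by
  have hc := MultiComp.colours_eq_of_start fun t _ => (h.start_eq t).symm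
  have hy := MultiComp.young_le_of_bd fun _ hx => h.bd_subset hx
  obtain ⟨f, hf⟩ := exists_isMergeMap (q := q) (Q := Q) hq h
  obtain ⟨s, hs, es⟩ := exists_mElt_eq (Q := Q) hq mu
  obtain ⟨t, ht, et⟩ := exists_mElt_eq (Q := Q) hq lam
  have h1 : LeftGen q Q mu lam ((t * s⁻¹) • mergeElt q Q mu lam) := by
    refine ⟨f, fun x => ?_, Algebra.subset_adjoin (IsGenerator.merge lam mu h f hf)⟩
    obtain ⟨a, rfl⟩ := exists_eq_mMul x
    rw [hf]
    change mElt q Q lam * a = _ * (mElt q Q mu * a)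
    rw [← mul_assoc, es, et, smul_mul_smul_comm, mSign_eq_mul_left hc hy, mul_assoc t,
      inv_mul_cancel₀ hs, mul_one]
  have h2 := h1.smul (t * s⁻¹)⁻¹
  rwa [smul_smul, inv_mul_cancel₀ (mul_ne_zero ht (inv_ne_zero hs)), one_smul] at h2

/-- Splits and merges along arbitrary refinements. -/
theorem LeftGen.refine (hq : q ≠ 0) {lam kap : MultiComp ℓ d}
    (hst : ∀ t ≤ ℓ + 1, kap.start t = lam.start t) (hbd : ∀ x ∈ lam.bd, x ∈ kap.bd) :
    LeftGen q Q lam kap 1 ∧ LeftGen q Q kap lam (mergeElt q Q kap lam) := by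
  -- The induction yields some generated multiplier with the right value at the sign element; it is
  -- identified with `mergeElt` only at the end.
  have key : LeftGen q Q lam kap 1 ∧ ∃ y, y * mSign q Q kap = mSign q Q lam ∧
      LeftGen q Q kap lam y := by
    obtain ⟨n, hn⟩ : ∃ n, (kap.bd \ lam.bd).ncard = n := ⟨_, rfl⟩
    induction n using Nat.strong_induction_on generalizing kap with
    | _ n ih =>
      by_cases h : ∃ x, x ∈ kap.bd ∧ x ∉ lam.bd
      · obtain ⟨x, hx, hx'⟩ := h
        -- One boundary of kap that is not in lam is removed. It is not a start of a component, so
        -- kap is a split of the resulting composition, which is closer to lam.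
        obtain ⟨nu, h1, h2⟩ := MultiComp.exists_of_bd (S := {y | y ∈ kap.bd ∧ y ≠ x})
          kap.start_zero kap.start_mono kap.start_last (fun t ht => ⟨kap.start_mem_bd ht, by
            rintro rfl
            exact hx' (by rw [hst t ht]; exact lam.start_mem_bd ht)⟩)
          (fun y hy => kap.le_of_mem_bd hy.1)
        have hs : nu.IsSplit kap := MultiComp.isSplit_of h1 hx h2
        have hfin : (kap.bd \ lam.bd).Finite :=
          (Set.finite_Iic d).subset fun y hy => kap.le_of_mem_bd hy.1
        have hlt : (nu.bd \ lam.bd).ncard < n := by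
          rw [← hn]
          refine Set.ncard_lt_ncard ⟨fun y hy => ⟨((h2 y).mp hy.1).1, hy.2⟩, fun hh => ?_⟩ hfin
          exact ((h2 x).mp (hh ⟨hx, hx'⟩).1).2 rfl
        obtain ⟨h3, y, h4, h5⟩ := ih _ hlt (fun t ht => (h1 t ht).trans (hst t ht))
          (fun z hz => (h2 z).mpr ⟨hbd z hz, fun e => hx' (e ▸ hz)⟩) rfl
        have hc := MultiComp.colours_eq_of_start fun t _ => (hs.start_eq t).symm
        have hy := MultiComp.young_le_of_bd fun _ hx => hs.bd_subset hx
        refine ⟨?_, y * mergeElt q Q kap nu, ?_, h5.mul (LeftGen.merge hq hs)⟩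
        · have := (LeftGen.split (Q := Q) hq hs).mul h3
          rwa [one_mul] at this
        · rw [mul_assoc, mSign_eq_mul_left hc hy, h4]
      · push Not at h
        have : kap = lam := MultiComp.ext_bd hst fun x => ⟨h x, hbd x⟩
        subst this
        exact ⟨LeftGen.one _, 1, one_mul _, LeftGen.one _⟩
  obtain ⟨h1, y, h2, h3⟩ := key
  refine ⟨h1, h3.congr hq ?_⟩
  rw [h2, mSign_eq_mul_left (MultiComp.colours_eq_of_start hst) (MultiComp.young_le_of_bd hbd)]

/-- The direct sum is finite, so an endomorphism is the sum of its matrix entries extended by zero.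
-/
theorem genAlg_eq_top (h : ∀ (lam mu : MultiComp ℓ d) (f : HomSpace q Q lam mu),
    extend q Q f ∈ genAlg q Q d) : genAlg q Q d = ⊤ := by
  classical
  have := Fintype.ofFinite (MultiComp ℓ d)
  rw [eq_top_iff]
  intro φ _
  set N : MultiComp ℓ d → Type _ := fun nu => mIdeal q Q nu with hN
  have e : φ = ∑ lam : MultiComp ℓ d, ∑ mu : MultiComp ℓ d,
      extend q Q ((DirectSum.component (Hecke q Q d)ᵐᵒᵖ (MultiComp ℓ d) (fun nu => mIdeal q Q nu) mu) ∘ₗ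
        φ ∘ₗ DirectSum.lof (Hecke q Q d)ᵐᵒᵖ (MultiComp ℓ d) (fun nu => mIdeal q Q nu) lam) := by
    have hid : ∀ x : DirectSum (MultiComp ℓ d) fun nu => mIdeal q Q nu,
        ∑ nu, DirectSum.lof (Hecke q Q d)ᵐᵒᵖ (MultiComp ℓ d) (fun nu => mIdeal q Q nu) nu
          (DirectSum.component (Hecke q Q d)ᵐᵒᵖ (MultiComp ℓ d) (fun nu => mIdeal q Q nu) nu x) = x :=
      fun x => DirectSum.sum_univ_of x
    refine LinearMap.ext fun x => ?_
    conv_lhs => rw [← hid x, map_sum]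
    rw [LinearMap.sum_apply]
    refine Finset.sum_congr rfl fun lam _ => ?_
    rw [LinearMap.sum_apply]
    conv_lhs => rw [← hid (φ _)]
    refine Finset.sum_congr rfl fun mu _ => ?_
    simp only [extend, LinearMap.comp_apply]
  rw [e]
  exact sum_mem fun lam _ => sum_mem fun mu _ => h _ _ _

end Generators

/-! ### Permutations that match blocks with blocks -/

section Match

variable {d : ℕ} {α β γ : Type*}

/-- `w` maps the fibres of `g` onto the fibres of `g'`, and is increasing on each of them. -/
def MatchFib (g : Fin d → α) (g' : Fin d → β) (w : Perm (Fin d)) : Prop :=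
  MonoFib g w ∧ ∀ i j, g i = g j ↔ g' (w i) = g' (w j)

theorem MatchFib.symm {g : Fin d → α} {g' : Fin d → β} {w : Perm (Fin d)} (h : MatchFib g g' w) :
    MatchFib g' g w⁻¹ := by
  have h2 : ∀ i j, g' i = g' j ↔ g (w⁻¹ i) = g (w⁻¹ j) := fun i j => by
    rw [h.2, perm_apply_inv, perm_apply_inv]
  refine ⟨fun i j hij e => ?_, h2⟩
  by_contra hc
  rcases (not_lt.mp hc).eq_or_lt with h3 | h3
  · exact hij.ne (w⁻¹.injective h3).symm
  · have := h.1 _ _ h3 ((h2 i j).mp e).symm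
    rw [perm_apply_inv, perm_apply_inv] at this
    exact absurd hij this.not_gt

theorem MatchFib.trans {g : Fin d → α} {g' : Fin d → β} {g'' : Fin d → γ} {w v : Perm (Fin d)}
    (h : MatchFib g g' w) (h' : MatchFib g' g'' v) : MatchFib g g'' (v * w) :=
  ⟨fun i j hij e => h'.1 _ _ (h.1 i j hij e) ((h.2 i j).mp e), fun i j => (h.2 i j).trans (h'.2 _ _)⟩

theorem MatchFib.conj_mem {g : Fin d → α} {g' : Fin d → β} {w z : Perm (Fin d)}
    (h : MatchFib g g' w) (hz : z ∈ fibreSubgroup g) : w * z * w⁻¹ ∈ fibreSubgroup g' := by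
  intro i
  have := (h.2 _ _).mp (hz (w⁻¹ i))
  rwa [perm_apply_inv] at this

theorem MatchFib.of_eq {g : Fin d → α} {g' : Fin d → β}
    (h : fibreSubgroup g = fibreSubgroup g') : MatchFib g g' 1 :=
  ⟨fun _ _ hij _ => hij, fun i j => ⟨fibre_le_iff.mp h.le i j, fibre_le_iff.mp h.ge i j⟩⟩

theorem MatchFib.eq_of_one {g : Fin d → α} {g' : Fin d → β} (h : MatchFib g g' 1) :
    fibreSubgroup g = fibreSubgroup g' :=
  le_antisymm (fibre_le_iff.mpr fun i j => (h.2 i j).mp) (fibre_le_iff.mpr fun i j => (h.2 i j).mpr)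

/-- Distinct blocks are mapped to distinct blocks, so an inversion of two elements is an inversion
of their blocks. -/
theorem MatchFib.lt_of_lt {g : Fin d → α} {g' : Fin d → β} (hg' : IntervalFibres g')
    {w : Perm (Fin d)} (h : MatchFib g g' w) {i i' j j' : Fin d} (hi : g i = g i') (hj : g j = g j')
    (hij : g i ≠ g j) (hlt : w j < w i) : w j' < w i' := by
  have e1 := (h.2 _ _).mp hi
  have e2 := (h.2 _ _).mp hj
  have e3 : g' (w i) ≠ g' (w j) := fun e => hij ((h.2 _ _).mpr e)
  by_contra hc
  rw [not_lt] at hc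
  rcases le_total (w i') (w j) with h1 | h1
  · exact e3 (e1.trans (hg' _ _ _ h1 hlt.le e1.symm).symm)
  · exact e3 (e1.trans (hg' _ _ _ h1 hc e2))

/-- The function that exchanges the intervals `[p, x)` and `[x, s)`. -/
def swapNat (p x s i : ℕ) : ℕ :=
  if i < p then i else if i < x then i + (s - x) else if i < s then i - (x - p) else i

theorem swapNat_swapNat {p x s : ℕ} (hp : p ≤ x) (hs : x ≤ s) (i : ℕ) :
    swapNat p (p + (s - x)) s (swapNat p x s i) = i := by
  unfold swapNat
  split_ifs <;> omega

theorem swapNat_lt {p x s i : ℕ} (hp : p ≤ x) (hs : x ≤ s) (hd : s ≤ d) (hi : i < d) :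
    swapNat p x s i < d := by
  unfold swapNat
  split_ifs <;> omega

/-- The permutation that exchanges the intervals `[p, x)` and `[x, s)`. -/
def blockSwap {p x s : ℕ} (hp : p ≤ x) (hs : x ≤ s) (hd : s ≤ d) : Perm (Fin d) where
  toFun i := ⟨swapNat p x s i, swapNat_lt hp hs hd i.2⟩
  invFun i := ⟨swapNat p (p + (s - x)) s i, swapNat_lt (by omega) (by omega) hd i.2⟩
  left_inv i := Fin.ext (swapNat_swapNat hp hs i)
  right_inv i := Fin.ext (by
    have := swapNat_swapNat (p := p) (x := p + (s - x)) (s := s) (by omega) (by omega) i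
    rwa [show p + (s - (p + (s - x))) = x by omega] at this)

end Match

/-! ### Exchange of two adjacent blocks -/

section Exchange

variable {ℓ d : ℕ}

/-- `x` is a boundary between the blocks `[p, x)` and `[x, s)` of the composition. -/
structure IsInner (nu : MultiComp ℓ d) (p x s : ℕ) : Prop where
  left : p ∈ nu.bd
  mid : x ∈ nu.bd
  right : s ∈ nu.bd
  lt_mid : p < x
  mid_lt : x < s
  gap : ∀ y ∈ nu.bd, p < y → y < s → y = x

theorem IsInner.le {nu : MultiComp ℓ d} {p x s : ℕ} (h : IsInner nu p x s) : s ≤ d :=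
  nu.le_of_mem_bd h.right

theorem exists_next_bd (nu : MultiComp ℓ d) {x : ℕ} (hd : x < d) :
    ∃ s ∈ nu.bd, x < s ∧ ∀ y ∈ nu.bd, ¬ (x < y ∧ y < s) := by
  classical
  have hs : ∃ s, s ∈ nu.bd ∧ x < s :=
    ⟨nu.start (ℓ + 1), nu.start_mem_bd le_rfl, by rwa [nu.start_last]⟩
  exact ⟨Nat.find hs, (Nat.find_spec hs).1, (Nat.find_spec hs).2,
    fun y hy h => Nat.find_min hs h.2 ⟨hy, h.1⟩⟩

theorem exists_prev_bd (nu : MultiComp ℓ d) {x : ℕ} (h0 : 0 < x) :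
    ∃ p ∈ nu.bd, p < x ∧ ∀ y ∈ nu.bd, ¬ (p < y ∧ y < x) := by
  classical
  have h := Nat.findGreatest_spec (P := fun p => p ∈ nu.bd) (Nat.zero_le (x - 1)) nu.zero_mem_bd
  have h1 := Nat.findGreatest_le (P := fun p => p ∈ nu.bd) (x - 1)
  refine ⟨_, h, by omega, fun y hy hyy => ?_⟩
  have := Nat.le_findGreatest (P := fun p => p ∈ nu.bd) (n := x - 1) (by omega) hy
  omega

theorem exists_isInner {nu : MultiComp ℓ d} {x : ℕ} (hx : x ∈ nu.bd) (h0 : 0 < x) (hd : x < d) :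
    ∃ p s, IsInner nu p x s := by
  obtain ⟨p, h1, h2, h3⟩ := exists_prev_bd nu h0
  obtain ⟨s, h4, h5, h6⟩ := exists_next_bd nu hd
  refine ⟨p, s, h1, hx, h4, h2, h5, fun y hy h7 h8 => ?_⟩
  have := h3 y hy
  have := h6 y hy
  omega

theorem MultiComp.index_eq_of {nu : MultiComp ℓ d} {i j : Fin d}
    (h : ∀ y ∈ nu.bd, ¬ ((i : ℕ) < y ∧ y ≤ j) ∧ ¬ ((j : ℕ) < y ∧ y ≤ i)) :
    nu.concat.index i = nu.concat.index j := by
  rcases le_total i j with hij | hij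
  · exact (index_eq_iff hij).mpr fun y hy => (h y hy).1
  · exact ((index_eq_iff hij).mpr fun y hy => (h y hy).2).symm

theorem MultiComp.not_between {nu : MultiComp ℓ d} {i j : Fin d}
    (h : nu.concat.index i = nu.concat.index j) {y : ℕ} (hy : y ∈ nu.bd) :
    ¬ ((i : ℕ) < y ∧ y ≤ j) ∧ ¬ ((j : ℕ) < y ∧ y ≤ i) := by
  rcases le_total i j with hij | hij
  · have := (index_eq_iff hij).mp h y hy
    have : (i : ℕ) ≤ j := hij
    omega
  · have := (index_eq_iff hij).mp h.symm y hy
    have : (j : ℕ) ≤ i := hij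
    omega

/-- A boundary of the new composition is the image of x, or it lies outside the open interval from p
to s, where the exchange does not disturb it. So none separates the images of two elements of a
block. -/
theorem IsInner.index_swap {nu nu' : MultiComp ℓ d} {p x s : ℕ} (h : IsInner nu p x s)
    (h' : ∀ y, y ∈ nu'.bd → (y ∈ nu.bd ∧ y ≠ x) ∨ y = p + (s - x)) {σ : Perm (Fin d)}
    (hσ : ∀ i, (σ i : ℕ) = swapNat p x s i) {i j : Fin d}
    (e : nu.concat.index i = nu.concat.index j) :
    nu'.concat.index (σ i) = nu'.concat.index (σ j) := by
  have h1 := MultiComp.not_between e h.left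
  have h2 := MultiComp.not_between e h.mid
  have h3 := MultiComp.not_between e h.right
  have h4 := h.lt_mid
  have h5 := h.mid_lt
  refine MultiComp.index_eq_of fun y hy => ?_
  have e1 : y = p + (s - x) ∨ y ≤ p ∨ s ≤ y := by
    rcases h' y hy with ⟨h6, h7⟩ | h6
    · have := h.gap y h6
      omega
    · exact Or.inl h6
  have e2 : (y ≤ p ∨ s ≤ y) → ¬ ((i : ℕ) < y ∧ y ≤ j) ∧ ¬ ((j : ℕ) < y ∧ y ≤ i) := by
    intro h6
    rcases h' y hy with h7 | h7
    · exact MultiComp.not_between e h7.1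
    · omega
  rw [hσ, hσ]
  unfold swapNat
  split_ifs <;> omega

theorem IsInner.monoFib_swap {nu : MultiComp ℓ d} {p x s : ℕ} (h : IsInner nu p x s)
    {σ : Perm (Fin d)} (hσ : ∀ i, (σ i : ℕ) = swapNat p x s i) :
    MonoFib nu.concat.index σ := by
  intro i j hij e
  have h1 := MultiComp.not_between e h.left
  have h2 := MultiComp.not_between e h.mid
  have h3 := MultiComp.not_between e h.right
  have h4 := h.lt_mid
  have h5 := h.mid_lt
  have h6 : (i : ℕ) < j := hij
  rw [Fin.lt_def, hσ, hσ]
  unfold swapNat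
  split_ifs <;> omega

end Exchange

/-! ### Thick diagrams and their leading terms. -/

section Thick

variable {k : Type*} [Field k] {ℓ d : ℕ} {q : k} {Q : Fin ℓ → k}

local notation "𝐞" c:max => heckeGen q Q (Gen.e c)
local notation "𝐓" r:max => heckeGen q Q (Gen.T r)

/-- Removing x merges the two blocks; the boundary p + (s - x) cuts them again with the sizes
exchanged. As x is not the start of a component, no red strand stands between the blocks. -/
theorem IsInner.exists_exchange {nu : MultiComp ℓ d} {p x s : ℕ} (h : IsInner nu p x s)
    (hx : ∀ t ≤ ℓ + 1, nu.start t ≠ x) :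
    ∃ (nup nu1 : MultiComp ℓ d) (σ : Perm (Fin d)), nup.IsSplit nu ∧ nup.IsSplit nu1 ∧
      (∀ y, y ∈ nup.bd ↔ y ∈ nu.bd ∧ y ≠ x) ∧ (∀ i, (σ i : ℕ) = swapNat p x s i) ∧
      MatchFib nu.concat.index nu1.concat.index σ := by
  have h4 := h.lt_mid
  have h5 := h.mid_lt
  have h6 := h.le
  obtain ⟨nup, a1, a2⟩ := MultiComp.exists_of_bd (S := {y | y ∈ nu.bd ∧ y ≠ x})
    nu.start_zero nu.start_mono nu.start_last (fun t ht => ⟨nu.start_mem_bd ht, hx t ht⟩)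
    (fun y hy => nu.le_of_mem_bd hy.1)
  obtain ⟨nu1, b1, b2⟩ := MultiComp.exists_of_bd
    (S := {y | (y ∈ nu.bd ∧ y ≠ x) ∨ y = p + (s - x)})
    nu.start_zero nu.start_mono nu.start_last (fun t ht => Or.inl ⟨nu.start_mem_bd ht, hx t ht⟩)
    (fun y hy => by
      rcases hy with hy | hy
      · exact nu.le_of_mem_bd hy.1
      · omega)
  have h' : IsInner nu1 p (p + (s - x)) s :=
    ⟨(b2 _).mpr (Or.inl ⟨h.left, by omega⟩), (b2 _).mpr (Or.inr rfl),
      (b2 _).mpr (Or.inl ⟨h.right, by omega⟩), by omega, by omega, fun y hy h1 h2 => by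
        rcases (b2 y).mp hy with h3 | h3
        · exact absurd (h.gap y h3.1 h1 h2) h3.2
        · exact h3⟩
  refine ⟨nup, nu1, blockSwap h4.le h5.le h6, MultiComp.isSplit_of a1 h.mid a2,
    MultiComp.isSplit_of (fun t ht => (a1 t ht).trans (b1 t ht).symm) h'.mid fun y => ?_, a2,
    fun _ => rfl, h.monoFib_swap fun _ => rfl, fun i j => ⟨fun e => ?_, fun e => ?_⟩⟩
  · rw [a2, b2]
    constructor
    · rintro ⟨h1, h2⟩
      refine ⟨Or.inl ⟨h1, h2⟩, fun h3 => h2 (h.gap y h1 (by omega) (by omega))⟩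
    · rintro ⟨h1 | h1, h2⟩
      · exact h1
      · exact absurd h1 h2
  · exact h.index_swap (fun y hy => (b2 y).mp hy) (fun _ => rfl) e
  · have := h'.index_swap (nu' := nu) (σ := (blockSwap h4.le h5.le h6)⁻¹) (fun y hy => by
      rw [show p + (s - (p + (s - x))) = x by omega]
      by_cases e1 : y = x
      · exact Or.inr e1
      · refine Or.inl ⟨(b2 y).mpr (Or.inl ⟨hy, e1⟩), fun e2 => ?_⟩
        exact e1 (h.gap y hy (by omega) (by omega))) (fun _ => rfl) e
    rwa [perm_inv_apply, perm_inv_apply] at this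

variable (q Q) in
/-- There is a diagram for `w` whose element intertwines the Young subgroups, and is up to
shorter diagrams the left multiplication by a generated homomorphism. -/
def Thick (nu nu' : MultiComp ℓ d) (w : Perm (Fin d)) : Prop :=
  ∃ L, IsReducedWord (strandPerm nu'.colours nu.colours w) L ∧
    (∀ z ∈ nu.young, tw q Q L * 𝐞 nu.colours * stdElt q Q nu.colours nu.colours z =
      stdElt q Q nu'.colours nu'.colours (w * z * w⁻¹) * (tw q Q L * 𝐞 nu.colours)) ∧
    ∃ t : k, t ≠ 0 ∧ ∃ y, LeftGen q Q nu nu' y ∧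
      y - t • (tw q Q L * 𝐞 nu.colours) ∈ flt q Q (len (strandPerm nu'.colours nu.colours w))

/-- When the crossings add up, reduced words concatenate, intertwiners compose, and the product of
the leading terms leads the product of the generated maps. -/
theorem Thick.comp {nu nu1 nu' : MultiComp ℓ d} {w σ : Perm (Fin d)}
    (h2 : Thick q Q nu1 nu' w) (h1 : Thick q Q nu nu1 σ)
    (hσ : ∀ z ∈ nu.young, σ * z * σ⁻¹ ∈ nu1.young)
    (hl : len (strandPerm nu'.colours nu.colours (w * σ)) =
      len (strandPerm nu'.colours nu1.colours w) + len (strandPerm nu1.colours nu.colours σ)) :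
    Thick q Q nu nu' (w * σ) := by
  obtain ⟨L2, a1, a2, t2, a3, y2, a4, a5⟩ := h2
  obtain ⟨L1, b1, b2, t1, b3, y1, b4, b5⟩ := h1
  have e0 : tw q Q (L2 ++ L1) * 𝐞 nu.colours =
      (tw q Q L2 * 𝐞 nu1.colours) * (tw q Q L1 * 𝐞 nu.colours) := by
    have e1 := tw_mul_e_of_isReducedWord (q := q) (Q := Q) b1
    rw [tw_append, mul_assoc, mul_assoc, e1, ← mul_assoc (𝐞 nu1.colours), e_mul_e]
  have ha : y2 - t2 • (tw q Q L2 * 𝐞 nu1.colours) ∈ flt q Q L2.length := by rw [a1.2]; exact a5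
  have hb : y1 - t1 • (tw q Q L1 * 𝐞 nu.colours) ∈ flt q Q L1.length := by rw [b1.2]; exact b5
  refine ⟨L2 ++ L1, ?_, fun z hz => ?_, t2 * t1, mul_ne_zero a3 b3, y2 * y1, a4.mul b4, ?_⟩
  · rw [← strandPerm_mul nu'.colours nu1.colours nu.colours]
    exact a1.append b1 (by rw [strandPerm_mul, hl])
  · have e2 : w * σ * z * (w * σ)⁻¹ = w * (σ * z * σ⁻¹) * w⁻¹ := by group
    rw [e0, mul_assoc, b2 z hz, ← mul_assoc, a2 _ (hσ z hz), mul_assoc, e2]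
  · have hy1 : y1 ∈ flt q Q (L1.length + 1) := by
      have h3 := add_mem (flt_mono (Nat.le_succ _) hb) (Submodule.smul_mem _ t1
        (flt_mul_e (tw_mem_flt (Nat.lt_succ_self L1.length)) nu.colours))
      rwa [sub_add_cancel] at h3
    have h3 := flt_mul_flt ha hy1
    have h4 := Submodule.smul_mem _ t2
      (tw_mul_flt (e_mul_flt hb nu1.colours) L2)
    have h5 := add_mem h3 (flt_mono (Nat.add_comm L1.length L2.length).le h4)
    rw [hl, ← a1.2, ← b1.2, e0]
    convert h5 using 1
    simp only [sub_mul, mul_sub, smul_sub, smul_mul_assoc, mul_smul_comm, mul_smul, mul_assoc]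
    abel

theorem thick_one_of_eq (hq : q ≠ 0) (nu : MultiComp ℓ d) : Thick q Q nu nu 1 := by
  refine ⟨[], by rw [strandPerm_self_one]; exact isReducedWord_nil, fun z _ => ?_, 1, one_ne_zero,
    𝐞 nu.colours, (LeftGen.one nu).congr hq ?_, ?_⟩
  · rw [tw_nil, one_mul, e_mul_stdElt, one_mul, inv_one, mul_one, stdElt_mul_e]
  · rw [one_mul, e_mul_signElt]
  · rw [tw_nil, one_mul, one_smul, sub_self]
    exact zero_mem _

theorem thick_crossing (hq : q ≠ 0) {lam mu : MultiComp ℓ d}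
    (h : lam.IsLeftCrossing mu ∨ mu.IsLeftCrossing lam) : Thick q Q lam mu 1 := by
  have hbd : ∀ x, x ∈ lam.bd ↔ x ∈ mu.bd := fun x => by
    rcases h with h | h
    · exact h.bd_iff x
    · exact (h.bd_iff x).symm
  have hc : (∀ m, cnt lam.colours m ≤ cnt mu.colours m) ∨
      ∀ m, cnt mu.colours m ≤ cnt lam.colours m :=
    h.imp IsLeftCrossing.colours IsLeftCrossing.colours
  have hb : Blocked mu.colours lam.concat.index :=
    mu.blocked.mono lam.intervalFibres_index (fibreSubgroup_index_eq hbd).le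
  refine ⟨redWord (strandPerm mu.colours lam.colours 1), redWord_spec _, fun z hz => ?_, 1,
    one_ne_zero, stdElt q Q mu.colours lam.colours 1, ?_, ?_⟩
  · rw [tw_redWord_mul_e, one_mul, inv_one, mul_one]
    exact crossing_mul_stdElt hb lam.blocked hc hz
  · rcases h with h | h
    · exact LeftGen.leftCrossing hq h
    · exact LeftGen.rightCrossing hq h
  · rw [tw_redWord_mul_e, one_smul, sub_self]
    exact zero_mem _

/-- Merging the two blocks and splitting them again gives the sum of the T_{u⁻¹} over the shortest
coset representatives u, with nonzero coefficients. The exchange of the blocks is the longest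
permutation that occurs. -/
theorem thick_exchange (hq : q ≠ 0) {nu nup nu1 : MultiComp ℓ d} {p x s : ℕ} {σ : Perm (Fin d)}
    (h : IsInner nu p x s) (h1 : nup.IsSplit nu) (h2 : nup.IsSplit nu1)
    (hbd : ∀ y, y ∈ nup.bd ↔ y ∈ nu.bd ∧ y ≠ x) (hσ : ∀ i, (σ i : ℕ) = swapNat p x s i)
    (hm : MatchFib nu.concat.index nu1.concat.index σ) : Thick q Q nu nu1 σ := by
  have l1 := h.lt_mid
  have l2 := h.mid_lt
  have hc : nup.colours = nu.colours := MultiComp.colours_eq_of_start fun t _ => h1.start_eq t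
  have hc1 : nu1.colours = nu.colours :=
    (MultiComp.colours_eq_of_start fun t _ => (h2.start_eq t).symm).trans hc
  have hy : nu.young ≤ nup.young := MultiComp.young_le_of_bd fun _ hx => h1.bd_subset hx
  have hy1 : nu1.young ≤ nup.young := MultiComp.young_le_of_bd fun _ hx => h2.bd_subset hx
  have hb : Blocked nu.colours nup.concat.index := by rw [← hc]; exact nup.blocked
  have hF := heckeFam_stdElt q Q hb
  have hp := (hbd p).mpr ⟨h.left, by omega⟩
  have hs := (hbd s).mpr ⟨h.right, by omega⟩
  have hσm : σ ∈ nup.young := fun i => by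
    refine MultiComp.index_eq_of fun y hy => ?_
    have h3 : y ≤ p ∨ s ≤ y := by
      have h4 := (hbd y).mp hy
      by_contra hh
      exact h4.2 (h.gap y h4.1 (by omega) (by omega))
    rw [hσ]
    unfold swapNat
    split_ifs <;> omega
  -- σ inverts every pair from the two different blocks that are merged.
  have hcross : ∀ i j, i < j → nup.concat.index i = nup.concat.index j →
      nu.concat.index i ≠ nu.concat.index j → σ j < σ i := by
    intro i j hij e1 e2
    have h3 := MultiComp.not_between e1 hp
    have h4 := MultiComp.not_between e1 hs
    have h6 : (i : ℕ) < j := hij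
    have h5 : (i : ℕ) < x ∧ x ≤ j := by
      by_contra hh
      refine e2 ((MultiComp.index_eq_iff hij.le).mpr fun y hy hyy => ?_)
      by_cases e : y = x
      · exact hh (e ▸ hyy)
      · exact (MultiComp.not_between e1 ((hbd y).mpr ⟨hy, e⟩)).1 hyy
    have h7 : p < x := l1
    have h8 : (p ≤ (i : ℕ)) ∧ (j : ℕ) < s := by omega
    rw [Fin.lt_def, hσ, hσ]
    unfold swapNat
    split_ifs <;> omega
  refine ⟨redWord (strandPerm nu1.colours nu.colours σ), redWord_spec _, fun z hz => ?_,
    (-q)⁻¹ ^ len σ, pow_ne_zero _ (inv_ne_zero (neg_ne_zero.mpr hq)),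
    1 * mergeElt q Q nu nup, (LeftGen.split hq h2).mul (LeftGen.merge hq h1), ?_⟩
  · rw [tw_redWord_mul_e, hc1,
      hF.mul nup.intervalFibres_index hσm (hy hz)
        (len_mul_of_monoFib' nu.intervalFibres_index hz hm.1),
      hF.mul nup.intervalFibres_index (hy1 (hm.conj_mem hz)) hσm
        (len_mul_of_monoFib nu1.intervalFibres_index (hm.conj_mem hz) hm.symm.1),
      inv_mul_cancel_right]
  · have hmem : σ⁻¹ ∈ minReps nu.concat.index nup.concat.index :=
      mem_minReps.mpr ⟨inv_mem hσm, by rw [inv_inv]; exact hm.1⟩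
    rw [one_mul, tw_redWord_mul_e, mergeElt, ← Finset.add_sum_erase _ _ hmem, hc, hc1, inv_inv,
      len_inv, add_sub_cancel_left, len_strandPerm_self hb hσm]
    refine Submodule.sum_mem _ fun u hu => Submodule.smul_mem _ _ ?_
    obtain ⟨hu1, hu2⟩ := Finset.mem_erase.mp hu
    obtain ⟨hu2, hu3⟩ := mem_minReps.mp hu2
    refine flt_mul_e (tw_mem_flt ?_) _
    rw [(redWord_spec _).2, len_strandPerm_self hb (inv_mem hu2)]
    -- All inversions of u⁻¹ are inversions of σ, hence l(σ) = l(σ u) + l(u⁻¹). So u⁻¹ is strictly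
    -- shorter than σ unless it is equal to σ.
    have e1 := len_mul_of_no_double_crossing (σ * u) u⁻¹ (fun i j hij hlt => by
      rw [Perm.mul_apply, Perm.mul_apply, perm_apply_inv, perm_apply_inv]
      refine hcross i j hij ?_ fun e => ?_
      · by_contra hh
        exact absurd (lt_of_mem_fibreSubgroup nup.intervalFibres_index (inv_mem hu2) hij hh) hlt.not_gt
      · exact absurd (hu3 i j hij e) hlt.not_gt)
    rw [mul_inv_cancel_right] at e1
    have e2 : len (σ * u) ≠ 0 := fun e => hu1 (eq_inv_of_mul_eq_one_right (eq_one_of_len _ e))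
    omega

end Thick

/-! ### Factorization of block permutations into thick crossings. -/

section Existence

variable {k : Type*} [Field k] {ℓ d : ℕ} {q : k} {Q : Fin ℓ → k}

local notation "𝐞" c:max => heckeGen q Q (Gen.e c)

/-- The red strand `m` is moved to another boundary, without changing the blocks. -/
theorem exists_move_red (nu : MultiComp ℓ d) (m : Fin ℓ) {x : ℕ} (hx : x ∈ nu.bd)
    (h1 : nu.start m ≤ x) (h2 : x ≤ nu.start (m + 2)) :
    ∃ nu1 : MultiComp ℓ d, (∀ t ≤ ℓ + 1, t ≠ m + 1 → nu1.start t = nu.start t) ∧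
      nu1.start (m + 1) = x ∧ ∀ y, y ∈ nu1.bd ↔ y ∈ nu.bd := by
  have hm := m.2
  obtain ⟨nu1, a1, a2⟩ := MultiComp.exists_of_bd (ℓ := ℓ) (d := d)
    (s := Function.update nu.start (m + 1) x) (S := nu.bd)
    (by rw [Function.update_of_ne (by omega), nu.start_zero])
    (monotone_nat_of_le_succ fun t => by
      by_cases e1 : t = m + 1
      · rw [e1, Function.update_self, Function.update_of_ne (by omega)]
        exact h2
      by_cases e2 : t + 1 = m + 1
      · rw [e2, Function.update_self, Function.update_of_ne (by omega), show t = m by omega]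
        exact h1
      · rw [Function.update_of_ne e1, Function.update_of_ne e2]
        exact nu.start_mono (Nat.le_succ t))
    (by rw [Function.update_of_ne (by omega), nu.start_last])
    (fun t ht => by
      by_cases e1 : t = m + 1
      · rw [e1, Function.update_self]
        exact hx
      · rw [Function.update_of_ne e1]
        exact nu.start_mem_bd ht)
    (fun y => nu.le_of_mem_bd)
  refine ⟨nu1, fun t ht hne => by rw [a1 t ht, Function.update_of_ne hne], ?_, a2⟩
  rw [a1 _ (by omega), Function.update_self]

theorem cnt_eq_of_move {nu nu1 : MultiComp ℓ d} {m : Fin ℓ}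
    (h : ∀ t ≤ ℓ + 1, t ≠ m + 1 → nu1.start t = nu.start t) {m' : Fin ℓ} (hm : m' ≠ m) :
    cnt nu1.colours m' = cnt nu.colours m' := by
  rw [MultiComp.cnt_colours, MultiComp.cnt_colours]
  have := m'.2
  exact h _ (by omega) fun e => hm (Fin.ext (by omega))

/-- One step of the induction: a red strand is moved across a block that it has to cross. -/
theorem thick_of_crossing (hq : q ≠ 0) {nu nu' nu1 : MultiComp ℓ d} {w : Perm (Fin d)}
    (hm : MatchFib nu.concat.index nu'.concat.index w) {m : Fin ℓ}
    (ih : ∀ {nu1 : MultiComp ℓ d} {v : Perm (Fin d)},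
      len (strandPerm nu'.colours nu1.colours v) < len (strandPerm nu'.colours nu.colours w) →
      MatchFib nu1.concat.index nu'.concat.index v → Thick q Q nu1 nu' v)
    (hst : ∀ t ≤ ℓ + 1, t ≠ m + 1 → nu1.start t = nu.start t) (hbd : ∀ y, y ∈ nu1.bd ↔ y ∈ nu.bd)
    (hne : nu.start (m + 1) ≠ nu1.start (m + 1))
    (hcr : nu.IsLeftCrossing nu1 ∨ nu1.IsLeftCrossing nu)
    (hw : ∀ i : Fin d, (cnt nu.colours m ≤ i ↔ cnt nu1.colours m ≤ i) ∨
      (cnt nu1.colours m ≤ i ↔ cnt nu'.colours m ≤ w i)) : Thick q Q nu nu' w := by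
  have e1 : fibreSubgroup nu.concat.index = fibreSubgroup nu1.concat.index :=
    fibreSubgroup_index_eq fun y => (hbd y).symm
  have e2 := (MatchFib.of_eq e1.symm).trans hm
  rw [mul_one] at e2
  have hl := len_strandPerm_mul nu'.colours nu1.colours nu.colours w 1
    (fun i j hij h => absurd hij h.not_gt) (fun m' i => by
      by_cases e : m' = m
      · rw [e]
        exact hw i
      · left
        rw [cnt_eq_of_move hst e]
        rfl)
  have h0 : len (strandPerm nu1.colours nu.colours 1) ≠ 0 := fun h => by
    have h3 := act_strandPerm nu1.colours nu.colours 1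
    rw [eq_one_of_len _ h, act_one] at h3
    have h4 := MultiComp.cnt_colours nu m
    rw [h3, MultiComp.cnt_colours] at h4
    exact hne h4.symm
  have h5 := (ih (by rw [mul_one] at hl; omega) e2).comp (thick_crossing hq hcr)
    (fun z hz => by
      rw [one_mul, inv_one, mul_one]
      exact e1.le hz) hl
  rwa [mul_one] at h5

/-- The black strand i starts a block, because a red strand stands directly to its left. The
permutation w keeps this block together between the red strands, so the red strand crosses all of it
and can first be moved to its right end. -/
theorem thick_of_red_black (hq : q ≠ 0) {nu nu' : MultiComp ℓ d} {w : Perm (Fin d)}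
    (hm : MatchFib nu.concat.index nu'.concat.index w)
    (ih : ∀ {nu1 : MultiComp ℓ d} {v : Perm (Fin d)},
      len (strandPerm nu'.colours nu1.colours v) < len (strandPerm nu'.colours nu.colours w) →
      MatchFib nu1.concat.index nu'.concat.index v → Thick q Q nu1 nu' v)
    {m : Fin ℓ} {i : Fin d} (h : (nu.colours.redPos m : ℕ) + 1 = nu.colours.blackPos i)
    (hw : nu'.colours.blackPos (w i) < nu'.colours.redPos m) : Thick q Q nu nu' w := by
  have hmℓ := m.2
  have hid := i.2
  have h1 : nu.start (m + 1) = i := by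
    rw [← MultiComp.cnt_colours]
    refine le_antisymm ((redPos_lt_blackPos _ _ _).mp (Fin.lt_def.mpr (by omega))) ?_
    by_contra hc
    have h2 := (redPos_lt_blackPos nu.colours m ⟨i - 1, by omega⟩).mpr (by simp only; omega)
    have h3 : nu.colours.blackPos ⟨i - 1, by omega⟩ < nu.colours.blackPos i :=
      nu.colours.blackPos_strictMono (Fin.lt_def.mpr (by simp only; omega))
    rw [Fin.lt_def] at h2 h3
    omega
  have h2 : (i : ℕ) < nu.start (m + 2) := by
    rcases (show (m : ℕ) + 1 ≤ ℓ by omega).eq_or_lt with e | e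
    · rw [show (m : ℕ) + 2 = ℓ + 1 by omega, nu.start_last]
      exact hid
    · have h3 := nu.colours.redPos_strictMono (a := m) (b := ⟨m + 1, e⟩)
        (Fin.lt_def.mpr (by simp only; omega))
      have h4 := redPos_ne_blackPos nu.colours ⟨m + 1, e⟩ i
      have h5 := (blackPos_lt_redPos nu.colours ⟨m + 1, e⟩ i).mp (by
        rw [Fin.lt_def] at h3 ⊢
        rw [Ne, Fin.ext_iff] at h4
        omega)
      rwa [MultiComp.cnt_colours] at h5
  -- The right end of the block that starts at i.
  obtain ⟨x, hx, hix, hgap⟩ := exists_next_bd nu hid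
  have h3 : nu.start m ≤ nu.start (m + 1) := nu.start_mono (Nat.le_succ _)
  have h4 := hgap _ (nu.start_mem_bd (t := m + 2) (by omega))
  obtain ⟨nu1, a1, a2, a3⟩ := exists_move_red nu m hx (by omega) (by omega)
  have e1 := MultiComp.cnt_colours nu m
  have e2 := MultiComp.cnt_colours nu1 m
  refine thick_of_crossing hq hm ih a1 a3 (by omega)
    (Or.inl (MultiComp.isLeftCrossing_of m a1 (by omega) (by omega) (fun y => (a3 y).symm)
      fun y hy hyy => hgap y hy (by omega))) fun i' => ?_
  by_cases hi : (i : ℕ) ≤ i' ∧ (i' : ℕ) < x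
  · right
    have e3 : nu.concat.index i = nu.concat.index i' := MultiComp.index_eq_of fun y hy => by
      have := hgap y hy
      omega
    rw [← nu'.blocked.cnt_le_iff ((hm.2 _ _).mp e3) m]
    rw [blackPos_lt_redPos] at hw
    omega
  · left
    omega

/-- The mirror case: the strand i ends a block, all of this block crosses the red strand on its
right, and the red strand is moved to the left end of the block. -/
theorem thick_of_black_red (hq : q ≠ 0) {nu nu' : MultiComp ℓ d} {w : Perm (Fin d)}
    (hm : MatchFib nu.concat.index nu'.concat.index w)
    (ih : ∀ {nu1 : MultiComp ℓ d} {v : Perm (Fin d)},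
      len (strandPerm nu'.colours nu1.colours v) < len (strandPerm nu'.colours nu.colours w) →
      MatchFib nu1.concat.index nu'.concat.index v → Thick q Q nu1 nu' v)
    {m : Fin ℓ} {i : Fin d} (h : (nu.colours.blackPos i : ℕ) + 1 = nu.colours.redPos m)
    (hw : nu'.colours.redPos m < nu'.colours.blackPos (w i)) : Thick q Q nu nu' w := by
  have hmℓ := m.2
  have h1 : nu.start (m + 1) = i + 1 := by
    rw [← MultiComp.cnt_colours]
    have h2 := (blackPos_lt_redPos nu.colours m i).mp (Fin.lt_def.mpr (by omega))
    have h3 : cnt nu.colours m ≤ d := by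
      rw [MultiComp.cnt_colours]
      exact nu.le_of_mem_bd (nu.start_mem_bd (by omega))
    by_contra hc
    have h4 := (blackPos_lt_redPos nu.colours m ⟨i + 1, by omega⟩).mpr (by simp only; omega)
    have h5 : nu.colours.blackPos i < nu.colours.blackPos ⟨i + 1, by omega⟩ :=
      nu.colours.blackPos_strictMono (Fin.lt_def.mpr (by simp only; omega))
    rw [Fin.lt_def] at h4 h5
    omega
  have h2 : nu.start m ≤ i := by
    rcases Nat.eq_zero_or_pos (m : ℕ) with e | e
    · rw [e, nu.start_zero]
      exact Nat.zero_le _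
    · have h3 := nu.colours.redPos_strictMono (a := ⟨m - 1, by omega⟩) (b := m)
        (Fin.lt_def.mpr (by simp only; omega))
      have h4 := redPos_ne_blackPos nu.colours ⟨m - 1, by omega⟩ i
      have h5 := (redPos_lt_blackPos nu.colours ⟨m - 1, by omega⟩ i).mp (by
        rw [Fin.lt_def] at h3 ⊢
        rw [Ne, Fin.ext_iff] at h4
        omega)
      rw [MultiComp.cnt_colours] at h5
      rwa [show (m : ℕ) = m - 1 + 1 by omega]
  -- The left end of the block that ends with i; the search starts from i + 1, its right boundary.
  obtain ⟨x, hx, hix, hgap⟩ := exists_prev_bd nu (Nat.succ_pos (i : ℕ))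
  have h3 : nu.start (m + 1) ≤ nu.start (m + 2) := nu.start_mono (Nat.le_succ _)
  have h4 := hgap _ (nu.start_mem_bd (t := m) (by omega))
  obtain ⟨nu1, a1, a2, a3⟩ := exists_move_red nu m hx (by omega) (by omega)
  have e1 := MultiComp.cnt_colours nu m
  have e2 := MultiComp.cnt_colours nu1 m
  have e3 := a1 (m + 2) (by omega) (by omega)
  refine thick_of_crossing hq hm ih a1 a3 (by omega)
    (Or.inr (MultiComp.isLeftCrossing_of m (fun t ht hne => (a1 t ht hne).symm) (by omega)
      (by omega) a3 fun y hy hyy => hgap y ((a3 y).mp hy) (by omega))) fun i' => ?_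
  by_cases hi : x ≤ (i' : ℕ) ∧ (i' : ℕ) ≤ i
  · right
    have e3 : nu.concat.index i = nu.concat.index i' := MultiComp.index_eq_of fun y hy => by
      have := hgap y hy
      omega
    rw [← nu'.blocked.cnt_le_iff ((hm.2 _ _).mp e3) m]
    rw [redPos_lt_blackPos] at hw
    omega
  · left
    omega

/-- w is increasing on blocks, so an inverted neighbouring pair lies in two neighbouring blocks, and
no red strand separates them. These two blocks are exchanged first. -/
theorem thick_of_swap (hq : q ≠ 0) {nu nu' : MultiComp ℓ d} {w : Perm (Fin d)}
    (hm : MatchFib nu.concat.index nu'.concat.index w)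
    (ih : ∀ {nu1 : MultiComp ℓ d} {v : Perm (Fin d)},
      len (strandPerm nu'.colours nu1.colours v) < len (strandPerm nu'.colours nu.colours w) →
      MatchFib nu1.concat.index nu'.concat.index v → Thick q Q nu1 nu' v)
    {j : Fin (d - 1)} (hj : w (hi j) < w (lo j)) (hadj : Adj nu.colours j) : Thick q Q nu nu' w := by
  have hne : nu.concat.index (lo j) ≠ nu.concat.index (hi j) := fun e =>
    absurd (hm.1 _ _ (lo_lt_hi j) e) hj.not_gt
  have hx : (j : ℕ) + 1 ∈ nu.bd := by
    by_contra hc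
    exact hne (simple_mem_fibreSubgroup.mp (MultiComp.simple_mem_young.mpr hc))
  have hjd := j.2
  have hstart : ∀ t ≤ ℓ + 1, nu.start t ≠ (j : ℕ) + 1 := fun t ht e => by
    rcases t with _ | t
    · rw [nu.start_zero] at e
      omega
    · rcases (show t ≤ ℓ by omega).eq_or_lt with e' | ht'
      · rw [e', nu.start_last] at e
        omega
      · exact hadj ⟨t, ht'⟩ (by rw [MultiComp.cnt_colours]; exact e)
  obtain ⟨p, s, hin⟩ := exists_isInner hx (by omega) (by omega)
  obtain ⟨nup, nu1, σ, h1, h2, h3, hσ, hms⟩ := hin.exists_exchange hstart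
  have l1 := hin.lt_mid
  have l2 := hin.mid_lt
  have hc1 : nu1.colours = nu.colours :=
    (MultiComp.colours_eq_of_start fun t _ => (h2.start_eq t).symm).trans
      (MultiComp.colours_eq_of_start fun t _ => h1.start_eq t)
  -- A pair inverted by σ consists of one element of each of the two blocks. As w inverts one such
  -- pair, it inverts all of them, so no pair of black strands crosses twice.
  have hl := len_strandPerm_mul nu'.colours nu1.colours nu.colours (w * σ⁻¹) σ
    (fun a b hab hlt => by
      rw [Perm.mul_apply, Perm.mul_apply, perm_inv_apply, perm_inv_apply]
      rw [Fin.lt_def, hσ, hσ] at hlt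
      have hab' : (a : ℕ) < b := hab
      have h5 : p ≤ (a : ℕ) ∧ (a : ℕ) ≤ j ∧ (j : ℕ) + 1 ≤ b ∧ (b : ℕ) < s := by
        unfold swapNat at hlt
        split_ifs at hlt <;> omega
      have gap : ∀ y ∈ nu.bd, p < y → y < s → y = j + 1 := hin.gap
      refine hm.lt_of_lt nu'.intervalFibres_index
        (MultiComp.index_eq_of fun y hy => ?_) (MultiComp.index_eq_of fun y hy => ?_) hne hj
      all_goals
        have := gap y hy
        simp only [lo, hi]
        omega)
    (fun m' i => by
      left
      rw [hc1, hσ, MultiComp.cnt_colours]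
      have h5 := hstart (m' + 1) (by omega)
      have h6 := hin.gap _ (nu.start_mem_bd (t := m' + 1) (by omega))
      unfold swapNat
      split_ifs <;> omega)
  have h0 : len (strandPerm nu1.colours nu.colours σ) ≠ 0 := fun h => by
    have h5 : σ = 1 := strandPerm_injective nu.colours nu.colours (by
      rw [strandPerm_self_one, ← hc1]
      rw [hc1] at h ⊢
      exact eq_one_of_len _ h)
    have h6 := hσ (hi j)
    rw [h5] at h6
    change (j : ℕ) + 1 = swapNat p (j + 1) s (j + 1) at h6
    rw [swapNat, if_neg (by omega), if_neg (by omega), if_pos l2] at h6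
    omega
  have h5 := (ih (by rw [inv_mul_cancel_right] at hl; omega) (hms.symm.trans hm)).comp
    (thick_exchange hq hin h1 h2 h3 hσ hms) (fun z hz => hms.conj_mem hz) hl
  rwa [inv_mul_cancel_right] at h5

/-- Induction on the number of crossings. Two neighbouring strands that cross are red-black,
black-red or black-black, and in each case a thick crossing splits off. If no neighbours cross, the
strand permutation is the identity and the two compositions coincide. -/
theorem thick_of_matchFib (hq : q ≠ 0) {nu nu' : MultiComp ℓ d} {w : Perm (Fin d)}
    (hm : MatchFib nu.concat.index nu'.concat.index w) : Thick q Q nu nu' w := by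
  obtain ⟨N, hN⟩ : ∃ N, len (strandPerm nu'.colours nu.colours w) = N := ⟨_, rfl⟩
  induction N using Nat.strong_induction_on generalizing nu w with
  | _ N ih' =>
  have ih : ∀ {nu1 : MultiComp ℓ d} {v : Perm (Fin d)},
      len (strandPerm nu'.colours nu1.colours v) < len (strandPerm nu'.colours nu.colours w) →
      MatchFib nu1.concat.index nu'.concat.index v → Thick q Q nu1 nu' v :=
    fun h h' => ih' _ (by rwa [hN] at h) h' rfl
  by_cases hr : ∃ r, strandPerm nu'.colours nu.colours w (hi r) <
      strandPerm nu'.colours nu.colours w (lo r)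
  · obtain ⟨r, hr⟩ := hr
    rcases red_or_black nu.colours (lo r) with ⟨m, h1⟩ | ⟨i, h1⟩ <;>
      rcases red_or_black nu.colours (hi r) with ⟨m', h2⟩ | ⟨i', h2⟩ <;> rw [← h1, ← h2] at hr
    · have h3 := lo_lt_hi r
      rw [← h1, ← h2] at h3
      rw [strandPerm_redPos, strandPerm_redPos] at hr
      exact absurd (nu'.colours.redPos_strictMono (nu.colours.redPos_strictMono.lt_iff_lt.mp h3))
        hr.not_gt
    · rw [strandPerm_blackPos, strandPerm_redPos] at hr
      exact thick_of_red_black hq hm ih (by rw [h1, h2]; rfl) hr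
    · rw [strandPerm_blackPos, strandPerm_redPos] at hr
      exact thick_of_black_red hq hm ih (by rw [h1, h2]; rfl) hr
    · obtain ⟨j, h3, h4⟩ := exists_black_neighbours (c := nu.colours) (r := r)
        (by rw [← h1]; exact colour_blackPos _ _) (by rw [← h2]; exact colour_blackPos _ _)
      rw [h1, h2, ← h3, ← h4, strandPerm_blackPos, strandPerm_blackPos] at hr
      exact thick_of_swap hq hm ih (nu'.colours.blackPos_strictMono.lt_iff_lt.mp hr)
        (adj_of_neighbours h3 h4)
  · push Not at hr
    have h1 := eq_one_of_no_descent _ fun r => not_lt.mpr (hr r)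
    have h2 := act_strandPerm nu'.colours nu.colours w
    rw [h1, act_one] at h2
    have h3 : w = 1 := strandPerm_injective nu.colours nu.colours (by
      rw [strandPerm_self_one, ← h1, h2])
    subst h3
    have h4 := hm.eq_of_one
    obtain rfl : nu = nu' := MultiComp.eq_of_colours h2 fun j => by
      rw [MultiComp.young, MultiComp.young, h4]
    exact thick_one_of_eq hq nu

end Existence

/-! ### Admissible diagrams and generation of all homomorphisms. -/

section Generation

variable {k : Type*} [Field k] {ℓ d : ℕ} {q : k} {Q : Fin ℓ → k} {α : Type*}

local notation "𝐞" c:max => heckeGen q Q (Gen.e c)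

/-- The refinement of a composition with given blocks. -/
theorem exists_refinement (nu : MultiComp ℓ d) {g : Fin d → α} (hg : IntervalFibres g)
    (h : fibreSubgroup g ≤ nu.young) :
    ∃ kap : MultiComp ℓ d, (∀ t ≤ ℓ + 1, kap.start t = nu.start t) ∧ (∀ x ∈ nu.bd, x ∈ kap.bd) ∧
      ∀ i j, kap.concat.index i = kap.concat.index j ↔ g i = g j := by
  have h0 : ∀ x ∈ nu.bd, x ≤ d ∧ ∀ i j : Fin d, (i : ℕ) < x → x ≤ j → g i ≠ g j :=
    fun x hx => ⟨nu.le_of_mem_bd hx, fun i j h1 h2 e =>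
      (MultiComp.not_between (fibre_le_iff.mp h i j e) hx).1 ⟨h1, h2⟩⟩
  obtain ⟨kap, a1, a2⟩ := MultiComp.exists_of_bd
    (S := {x | x ≤ d ∧ ∀ i j : Fin d, (i : ℕ) < x → x ≤ j → g i ≠ g j}) nu.start_zero nu.start_mono
    nu.start_last (fun t ht => h0 _ (nu.start_mem_bd ht)) (fun x hx => hx.1)
  have key : ∀ i j : Fin d, i ≤ j → (kap.concat.index i = kap.concat.index j ↔ g i = g j) := by
    intro i j hij
    rw [MultiComp.index_eq_iff hij]
    constructor
    · intro h1
      have step : ∀ n, ∀ hn : n < d, (i : ℕ) ≤ n → n ≤ j → g ⟨n, hn⟩ = g i := by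
        intro n
        induction n with
        | zero => exact fun hn h2 _ => congrArg g (Fin.ext (show 0 = (i : ℕ) by omega))
        | succ n ih =>
          intro hn h2 h3
          rcases h2.eq_or_lt with h4 | h4
          · exact congrArg g (Fin.ext h4.symm)
          · have h5 := ih (by omega) (by omega) (by omega)
            by_contra hc
            refine h1 (n + 1) ((a2 _).mpr ⟨hn.le, fun a b ha hb e => hc ?_⟩) ⟨h4, h3⟩
            have e1 := hg a ⟨n, by omega⟩ b (Fin.le_def.mpr (by simp only; omega))
              (Fin.le_def.mpr (by simp only; omega)) e
            have e2 := hg a ⟨n + 1, hn⟩ b (Fin.le_def.mpr (by simp only; omega))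
              (Fin.le_def.mpr (by simp only; omega)) e
            rw [e2, ← e1, h5]
      exact (step j j.2 hij le_rfl).symm
    · intro e x hx hxx
      exact ((a2 x).mp hx).2 i j hxx.1 hxx.2 e
  refine ⟨kap, a1, fun x hx => (a2 x).mpr (h0 x hx), fun i j => ?_⟩
  rcases le_total i j with hij | hij
  · exact key i j hij
  · rw [eq_comm, key j i hij, eq_comm]

/-- The intersections of the blocks of `lam` with the preimages of those of `mu`, and their images,
are the blocks of refinements of `lam` and `mu`. -/
theorem exists_refinements {lam mu : MultiComp ℓ d} {w : Perm (Fin d)}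
    (hw : LocalMin mu.concat.index lam.concat.index w) :
    ∃ kap kap' : MultiComp ℓ d, (∀ t ≤ ℓ + 1, kap.start t = lam.start t) ∧
      (∀ x ∈ lam.bd, x ∈ kap.bd) ∧ (∀ t ≤ ℓ + 1, kap'.start t = mu.start t) ∧
      (∀ x ∈ mu.bd, x ∈ kap'.bd) ∧
      fibreSubgroup (meet mu.concat.index lam.concat.index w) = kap.young ∧
      MatchFib kap.concat.index kap'.concat.index w := by
  have hw' : LocalMin lam.concat.index mu.concat.index w⁻¹ := ⟨hw.2, by rw [inv_inv]; exact hw.1⟩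
  obtain ⟨kap, a1, a2, a3⟩ := exists_refinement lam
    (hw.intervalFibres mu.intervalFibres_index lam.intervalFibres_index) (meet_le _ _ _)
  obtain ⟨kap', b1, b2, b3⟩ := exists_refinement mu
    (hw'.intervalFibres lam.intervalFibres_index mu.intervalFibres_index) (meet_le _ _ _)
  refine ⟨kap, kap', a1, a2, b1, b2, le_antisymm (fibre_le_iff.mpr fun i j e => (a3 i j).mpr e)
    (fibre_le_iff.mpr fun i j e => (a3 i j).mp e), fun i j hij e => ?_, fun i j => ?_⟩
  · exact hw.1 i j hij (Prod.ext_iff.mp ((a3 i j).mp e)).1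
  · rw [a3, b3, Prod.mk.injEq, Prod.mk.injEq, perm_inv_apply, perm_inv_apply, and_comm]

/-- The thick diagram between the refinements with blocks S_lam ∩ w⁻¹ S_mu w and its conjugate
works. Refining does not change the colours, and its intertwining property is the admissibility of
w. -/
theorem exists_isAdmissible (hq : q ≠ 0) {lam mu : MultiComp ℓ d} {w : Perm (Fin d)}
    (hw : IsDoubleMin mu.young lam.young w) :
    ∃ L : List (Fin (ℓ + d - 1)), IsAdmissible q Q lam mu w L := by
  have hw' := (isDoubleMin_iff mu.intervalFibres_index lam.intervalFibres_index).mp hw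
  obtain ⟨kap, kap', a1, -, b1, -, h1, h2⟩ := exists_refinements hw'
  obtain ⟨L, h3, h4, -⟩ := thick_of_matchFib (Q := Q) hq h2
  rw [MultiComp.colours_eq_of_start a1, MultiComp.colours_eq_of_start b1] at h3 h4
  refine ⟨L, h3, fun z hz => ?_⟩
  rw [interSubgroup_eq, h1] at hz
  exact h4 z hz

theorem signElt_eq_sum (c : ColourSeq ℓ d) (g : Fin d → α) :
    signElt q Q c g = ∑ z ∈ allReps g, (-q)⁻¹ ^ len z • stdElt q Q c c z := rfl

/-- An intertwiner of two Young subgroups also intertwines their sign elements. -/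
theorem mul_mSign_of_inter {kap kap' : MultiComp ℓ d} {w : Perm (Fin d)}
    (hm : MatchFib kap.concat.index kap'.concat.index w) {A : Hecke q Q d}
    (h : ∀ z ∈ kap.young, A * stdElt q Q kap.colours kap.colours z =
      stdElt q Q kap'.colours kap'.colours (w * z * w⁻¹) * A) :
    A * mSign q Q kap = mSign q Q kap' * A := by
  have hlen : ∀ z ∈ kap.young, len (w * z * w⁻¹) = len z := fun z hz => by
    have h1 := len_mul_of_monoFib' kap.intervalFibres_index hz hm.1
    have h2 := len_mul_of_monoFib kap'.intervalFibres_index (hm.conj_mem hz) hm.symm.1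
    rw [inv_mul_cancel_right] at h2
    omega
  rw [mSign, mSign, signElt_eq_sum, signElt_eq_sum, Finset.mul_sum, Finset.sum_mul]
  refine Finset.sum_bij' (fun z _ => w * z * w⁻¹) (fun z _ => w⁻¹ * z * w)
    (fun z hz => mem_allReps.mpr (hm.conj_mem (mem_allReps.mp hz)))
    (fun z hz => mem_allReps.mpr (by
      have := hm.symm.conj_mem (mem_allReps.mp hz)
      rwa [inv_inv] at this))
    (fun z _ => by group) (fun z _ => by group) fun z hz => ?_
  rw [hlen z (mem_allReps.mp hz), mul_smul_comm, smul_mul_assoc, h z (mem_allReps.mp hz)]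

theorem stdElt_mem_flt {c : ColourSeq ℓ d} {g : Fin d → α} (h : Blocked c g) {z : Perm (Fin d)}
    (hz : z ∈ fibreSubgroup g) : stdElt q Q c c z ∈ flt q Q (len z + 1) := by
  refine flt_mul_e (tw_mem_flt ?_) _
  rw [(redWord_spec _).2, len_strandPerm_self h hz]
  exact Nat.lt_succ_self _

theorem stdElt_mul_flt {c : ColourSeq ℓ d} {g : Fin d → α} (h : Blocked c g) {z : Perm (Fin d)}
    (hz : z ∈ fibreSubgroup g) {N : ℕ} {x : Hecke q Q d} (hx : x ∈ flt q Q N) :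
    stdElt q Q c c z * x ∈ flt q Q (N + len z) := by
  have h1 := tw_mul_flt (e_mul_flt hx c) (redWord (strandPerm c c z))
  rwa [(redWord_spec _).2, len_strandPerm_self h hz, ← mul_assoc, tw_redWord_mul_e] at h1

theorem len_strandPerm_mul_mul {β : Type*} {b c : ColourSeq ℓ d} {f : Fin d → β} {g : Fin d → α}
    (hb : Blocked b f) (hc : Blocked c g) {z w u : Perm (Fin d)} (hw : LocalMin f g w)
    (hz : z ∈ fibreSubgroup f) (hu : u ∈ minReps (meet f g w) g) :
    len (strandPerm b c (z * w * u)) = len z + len (strandPerm b c w) + len u := by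
  obtain ⟨h1, h2⟩ := mem_minReps.mp hu
  rw [mul_assoc, len_strandPerm_mul_left hb hz (hw.monoFib_mul hc.1 h1 h2),
    len_strandPerm_mul_right hc h1 hw.1, len_strandPerm_self hb hz, len_strandPerm_self hc h1]
  omega

/-- The part of a homomorphism that belongs to a double coset is generated up to shorter terms. -/
theorem exists_leftGen (hq : q ≠ 0) {lam mu : MultiComp ℓ d} {w : Perm (Fin d)}
    (hw : LocalMin mu.concat.index lam.concat.index w) :
    ∃ L, IsReducedWord (strandPerm mu.colours lam.colours w) L ∧
      (∀ z ∈ fibreSubgroup (meet mu.concat.index lam.concat.index w),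
        tw q Q L * 𝐞 lam.colours * stdElt q Q lam.colours lam.colours z =
          stdElt q Q mu.colours mu.colours (w * z * w⁻¹) * (tw q Q L * 𝐞 lam.colours)) ∧
      ∀ (p : Laurent k d) (N : ℕ), IsSymm (meet mu.concat.index lam.concat.index w) p →
        (∀ z ∈ mu.young, ∀ u ∈ minReps (meet mu.concat.index lam.concat.index w) lam.concat.index,
          len (strandPerm mu.colours lam.colours (z * w * u)) ≤ N) →
        ∃ y, LeftGen q Q lam mu y ∧
          mSign q Q mu * (tw q Q L * 𝐞 lam.colours) * phi q Q p *
              signSum q (stdElt q Q lam.colours lam.colours)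
                (minReps (meet mu.concat.index lam.concat.index w) lam.concat.index) -
            y * mSign q Q lam ∈ flt q Q N := by
  obtain ⟨kap, kap', a1, a2, b1, b2, h1, h2⟩ := exists_refinements hw
  obtain ⟨L, h3, h4, t, ht, y, h5, h6⟩ := thick_of_matchFib (Q := Q) hq h2
  have ec := MultiComp.colours_eq_of_start a1
  have ec' := MultiComp.colours_eq_of_start b1
  have hy := MultiComp.young_le_of_bd a2
  have hy' := MultiComp.young_le_of_bd b2
  have h7 := mul_mSign_of_inter h2 h4
  have hsym : ∀ {p : Laurent k d}, IsSymm (meet mu.concat.index lam.concat.index w) p →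
      IsSymm kap.concat.index p := fun hp j hj => hp j (h1.ge hj)
  have hmin : minReps (meet mu.concat.index lam.concat.index w) lam.concat.index =
      minReps kap.concat.index lam.concat.index := by
    ext u
    rw [mem_minReps, mem_minReps]
    refine and_congr_right fun _ => ⟨fun h i j hij e => h i j hij (fibre_le_iff.mp h1.ge i j e),
      fun h i j hij e => h i j hij (fibre_le_iff.mp h1.le i j e)⟩
  have hphi : ∀ {p : Laurent k d}, IsSymm (meet mu.concat.index lam.concat.index w) p →
      phi q Q p * mSign q Q lam = mSign q Q kap * phi q Q p *
        signSum q (stdElt q Q lam.colours lam.colours)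
          (minReps kap.concat.index lam.concat.index) := fun hp => by
    rw [mSign_eq_mul ec hy, ← mul_assoc, phi_mul_signElt kap.blocked (hsym hp)]
  have hmerge := mSign_eq_mul_left (q := q) (Q := Q) ec' hy'
  rw [ec] at h3 h4 h6 h7
  rw [ec'] at h3 h4 h6
  -- The generated map splits lam to its refinement, multiplies by the symmetric polynomial, applies
  -- the thick diagram and merges to mu. The scalar t⁻¹ normalizes the leading term.
  refine ⟨L, h3, fun z hz => h4 z (h1.le hz), fun p N hp hN => ⟨t⁻¹ •
    (mergeElt q Q kap' mu * y * phi q Q p * 1),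
    ((((LeftGen.refine hq b1 b2).2.mul h5).mul (LeftGen.poly hq (hsym hp))).mul
      (LeftGen.refine hq a1 a2).1).smul _, ?_⟩⟩
  set A := tw q Q L * 𝐞 lam.colours with hA
  set ss := signSum q (stdElt q Q lam.colours lam.colours)
    (minReps kap.concat.index lam.concat.index) with hss
  have e1 : mSign q Q mu * A * phi q Q p * ss -
      (t⁻¹ • (mergeElt q Q kap' mu * y * phi q Q p * 1)) * mSign q Q lam =
      -(t⁻¹ • (mergeElt q Q kap' mu * (y - t • A) * mSign q Q kap * phi q Q p * ss)) := by
    have e2 : mergeElt q Q kap' mu * y * phi q Q p * 1 * mSign q Q lam =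
        mergeElt q Q kap' mu * y * mSign q Q kap * phi q Q p * ss := by
      rw [mul_one, mul_assoc _ (phi q Q p), hphi hp]
      simp only [mul_assoc]
    have e3 : mSign q Q mu * A = mergeElt q Q kap' mu * A * mSign q Q kap := by
      rw [mul_assoc (mergeElt q Q kap' mu), h7, ← mul_assoc (mergeElt q Q kap' mu), hmerge]
    rw [smul_mul_assoc, e2, e3, mul_sub, sub_mul, sub_mul, sub_mul, smul_sub, mul_smul_comm,
      smul_mul_assoc, smul_mul_assoc, smul_mul_assoc, smul_smul, inv_mul_cancel₀ ht, one_smul,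
      neg_sub]
  rw [hmin, e1]
  refine neg_mem (Submodule.smul_mem _ _ ?_)
  rw [mergeElt, hss, signSum, mSign, signElt_eq_sum, ec]
  simp only [Finset.sum_mul, Finset.mul_sum, smul_mul_assoc, mul_smul_comm]
  refine Submodule.sum_mem _ fun u' hu' => Submodule.smul_mem _ _ ?_
  refine Submodule.sum_mem _ fun x hx => Submodule.smul_mem _ _ ?_
  refine Submodule.sum_mem _ fun u hu => Submodule.smul_mem _ _ ?_
  obtain ⟨hu1, hu2⟩ := mem_minReps.mp hu
  have hx := mem_allReps.mp hx
  have c1 := h2.conj_mem hx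
  -- The lengths of the four factors add up to the length of an element of the double coset of w,
  -- which is at most N. As y - t • A has strictly fewer crossings than w, the error has fewer than
  -- N.
  have c2 := hN (u⁻¹ * (w * x * w⁻¹)) (mul_mem (inv_mem hu1) (hy' c1)) u' (by rw [hmin]; exact hu')
  rw [len_strandPerm_mul_mul mu.blocked lam.blocked hw (mul_mem (inv_mem hu1) (hy' c1))
    (by rw [hmin]; exact hu'), len_mul_of_monoFib' kap'.intervalFibres_index c1 hu2,
    hw.len_conj mu.intervalFibres_index lam.intervalFibres_index (h1.ge hx)] at c2
  have f1 := stdElt_mul_flt mu.blocked (inv_mem hu1) h6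
  have f2 := stdElt_mem_flt (q := q) (Q := Q) lam.blocked (hy hx)
  have f3 := stdElt_mem_flt (q := q) (Q := Q) lam.blocked (mem_minReps.mp hu').1
  exact flt_mono (by rw [← ec] at c2 ⊢; omega) (flt_mul_flt (flt_mul_phi (flt_mul_flt f1 f2) p) f3)

/-- Every homomorphism is generated. -/
theorem extend_mem_genAlg (hq : q ≠ 0) {lam mu : MultiComp ℓ d} (f : HomSpace q Q lam mu) :
    extend q Q f ∈ genAlg q Q d := by
  have hD := fun w (hw : LocalMin mu.concat.index lam.concat.index w) =>
    exists_leftGen (Q := Q) hq hw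
  choose! D hD using hD
  have hch : IsChoice q Q mu.colours lam.colours mu.concat.index lam.concat.index D :=
    ⟨fun w hw => (hD w hw).1, fun w hw => (hD w hw).2.1⟩
  obtain ⟨s, hs, es⟩ := exists_mElt_eq (Q := Q) hq lam
  obtain ⟨N, hN⟩ := exists_mem_flt (q := q) (Q := Q) (evalHom lam mu f)
  replace hN : evalHom lam mu f ∈ flt q Q (N + 1) := hN
  generalize N + 1 = N at hN
  induction N generalizing f with
  | zero =>
    have h0 : evalHom lam mu f = 0 := by
      refine flt_induction (p := fun x _ => x = 0) (fun L _ _ h => absurd h (Nat.not_lt_zero _)) rfl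
        (fun x y _ _ hx hy => by rw [hx, hy, add_zero]) (fun t x _ hx => by rw [hx, smul_zero]) hN
    have h1 : f = 0 := evalHom_injective lam mu (by rw [h0, map_zero])
    exact (LeftGen.zero lam mu).mem fun x => by rw [h1, zero_mul]; rfl
  | succ N ih =>
    obtain ⟨h, hh⟩ := (mem_mIdeal_iff hq).mp (f (mMul q Q lam 1)).2
    have hh : evalHom lam mu f = mSign q Q mu * h := hh
    have hsg := isSign_evalHom hq f
    rw [hh] at hsg hN
    obtain ⟨F, hF, e1⟩ := hch.exists_symm hq mu.blocked lam.blocked hsg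
    rw [e1] at hN
    -- Each double coset with a nonzero coefficient gets a generated map with the same leading part.
    -- Its elements all have length at most N, since a longer one would force the coefficient to
    -- vanish.
    have hY : ∀ w, ∃ y, w ∈ dmin mu.concat.index lam.concat.index → LeftGen q Q lam mu y ∧
        dcGen q Q mu.colours lam.colours mu.concat.index D w * phi q Q (F w) *
          signSum q (stdElt q Q lam.colours lam.colours)
            (minReps (meet mu.concat.index lam.concat.index w) lam.concat.index) -
          y * mSign q Q lam ∈ flt q Q N := fun w => by
      by_cases hw : w ∈ dmin mu.concat.index lam.concat.index
      · by_cases h0 : F w = 0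
        · refine ⟨0, fun _ => ⟨LeftGen.zero _ _, ?_⟩⟩
          rw [h0, map_zero, mul_zero, zero_mul, zero_mul, sub_zero]
          exact zero_mem _
        · have hw' := mem_dmin.mp hw
          obtain ⟨y, h1, h2⟩ := (hD w hw').2.2 (F w) N (hF w hw') fun z hz u hu => by
            by_contra hc
            exact h0 (hch.symm_eq_zero_of_mem_flt hq mu.blocked lam.blocked hN hz hw' hu
              (by omega))
          exact ⟨y, fun _ => ⟨h1, h2⟩⟩
      · exact ⟨0, fun h => absurd h hw⟩
    choose Y hY using hY
    have hsum := LeftGen.sum _ fun w hw => (hY w hw).1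
    obtain ⟨f', h1, h2⟩ := id hsum
    have e2 : evalHom lam mu (s⁻¹ • f') =
        (∑ w ∈ dmin mu.concat.index lam.concat.index, Y w) * mSign q Q lam := by
      have e3 : evalHom lam mu f' = _ * (mElt q Q lam * 1) := h1 (mMul q Q lam 1)
      rw [map_smul, e3, mul_one, es, mul_smul_comm, smul_smul, inv_mul_cancel₀ hs, one_smul]
    -- Subtracting the generated maps leaves a homomorphism whose value has fewer than N crossings.
    -- The factor s⁻¹ compensates that homomorphisms are evaluated at m_lam and not at the
    -- normalized sign element.
    have h3 := ih (f + (-1 : k) • s⁻¹ • f') (by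
      rw [map_add, map_smul, e2, hh, e1, neg_smul, one_smul, ← sub_eq_add_neg, Finset.sum_mul,
        ← Finset.sum_sub_distrib]
      exact Submodule.sum_mem _ fun w hw => (hY w hw).2)
    have h4 := add_mem h3 (Subalgebra.smul_mem _ h2 s⁻¹)
    rwa [extend_add, extend_smul, extend_smul, smul_smul, add_assoc, ← add_smul, neg_one_mul,
      neg_add_cancel, zero_smul, add_zero] at h4

end Generation

end HigherSchur

open HigherSchur in
theorem mainTheorem10 {k : Type*} [Field k] [IsAlgClosed k] (q : k) (hq0 : q ≠ 0) (hq1 : q ≠ 1)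
    (ℓ d : ℕ) (Q : Fin ℓ → k) (hQ : ∀ m, Q m ≠ 0) :
    (∀ lam mu : MultiComp ℓ d,
      (∀ w : Equiv.Perm (Fin d), IsDoubleMin mu.young lam.young w →
        ∃ L : List (Fin (ℓ + d - 1)), IsAdmissible q Q lam mu w L) ∧
      ∀ D : Equiv.Perm (Fin d) → List (Fin (ℓ + d - 1)),
        (∀ w, IsDoubleMin mu.young lam.young w → IsAdmissible q Q lam mu w (D w)) →
        ∃ b : Module.Basis (BasisIndex lam mu) k (HomSpace q Q lam mu),
          ∀ i : BasisIndex lam mu, IsBasisMap q Q i.1.1 i.1.2 (D i.1.1) (b i)) ∧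
    ((∀ lam mu : MultiComp ℓ d, lam.IsSplit mu →
        (∃ f : HomSpace q Q lam mu, IsSplitMap q Q f) ∧
        ∃ f : HomSpace q Q mu lam, IsMergeMap q Q f) ∧
      (∀ lam mu : MultiComp ℓ d, lam.IsLeftCrossing mu →
        (∃ f : HomSpace q Q lam mu, IsCrossingMap q Q f) ∧
        ∃ f : HomSpace q Q mu lam, IsCrossingMap q Q f) ∧
      (∀ (lam : MultiComp ℓ d) (p : AddMonoidAlgebra k (Fin d → ℤ)), IsInvariant lam p →
        ∃ f : HomSpace q Q lam lam, IsPolyMap q Q p f)) ∧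
    Algebra.adjoin k {φ : SchurAlg q Q d | IsGenerator q Q φ} = ⊤ :=
  ⟨fun lam mu => ⟨fun _ => exists_isAdmissible hq0, exists_basis hq0 lam mu⟩,
    ⟨fun _ _ h => ⟨exists_isSplitMap hq0 h, exists_isMergeMap hq0 h⟩,
      fun _ _ h => ⟨exists_isCrossingMap hq0 (Or.inl h), exists_isCrossingMap hq0 (Or.inr h)⟩,
      fun _ _ => exists_isPolyMap hq0⟩,
    genAlg_eq_top fun _ _ => extend_mem_genAlg hq0⟩
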